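/- All manifolds are smooth ($C^\infty$), finite-dimensional, Hausdorff and second countable. Let $X$ be an $n$-dimensional manifold. Let $q\ge 0$ and let $\Pi_q$ be the full jet groupoid of order $q$ over $X$: the set of $q$-jets of local diffeomorphisms of $X$, an open subset of the manifold $J_q(X\times X)$ of $q$-jets of local smooth maps $X\to X$, with source $s$, target $t$, multiplication $j_q(\varphi)(\psi(x))\,j_q(\psi)(x)=j_q(\varphi\circ\psi)(x)$, and projections $\pi^{q+1}_q:\Pi_{q+1}\to\Pi_q$. Fix $y_0\in X$, and write $\mathrm{GL}_q=\Pi_q(y_0,y_0)$ for the isotropy group at $y_0$, $K_{q+1}=\ker(\pi^{q+1}_q:\mathrm{GL}_{q+1}\to\mathrm{GL}_q)$, and $P_q=\{f\in\Pi_q: t(f)=y_0\}$. A *natural bundle of order $q$* is a smooth fibre bundle $\pi:\mathcal F\to X$ with a smooth right action of $\Pi_q$, i.e. a smooth map $(u,f)\mapsto uf$ on $\{(u,f)\in\mathcal F\times\Pi_q : \pi(u)=t(f)\}$ with $\pi(uf)=s(f)$, $u(fg)=(uf)g$ and $u\,1_{\pi(u)}=u$. For a smooth section $\omega$ of $\mathcal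 F$, its *symmetry groupoid* is $\mathrm{Stab}^q_{\mathcal F}(\omega)=\{f\in\Pi_q : \omega(t(f))\,f=\omega(s(f))\}$. Let $\mathcal F$ be a natural bundle of order $q$ such that $\Pi_q(y,y)$ acts transitively on the fibre $\mathcal F_y$ for every $y\in X$. Let $J_1(\mathcal F)$ be the bundle of $1$-jets of local sections of $\mathcal F$, with the induced action of $\Pi_{q+1}$: $j_1(\sigma)(\varphi(x))\,j_{q+1}(\varphi)(x)$ is the $1$-jet at $x$ of $x'\mapsto\sigma(\varphi(x'))\,j_q(\varphi)(x')$. Put $J_1(F)=J_1(\mathcal F)_{y_0}$ and $F_1=J_1(F)/K_{q+1}$; $\mathrm{GL}_{q+1}$ acts on $F_1$, and this action factors through $\mathrm{GL}_q$. For $k\in\{q,q+1\}$ let $P_k\times_{\mathrm{GL}_k}F_1$ be the quotient of $P_k\times F_1$ by $(gf,z)\sim(f,zg)$, $g\in\mathrm{GL}_k$, projected to $X$ by $[f,z]\mapsto s(f)$, and put $\mathcal F_1=P_{q+1}\times_{\mathrm{GL}_{q+1}}F_1$. Then: 1. $F_1$, $\mathcal F_1$ and $P_q\times_{\mathrm{GL}_q}F_1$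 carry manifold structures for which the quotient maps $J_1(F)\to F_1$, $P_{q+1}\times F_1\to\mathcal F_1$ and $P_q\times F_1\to P_q\times_{\mathrm{GL}_q}F_1$ are submersions, and $\mathcal F_1$ and $P_q\times_{\mathrm{GL}_q}F_1$ are smooth fibre bundles over $X$ with typical fibre $F_1$. 2. $\mathcal F_1$ is a natural bundle of order $q$ with the action $[f,z]\,\pi^{q+1}_q(g)=[fg,z]$ for $g\in\Pi_{q+1}$ with $t(g)=s(f)$; $P_q\times_{\mathrm{GL}_q}F_1$ is a natural bundle of order $q$ with the action $[f,z]\,g=[fg,z]$; and $[f,z]\mapsto[\pi^{q+1}_q(f),z]$ is a well-defined $\Pi_q$-equivariant diffeomorphism $\mathcal F_1\cong P_q\times_{\mathrm{GL}_q}F_1$ over $X$. 3. There is a submersion $I:J_1(\mathcal F)\to\mathcal F_1$ with $I(wf)=[f,wK_{q+1}]$ for all $w\in J_1(F)$ and $f\in P_{q+1}$. 4. For every smooth section $\omega$ of $\mathcal F$, $I\circ j_1(\omega)$ is a smooth section of $\mathcal F_1$, and $\mathcal R^{(1)}_q(\omega)=\mathrm{Stab}^q_{\mathcal F_1}(I(j_1(\omega)))$.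 Here $\mathcal R_q(\omega)=\mathrm{Stab}^q_{\mathcal F}(\omega)$; $\mathcal R_{q+1}(\omega)=J_1(\mathcal R_q(\omega))\cap J_{q+1}(X\times X)$ is its prolongation, where $J_1(\mathcal R_q(\omega))$ consists of the $1$-jets of local smooth sections of $s:\Pi_q\to X$ with values in $\mathcal R_q(\omega)$ and $j_{q+1}(\varphi)(x)$ is identified with $j_1(j_q(\varphi))(x)$; and $\mathcal R^{(1)}_q(\omega)=\pi^{q+1}_q(\mathcal R_{q+1}(\omega))$. -/

import Mathlib

open scoped Manifold ContDiff Topology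
open Set Filter

noncomputable section

namespace JetGroupoid

set_option linter.unusedSectionVars false

section Calculus

variable {E E' : Type*} [NormedAddCommGroup E] [NormedSpace ℝ E]
  [NormedAddCommGroup E'] [NormedSpace ℝ E']

lemma nat_le_infty (k : ℕ) : ((k : ℕ) : WithTop ℕ∞) ≤ (∞ : WithTop ℕ∞) := by
  have : ((k : ℕ∞) : WithTop ℕ∞) ≤ ((⊤ : ℕ∞) : WithTop ℕ∞) := WithTop.coe_le_coe.2 le_top
  exact this

lemma iteratedFDeriv_succ_apply_fderiv {f : E → E'} {x : E} (m : ℕ)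
    (hf : ContDiffAt ℝ (m + 1 : ℕ) f x) (w : Fin (m + 1) → E) :
    iteratedFDeriv ℝ (m + 1) f x w =
      fderiv ℝ (fun y => iteratedFDeriv ℝ m f y (Fin.tail w)) x (w 0) := by
  have hs : ContDiffAt ℝ 1 (iteratedFDeriv ℝ m f) x :=
    hf.iteratedFDeriv_right (by push_cast; rw [add_comm])
  have hd := (hs.differentiableAt (by simp)).hasFDerivAt
  have := ((ContinuousMultilinearMap.apply ℝ (fun _ : Fin m => E) E'
    (Fin.tail w)).hasFDerivAt.comp x hd).fderiv
  rw [iteratedFDeriv_succ_apply_left]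
  change _ = fderiv ℝ ((ContinuousMultilinearMap.apply ℝ (fun _ : Fin m => E) E'
    (Fin.tail w)) ∘ iteratedFDeriv ℝ m f) x (w 0)
  rw [this]
  rfl

lemma iteratedFDeriv_swap (f : E → E') : ∀ (m : ℕ) (x : E), ContDiffAt ℝ (m + 1 : ℕ) f x →
    ∀ (k : Fin m) (v : Fin (m + 1) → E),
      iteratedFDeriv ℝ (m + 1) f x (v ∘ Equiv.swap k.castSucc k.succ) =
        iteratedFDeriv ℝ (m + 1) f x v := by
  intro m
  induction m with
  | zero => intro x _ k; exact k.elim0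
  | succ m ih =>
    intro x hf k v
    have hev : ∀ᶠ y in 𝓝 x, ContDiffAt ℝ (m + 1 : ℕ) f y :=
      (hf.of_le (by norm_cast; omega)).eventually (by simp)
    refine Fin.cases ?_ (fun k => ?_) k
    · have hd : ∀ w : Fin (m + 2) → E, iteratedFDeriv ℝ (m + 2) f x w =
          fderiv ℝ (fderiv ℝ (fun y => iteratedFDeriv ℝ m f y (Fin.tail (Fin.tail w)))) x
            (w 0) (w 1) := by
        intro w
        rw [iteratedFDeriv_succ_apply_fderiv _ hf]
        have h1 : (fun y => iteratedFDeriv ℝ (m + 1) f y (Fin.tail w)) =ᶠ[𝓝 x]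
            fun y => fderiv ℝ (fun z => iteratedFDeriv ℝ m f z (Fin.tail (Fin.tail w))) y
              (w 1) := by
          filter_upwards [hev] with y hy
          rw [iteratedFDeriv_succ_apply_fderiv _ hy]
          rfl
        rw [h1.fderiv_eq]
        have hg : ContDiffAt ℝ 2 (fun y => iteratedFDeriv ℝ m f y (Fin.tail (Fin.tail w))) x :=
          (ContinuousMultilinearMap.apply ℝ (fun _ : Fin m => E) E'
            (Fin.tail (Fin.tail w))).contDiff.contDiffAt.comp x
            (hf.iteratedFDeriv_right (m := 2) (by norm_cast; omega))
        have hg' : DifferentiableAt ℝ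
            (fderiv ℝ (fun y => iteratedFDeriv ℝ m f y (Fin.tail (Fin.tail w)))) x :=
          (hg.fderiv_right (m := 1) (by norm_num)).differentiableAt (by simp)
        rw [fderiv_clm_apply hg' (differentiableAt_const _)]
        simp
      rw [hd, hd]
      have e1 : Fin.tail (Fin.tail (v ∘ Equiv.swap (0 : Fin (m + 1)).castSucc
          (0 : Fin (m + 1)).succ)) = Fin.tail (Fin.tail v) := by
        funext i
        simp only [Fin.tail, Function.comp]
        rw [Equiv.swap_apply_of_ne_of_ne]
        · simp [Fin.ext_iff]
        · simp [Fin.ext_iff]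
      have hg : ContDiffAt ℝ 2 (fun y => iteratedFDeriv ℝ m f y (Fin.tail (Fin.tail v))) x :=
          (ContinuousMultilinearMap.apply ℝ (fun _ : Fin m => E) E'
            (Fin.tail (Fin.tail v))).contDiff.contDiffAt.comp x
            (hf.iteratedFDeriv_right (m := 2) (by norm_cast; omega))
      rw [e1]
      simpa using ((hg.isSymmSndFDerivAt (by simp)).eq (v 0) (v 1)).symm
    · rw [iteratedFDeriv_succ_apply_fderiv _ hf, iteratedFDeriv_succ_apply_fderiv _ hf]
      have e1 : (v ∘ Equiv.swap k.succ.castSucc k.succ.succ) 0 = v 0 := by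
        simp only [Function.comp]
        rw [Equiv.swap_apply_of_ne_of_ne]
        · simp [Fin.ext_iff]
        · simp [Fin.ext_iff]
      have e2 : Fin.tail (v ∘ Equiv.swap k.succ.castSucc k.succ.succ) =
          Fin.tail v ∘ Equiv.swap k.castSucc k.succ := by
        funext i
        simp only [Fin.tail, Function.comp]
        congr 1
        have := (Fin.succ_injective (m + 1)).map_swap k.castSucc k.succ i
        exact this.symm
      rw [e1, e2]
      congr 1
      apply Filter.EventuallyEq.fderiv_eq
      filter_upwards [hev] with y hy
      exact ih y hy k _

lemma iteratedFDeriv_perm {f : E → E'} {x : E} (m : ℕ) (hf : ContDiffAt ℝ m f x)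
    (σ : Equiv.Perm (Fin m)) (v : Fin m → E) :
    iteratedFDeriv ℝ m f x (v ∘ σ) = iteratedFDeriv ℝ m f x v := by
  cases m with
  | zero => congr 1; exact Subsingleton.elim _ _
  | succ m =>
    have hσ : σ ∈ Submonoid.closure
        (Set.range fun i : Fin m ↦ Equiv.swap i.castSucc i.succ) := by
      rw [Equiv.Perm.mclosure_swap_castSucc_succ]; trivial
    induction hσ using Submonoid.closure_induction generalizing v with
    | mem σ h => obtain ⟨k, rfl⟩ := h; exact iteratedFDeriv_swap f m x hf k v
    | one => rfl
    | mul σ τ _ _ h1 h2 =>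
      have : v ∘ (σ * τ : Equiv.Perm _) = (v ∘ σ) ∘ τ := rfl
      rw [this, h2, h1]


lemma contDiff_diag (i : ℕ) :
    ContDiff ℝ ∞ (fun z : (E [×i]→L[ℝ] E') × E => z.1 (fun _ => z.2)) := by
  induction i with
  | zero =>
    have : (fun z : (E [×0]→L[ℝ] E') × E => z.1 (fun _ => z.2)) =
        fun z => ContinuousMultilinearMap.apply ℝ (fun _ : Fin 0 => E) E' 0 z.1 := by
      funext z
      simp only [ContinuousMultilinearMap.apply_apply]
      congr 1; exact Subsingleton.elim _ _
    rw [this]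
    exact (ContinuousLinearMap.contDiff _).comp contDiff_fst
  | succ i ih =>
    have h1 : ContDiff ℝ ∞ (fun z : (E [×(i + 1)]→L[ℝ] E') × E =>
        (continuousMultilinearCurryLeftEquiv ℝ (fun _ : Fin (i + 1) => E) E' z.1) z.2) :=
      ((LinearIsometryEquiv.contDiff _).comp contDiff_fst).clm_apply contDiff_snd
    have h2 := ih.comp (h1.prodMk contDiff_snd)
    have h3 : (fun z : (E [×(i + 1)]→L[ℝ] E') × E => z.1 (fun _ => z.2)) =
        ((fun z : (E [×i]→L[ℝ] E') × E => z.1 (fun _ => z.2)) ∘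
        fun z : (E [×(i + 1)]→L[ℝ] E') × E =>
          ((continuousMultilinearCurryLeftEquiv ℝ (fun _ : Fin (i + 1) => E) E' z.1) z.2,
            z.2)) := by
      funext z
      simp only [Function.comp, continuousMultilinearCurryLeftEquiv_apply]
      congr 1
      funext j
      refine Fin.cases rfl (fun j => rfl) j
    rw [h3]
    exact h2

lemma contDiffAt_iteratedFDeriv_param {G : Type*} [NormedAddCommGroup G] [NormedSpace ℝ G]
    {f : G → E → E'} {c : G} {x : E} (hf : ContDiffAt ℝ ∞ (Function.uncurry f) (c, x)) (i : ℕ) :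
    ContDiffAt ℝ ∞ (fun z : G × E => iteratedFDeriv ℝ i (f z.1) z.2) (c, x) := by
  induction i with
  | zero =>
    exact (LinearIsometryEquiv.contDiff
      (continuousMultilinearCurryFin0 ℝ E E').symm).contDiffAt.comp (c, x) hf
  | succ i ih =>
    have h1 : ContDiffAt ℝ ∞ (fun z : G × E =>
        fderiv ℝ (fun y => iteratedFDeriv ℝ i (f z.1) y) z.2) (c, x) := by
      refine ContDiffAt.fderiv (n := ∞) (f := fun (z : G × E) y => iteratedFDeriv ℝ i (f z.1) y)
        (g := fun z => z.2) (x₀ := (c, x)) ?_ contDiffAt_snd le_rfl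
      have h2 : ContDiffAt ℝ ∞ (fun w : (G × E) × E => (w.1.1, w.2)) ((c, x), x) := by fun_prop
      exact ContDiffAt.comp (g := fun z : G × E => iteratedFDeriv ℝ i (f z.1) z.2)
        ((c, x), x) ih h2
    exact (LinearIsometryEquiv.contDiff
      (continuousMultilinearCurryLeftEquiv ℝ (fun _ : Fin (i + 1) => E) E').symm).contDiffAt.comp
        (c, x) h1

variable (E E') in
/-- Coordinates of the fibre directions of the bundle of `q`-jets of maps `E → E'`: families
`(p₀, …, p_q)` of symmetric `i`-linear maps `pᵢ`. -/
def jetCoord (q : ℕ) : Submodule ℝ (∀ i : Fin (q + 1), E [×(i : ℕ)]→L[ℝ] E') where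
  carrier := {p | ∀ (i : Fin (q + 1)) (σ : Equiv.Perm (Fin i)) (v : Fin i → E),
    p i (v ∘ σ) = p i v}
  add_mem' := by intro a b ha hb i σ v; simp [ha i σ v, hb i σ v]
  zero_mem' := by intro i σ v; simp
  smul_mem' := by intro c a ha i σ v; simp [ha i σ v]

lemma mem_jetCoord {q : ℕ} {p : ∀ i : Fin (q + 1), E [×(i : ℕ)]→L[ℝ] E'} :
    p ∈ jetCoord E E' q ↔ ∀ (i : Fin (q + 1)) (σ : Equiv.Perm (Fin i)) (v : Fin i → E),
      p i (v ∘ σ) = p i v := Iff.rfl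

variable (E E') in
/-- Averaging of multilinear maps over all permutations of their arguments. -/
def average (q : ℕ) :
    (∀ i : Fin (q + 1), E [×(i : ℕ)]→L[ℝ] E') →L[ℝ]
      (∀ i : Fin (q + 1), E [×(i : ℕ)]→L[ℝ] E') :=
  ContinuousLinearMap.pi fun i : Fin (q + 1) =>
    (((Nat.factorial i : ℝ)⁻¹) • ∑ σ : Equiv.Perm (Fin i),
      ((ContinuousMultilinearMap.domDomCongrₗᵢ ℝ E E' σ).toContinuousLinearEquiv :
        (E [×(i : ℕ)]→L[ℝ] E') →L[ℝ] (E [×(i : ℕ)]→L[ℝ] E')).comp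
        (ContinuousLinearMap.proj i))

lemma average_apply (q : ℕ) (p : ∀ i : Fin (q + 1), E [×(i : ℕ)]→L[ℝ] E') (i : Fin (q + 1))
    (v : Fin i → E) : average E E' q p i v =
      ((Nat.factorial i : ℝ)⁻¹) • ∑ σ : Equiv.Perm (Fin i), p i (fun j => v (σ j)) := by
  simp [average]
  congr

lemma average_mem (q : ℕ) (p : ∀ i : Fin (q + 1), E [×(i : ℕ)]→L[ℝ] E') :
    average E E' q p ∈ jetCoord E E' q := by
  rw [mem_jetCoord]
  intro i σ v
  rw [average_apply, average_apply]
  congr 1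
  exact Fintype.sum_equiv (Equiv.mulLeft σ) _ _ (fun τ => rfl)

variable (E E') in
/-- Averaging, as a projection onto the symmetric families. -/
def symmetrize (q : ℕ) :
    (∀ i : Fin (q + 1), E [×(i : ℕ)]→L[ℝ] E') →L[ℝ] jetCoord E E' q :=
  (average E E' q).codRestrict (jetCoord E E' q) (average_mem q)

lemma symmetrize_of_mem {q : ℕ} {p : ∀ i : Fin (q + 1), E [×(i : ℕ)]→L[ℝ] E'}
    (hp : p ∈ jetCoord E E' q) : symmetrize E E' q p = ⟨p, hp⟩ := by
  apply Subtype.ext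
  funext i
  ext v
  have : ∀ σ : Equiv.Perm (Fin i), p i (fun j => v (σ j)) = p i v := fun σ => hp i σ v
  have h2 : (symmetrize E E' q p).1 i v = average E E' q p i v := rfl
  rw [h2, average_apply]
  simp only [this, Finset.sum_const, Finset.card_univ, Fintype.card_perm, Fintype.card_fin]
  rw [← Nat.cast_smul_eq_nsmul ℝ, smul_smul, inv_mul_cancel₀, one_smul]
  exact_mod_cast Nat.factorial_ne_zero _

lemma contDiff_symmetrize (q : ℕ) : ContDiff ℝ ∞ (symmetrize E E' q) :=
  ContinuousLinearMap.contDiff (𝕜 := ℝ) (E := ∀ i : Fin (q + 1), E [×(i : ℕ)]→L[ℝ] E')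
    (F := jetCoord E E' q) (symmetrize E E' q)

/-- The polynomial map of degree at most `q` whose derivatives at `a` are `p₀, …, p_q`. -/
def taylorPoly {q : ℕ} (a : E) (p : ∀ i : Fin (q + 1), E [×(i : ℕ)]→L[ℝ] E') (y : E) : E' :=
  ∑ i : Fin (q + 1), ((Nat.factorial i : ℝ)⁻¹) • p i (fun _ => y - a)

lemma contDiff_taylorPoly (q : ℕ) :
    ContDiff ℝ ∞ (fun z : (E × jetCoord E E' q) × E => taylorPoly z.1.1 z.1.2.1 z.2) := by
  unfold taylorPoly
  refine ContDiff.sum fun i _ => ContDiff.const_smul _ ?_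
  have h1 : ContDiff ℝ ∞ (fun z : (E × jetCoord E E' q) × E => (z.1.2.1 i, z.2 - z.1.1)) := by
    refine ContDiff.prodMk ?_ (by fun_prop)
    have h0 : ContDiff ℝ ∞ (fun p : jetCoord E E' q => p.1) :=
      ContinuousLinearMap.contDiff (𝕜 := ℝ) (E := jetCoord E E' q)
        (F := ∀ i : Fin (q + 1), E [×(i : ℕ)]→L[ℝ] E') (jetCoord E E' q).subtypeL
    exact (contDiff_pi.1 h0 i).comp (contDiff_snd.comp contDiff_fst)
  exact (contDiff_diag (E := E) (E' := E') i).comp h1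

lemma iteratedFDeriv_taylorPoly {q : ℕ} (a : E) (p : jetCoord E E' q) (i : Fin (q + 1)) :
    iteratedFDeriv ℝ i (taylorPoly a p.1) a = p.1 i := by
  let s : FormalMultilinearSeries ℝ E E' := fun k =>
    if h : k < q + 1 then ((Nat.factorial k : ℝ)⁻¹) • p.1 ⟨k, h⟩ else 0
  have hs : ∀ k : Fin (q + 1), s k = ((Nat.factorial k : ℝ)⁻¹) • p.1 k := fun k =>
    dif_pos k.2
  have A : HasFiniteFPowerSeriesOnBall (taylorPoly a p.1) s a (q + 1) ⊤ := by
    apply HasFiniteFPowerSeriesOnBall.mk'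
    · intro m hm
      exact dif_neg (Nat.not_lt.2 hm)
    · simp
    · intro y _
      rw [Finset.sum_range]
      refine Finset.sum_congr rfl fun k _ => ?_
      rw [hs]
      simp
  have B : AnalyticOn ℝ (taylorPoly a p.1) univ := by
    have := A.cpolynomialOn.analyticOn
    simpa using this
  ext v
  rw [A.toHasFPowerSeriesOnBall.iteratedFDeriv_eq_sum B]
  have : ∀ σ : Equiv.Perm (Fin i), p.1 i (fun j => v (σ j)) = p.1 i v := fun σ => p.2 i σ v
  rw [hs]
  simp only [smul_apply, this, Finset.sum_const, Finset.card_univ,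
    Fintype.card_perm, Fintype.card_fin]
  rw [← Nat.cast_smul_eq_nsmul ℝ, smul_smul, mul_inv_cancel₀, one_smul]
  exact_mod_cast Nat.factorial_ne_zero _

end Calculus

section Jets

variable {E E' E'' : Type*} [NormedAddCommGroup E] [NormedSpace ℝ E]
  [NormedAddCommGroup E'] [NormedSpace ℝ E'] [NormedAddCommGroup E''] [NormedSpace ℝ E'']
  {M N P : Type*} [TopologicalSpace M] [ChartedSpace E M]
  [TopologicalSpace N] [ChartedSpace E' N] [TopologicalSpace P] [ChartedSpace E'' P]

variable (E E') in
/-- `f` is smooth on a neighbourhood of `x`. -/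
def SmoothNear (f : M → N) (x : M) : Prop :=
  ∀ᶠ y in 𝓝 x, ContMDiffAt 𝓘(ℝ, E) 𝓘(ℝ, E') ∞ f y

variable (E E' M N) in
/-- A map together with a source point near which it is smooth. -/
structure PointedMap where
  toFun : M → N
  src : M
  smooth : SmoothNear E E' toFun src

/-- Two maps have the same `q`-jet if they have the same source, the same target, and the same
derivatives up to order `q` at the source in all charts. -/
def SameJet (q : ℕ) (a b : PointedMap E E' M N) : Prop :=
  a.src = b.src ∧ a.toFun a.src = b.toFun b.src ∧
    ∀ e ∈ atlas E M, ∀ e' ∈ atlas E' N, a.src ∈ e.source → a.toFun a.src ∈ e'.source →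
      ∀ i ≤ q, iteratedFDeriv ℝ i (e' ∘ a.toFun ∘ e.symm) (e a.src) =
        iteratedFDeriv ℝ i (e' ∘ b.toFun ∘ e.symm) (e b.src)

variable (E E' M N) in
/-- Having the same `q`-jet is an equivalence relation. -/
def jetSetoid (q : ℕ) : Setoid (PointedMap E E' M N) where
  r := SameJet q
  iseqv :=
    { refl := fun _ => ⟨rfl, rfl, fun _ _ _ _ _ _ _ _ => rfl⟩
      symm := fun h => ⟨h.1.symm, h.2.1.symm, fun e he e' he' hs ht i hi =>
        (h.2.2 e he e' he' (h.1 ▸ hs) (h.2.1 ▸ ht) i hi).symm⟩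
      trans := fun h k => ⟨h.1.trans k.1, h.2.1.trans k.2.1, fun e he e' he' hs ht i hi =>
        (h.2.2 e he e' he' hs ht i hi).trans
          (k.2.2 e he e' he' (h.1 ▸ hs) (h.2.1 ▸ ht) i hi)⟩ }

variable (E E' M N) in
/-- The manifold `J_q(M × N)` of `q`-jets of local smooth maps `M → N` -/
def Jet (q : ℕ) : Type _ := Quotient (jetSetoid E E' M N q)

namespace Jet

variable {q : ℕ}

def mk (q : ℕ) (a : PointedMap E E' M N) : Jet E E' M N q := Quotient.mk (jetSetoid E E' M N q) a

/-- The source of a jet. -/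
def src : Jet E E' M N q → M := Quotient.lift (fun a => a.src) fun _ _ h => h.1

/-- The target of a jet. -/
def tgt : Jet E E' M N q → N := Quotient.lift (fun a => a.toFun a.src) fun _ _ h => h.2.1

/-- The projection from `(q+1)`-jets to `q`-jets. -/
def proj : Jet E E' M N (q + 1) → Jet E E' M N q :=
  Quotient.map' id fun _ _ h => ⟨h.1, h.2.1, fun e he e' he' hs ht i hi =>
    h.2.2 e he e' he' hs ht i (hi.trans (Nat.le_succ q))⟩

/-- A map representing a jet. -/
def rep (j : Jet E E' M N q) : PointedMap E E' M N := Quotient.out j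

lemma smoothNear_const (x : M) (y : N) : SmoothNear E E' (fun _ : M => y) x :=
  Filter.Eventually.of_forall fun _ => contMDiffAt_const

open Classical in
variable (E E') in
/-- The `q`-jet `j_q(f)(x)`; it is only meaningful if `f` is smooth near `x`, and a jet of a constant
map otherwise. -/
def of (q : ℕ) (f : M → N) (x : M) : Jet E E' M N q :=
  if h : SmoothNear E E' f x then mk q ⟨f, x, h⟩
  else mk q ⟨fun _ => f x, x, smoothNear_const x (f x)⟩

lemma of_eq {f : M → N} {x : M} (h : SmoothNear E E' f x) : of E E' q f x = mk q ⟨f, x, h⟩ :=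
  dif_pos h

@[simp] lemma src_of (f : M → N) (x : M) : (of E E' q f x).src = x := by
  unfold of; split_ifs <;> rfl

@[simp] lemma tgt_of (f : M → N) (x : M) : (of E E' q f x).tgt = f x := by
  unfold of; split_ifs <;> rfl

lemma of_rep (j : Jet E E' M N q) : of E E' q j.rep.toFun j.rep.src = j := by
  rw [of_eq j.rep.smooth]
  exact Quotient.out_eq j

lemma rep_src (j : Jet E E' M N q) : j.rep.src = j.src := by
  conv_rhs => rw [← of_rep j]
  simp

lemma rep_tgt (j : Jet E E' M N q) : j.rep.toFun j.src = j.tgt := by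
  conv_rhs => rw [← of_rep j]
  simp [rep_src]

lemma mk_eq_iff {a b : PointedMap E E' M N} : mk q a = mk q b ↔ SameJet q a b :=
  Quotient.eq (r := jetSetoid E E' M N q)

/-- The composite `b ∘ a` of jets; it is only meaningful if `a.tgt = b.src`. -/
def comp (b : Jet E' E'' N P q) (a : Jet E E' M N q) : Jet E E'' M P q :=
  of E E'' q (b.rep.toFun ∘ a.rep.toFun) a.src

@[simp] lemma src_comp (b : Jet E' E'' N P q) (a : Jet E E' M N q) : (comp b a).src = a.src :=
  src_of _ _

lemma proj_of {f : M → N} {x : M} (h : SmoothNear E E' f x) :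
    (of E E' (q + 1) f x).proj = of E E' q f x := by
  rw [of_eq h, of_eq h]; rfl

end Jet

lemma SmoothNear.comp {g : N → P} {f : M → N} {x : M} (hg : SmoothNear E' E'' g (f x))
    (hf : SmoothNear E E' f x) : SmoothNear E E'' (g ∘ f) x := by
  have hc : ContinuousAt f x := hf.self_of_nhds.continuousAt
  filter_upwards [hf, hc.eventually hg] with y h1 h2
  exact ContMDiffAt.comp y h2 h1

lemma iteratedFDeriv_comp_congr {q : ℕ} {g g' : E' → E''} {f f' : E → E'} {x : E}
    (hf : ContDiffAt ℝ q f x) (hf' : ContDiffAt ℝ q f' x) (hx : f x = f' x)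
    (hg : ContDiffAt ℝ q g (f x)) (hg' : ContDiffAt ℝ q g' (f x))
    (h1 : ∀ i ≤ q, iteratedFDeriv ℝ i f x = iteratedFDeriv ℝ i f' x)
    (h2 : ∀ i ≤ q, iteratedFDeriv ℝ i g (f x) = iteratedFDeriv ℝ i g' (f x)) :
    ∀ i ≤ q, iteratedFDeriv ℝ i (g ∘ f) x = iteratedFDeriv ℝ i (g' ∘ f') x := by
  intro i hi
  rw [iteratedFDeriv_comp hg hf (by exact_mod_cast hi),
    iteratedFDeriv_comp (hx ▸ hg') hf' (by exact_mod_cast hi)]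
  unfold FormalMultilinearSeries.taylorComp
  refine Finset.sum_congr rfl fun c _ => ?_
  unfold FormalMultilinearSeries.compAlongOrderedFinpartition
  congr 1
  · simp only [ftaylorSeries]
    rw [← hx]
    exact h2 _ (c.length_le.trans hi)
  · funext m
    exact h1 _ ((c.partSize_le m).trans hi)

variable [IsManifold 𝓘(ℝ, E) ∞ M] [IsManifold 𝓘(ℝ, E') ∞ N] [IsManifold 𝓘(ℝ, E'') ∞ P]

lemma contMDiffAt_iff_coord {f : M → N} {x : M}
    {e : OpenPartialHomeomorph M E} (he : e ∈ atlas E M)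
    {e' : OpenPartialHomeomorph N E'} (he' : e' ∈ atlas E' N)
    (hx : x ∈ e.source) (hy : f x ∈ e'.source) :
    ContMDiffAt 𝓘(ℝ, E) 𝓘(ℝ, E') ∞ f x ↔
      ContinuousAt f x ∧ ContDiffAt ℝ ∞ (e' ∘ f ∘ e.symm) (e x) := by
  have := contMDiffAt_iff_of_mem_maximalAtlas (I := 𝓘(ℝ, E)) (I' := 𝓘(ℝ, E')) (n := ∞) (f := f)
    (IsManifold.subset_maximalAtlas he) (IsManifold.subset_maximalAtlas he') hx hy
  simpa [contDiffWithinAt_univ] using this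

lemma contDiffAt_coord {f : M → N} {x : M} (h : SmoothNear E E' f x)
    {e : OpenPartialHomeomorph M E} (he : e ∈ atlas E M)
    {e' : OpenPartialHomeomorph N E'} (he' : e' ∈ atlas E' N)
    (hx : x ∈ e.source) (hy : f x ∈ e'.source) :
    ContDiffAt ℝ ∞ (e' ∘ f ∘ e.symm) (e x) :=
  ((contMDiffAt_iff_coord he he' hx hy).1 h.self_of_nhds).2

lemma contDiffAt_transition {e d : OpenPartialHomeomorph M E} (he : e ∈ atlas E M)
    (hd : d ∈ atlas E M) {x : M} (hx : x ∈ e.source) (hx' : x ∈ d.source) :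
    ContDiffAt ℝ ∞ (d ∘ e.symm) (e x) :=
  contDiffAt_coord (f := id) (Filter.Eventually.of_forall fun _ => contMDiffAt_id) he hd hx hx'

lemma coord_change {f : M → N} {x : M} (hf : ContinuousAt f x)
    {e d : OpenPartialHomeomorph M E} {e' d' : OpenPartialHomeomorph N E'}
    (hx : x ∈ e.source) (hx' : x ∈ d.source) (hy : f x ∈ e'.source) :
    d' ∘ f ∘ d.symm =ᶠ[𝓝 (d x)] (d' ∘ e'.symm) ∘ (e' ∘ f ∘ e.symm) ∘ (e ∘ d.symm) := by
  have h1 : Tendsto d.symm (𝓝 (d x)) (𝓝 x) := by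
    have := (d.continuousAt_symm (d.map_source hx')).tendsto
    rwa [d.left_inv hx'] at this
  filter_upwards [h1.eventually (e.open_source.mem_nhds hx),
    h1.eventually (hf.eventually (e'.open_source.mem_nhds hy))] with z hz hz'
  simp only [Function.comp]
  rw [e.left_inv hz, e'.left_inv hz']

/-- Agreement of the derivatives in one pair of charts suffices. -/
lemma sameJet_of_chart {q : ℕ} {a b : PointedMap E E' M N} (hs : a.src = b.src)
    (ht : a.toFun a.src = b.toFun b.src)
    {e : OpenPartialHomeomorph M E} (he : e ∈ atlas E M)
    {e' : OpenPartialHomeomorph N E'} (he' : e' ∈ atlas E' N)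
    (hx : a.src ∈ e.source) (hy : a.toFun a.src ∈ e'.source)
    (h : ∀ i ≤ q, iteratedFDeriv ℝ i (e' ∘ a.toFun ∘ e.symm) (e a.src) =
        iteratedFDeriv ℝ i (e' ∘ b.toFun ∘ e.symm) (e b.src)) : SameJet q a b := by
  refine ⟨hs, ht, fun d hd d' hd' hx' hy' i hi => ?_⟩
  obtain ⟨f, x, hf⟩ := a
  obtain ⟨g, x', hg⟩ := b
  dsimp only at *
  subst hs
  rw [((coord_change (d' := d') hf.self_of_nhds.continuousAt hx hx' hy).iteratedFDeriv
      ℝ i).self_of_nhds,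
    ((coord_change (d' := d') hg.self_of_nhds.continuousAt hx hx' (ht ▸ hy)).iteratedFDeriv
      ℝ i).self_of_nhds]
  have hle := nat_le_infty q
  have e1 : (e ∘ d.symm) (d x) = e x := by simp [hx']
  have e2 : (e' ∘ f ∘ e.symm) (e x) = e' (f x) := by simp [hx]
  have e3 : (e' ∘ g ∘ e.symm) (e x) = e' (f x) := by simp [hx, ht]
  have c1 : ContDiffAt ℝ q (e ∘ d.symm) (d x) := (contDiffAt_transition hd he hx' hx).of_le hle
  have c2 : ContDiffAt ℝ q (e' ∘ f ∘ e.symm) (e x) := (contDiffAt_coord hf he he' hx hy).of_le hle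
  have c3 : ContDiffAt ℝ q (e' ∘ g ∘ e.symm) (e x) :=
    (contDiffAt_coord hg he he' hx (ht ▸ hy)).of_le hle
  have c4 : ContDiffAt ℝ q (d' ∘ e'.symm) (e' (f x)) :=
    (contDiffAt_transition he' hd' hy hy').of_le hle
  refine iteratedFDeriv_comp_congr (q := q) ?_ ?_ ?_ ?_ ?_ ?_ ?_ i hi
  · exact ContDiffAt.comp (d x) (e1.symm ▸ c2) c1
  · exact ContDiffAt.comp (d x) (e1.symm ▸ c3) c1
  · simp [hx', hx, ht]
  · simpa [hx', hx] using c4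
  · simpa [hx', hx] using c4
  · refine iteratedFDeriv_comp_congr (q := q) c1 c1 rfl (e1.symm ▸ c2) (e1.symm ▸ c3)
      (fun _ _ => rfl) ?_
    rw [e1]; exact h
  · intro i _; rfl


namespace Jet

variable {q : ℕ}

/-- Coordinates of a jet in a pair of charts: the coordinates of the source, and the derivatives
of order `0, …, q` there of the coordinate expression of a representative. These derivatives are
symmetric; `symmetrize` only records this in the type. -/
def coord (e : OpenPartialHomeomorph M E) (e' : OpenPartialHomeomorph N E')
    (j : Jet E E' M N q) : E × jetCoord E E' q :=
  (e j.src, symmetrize E E' q fun i => iteratedFDeriv ℝ i (e' ∘ j.rep.toFun ∘ e.symm) (e j.src))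

/-- The jet with given coordinates, represented by a polynomial map in the charts. -/
def ofCoord (e : OpenPartialHomeomorph M E) (e' : OpenPartialHomeomorph N E')
    (c : E × jetCoord E E' q) : Jet E E' M N q :=
  of E E' q (e'.symm ∘ taylorPoly c.1 c.2.1 ∘ e) (e.symm c.1)

lemma coord_of {f : M → N} {x : M} (h : SmoothNear E E' f x)
    {e : OpenPartialHomeomorph M E} (he : e ∈ atlas E M)
    {e' : OpenPartialHomeomorph N E'} (he' : e' ∈ atlas E' N)
    (hx : x ∈ e.source) (hy : f x ∈ e'.source) :
    coord e e' (of E E' q f x) =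
      (e x, symmetrize E E' q fun i => iteratedFDeriv ℝ i (e' ∘ f ∘ e.symm) (e x)) := by
  have h1 : mk q (of E E' q f x).rep = mk q ⟨f, x, h⟩ := by
    rw [← of_eq h]; exact Quotient.out_eq _
  have h2 := (mk_eq_iff.1 h1)
  have h3 : (of E E' q f x).rep.src = x := h2.1
  unfold coord
  rw [src_of]
  congr 2
  funext i
  have := h2.2.2 e he e' he' (h2.1 ▸ hx) (h2.2.1 ▸ hy) i (Nat.lt_succ_iff.1 i.2)
  rwa [h3] at this

lemma derivs_mem {f : M → N} {x : M} (h : SmoothNear E E' f x)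
    {e : OpenPartialHomeomorph M E} (he : e ∈ atlas E M)
    {e' : OpenPartialHomeomorph N E'} (he' : e' ∈ atlas E' N)
    (hx : x ∈ e.source) (hy : f x ∈ e'.source) :
    (fun i : Fin (q + 1) => iteratedFDeriv ℝ i (e' ∘ f ∘ e.symm) (e x)) ∈ jetCoord E E' q :=
  fun i σ v => iteratedFDeriv_perm i
    ((contDiffAt_coord h he he' hx hy).of_le (nat_le_infty i)) σ v

lemma taylorPoly_self {a : E} (p : jetCoord E E' q) : taylorPoly a p.1 a = p.1 0 0 := by
  have := congrArg (fun φ => φ 0) (iteratedFDeriv_taylorPoly a p 0)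
  exact (iteratedFDeriv_zero_apply (𝕜 := ℝ) (f := taylorPoly a p.1) (x := a) 0).symm.trans this

lemma contDiff_taylorPoly_snd (a : E) (p : jetCoord E E' q) :
    ContDiff ℝ ∞ (taylorPoly a p.1) :=
  (contDiff_taylorPoly q).comp (f := fun y => ((a, p), y)) (by fun_prop)

lemma smoothNear_ofCoord {e : OpenPartialHomeomorph M E} (he : e ∈ atlas E M)
    {e' : OpenPartialHomeomorph N E'} (he' : e' ∈ atlas E' N) {c : E × jetCoord E E' q}
    (h1 : c.1 ∈ e.target) (h2 : c.2.1 0 0 ∈ e'.target) :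
    SmoothNear E E' (e'.symm ∘ taylorPoly c.1 c.2.1 ∘ e) (e.symm c.1) := by
  have hx := e.map_target h1
  have hc : ContinuousAt (taylorPoly c.1 c.2.1 ∘ e) (e.symm c.1) :=
    (contDiff_taylorPoly_snd c.1 c.2).continuous.continuousAt.comp (e.continuousAt hx)
  have ht : (taylorPoly c.1 c.2.1 ∘ e) (e.symm c.1) ∈ e'.target := by
    simpa [e.right_inv h1, taylorPoly_self] using h2
  filter_upwards [e.open_source.mem_nhds hx, hc.eventually (e'.open_target.mem_nhds ht)]
    with y hy hy'
  have m1 : ContMDiffAt 𝓘(ℝ, E) 𝓘(ℝ, E) ∞ e y :=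
    contMDiffAt_of_mem_maximalAtlas (IsManifold.subset_maximalAtlas he) hy
  have m2 : ContMDiffAt 𝓘(ℝ, E') 𝓘(ℝ, E') ∞ e'.symm (taylorPoly c.1 c.2.1 (e y)) :=
    contMDiffAt_symm_of_mem_maximalAtlas (IsManifold.subset_maximalAtlas he') hy'
  have m3 : ContMDiffAt 𝓘(ℝ, E) 𝓘(ℝ, E') ∞ (taylorPoly c.1 c.2.1) (e y) :=
    (contDiff_taylorPoly_snd c.1 c.2).contMDiff.contMDiffAt
  exact ContMDiffAt.comp y m2 (ContMDiffAt.comp y m3 m1)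

lemma zero_deriv_mem {f : M → N} {x : M} {e : OpenPartialHomeomorph M E}
    {e' : OpenPartialHomeomorph N E'} (hx : x ∈ e.source) (hy : f x ∈ e'.source) :
    iteratedFDeriv ℝ 0 (e' ∘ f ∘ e.symm) (e x) 0 ∈ e'.target := by
  rw [iteratedFDeriv_zero_apply]
  simpa [hx] using e'.map_source hy

lemma ofCoord_coord_expr (e : OpenPartialHomeomorph M E)
    (e' : OpenPartialHomeomorph N E') {c : E × jetCoord E E' q}
    (h1 : c.1 ∈ e.target) (h2 : c.2.1 0 0 ∈ e'.target) :
    e' ∘ (e'.symm ∘ taylorPoly c.1 c.2.1 ∘ e) ∘ e.symm =ᶠ[𝓝 c.1] taylorPoly c.1 c.2.1 := by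
  have hc := (contDiff_taylorPoly_snd c.1 c.2).continuous.continuousAt (x := c.1)
  rw [← taylorPoly_self (a := c.1)] at h2
  filter_upwards [e.open_target.mem_nhds h1, hc.eventually (e'.open_target.mem_nhds h2)]
    with y hy hy'
  simp only [Function.comp]
  rw [e.right_inv hy, e'.right_inv hy']

/-- Jet coordinates, as a partial bijection onto an open set. -/
def chart (e : OpenPartialHomeomorph M E) (he : e ∈ atlas E M)
    (e' : OpenPartialHomeomorph N E') (he' : e' ∈ atlas E' N) :
    PartialEquiv (Jet E E' M N q) (E × jetCoord E E' q) where
  toFun := coord e e'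
  invFun := ofCoord e e'
  source := {j | j.src ∈ e.source ∧ j.tgt ∈ e'.source}
  target := {c | c.1 ∈ e.target ∧ c.2.1 0 0 ∈ e'.target}
  map_source' := by
    rintro j ⟨h1, h2⟩
    rw [← rep_tgt, ← rep_src] at h2
    rw [← rep_src] at h1
    have hm := derivs_mem (q := q) j.rep.smooth he he' h1 h2
    refine ⟨?_, ?_⟩
    · rw [rep_src] at h1
      exact e.map_source h1
    · simp only [coord, ← rep_src]
      rw [symmetrize_of_mem hm]
      exact zero_deriv_mem h1 h2
  map_target' := by
    rintro c ⟨h1, h2⟩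
    refine ⟨?_, ?_⟩
    · simpa [ofCoord] using e.map_target h1
    · simpa [ofCoord, e.right_inv h1, taylorPoly_self] using e'.map_target h2
  left_inv' := by
    rintro j ⟨h1, h2⟩
    have hj : mk q j.rep = j := Quotient.out_eq j
    rw [← rep_tgt, ← rep_src] at h2
    rw [← rep_src] at h1
    have hm := derivs_mem (q := q) j.rep.smooth he he' h1 h2
    have hc : coord e e' j = (e j.rep.src, ⟨_, hm⟩) := by
      unfold coord
      rw [← rep_src, symmetrize_of_mem hm]
    have t1 : (coord e e' j).1 ∈ e.target := by rw [hc]; exact e.map_source h1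
    have t2 : (coord e e' j).2.1 0 0 ∈ e'.target := by
      rw [hc]; exact zero_deriv_mem h1 h2
    have hsm := smoothNear_ofCoord he he' t1 t2
    unfold ofCoord
    rw [of_eq hsm]
    conv_rhs => rw [← hj]
    rw [mk_eq_iff]
    have hy : (e'.symm ∘ taylorPoly (coord e e' j).1 (coord e e' j).2.1 ∘ e)
        (e.symm (coord e e' j).1) ∈ e'.source := by
      simpa [e.right_inv t1, taylorPoly_self] using e'.map_target t2
    refine sameJet_of_chart ?_ ?_ he he' (e.map_target t1) hy ?_
    · dsimp only
      rw [hc, e.left_inv h1]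
    · simp only [Function.comp]
      rw [e.right_inv t1, taylorPoly_self, hc]
      refine (congrArg e'.symm (iteratedFDeriv_zero_apply (𝕜 := ℝ)
        (f := e' ∘ j.rep.toFun ∘ e.symm) (x := e j.rep.src) 0)).trans ?_
      simp [h1, h2]
    · intro i hi
      dsimp only
      rw [e.right_inv t1, ((ofCoord_coord_expr e e' t1 t2).iteratedFDeriv ℝ i).self_of_nhds]
      have := iteratedFDeriv_taylorPoly (coord e e' j).1 (coord e e' j).2
        ⟨i, Nat.lt_succ_of_le hi⟩
      refine this.trans ?_
      rw [hc]
  right_inv' := by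
    rintro c ⟨h1, h2⟩
    have hsm := smoothNear_ofCoord he he' h1 h2
    have hy : (e'.symm ∘ taylorPoly c.1 c.2.1 ∘ e) (e.symm c.1) ∈ e'.source := by
      simpa [e.right_inv h1, taylorPoly_self] using e'.map_target h2
    unfold ofCoord
    rw [coord_of hsm he he' (e.map_target h1) hy, e.right_inv h1]
    have h3 : (fun i : Fin (q + 1) => iteratedFDeriv ℝ i
        (e' ∘ (e'.symm ∘ taylorPoly c.1 c.2.1 ∘ e) ∘ e.symm) c.1) = c.2.1 := by
      funext i
      rw [((ofCoord_coord_expr e e' h1 h2).iteratedFDeriv ℝ i).self_of_nhds,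
        iteratedFDeriv_taylorPoly]
    rw [h3, symmetrize_of_mem c.2.2]

lemma mem_chart_trans_iff
    {e d : OpenPartialHomeomorph M E} (he : e ∈ atlas E M) (hd : d ∈ atlas E M)
    {e' d' : OpenPartialHomeomorph N E'} (he' : e' ∈ atlas E' N) (hd' : d' ∈ atlas E' N)
    {c : E × jetCoord E E' q} :
    c ∈ ((chart (q := q) e he e' he').symm.trans (chart d hd d' hd')).source ↔
      c.1 ∈ e.target ∧ c.2.1 0 0 ∈ e'.target ∧ e.symm c.1 ∈ d.source ∧
        e'.symm (c.2.1 0 0) ∈ d'.source := by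
  constructor
  · rintro ⟨⟨h1, h2⟩, h3⟩
    have h3' : (e.symm c.1) ∈ d.source ∧ e'.symm (c.2.1 0 0) ∈ d'.source := by
      simpa [chart, ofCoord, e.right_inv h1, taylorPoly_self] using h3
    exact ⟨h1, h2, h3'.1, h3'.2⟩
  · rintro ⟨h1, h2, h3, h4⟩
    refine ⟨⟨h1, h2⟩, ?_⟩
    simpa [chart, ofCoord, e.right_inv h1, taylorPoly_self] using And.intro h3 h4

/-- The transition maps between jet coordinates are smooth. -/
lemma contDiffOn_chart_trans
    {e d : OpenPartialHomeomorph M E} (he : e ∈ atlas E M) (hd : d ∈ atlas E M)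
    {e' d' : OpenPartialHomeomorph N E'} (he' : e' ∈ atlas E' N) (hd' : d' ∈ atlas E' N) :
    ContDiffOn ℝ ∞ ((chart (q := q) e he e' he').symm.trans (chart d hd d' hd'))
      ((chart (q := q) e he e' he').symm.trans (chart d hd d' hd')).source := by
  have key : ∀ c ∈ ((chart (q := q) e he e' he').symm.trans (chart d hd d' hd')).source,
      c.1 ∈ e.target ∧ c.2.1 0 0 ∈ e'.target ∧ e.symm c.1 ∈ d.source ∧
        e'.symm (c.2.1 0 0) ∈ d'.source := fun c hc => (mem_chart_trans_iff he hd he' hd').1 hc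
  have main : ContDiffOn ℝ ∞ (fun c : E × jetCoord E E' q => (d (e.symm c.1),
      symmetrize E E' q fun i : Fin (q + 1) => iteratedFDeriv ℝ i
        (d' ∘ (e'.symm ∘ taylorPoly c.1 c.2.1 ∘ e) ∘ d.symm) (d (e.symm c.1))))
      ((chart (q := q) e he e' he').symm.trans (chart d hd d' hd')).source := by
    intro c hc
    obtain ⟨h1, h2, h3, h4⟩ := key c hc
    refine ContDiffAt.contDiffWithinAt ?_
    have t1 : ContDiffAt ℝ ∞ (d ∘ e.symm) c.1 := by
      have := contDiffAt_transition he hd (e.map_target h1) h3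
      rwa [e.right_inv h1] at this
    have t2 : ContDiffAt ℝ ∞ (e ∘ d.symm) (d (e.symm c.1)) :=
      contDiffAt_transition hd he h3 (e.map_target h1)
    have t3 : ContDiffAt ℝ ∞ (d' ∘ e'.symm) (c.2.1 0 0) := by
      have := contDiffAt_transition he' hd' (e'.map_target h2) h4
      rwa [e'.right_inv h2] at this
    have hG : ContDiffAt ℝ ∞ (Function.uncurry fun (c : E × jetCoord E E' q) (z : E) =>
        (d' ∘ (e'.symm ∘ taylorPoly c.1 c.2.1 ∘ e) ∘ d.symm) z) (c, d (e.symm c.1)) := by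
      have u1 : ContDiffAt ℝ ∞ (fun w : (E × jetCoord E E' q) × E => (w.1, (e ∘ d.symm) w.2))
          (c, d (e.symm c.1)) :=
        contDiffAt_fst.prodMk (ContDiffAt.comp (g := e ∘ d.symm)
          (f := fun w : (E × jetCoord E E' q) × E => w.2) (c, d (e.symm c.1)) t2 contDiffAt_snd)
      have u2 := (contDiff_taylorPoly (E := E) (E' := E') q).contDiffAt.comp _ u1
      refine ContDiffAt.comp (g := d' ∘ e'.symm) (c, d (e.symm c.1)) ?_ u2
      convert! t3 using 1
      simp [h3, e.right_inv h1, taylorPoly_self]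
    have t1' : ContDiffAt ℝ ∞ (fun c : E × jetCoord E E' q => d (e.symm c.1)) c :=
      ContDiffAt.comp (g := d ∘ e.symm) (f := Prod.fst) c t1 contDiffAt_fst
    refine t1'.prodMk ?_
    refine (contDiff_symmetrize (E := E) (E' := E') q).contDiffAt.comp c ?_
    refine contDiffAt_pi.2 fun i => ?_
    exact ContDiffAt.comp (f := fun c : E × jetCoord E E' q => (c, d (e.symm c.1))) c
      (contDiffAt_iteratedFDeriv_param hG i) (contDiffAt_id.prodMk t1')
  refine main.congr fun c hc => ?_
  obtain ⟨h1, h2, h3, h4⟩ := key c hc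
  refine coord_of (smoothNear_ofCoord he he' h1 h2) hd hd' h3 ?_
  simpa [e.right_inv h1, taylorPoly_self] using h4

lemma isOpen_chart_trans
    {e d : OpenPartialHomeomorph M E} (he : e ∈ atlas E M) (hd : d ∈ atlas E M)
    {e' d' : OpenPartialHomeomorph N E'} (he' : e' ∈ atlas E' N) (hd' : d' ∈ atlas E' N) :
    IsOpen ((chart (q := q) e he e' he').symm.trans (chart d hd d' hd')).source := by
  have h : ((chart (q := q) e he e' he').symm.trans (chart d hd d' hd')).source =
      (fun c : E × jetCoord E E' q => c.1) ⁻¹' (e.symm.trans d).source ∩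
        (fun c : E × jetCoord E E' q => c.2.1 0 0) ⁻¹' (e'.symm.trans d').source := by
    ext c
    rw [mem_chart_trans_iff he hd he' hd']
    simp only [mem_inter_iff, mem_preimage, OpenPartialHomeomorph.trans_source,
      OpenPartialHomeomorph.symm_source]
    tauto
  rw [h]
  have hc : Continuous (fun c : E × jetCoord E E' q => c.2.1 0 0) := by
    have h1 : Continuous (fun c : E × jetCoord E E' q => c.2.1 0) :=
      (continuous_apply (0 : Fin (q + 1))).comp (continuous_subtype_val.comp continuous_snd)
    exact (ContinuousMultilinearMap.apply ℝ (fun _ : Fin ((0 : Fin (q + 1)) : ℕ) => E) E'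
      0).continuous.comp h1
  exact ((e.symm.trans d).open_source.preimage continuous_fst).inter
    ((e'.symm.trans d').open_source.preimage hc)

variable (E E' M N q) in
/-- The atlas of jet coordinates. -/
def chartedSpaceCore : ChartedSpaceCore (E × jetCoord E E' q) (Jet E E' M N q) where
  atlas := {c | ∃ e he e' he', c = chart (q := q) e he e' he'}
  chartAt j := chart (chartAt E j.src) (chart_mem_atlas E j.src) (chartAt E' j.tgt)
    (chart_mem_atlas E' j.tgt)
  mem_chart_source j := ⟨mem_chart_source E j.src, mem_chart_source E' j.tgt⟩
  chart_mem_atlas j := ⟨_, _, _, _, rfl⟩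
  open_source := by
    rintro _ _ ⟨e, he, e', he', rfl⟩ ⟨d, hd, d', hd', rfl⟩
    exact isOpen_chart_trans he hd he' hd'
  continuousOn_toFun := by
    rintro _ _ ⟨e, he, e', he', rfl⟩ ⟨d, hd, d', hd', rfl⟩
    exact (contDiffOn_chart_trans he hd he' hd').continuousOn

instance : TopologicalSpace (Jet E E' M N q) := (chartedSpaceCore E E' M N q).toTopologicalSpace

instance : ChartedSpace (E × jetCoord E E' q) (Jet E E' M N q) :=
  (chartedSpaceCore E E' M N q).toChartedSpace

/-- The jet manifold is smooth. -/
instance : IsManifold 𝓘(ℝ, E × jetCoord E E' q) ∞ (Jet E E' M N q) := by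
  apply isManifold_of_contDiffOn
  intro a b ha hb
  change a ∈ ⋃ (e : PartialEquiv (Jet E E' M N q) (E × jetCoord E E' q))
    (he : e ∈ (chartedSpaceCore E E' M N q).atlas), _ at ha
  change b ∈ ⋃ (e : PartialEquiv (Jet E E' M N q) (E × jetCoord E E' q))
    (he : e ∈ (chartedSpaceCore E E' M N q).atlas), _ at hb
  simp only [mem_iUnion, mem_singleton_iff] at ha hb
  obtain ⟨_, ⟨e, he, e', he', rfl⟩, rfl⟩ := ha
  obtain ⟨_, ⟨d, hd, d', hd', rfl⟩, rfl⟩ := hb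
  have := contDiffOn_chart_trans (q := q) he hd he' hd'
  have h2 : ContDiffOn ℝ ∞ (chart d hd d' hd' ∘ (chart (q := q) e he e' he').symm)
      ((chart (q := q) e he e' he').target ∩
        (chart (q := q) e he e' he').symm ⁻¹' (chart d hd d' hd').source) := by
    simpa using this
  simp only [modelWithCornersSelf_coe, modelWithCornersSelf_coe_symm, range_id, inter_univ,
    Function.id_comp, Function.comp_id, preimage_id, OpenPartialHomeomorph.coe_trans,
    OpenPartialHomeomorph.trans_source]
  exact h2

end Jet

namespace Jet

variable {q : ℕ}

/-- The composite of jets may be computed with arbitrary representatives. -/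
lemma comp_of {g : N → P} {f : M → N} {x : M} (hg : SmoothNear E' E'' g (f x))
    (hf : SmoothNear E E' f x) :
    comp (of E' E'' q g (f x)) (of E E' q f x) = of E E'' q (g ∘ f) x := by
  obtain ⟨⟨f', x', hf'⟩, ha⟩ : ∃ a, a = (of E E' q f x).rep := ⟨_, rfl⟩
  obtain ⟨⟨g', y', hg'⟩, hb⟩ : ∃ b, b = (of E' E'' q g (f x)).rep := ⟨_, rfl⟩
  have h1 : mk q ⟨f', x', hf'⟩ = mk q ⟨f, x, hf⟩ := by
    rw [ha, ← of_eq hf]; exact Quotient.out_eq _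
  have h2 : mk q ⟨g', y', hg'⟩ = mk q ⟨g, f x, hg⟩ := by
    rw [hb, ← of_eq hg]; exact Quotient.out_eq _
  obtain ⟨r1, r2, r3⟩ := mk_eq_iff.1 h1
  obtain ⟨s1, s2, s3⟩ := mk_eq_iff.1 h2
  dsimp only at *
  subst r1 s1
  unfold comp
  rw [← ha, ← hb, src_of]
  dsimp only
  have hgf' : SmoothNear E E'' (g' ∘ f') x' := SmoothNear.comp (r2 ▸ hg') hf'
  rw [of_eq hgf', of_eq (hg.comp hf), mk_eq_iff]
  set e := chartAt E x'
  set e' := chartAt E' (f x')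
  set e'' := chartAt E'' (g (f x'))
  have he : e ∈ atlas E M := chart_mem_atlas _ _
  have he' : e' ∈ atlas E' N := chart_mem_atlas _ _
  have he'' : e'' ∈ atlas E'' P := chart_mem_atlas _ _
  have hx : x' ∈ e.source := mem_chart_source _ _
  have hy : f x' ∈ e'.source := mem_chart_source _ _
  have hz : g (f x') ∈ e''.source := mem_chart_source _ _
  have hy' : f' x' ∈ e'.source := r2 ▸ hy
  have hz' : g' (f x') ∈ e''.source := s2 ▸ hz
  refine sameJet_of_chart rfl ?_ he he'' hx ?_ ?_
  · simp [r2, s2]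
  · simpa [r2] using hz'
  have hle := nat_le_infty q
  have c1 := (contDiffAt_coord hf' he he' hx hy').of_le hle
  have c2 := (contDiffAt_coord hf he he' hx hy).of_le hle
  have c3 := (contDiffAt_coord hg' he' he'' hy hz').of_le hle
  have c4 := (contDiffAt_coord hg he' he'' hy hz).of_le hle
  have v1 : (e' ∘ f' ∘ e.symm) (e x') = e' (f x') := by simp [hx, r2]
  have v2 : (e' ∘ f ∘ e.symm) (e x') = e' (f x') := by simp [hx]
  have key := iteratedFDeriv_comp_congr (q := q) c1 c2 (v1.trans v2.symm) (v1.symm ▸ c3)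
    (v1.symm ▸ c4) (r3 e he e' he' hx hy') (by
      rw [v1]; exact s3 e' he' e'' he'' hy hz')
  have expr : ∀ (f : M → N) (g : N → P), ContinuousAt f x' → f x' ∈ e'.source →
      e'' ∘ (g ∘ f) ∘ e.symm =ᶠ[𝓝 (e x')] (e'' ∘ g ∘ e'.symm) ∘ (e' ∘ f ∘ e.symm) := by
    intro f g hf hy
    have h1 : Tendsto e.symm (𝓝 (e x')) (𝓝 x') := by
      have := (e.continuousAt_symm (e.map_source hx)).tendsto
      rwa [e.left_inv hx] at this
    filter_upwards [h1.eventually (hf.eventually (e'.open_source.mem_nhds hy))] with z hz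
    simp only [Function.comp]
    rw [e'.left_inv hz]
  intro i hi
  rw [((expr f' g' hf'.self_of_nhds.continuousAt hy').iteratedFDeriv ℝ i).self_of_nhds,
    ((expr f g hf.self_of_nhds.continuousAt hy).iteratedFDeriv ℝ i).self_of_nhds]
  exact key i hi

end Jet

end Jets

section Submersions

variable {E H M E' H' N : Type*} [NormedAddCommGroup E] [NormedSpace ℝ E] [TopologicalSpace H]
  [TopologicalSpace M] [ChartedSpace H M]
  [NormedAddCommGroup E'] [NormedSpace ℝ E'] [TopologicalSpace H']
  [TopologicalSpace N] [ChartedSpace H' N]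

/-- A map on a subset `S` of a manifold (below: an embedded submanifold) is smooth if it
locally extends to a smooth map on an open set of the ambient manifold. -/
def SmoothOnSubset (I : ModelWithCorners ℝ E H) (J : ModelWithCorners ℝ E' H') {S : Set M}
    (f : S → N) : Prop :=
  ∀ x : S, ∃ U ∈ 𝓝 (x : M), ∃ g : M → N, ContMDiffOn I J ∞ g U ∧
    ∀ y : S, (y : M) ∈ U → g y = f y

/-- Submersions from an embedded submanifold `S`: smooth maps with a smooth local section
through every point of `S`. -/
def IsSubmersionOnSubset (I : ModelWithCorners ℝ E H) (J : ModelWithCorners ℝ E' H') {S : Set M}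
    (f : S → N) : Prop :=
  SmoothOnSubset I J f ∧ ∀ x : S, ∃ V ∈ 𝓝 (f x), ∃ σ : N → S,
    σ (f x) = x ∧ ContMDiffOn J I ∞ (fun y => (σ y : M)) V ∧ ∀ y ∈ V, f (σ y) = y

end Submersions

/-- `ℝⁿ` -/
abbrev Euc (n : ℕ) := EuclideanSpace ℝ (Fin n)

/-- Smooth (Hausdorff, second countable) manifolds of dimension `n`. -/
class SmoothManifold (n : ℕ) (M : Type*) [TopologicalSpace M] [ChartedSpace (Euc n) M] : Prop
    extends IsManifold 𝓘(ℝ, Euc n) ∞ M, T2Space M, SecondCountableTopology M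

/-- `π : B → X` is a smooth fibre bundle with typical fibre `F` (of dimension `r`): there are
local trivializations that are diffeomorphisms. -/
def IsSmoothFibreBundle (n d r : ℕ) {X B : Type*} (F : Type*)
    [TopologicalSpace X] [ChartedSpace (Euc n) X] [TopologicalSpace B] [ChartedSpace (Euc d) B]
    [TopologicalSpace F] [ChartedSpace (Euc r) F] (π : B → X) : Prop :=
  ∀ x : X, ∃ e : Bundle.Trivialization F π, x ∈ e.baseSet ∧
    ContMDiffOn 𝓘(ℝ, Euc d) (𝓘(ℝ, Euc n).prod 𝓘(ℝ, Euc r)) ∞ e e.source ∧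
    ContMDiffOn (𝓘(ℝ, Euc n).prod 𝓘(ℝ, Euc r)) 𝓘(ℝ, Euc d) ∞
      e.toOpenPartialHomeomorph.symm e.target

section Groupoid

variable (n : ℕ) (X : Type*) [TopologicalSpace X] [ChartedSpace (Euc n) X]

/-- `J_q(X × X)` -/
abbrev SelfJet (q : ℕ) := Jet (Euc n) (Euc n) X X q

/-- The full jet groupoid `Π_q`: the `q`-jets of local diffeomorphisms of `X`. The groupoid
multiplication is `Jet.comp`. -/
def fullJetGroupoid (q : ℕ) : Set (SelfJet n X q) :=
  {f | ∃ (φ : X → X) (x : X), IsLocalDiffeomorphAt 𝓘(ℝ, Euc n) 𝓘(ℝ, Euc n) ∞ φ x ∧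
    f = Jet.of (Euc n) (Euc n) q φ x}

variable {X}

/-- The unit of `Π_q` at `x`. -/
def unitJet (q : ℕ) (x : X) : SelfJet n X q := Jet.of (Euc n) (Euc n) q id x

/-- The isotropy group `Π_q(x, x)`, a copy of `GL_q`. -/
def isotropy (q : ℕ) (x : X) : Set (SelfJet n X q) :=
  {g | g ∈ fullJetGroupoid n X q ∧ g.src = x ∧ g.tgt = x}

/-- `K_{q+1}`, the kernel of `Π_{q+1}(x, x) → Π_q(x, x)`. -/
def kernel (q : ℕ) (x : X) : Set (SelfJet n X (q + 1)) :=
  {k | k ∈ isotropy n (q + 1) x ∧ k.proj = unitJet n q x}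

/-- The principal bundle `P_q = Π_q(-, y₀)`, fibred over `X` by the source. -/
def principalBundle (q : ℕ) (y₀ : X) : Set (SelfJet n X q) :=
  {f | f ∈ fullJetGroupoid n X q ∧ f.tgt = y₀}

variable {n}

lemma _root_.IsLocalDiffeomorphAt.smoothNear {φ : X → X} {x : X}
    (h : IsLocalDiffeomorphAt 𝓘(ℝ, Euc n) 𝓘(ℝ, Euc n) ∞ φ x) :
    SmoothNear (Euc n) (Euc n) φ x := by
  obtain ⟨Φ, hx, hΦ⟩ := h
  filter_upwards [Φ.open_source.mem_nhds hx] with y hy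
  exact IsLocalDiffeomorphAt.contMDiffAt ⟨Φ, hy, hΦ⟩

/-- The projection `P_{q+1} → P_q` -/
def principalBundle.proj {q : ℕ} {y₀ : X} (f : principalBundle n (q + 1) y₀) :
    principalBundle n q y₀ :=
  ⟨f.1.proj, by
    obtain ⟨_, ⟨φ, x, h, rfl⟩, ht⟩ := f
    rw [Jet.tgt_of] at ht
    dsimp only
    rw [Jet.proj_of h.smoothNear]
    exact ⟨⟨φ, x, h, rfl⟩, by simpa using ht⟩⟩

variable [IsManifold 𝓘(ℝ, Euc n) ∞ X]

lemma comp_mem_fullJetGroupoid {q : ℕ} {f g : SelfJet n X q} (hf : f ∈ fullJetGroupoid n X q)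
    (hg : g ∈ fullJetGroupoid n X q) (h : f.src = g.tgt) :
    f.comp g ∈ fullJetGroupoid n X q ∧ (f.comp g).tgt = f.tgt := by
  obtain ⟨φ, y, hφ, rfl⟩ := hf
  obtain ⟨ψ, x, hψ, rfl⟩ := hg
  simp only [Jet.src_of, Jet.tgt_of] at h
  subst h
  rw [Jet.comp_of hφ.smoothNear hψ.smoothNear]
  exact ⟨⟨_, x, hψ.comp 𝓘(ℝ, Euc n) X hφ, rfl⟩, by simp⟩

/-- The right multiplication of `P_q` by `Π_q`. -/
def principalBundle.mul {q : ℕ} {y₀ : X} (f : principalBundle n q y₀) (g : SelfJet n X q)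
    (hg : g ∈ fullJetGroupoid n X q) (h : f.1.src = g.tgt) : principalBundle n q y₀ :=
  ⟨f.1.comp g, (comp_mem_fullJetGroupoid f.2.1 hg h).1,
    (comp_mem_fullJetGroupoid f.2.1 hg h).2.trans f.2.2⟩

/-- For a system `R ⊆ Π_q ⊆ J_q(X × X)`, the prolongation `J_1(R) ∩ J_{q+1}(X × X)`, where
`j_{q+1}(φ)(x)` is identified with `j_1(j_q(φ))(x)`, and `J_1(R)` consists of the 1-jets of
local smooth sections of the source map with values in `R`. -/
def prolongation {q : ℕ} (R : Set (SelfJet n X q)) : Set (SelfJet n X (q + 1)) :=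
  {f | ∃ (φ : X → X) (x : X), SmoothNear (Euc n) (Euc n) φ x ∧
    f = Jet.of (Euc n) (Euc n) (q + 1) φ x ∧
    ∃ σ : X → SelfJet n X q, SmoothNear (Euc n) (Euc n × jetCoord (Euc n) (Euc n) q) σ x ∧
      (∀ᶠ x' in 𝓝 x, (σ x').src = x' ∧ σ x' ∈ R) ∧
      Jet.of (Euc n) (Euc n × jetCoord (Euc n) (Euc n) q) 1 σ x =
        Jet.of (Euc n) (Euc n × jetCoord (Euc n) (Euc n) q) 1
          (fun x' => Jet.of (Euc n) (Euc n) q φ x') x}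

end Groupoid

section AssociatedBundles

/-- The associated bundle `P_k ×_{GL_k} Z`, where `GL_k = Π_k(y₀, y₀)` acts on `Z` from the right
by `z g = z' ↔ ρ z g z'`: the quotient of `P_k × Z` by `(g f, z) ∼ (f, z g)`. -/
def AssocBundle {n k : ℕ} {X : Type*} [TopologicalSpace X] [ChartedSpace (Euc n) X] (y₀ : X) {Z : Type*} (ρ : Z → SelfJet n X k → Z → Prop) : Type _ :=
  Quot fun a b : principalBundle n k y₀ × Z =>
    ∃ g ∈ isotropy n k y₀, a.1.1 = g.comp b.1.1 ∧ ρ a.2 g b.2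

namespace AssocBundle

variable {n k : ℕ} {X : Type*} [TopologicalSpace X] [ChartedSpace (Euc n) X]
  {y₀ : X} {Z : Type*} {ρ : Z → SelfJet n X k → Z → Prop}

/-- The class `[f, z]`. -/
def mk (ρ : Z → SelfJet n X k → Z → Prop) (f : principalBundle n k y₀) (z : Z) :
    AssocBundle y₀ ρ := Quot.mk _ (f, z)

/-- The bundle projection `[f, z] ↦ s(f)`. -/
def base : AssocBundle y₀ ρ → X :=
  Quot.lift (fun a => a.1.1.src) (by
    rintro ⟨f, z⟩ ⟨f', z'⟩ ⟨g, _, h, _⟩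
    dsimp only at h ⊢
    rw [h, Jet.src_comp])

/-- The quotient map `P_k × Z → P_k ×_{GL_k} Z`, for `P_k × Z` as a subset of `J_k(X × X) × Z`. -/
def quotientMap (ρ : Z → SelfJet n X k → Z → Prop)
    (p : {p : SelfJet n X k × Z | p.1 ∈ principalBundle n k y₀}) : AssocBundle y₀ ρ :=
  mk ρ ⟨p.1.1, p.2⟩ p.1.2

end AssocBundle

end AssociatedBundles

section Actions

variable (n d : ℕ) {X B : Type*} [TopologicalSpace X] [ChartedSpace (Euc n) X]
  [TopologicalSpace B] [ChartedSpace (Euc d) B]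

/-- `J_r(B)` for a bundle `π : B → X`: the `r`-jets of local smooth sections. -/
def sectionJets (r : ℕ) (π : B → X) : Set (Jet (Euc n) (Euc d) X B r) :=
  {w | ∃ (s : X → B) (x : X), SmoothNear (Euc n) (Euc d) s x ∧ (∀ᶠ x' in 𝓝 x, π (s x') = x') ∧
    w = Jet.of (Euc n) (Euc d) r s x}

lemma jet_mem_sectionJets {π : B → X} {s : X → B}
    (hs : ContMDiff 𝓘(ℝ, Euc n) 𝓘(ℝ, Euc d) ∞ s) (h : ∀ x, π (s x) = x) (r : ℕ) (x : X) :
    Jet.of (Euc n) (Euc d) r s x ∈ sectionJets n d r π :=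
  ⟨s, x, Filter.Eventually.of_forall fun y => hs y, Filter.Eventually.of_forall h, rfl⟩

/-- A smooth right action of the groupoid `Π_q` on `π : B → X`. The value `act u f` is only
meaningful for `f ∈ Π_q` and `π u = t(f)`. -/
structure JetAction [IsManifold 𝓘(ℝ, Euc n) ∞ X] (q : ℕ) (π : B → X) where
  act : B → SelfJet n X q → B
  π_act : ∀ u, ∀ f ∈ fullJetGroupoid n X q, π u = f.tgt → π (act u f) = f.src
  act_comp : ∀ u, ∀ f ∈ fullJetGroupoid n X q, ∀ g ∈ fullJetGroupoid n X q,
    π u = f.tgt → f.src = g.tgt → act u (f.comp g) = act (act u f) g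
  act_unit : ∀ u, act u (unitJet n q (π u)) = u
  smooth : SmoothOnSubset
    (𝓘(ℝ, Euc d).prod 𝓘(ℝ, Euc n × jetCoord (Euc n) (Euc n) q)) 𝓘(ℝ, Euc d)
    (fun p : {p : B × SelfJet n X q | p.2 ∈ fullJetGroupoid n X q ∧ π p.1 = p.2.tgt} =>
      act p.1.1 p.1.2)

namespace JetAction

variable {n d} [IsManifold 𝓘(ℝ, Euc n) ∞ X] {q : ℕ} {π : B → X} (A : JetAction n d q π)

/-- All isotropy groups act transitively on the fibres. -/
def IsHomogeneous : Prop :=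
  ∀ u u' : B, π u = π u' → ∃ g ∈ isotropy n q (π u), A.act u g = u'

/-- The symmetry groupoid `Stab(ω)` of a section `ω₀`. -/
def stab (ω₀ : X → B) : Set (SelfJet n X q) :=
  {f | f ∈ fullJetGroupoid n X q ∧ A.act (ω₀ f.tgt) f = ω₀ f.src}

/-- The action of `Π_{q+1}` on `J_1(B)` that is induced by the action of `Π_q` on `B`: `w f = w'`
for `w = j_1(s)(y)`, `f = j_{q+1}(φ)(x)` with `φ(x) = y`, and `w'` the 1-jet at `x` of the local
section `x' ↦ s(φ(x')) · j_q(φ)(x')`. -/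
def ProlongedAct (w : Jet (Euc n) (Euc d) X B 1) (f : SelfJet n X (q + 1))
    (w' : Jet (Euc n) (Euc d) X B 1) : Prop :=
  ∃ (s : X → B) (φ : X → X) (x : X), SmoothNear (Euc n) (Euc d) s (φ x) ∧
    (∀ᶠ y in 𝓝 (φ x), π (s y) = y) ∧
    IsLocalDiffeomorphAt 𝓘(ℝ, Euc n) 𝓘(ℝ, Euc n) ∞ φ x ∧
    w = Jet.of (Euc n) (Euc d) 1 s (φ x) ∧ f = Jet.of (Euc n) (Euc n) (q + 1) φ x ∧
    w' = Jet.of (Euc n) (Euc d) 1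
      (fun x' => A.act (s (φ x')) (Jet.of (Euc n) (Euc n) q φ x')) x

variable (n d π) in
/-- `J_1(F)`, the fibre of `J_1(B)` over `y₀`. -/
def sectionJetsAt (y₀ : X) : Set (Jet (Euc n) (Euc d) X B 1) :=
  {w | w ∈ sectionJets n d 1 π ∧ w.src = y₀}

/-- `F_1 = J_1(F) / K_{q+1}` -/
def F₁ (y₀ : X) : Type _ :=
  Quot fun w w' : sectionJetsAt n d π y₀ => ∃ k ∈ kernel n q y₀, A.ProlongedAct w k w'

/-- The quotient map `J_1(F) → F_1`. -/
def toF₁ (y₀ : X) (w : sectionJetsAt n d π y₀) : A.F₁ y₀ := Quot.mk _ w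

/-- The right action of `Π_{q+1}(y₀, y₀)` on `F_1`: `z g = z'`. -/
def ActF₁ (y₀ : X) (z : A.F₁ y₀) (g : SelfJet n X (q + 1)) (z' : A.F₁ y₀) : Prop :=
  ∃ w w' : sectionJetsAt n d π y₀,
    A.toF₁ y₀ w = z ∧ A.toF₁ y₀ w' = z' ∧ A.ProlongedAct w g w'

/-- The right action of `Π_q(y₀, y₀) = Π_{q+1}(y₀, y₀) / K_{q+1}` on `F_1`: `z g = z'`. -/
def ActF₁q (y₀ : X) (z : A.F₁ y₀) (g : SelfJet n X q) (z' : A.F₁ y₀) : Prop :=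
  ∃ h ∈ isotropy n (q + 1) y₀, h.proj = g ∧ A.ActF₁ y₀ z h z'

/-- `𝓕_1 = P_{q+1} ×_{GL_{q+1}} F_1` -/
abbrev 𝓕₁ (y₀ : X) : Type _ := AssocBundle y₀ (A.ActF₁ y₀)

/-- `P_q ×_{GL_q} F_1` -/
abbrev 𝓕₁q (y₀ : X) : Type _ := AssocBundle y₀ (A.ActF₁q y₀)

end JetAction

end Actions

end JetGroupoid

end

open scoped Manifold ContDiff Topology
open Set Filter

noncomputable section

set_option linter.unusedSectionVars false

namespace JetGroupoid

namespace NormedSpaceInstances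

variable {E E' : Type*} [NormedAddCommGroup E] [NormedSpace ℝ E] [NormedAddCommGroup E']
  [NormedSpace ℝ E'] {q : ℕ}

/-! Shortcuts for instance search. -/

-- The theorem rests on two facts about a homogeneous natural bundle: the kernel `K_{q+1}` acts on
-- the 1-jets of sections through a point by translations, and the orbit maps `f ↦ u₀ f` of the
-- groupoid have smooth local sections.
--
-- Translations. The 1-jets of sections through a fixed `u` form an affine space over the linear
-- maps `ℝⁿ → ℝʳ`, with the vertical derivative as coordinate (`exists_jetsThrough_coordinates`).
-- Let `q ≥ 1` and let `j_q(φ)` be a unit. In a chart `φ = id + h`, where `h` vanishes to order `q`,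
-- and by the chain rule the vertical derivative of `x ↦ s(φ(x)) j_q(φ)(x)` differs from that of `s`
-- by a linear function of the derivatives of `h` of order `q + 1`. The orbits are therefore the
-- cosets of one linear subspace, and a linear projection along it is a complete smooth invariant
-- (`exists_kernel_translations`, `exists_kernel_invariants`). For `q = 0` homogeneity makes the
-- fibres points, and there is nothing to divide out.
--
-- Orbit sections. Transitivity is only assumed for sets. At a point of maximal rank the orbit map
-- in the fibre is either a submersion, so that the inverse function theorem gives a section, or it
-- maps a neighbourhood to a set without interior. In the second case the fibre would be a countable
-- union of translates of thin compact sets, because the isotropy group is Lindelöf; this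
-- contradicts Baire's theorem. One local section is then moved everywhere by the groupoid
-- (`exists_isOrbitSection`).
--
-- Quotients. A lifted orbit section moves the jets with value near a given one to jets through a
-- fixed `u₀`. Kernels are stable under conjugation, so the vertical coordinate of the value and the
-- invariant of the moved jet are slice coordinates (`exists_kernel_slices`), and slices make `F_1`
-- a manifold (`exists_quotient_manifold`). Local sections of `P_k` trivialize the associated
-- bundles. The two bundles agree because `K_{q+1}` acts trivially on `F_1`, and `I(v) = [f, v f⁻¹
-- K_{q+1}]` for any arrow `f` from the source of `v` to `y₀`.
--
-- Symmetries. For `g ∈ Π_{q+1}`, the projection of `g` fixes `I(j_1(ω))` iff `g k` fixes `j_1(ω)`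
-- for some `k` in the kernel at the source (`jetClass_eq_iff`). If `j_{q+1}(φ)(x)` fixes `j_1(ω)`,
-- then `ω₁(y) = ω(φ(y)) j_q(φ)(y)` has the same 1-jet as `ω` at `x`. With an orbit section `τ`, the
-- arrows `j_q(φ)(y) τ(ω₁(y))⁻¹ τ(ω(y))` are symmetries of `ω`, and they have the 1-jet of `j_q(φ)`;
-- this is membership in the prolongation (`mem_prolongation_stab`). Conversely the 1-jet of `j ↦
-- ω(t(j)) j` along such a family of symmetries is that of `ω`.
--
-- All smoothness statements about jets come from one construction: the jets near a given one are
-- represented by a smooth family of maps (`Jet.exists_family`).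

scoped instance normedSpaceJetCoord : @NormedSpace ℝ (jetCoord E E' q) _
    (@NormedAddCommGroup.toSeminormedAddCommGroup _ (Submodule.normedAddCommGroup _)) :=
  Submodule.normedSpace _

scoped instance normedSpaceProd : @NormedSpace ℝ (E × E') _
    (@NormedAddCommGroup.toSeminormedAddCommGroup _ Prod.normedAddCommGroup) :=
  Prod.normedSpace

end NormedSpaceInstances

open scoped NormedSpaceInstances

/-! ### Maps smooth near a point, and maps smooth along a subset -/

section SmoothCalculus

variable {E H M E' H' N E'' H'' P : Type*}
  [NormedAddCommGroup E] [NormedSpace ℝ E] [TopologicalSpace H]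
  [TopologicalSpace M] [ChartedSpace H M] {I : ModelWithCorners ℝ E H}
  [NormedAddCommGroup E'] [NormedSpace ℝ E'] [TopologicalSpace H']
  [TopologicalSpace N] [ChartedSpace H' N] {J : ModelWithCorners ℝ E' H'}
  [NormedAddCommGroup E''] [NormedSpace ℝ E''] [TopologicalSpace H'']
  [TopologicalSpace P] [ChartedSpace H'' P] {K : ModelWithCorners ℝ E'' H''}

/-- `f` is smooth on a neighbourhood of `x`, for arbitrary models. -/
def SmNear (I : ModelWithCorners ℝ E H) (J : ModelWithCorners ℝ E' H') (f : M → N) (x : M) :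
    Prop :=
  ∀ᶠ y in 𝓝 x, ContMDiffAt I J ∞ f y

/-- `f` agrees near `x` on `S` with a map that is smooth near `x`. -/
def SmOn (I : ModelWithCorners ℝ E H) (J : ModelWithCorners ℝ E' H') (S : Set M) (f : M → N)
    (x : M) : Prop :=
  ∃ g, SmNear I J g x ∧ f =ᶠ[𝓝[S] x] g

lemma SmNear.contMDiffAt {f : M → N} {x : M} (h : SmNear I J f x) : ContMDiffAt I J ∞ f x :=
  h.self_of_nhds

lemma SmNear.continuousAt {f : M → N} {x : M} (h : SmNear I J f x) : ContinuousAt f x :=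
  h.self_of_nhds.continuousAt

lemma SmNear.eventually {f : M → N} {x : M} (h : SmNear I J f x) :
    ∀ᶠ y in 𝓝 x, SmNear I J f y :=
  eventually_eventually_nhds.2 h

lemma SmNear.congr {f g : M → N} {x : M} (h : SmNear I J f x) (hfg : g =ᶠ[𝓝 x] f) :
    SmNear I J g x := by
  filter_upwards [h, eventually_eventually_nhds.2 hfg] with y h1 h2
  exact h1.congr_of_eventuallyEq h2

lemma smNear_of_contMDiffOn {f : M → N} {x : M} {U : Set M} (h : ContMDiffOn I J ∞ f U)
    (hU : U ∈ 𝓝 x) : SmNear I J f x := by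
  filter_upwards [eventually_mem_nhds_iff.2 hU] with y hy
  exact h.contMDiffAt hy

lemma ContMDiff.smNear {f : M → N} (h : ContMDiff I J ∞ f) (x : M) : SmNear I J f x :=
  Eventually.of_forall fun y => h y

lemma SmNear.comp {g : N → P} {f : M → N} {x : M} (hg : SmNear J K g (f x))
    (hf : SmNear I J f x) : SmNear I K (fun y => g (f y)) x := by
  filter_upwards [hf, hf.continuousAt.eventually hg] with y h1 h2
  exact ContMDiffAt.comp y h2 h1

lemma SmNear.comp_eq {g : N → P} {f : M → N} {x : M} {z : N} (hg : SmNear J K g z)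
    (hf : SmNear I J f x) (hz : f x = z) : SmNear I K (fun y => g (f y)) x := by
  subst hz
  exact hg.comp hf

lemma SmNear.prodMk {f : M → N} {g : M → P} {x : M} (hf : SmNear I J f x)
    (hg : SmNear I K g x) : SmNear I (J.prod K) (fun y => (f y, g y)) x := by
  filter_upwards [hf, hg] with y h1 h2
  exact h1.prodMk h2

lemma SmNear.prodMk_space {f : M → E'} {g : M → E''} {x : M} (hf : SmNear I 𝓘(ℝ, E') f x)
    (hg : SmNear I 𝓘(ℝ, E'') g x) : SmNear I 𝓘(ℝ, E' × E'') (fun y => (f y, g y)) x := by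
  filter_upwards [hf, hg] with y h1 h2
  exact h1.prodMk_space h2

lemma smNear_id (x : M) : SmNear I I (fun y : M => y) x :=
  Eventually.of_forall fun _ => contMDiffAt_id

lemma smNear_const (c : N) (x : M) : SmNear I J (fun _ : M => c) x :=
  Eventually.of_forall fun _ => contMDiffAt_const

lemma smNear_fst (x : M × N) : SmNear (I.prod J) I (Prod.fst : M × N → M) x :=
  Eventually.of_forall fun _ => contMDiffAt_fst

lemma smNear_snd (x : M × N) : SmNear (I.prod J) J (Prod.snd : M × N → N) x :=
  Eventually.of_forall fun _ => contMDiffAt_snd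

lemma SmNear.fst {f : M → N × P} {x : M} (h : SmNear I (J.prod K) f x) :
    SmNear I J (fun y => (f y).1) x := (smNear_fst (f x)).comp h

lemma SmNear.snd {f : M → N × P} {x : M} (h : SmNear I (J.prod K) f x) :
    SmNear I K (fun y => (f y).2) x := (smNear_snd (f x)).comp h

lemma ContDiff.smNear {f : E → E'} (h : ContDiff ℝ ∞ f) (x : E) :
    SmNear 𝓘(ℝ, E) 𝓘(ℝ, E') f x :=
  ContMDiff.smNear h.contMDiff x

lemma smNear_iff_contDiffAt {f : E → E'} {x : E} :
    SmNear 𝓘(ℝ, E) 𝓘(ℝ, E') f x ↔ ∀ᶠ y in 𝓝 x, ContDiffAt ℝ ∞ f y := by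
  simp only [SmNear, contMDiffAt_iff_contDiffAt]

lemma SmNear.contDiffAt {f : E → E'} {x : E} (h : SmNear 𝓘(ℝ, E) 𝓘(ℝ, E') f x) :
    ContDiffAt ℝ ∞ f x := h.self_of_nhds.contDiffAt

/-- The product of two vector spaces, as a product of manifolds, is the product vector space with
its own chart. This lets calculus in vector spaces be applied to maps of several variables on
manifolds. -/
lemma smNear_prod_iff {f : E × E' → P} {x : E × E'} :
    SmNear (𝓘(ℝ, E).prod 𝓘(ℝ, E')) K f x ↔ SmNear 𝓘(ℝ, E × E') K f x := by
  unfold SmNear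
  rw [← modelWithCornersSelf_prod, ← chartedSpaceSelf_prod]

lemma SmNear.add {f g : M → E'} {x : M} (hf : SmNear I 𝓘(ℝ, E') f x)
    (hg : SmNear I 𝓘(ℝ, E') g x) : SmNear I 𝓘(ℝ, E') (fun y => f y + g y) x := by
  filter_upwards [hf, hg] with y h1 h2
  exact h1.add h2

lemma SmNear.sub {f g : M → E'} {x : M} (hf : SmNear I 𝓘(ℝ, E') f x)
    (hg : SmNear I 𝓘(ℝ, E') g x) : SmNear I 𝓘(ℝ, E') (fun y => f y - g y) x := by
  filter_upwards [hf, hg] with y h1 h2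
  exact h1.sub h2

lemma SmNear.clm {f : M → E'} {x : M} (L : E' →L[ℝ] E'') (hf : SmNear I 𝓘(ℝ, E') f x) :
    SmNear I 𝓘(ℝ, E'') (fun y => L (f y)) x :=
  (ContDiff.smNear L.contDiff (f x)).comp hf

/-! ### Smoothness on subsets -/

lemma SmNear.smOn {f : M → N} {x : M} (h : SmNear I J f x) (S : Set M) : SmOn I J S f x :=
  ⟨f, h, EventuallyEq.rfl⟩

lemma SmOn.smNear {f : M → N} {x : M} {S : Set M} (h : SmOn I J S f x) (hS : S ∈ 𝓝 x) :
    SmNear I J f x := by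
  obtain ⟨g, hg, he⟩ := h
  rw [nhdsWithin_eq_nhds.2 hS] at he
  exact hg.congr he

lemma SmOn.congr {f f' : M → N} {x : M} {S : Set M} (h : SmOn I J S f x)
    (hf : f' =ᶠ[𝓝[S] x] f) : SmOn I J S f' x := by
  obtain ⟨g, hg, he⟩ := h
  exact ⟨g, hg, hf.trans he⟩

lemma SmOn.tendsto {f : M → N} {x : M} {S : Set M} (h : SmOn I J S f x) (hx : x ∈ S) :
    Tendsto f (𝓝[S] x) (𝓝 (f x)) := by
  obtain ⟨g, hg, he⟩ := h
  rw [he.self_of_nhdsWithin hx]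
  exact (hg.continuousAt.tendsto.mono_left nhdsWithin_le_nhds).congr' he.symm

/-- Jet composition and groupoid actions make sense only along a matching condition `T`. The inner
map has to respect it near `x`; the local extensions of the two maps then compose. -/
lemma SmOn.comp {g : N → P} {f : M → N} {x : M} {S : Set M} {T : Set N} (hx : x ∈ S)
    (hg : SmOn J K T g (f x)) (hf : SmOn I J S f x) (hT : ∀ᶠ y in 𝓝[S] x, f y ∈ T) :
    SmOn I K S (fun y => g (f y)) x := by
  have ht : Tendsto f (𝓝[S] x) (𝓝[T] (f x)) :=
    tendsto_nhdsWithin_iff.2 ⟨hf.tendsto hx, hT⟩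
  obtain ⟨g', hg', heg⟩ := hg
  obtain ⟨f', hf', hef⟩ := hf
  have e0 := hef.self_of_nhdsWithin hx
  refine ⟨fun y => g' (f' y), hg'.comp_eq hf' e0.symm, ?_⟩
  filter_upwards [hef, ht.eventually heg] with y h1 h2
  rw [h2, h1]

lemma SmOn.comp_smNear {g : N → P} {f : M → N} {x : M} {T : Set N}
    (hg : SmOn J K T g (f x)) (hf : SmNear I J f x) (hT : ∀ᶠ y in 𝓝 x, f y ∈ T) :
    SmNear I K (fun y => g (f y)) x := by
  have := SmOn.comp (S := univ) (mem_univ x) hg (hf.smOn univ) (by rwa [nhdsWithin_univ])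
  exact this.smNear univ_mem

lemma SmNear.comp_smOn {g : N → P} {f : M → N} {x : M} {S : Set M} (hx : x ∈ S)
    (hg : SmNear J K g (f x)) (hf : SmOn I J S f x) : SmOn I K S (fun y => g (f y)) x :=
  SmOn.comp hx (hg.smOn univ) hf (Eventually.of_forall fun _ => mem_univ _)

lemma SmOn.prodMk {f : M → N} {g : M → P} {x : M} {S : Set M} (hf : SmOn I J S f x)
    (hg : SmOn I K S g x) : SmOn I (J.prod K) S (fun y => (f y, g y)) x := by
  obtain ⟨f', hf', hef⟩ := hf
  obtain ⟨g', hg', heg⟩ := hg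
  refine ⟨_, hf'.prodMk hg', ?_⟩
  filter_upwards [hef, heg] with y h1 h2
  rw [h1, h2]

lemma SmOn.prodMk_space {f : M → E'} {g : M → E''} {x : M} {S : Set M}
    (hf : SmOn I 𝓘(ℝ, E') S f x) (hg : SmOn I 𝓘(ℝ, E'') S g x) :
    SmOn I 𝓘(ℝ, E' × E'') S (fun y => (f y, g y)) x := by
  obtain ⟨f', hf', hef⟩ := hf
  obtain ⟨g', hg', heg⟩ := hg
  refine ⟨_, hf'.prodMk_space hg', ?_⟩
  filter_upwards [hef, heg] with y h1 h2
  rw [h1, h2]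

lemma smoothOnSubset_of_smOn {S : Set M} {f : S → N}
    (h : ∀ x : S, ∃ g : M → N, SmOn I J S g x ∧ ∀ y : S, g y = f y) :
    SmoothOnSubset I J f := by
  intro x
  obtain ⟨g, ⟨g', hg', he⟩, hf⟩ := h x
  rw [EventuallyEq, eventually_nhdsWithin_iff] at he
  refine ⟨{y | ContMDiffAt I J ∞ g' y ∧ (y ∈ S → g y = g' y)}, hg'.and he, g',
    fun y hy => hy.1.contMDiffWithinAt, fun y hy => ?_⟩
  rw [← hy.2 y.2, hf]

lemma SmoothOnSubset.smOn {S : Set M} {f : S → N} (h : SmoothOnSubset I J f) {g : M → N}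
    (hg : ∀ y : S, g y = f y) {x : M} (hx : x ∈ S) : SmOn I J S g x := by
  obtain ⟨U, hU, f', hf', he⟩ := h ⟨x, hx⟩
  refine ⟨f', smNear_of_contMDiffOn hf' hU, ?_⟩
  filter_upwards [self_mem_nhdsWithin, mem_nhdsWithin_of_mem_nhds hU] with y h1 h2
  rw [hg ⟨y, h1⟩, he ⟨y, h1⟩ h2]

/-- Germs replace the neighbourhoods of `SmoothOnSubset`, so that smoothness can be verified and
composed at one point of `S` at a time. -/
lemma smoothOnSubset_iff_smOn {S : Set M} {f : M → N} :
    SmoothOnSubset I J (fun y : S => f y) ↔ ∀ x ∈ S, SmOn I J S f x :=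
  ⟨fun h _ hx => h.smOn (fun _ => rfl) hx,
    fun h => smoothOnSubset_of_smOn fun x => ⟨f, h x x.2, fun _ => rfl⟩⟩

end SmoothCalculus

/-! ### The inverse function theorem -/

section InverseFunction

variable {E H M E' H' N : Type*}
  [NormedAddCommGroup E] [NormedSpace ℝ E] [TopologicalSpace H]
  [TopologicalSpace M] [ChartedSpace H M] {I : ModelWithCorners ℝ E H}
  [NormedAddCommGroup E'] [NormedSpace ℝ E'] [TopologicalSpace H']
  [TopologicalSpace N] [ChartedSpace H' N] {J : ModelWithCorners ℝ E' H'}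

lemma smNear_extChartAt [IsManifold I ∞ M] [I.Boundaryless] (x : M) :
    SmNear I 𝓘(ℝ, E) (extChartAt I x) x :=
  smNear_of_contMDiffOn (contMDiffOn_extChartAt (n := ∞))
    ((chartAt H x).open_source.mem_nhds (mem_chart_source H x))

lemma smNear_extChartAt_symm [IsManifold I ∞ M] [I.Boundaryless] (x : M) :
    SmNear 𝓘(ℝ, E) I (extChartAt I x).symm (extChartAt I x x) :=
  smNear_of_contMDiffOn (contMDiffOn_extChartAt_symm (n := ∞) x) (extChartAt_target_mem_nhds x)

lemma hasMFDerivAt_iff_chart [I.Boundaryless] {f : M → N} {x : M} {T : E →L[ℝ] E'} :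
    HasMFDerivAt I J f x T ↔ ContinuousAt f x ∧
      HasFDerivAt (fun v => extChartAt J (f x) (f ((extChartAt I x).symm v))) T
        (extChartAt I x x) := by
  refine and_congr Iff.rfl ?_
  rw [← hasFDerivWithinAt_univ, ← I.range_eq_univ]
  exact Iff.rfl

/-- The inverse function theorem in vector spaces. -/
lemma smNear_inverse_space [CompleteSpace E] {f : E → E'} {a : E}
    (hf : SmNear 𝓘(ℝ, E) 𝓘(ℝ, E') f a) {T : E ≃L[ℝ] E'} (hT : HasFDerivAt f (T : E →L[ℝ] E') a) :
    ∃ g : E' → E, SmNear 𝓘(ℝ, E') 𝓘(ℝ, E) g (f a) ∧ (∀ᶠ y in 𝓝 a, g (f y) = y) ∧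
      ∀ᶠ z in 𝓝 (f a), f (g z) = z := by
  have hc := hf.contDiffAt
  have h0 : (∞ : WithTop ℕ∞) ≠ 0 := by simp
  set h := hc.toOpenPartialHomeomorph f hT h0 with hh
  have hcoe : (h : E → E') = f := hc.toOpenPartialHomeomorph_coe hT h0
  have ha : a ∈ h.source := hc.mem_toOpenPartialHomeomorph_source hT h0
  have hfa : f a ∈ h.target := hcoe ▸ h.map_source ha
  have hsa : h.symm (f a) = a := by rw [← hcoe]; exact h.left_inv ha
  refine ⟨h.symm, ?_, ?_, ?_⟩
  · rw [smNear_iff_contDiffAt] at hf ⊢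
    have hd : ContinuousAt (fderiv ℝ f) a :=
      (hc.fderiv_right (m := 0) (by simp)).continuousAt
    -- Being `C^∞` at one point only gives neighbourhoods that may shrink with the order. The
    -- inverse is therefore shown to be smooth at every nearby point, where the derivative is still
    -- invertible because invertible operators form an open set.
    have hn : ∀ᶠ y in 𝓝 a, fderiv ℝ f y ∈ range ((↑) : (E ≃L[ℝ] E') → E →L[ℝ] E') := by
      apply hd.eventually
      rw [hT.fderiv]
      exact ContinuousLinearEquiv.nhds T
    have ht : Tendsto h.symm (𝓝 (f a)) (𝓝 a) := by
      have := (h.continuousAt_symm hfa).tendsto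
      rwa [hsa] at this
    filter_upwards [ht.eventually hn, ht.eventually hf, h.open_target.mem_nhds hfa]
      with z ⟨S, hS⟩ h2 h3
    refine h.contDiffAt_symm h3 (f₀' := S) ?_ ?_
    · rw [hS, hcoe]
      exact (h2.differentiableAt h0).hasFDerivAt
    · rw [hcoe]; exact h2
  · filter_upwards [h.open_source.mem_nhds ha] with y hy
    rw [← hcoe]; exact h.left_inv hy
  · filter_upwards [h.open_target.mem_nhds hfa] with z hz
    have := h.right_inv hz
    rwa [hcoe] at this

/-- The inverse function theorem on manifolds without boundary. -/
lemma smNear_inverse [CompleteSpace E] [IsManifold I ∞ M] [I.Boundaryless] [IsManifold J ∞ N]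
    [J.Boundaryless] {f : M → N} {x : M} (hf : SmNear I J f x) {T : E ≃L[ℝ] E'}
    (hT : HasMFDerivAt I J f x (T : E →L[ℝ] E')) :
    ∃ g : N → M, SmNear J I g (f x) ∧ (∀ᶠ y in 𝓝 x, g (f y) = y) ∧
      ∀ᶠ z in 𝓝 (f x), f (g z) = z := by
  set e := extChartAt I x
  set e' := extChartAt J (f x)
  have hex : e.symm (e x) = x := extChartAt_to_inv x
  have hF : SmNear 𝓘(ℝ, E) 𝓘(ℝ, E') (fun v => e' (f (e.symm v))) (e x) :=
    (smNear_extChartAt (I := J) (f x)).comp_eq (hf.comp_eq (smNear_extChartAt_symm x) hex)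
      (by simp only [e]; rw [hex])
  have hd : HasFDerivAt (fun v => e' (f (e.symm v))) (T : E →L[ℝ] E') (e x) :=
    (hasMFDerivAt_iff_chart.1 hT).2
  obtain ⟨g, hg, h1, h2⟩ := smNear_inverse_space hF hd
  have hgx : g (e' (f x)) = e x := by
    have := h1.self_of_nhds
    rwa [hex] at this
  rw [hex] at hg h2
  have cx : Tendsto e (𝓝 x) (𝓝 (e x)) := (continuousAt_extChartAt x).tendsto
  have cf : Tendsto e' (𝓝 (f x)) (𝓝 (e' (f x))) := (continuousAt_extChartAt (f x)).tendsto
  have hg' : SmNear J I (fun z => e.symm (g (e' z))) (f x) :=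
    (smNear_extChartAt_symm x).comp_eq (hg.comp (smNear_extChartAt (f x))) hgx
  refine ⟨fun z => e.symm (g (e' z)), hg', ?_, ?_⟩
  · filter_upwards [cx.eventually h1, extChartAt_source_mem_nhds (I := I) x] with y hy hs
    have : e.symm (e y) = y := e.left_inv hs
    rw [this] at hy
    rw [hy, this]
  · have cz := hg'.continuousAt.tendsto
    have hz0 : f (e.symm (g (e' (f x)))) = f x := by rw [hgx, hex]
    -- The equation `f (g z) = z` is known after applying the chart at `f x`; both sides must stay
    -- in its domain for the chart to be cancelled.
    have c2 : Tendsto (fun z => f (e.symm (g (e' z)))) (𝓝 (f x)) (𝓝 (f x)) := by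
      have h := (hf.continuousAt.comp_of_eq hg'.continuousAt (by simp only [hgx, hex])).tendsto
      simp only [Function.comp, hgx, hex] at h
      exact h
    filter_upwards [cf.eventually h2, extChartAt_source_mem_nhds (I := J) (f x),
      c2.eventually (extChartAt_source_mem_nhds (I := J) (f x))] with z h3 h4 h5
    exact e'.injOn h5 h4 h3

end InverseFunction

/-! ### Derivatives at a point, in the preferred charts -/

section Derivatives

variable {E H M E' H' N E'' H'' P : Type*}
  [NormedAddCommGroup E] [NormedSpace ℝ E] [TopologicalSpace H]
  [TopologicalSpace M] [ChartedSpace H M] {I : ModelWithCorners ℝ E H}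
  [NormedAddCommGroup E'] [NormedSpace ℝ E'] [TopologicalSpace H']
  [TopologicalSpace N] [ChartedSpace H' N] {J : ModelWithCorners ℝ E' H'}
  [NormedAddCommGroup E''] [NormedSpace ℝ E''] [TopologicalSpace H'']
  [TopologicalSpace P] [ChartedSpace H'' P] {K : ModelWithCorners ℝ E'' H''}

/-- `f` has derivative `T` at `x`, in the preferred charts. -/
def HasD (I : ModelWithCorners ℝ E H) (J : ModelWithCorners ℝ E' H') (f : M → N) (x : M)
    (T : E →L[ℝ] E') : Prop := HasMFDerivAt I J f x T

lemma HasD.comp {g : N → P} {f : M → N} {x : M} {S : E' →L[ℝ] E''} {T : E →L[ℝ] E'}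
    (hg : HasD J K g (f x) S) (hf : HasD I J f x T) : HasD I K (fun y => g (f y)) x (S.comp T) :=
  HasMFDerivAt.comp x hg hf

lemma HasD.comp_eq {g : N → P} {f : M → N} {x : M} {z : N} {S : E' →L[ℝ] E''} {T : E →L[ℝ] E'}
    (hg : HasD J K g z S) (hf : HasD I J f x T) (hz : f x = z) :
    HasD I K (fun y => g (f y)) x (S.comp T) := by
  subst hz
  exact hg.comp hf

lemma HasD.prodMk {g : M → P} {f : M → N} {x : M} {S : E →L[ℝ] E''} {T : E →L[ℝ] E'}
    (hf : HasD I J f x T) (hg : HasD I K g x S) :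
    HasD I (J.prod K) (fun y => (f y, g y)) x (T.prod S) :=
  HasMFDerivAt.prodMk hf hg

lemma hasD_id (x : M) : HasD I I (fun y : M => y) x (ContinuousLinearMap.id ℝ E) :=
  hasMFDerivAt_id x

lemma hasD_const (c : N) (x : M) : HasD I J (fun _ : M => c) x 0 :=
  hasMFDerivAt_const c x

lemma hasD_fst (x : M × N) :
    HasD (I.prod J) I (Prod.fst : M × N → M) x (ContinuousLinearMap.fst ℝ E E') :=
  hasMFDerivAt_fst x

lemma HasD.unique {f : M → N} {x : M} {S T : E →L[ℝ] E'} (h : HasD I J f x S)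
    (h' : HasD I J f x T) : S = T :=
  hasMFDerivAt_unique h h'

lemma HasD.congr {f g : M → N} {x : M} {T : E →L[ℝ] E'} (h : HasD I J f x T)
    (hg : g =ᶠ[𝓝 x] f) : HasD I J g x T :=
  HasMFDerivAt.congr_of_eventuallyEq h hg

lemma SmNear.exists_hasD {f : M → N} {x : M} (h : SmNear I J f x) : ∃ T, HasD I J f x T :=
  ⟨_, (h.contMDiffAt.mdifferentiableAt (by simp)).hasMFDerivAt⟩

lemma hasD_iff_chart [I.Boundaryless] {f : M → N} {x : M} {T : E →L[ℝ] E'} :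
    HasD I J f x T ↔ ContinuousAt f x ∧
      HasFDerivAt (fun v => extChartAt J (f x) (f ((extChartAt I x).symm v))) T
        (extChartAt I x x) :=
  hasMFDerivAt_iff_chart

end Derivatives

/-! ### Local inverses and smooth families of local inverses -/

section LocalInverses

variable {E H M E' H' N E'' H'' P : Type*}
  [NormedAddCommGroup E] [NormedSpace ℝ E] [TopologicalSpace H]
  [TopologicalSpace M] [ChartedSpace H M] {I : ModelWithCorners ℝ E H}
  [NormedAddCommGroup E'] [NormedSpace ℝ E'] [TopologicalSpace H']
  [TopologicalSpace N] [ChartedSpace H' N] {J : ModelWithCorners ℝ E' H'}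
  [NormedAddCommGroup E''] [NormedSpace ℝ E''] [TopologicalSpace H'']
  [TopologicalSpace P] [ChartedSpace H'' P] {K : ModelWithCorners ℝ E'' H''}

/-- `ψ` is a smooth inverse of `φ` near `x`. -/
structure LocInv (I : ModelWithCorners ℝ E H) (J : ModelWithCorners ℝ E' H') (φ : M → N)
    (ψ : N → M) (x : M) : Prop where
  smooth : SmNear I J φ x
  smooth_inv : SmNear J I ψ (φ x)
  left_inv : ∀ᶠ y in 𝓝 x, ψ (φ y) = y
  right_inv : ∀ᶠ z in 𝓝 (φ x), φ (ψ z) = z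

lemma LocInv.symm {φ : M → N} {ψ : N → M} {x : M} (h : LocInv I J φ ψ x) :
    LocInv J I ψ φ (φ x) := by
  have hx := h.left_inv.self_of_nhds
  exact ⟨h.smooth_inv, hx.symm ▸ h.smooth, h.right_inv, hx.symm ▸ h.left_inv⟩

/-- The germs are realised on the open sets `U ∩ φ⁻¹(V)` and `V ∩ ψ⁻¹(U)`, which `φ` and `ψ`
exchange. -/
lemma LocInv.isLocalDiffeomorphAt {φ : M → N} {ψ : N → M} {x : M} (h : LocInv I J φ ψ x) :
    IsLocalDiffeomorphAt I J ∞ φ x := by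
  have hx := h.left_inv.self_of_nhds
  obtain ⟨U, hU, hUo, hxU⟩ := eventually_nhds_iff.1 (h.smooth.and h.left_inv)
  obtain ⟨V, hV, hVo, hxV⟩ := eventually_nhds_iff.1 (h.smooth_inv.and h.right_inv)
  have cφ : ContinuousOn φ U := fun y hy => (hU y hy).1.continuousAt.continuousWithinAt
  have cψ : ContinuousOn ψ V := fun y hy => (hV y hy).1.continuousAt.continuousWithinAt
  refine ⟨{ toFun := φ, invFun := ψ, source := U ∩ φ ⁻¹' V, target := V ∩ ψ ⁻¹' U,
            map_source' := fun y hy => ⟨hy.2, by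
              change ψ (φ y) ∈ U
              rw [(hU y hy.1).2]; exact hy.1⟩
            map_target' := fun z hz => ⟨hz.2, by
              change φ (ψ z) ∈ V
              rw [(hV z hz.1).2]; exact hz.1⟩
            left_inv' := fun y hy => (hU y hy.1).2
            right_inv' := fun z hz => (hV z hz.1).2
            open_source := cφ.isOpen_inter_preimage hUo hVo
            open_target := cψ.isOpen_inter_preimage hVo hUo
            contMDiffOn_toFun := fun y hy => (hU y hy.1).1.contMDiffWithinAt
            contMDiffOn_invFun := fun z hz => (hV z hz.1).1.contMDiffWithinAt }, ⟨hxU, hxV⟩,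
          fun _ _ => rfl⟩

lemma exists_locInv {φ : M → N} {x : M} (h : IsLocalDiffeomorphAt I J ∞ φ x) :
    ∃ ψ, LocInv I J φ ψ x := by
  obtain ⟨Φ, hx, hΦ⟩ := h
  have hs := Φ.open_source.mem_nhds hx
  have ht : Φ.target ∈ 𝓝 (φ x) := by
    rw [hΦ hx]; exact Φ.open_target.mem_nhds (Φ.map_source hx)
  refine ⟨Φ.symm, smNear_of_contMDiffOn (Φ.contMDiffOn.congr hΦ) hs,
    smNear_of_contMDiffOn Φ.symm.contMDiffOn ht, ?_, ?_⟩
  · filter_upwards [hs] with y hy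
    rw [hΦ hy]
    exact Φ.left_inv' hy
  · filter_upwards [ht] with z hz
    have h1 : Φ.symm z ∈ Φ.source := Φ.map_target' hz
    rw [hΦ h1]
    exact Φ.right_inv' hz

lemma LocInv.comp {φ : M → N} {ψ : N → M} {φ' : N → P} {ψ' : P → N} {x : M}
    (h' : LocInv J K φ' ψ' (φ x)) (h : LocInv I J φ ψ x) :
    LocInv I K (fun y => φ' (φ y)) (fun z => ψ (ψ' z)) x := by
  have e := h'.left_inv.self_of_nhds
  refine ⟨h'.smooth.comp h.smooth, h.smooth_inv.comp_eq h'.smooth_inv e, ?_, ?_⟩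
  · filter_upwards [h.left_inv, h.smooth.continuousAt.eventually h'.left_inv] with y h1 h2
    rw [h2, h1]
  · have ht : Tendsto ψ' (𝓝 (φ' (φ x))) (𝓝 (φ x)) := by
      have := h'.smooth_inv.continuousAt.tendsto
      rwa [e] at this
    filter_upwards [h'.right_inv, ht.eventually h.right_inv] with z h1 h2
    rw [h2, h1]

lemma LocInv.eventually {φ : M → N} {ψ : N → M} {x : M} (h : LocInv I J φ ψ x) :
    ∀ᶠ y in 𝓝 x, LocInv I J φ ψ y := by
  filter_upwards [h.smooth.eventually, h.smooth.continuousAt.eventually h.smooth_inv.eventually,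
    eventually_eventually_nhds.2 h.left_inv,
    h.smooth.continuousAt.eventually (eventually_eventually_nhds.2 h.right_inv)]
    with y h1 h2 h3 h4
  exact ⟨h1, h2, h3, h4⟩

lemma locInv_of_hasD [CompleteSpace E] [IsManifold I ∞ M] [I.Boundaryless] [IsManifold J ∞ N]
    [J.Boundaryless] {f : M → N} {x : M} (hf : SmNear I J f x) {T : E ≃L[ℝ] E'}
    (hT : HasD I J f x (T : E →L[ℝ] E')) : ∃ g, LocInv I J f g x := by
  obtain ⟨g, h1, h2, h3⟩ := smNear_inverse hf hT
  exact ⟨g, hf, h1, h2, h3⟩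

/-- A smooth family of maps, one of which is a local diffeomorphism, has a smooth family of local
inverses. -/
lemma exists_family_inverse [CompleteSpace E] [CompleteSpace E''] [IsManifold I ∞ M]
    [I.Boundaryless] [IsManifold K ∞ P] [K.Boundaryless] {G : P → M → N} {p : P} {x : M}
    (hG : SmNear (K.prod I) J (Function.uncurry G) (p, x)) {ψ : N → M}
    (hψ : LocInv I J (G p) ψ x) :
    ∃ G' : P → N → M, SmNear (K.prod J) I (Function.uncurry G') (p, G p x) ∧
      (∀ᶠ z in 𝓝 (p, x), G' z.1 (G z.1 z.2) = z.2) ∧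
      ∀ᶠ z in 𝓝 (p, G p x), G z.1 (G' z.1 z.2) = z.2 := by
  have hx := hψ.left_inv.self_of_nhds
  have hs : SmNear (K.prod I) I (fun z : P × M => ψ (G z.1 z.2)) (p, x) :=
    SmNear.comp (g := ψ) (f := Function.uncurry G) hψ.smooth_inv hG
  -- Composing with the inverse of the member at `p` turns the family into self-maps of `M`, the one
  -- at `p` being the identity near `x`. With the parameter kept as a coordinate, inverting the
  -- family means inverting the single map `Θ`.
  set Θ : P × M → P × M := fun z => (z.1, ψ (G z.1 z.2)) with hΘ
  have hΘs : SmNear (K.prod I) (K.prod I) Θ (p, x) := (smNear_fst _).prodMk hs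
  have hΘx : Θ (p, x) = (p, x) := by simp [hΘ, hx]
  obtain ⟨D, hD⟩ := hΘs.exists_hasD
  have h1 : (ContinuousLinearMap.fst ℝ E'' E).comp D = ContinuousLinearMap.fst ℝ E'' E :=
    ((hasD_fst (Θ (p, x))).comp hD).unique (hasD_fst (I := K) (J := I) (p, x))
  have h2 : D.comp (ContinuousLinearMap.inr ℝ E'' E) = ContinuousLinearMap.inr ℝ E'' E := by
    have a : HasD I (K.prod I) (fun y : M => ((p, y) : P × M)) x
        (ContinuousLinearMap.inr ℝ E'' E) := (hasD_const p x).prodMk (hasD_id x)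
    refine HasD.unique (HasD.comp_eq hD a rfl) (a.congr ?_)
    filter_upwards [hψ.left_inv] with y hy
    simp [hΘ, hy]
  -- `D` preserves the parameter component and is the identity on `M`-directions, so `D - 1` has
  -- square zero.
  have key : ∀ z, D (D z) = (2 : ℝ) • D z - z := by
    intro z
    have e1 : ∀ z, (D z).1 = z.1 := fun z => congrArg (fun f => f z) h1
    have e2 : ∀ b, D (0, b) = (0, b) := fun b => congrArg (fun f => f b) h2
    have e3 : D z = z + (0, (D z).2 - z.2) := by
      ext
      · simp [e1]
      · simp
    have e4 : D (D z) = D z + (0, (D z).2 - z.2) := by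
      conv_lhs => rw [e3, map_add, e2]
    have e5 : ((0 : E''), (D z).2 - z.2) = D z - z := (sub_eq_of_eq_add' e3).symm
    rw [e4, e5, two_smul]
    abel
  -- A unipotent `D` with `(D - 1)² = 0` has the inverse `2 - D`.
  let T : (E'' × E) ≃L[ℝ] (E'' × E) := ContinuousLinearEquiv.equivOfInverse D
    ((2 : ℝ) • ContinuousLinearMap.id ℝ (E'' × E) - D)
    (fun z => by simp [key]) (fun z => by
      simp only [sub_apply, smul_apply, ContinuousLinearMap.id_apply, map_sub, map_smul, key]
      abel)
  obtain ⟨Ξ, hΞ⟩ := locInv_of_hasD (T := T) hΘs hD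
  have hΞs := hΞ.smooth_inv
  have hl := hΞ.left_inv
  have hr := hΞ.right_inv
  rw [hΘx] at hΞs hr
  have hΞx : Ξ (p, x) = (p, x) := by
    have := hl.self_of_nhds
    rwa [hΘx] at this
  have hψ' : SmNear (K.prod J) (K.prod I) (fun z : P × N => (z.1, ψ z.2)) (p, G p x) :=
    (smNear_fst _).prodMk (hψ.smooth_inv.comp_eq (smNear_snd _) rfl)
  have hG' : SmNear (K.prod J) I (fun z : P × N => (Ξ (z.1, ψ z.2)).2) (p, G p x) :=
    (hΞs.comp_eq hψ' (by simp [hx])).snd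
  refine ⟨fun p y => (Ξ (p, ψ y)).2, hG', ?_, ?_⟩
  · filter_upwards [hl] with z hz
    exact congrArg Prod.snd hz
  · have t1 : Tendsto (fun z : P × N => (z.1, ψ z.2)) (𝓝 (p, G p x)) (𝓝 (p, x)) := by
      have := hψ'.continuousAt.tendsto
      rwa [hx] at this
    have t2 : Tendsto (fun z : P × N => G z.1 (Ξ (z.1, ψ z.2)).2) (𝓝 (p, G p x))
        (𝓝 (G p x)) := by
      have h3 : SmNear (K.prod J) J
          (fun z : P × N => G z.1 (Ξ (z.1, ψ z.2)).2) (p, G p x) :=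
        hG.comp_eq ((smNear_fst (p, G p x)).prodMk hG') (by simp [hx, hΞx])
      have := h3.continuousAt.tendsto
      simpa [hx, hΞx] using this
    have hr' : ∀ᶠ z in 𝓝 (G p x), G p (ψ z) = z := hψ.right_inv
    have hri : ∀ᶠ z in 𝓝 (p, G p x), G p (ψ z.2) = z.2 :=
      (continuous_snd.tendsto (p, G p x)).eventually hr'
    filter_upwards [t1.eventually hr, t2.eventually hr', hri] with z h1 h2 h3
    have e1 : (Ξ (z.1, ψ z.2)).1 = z.1 := congrArg Prod.fst h1
    have e2 : ψ (G (Ξ (z.1, ψ z.2)).1 (Ξ (z.1, ψ z.2)).2) = ψ z.2 := congrArg Prod.snd h1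
    rw [e1] at e2
    -- The right inverse is known only after `ψ`; applying `G p`, which undoes `ψ` near `G p x`,
    -- gives it in `N`.
    rw [← h2, e2, h3]

/-- The conditions on the pair of families are open in parameter and point together, and each
restricts to the slice with fixed parameter. -/
lemma family_locInv {G : P → M → N} {G' : P → N → M} {p : P} {x : M}
    (hG : SmNear (K.prod I) J (Function.uncurry G) (p, x))
    (hG' : SmNear (K.prod J) I (Function.uncurry G') (p, G p x))
    (hl : ∀ᶠ z in 𝓝 (p, x), G' z.1 (G z.1 z.2) = z.2)
    (hr : ∀ᶠ z in 𝓝 (p, G p x), G z.1 (G' z.1 z.2) = z.2) :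
    ∀ᶠ z in 𝓝 (p, x), LocInv I J (G z.1) (G' z.1) z.2 := by
  have sec : ∀ {A B : Type _} [TopologicalSpace A] [TopologicalSpace B] (z : A × B),
      Tendsto (fun y => (z.1, y)) (𝓝 z.2) (𝓝 z) := fun z =>
    (Continuous.prodMk_right z.1).tendsto' _ _ rfl
  have ht : Tendsto (fun z : P × M => (z.1, G z.1 z.2)) (𝓝 (p, x)) (𝓝 (p, G p x)) :=
    ((smNear_fst (I := K) (J := I) (p, x)).prodMk hG).continuousAt
  filter_upwards [hG.eventually, ht.eventually hG'.eventually,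
    eventually_eventually_nhds.2 hl, ht.eventually (eventually_eventually_nhds.2 hr)]
    with z h1 h2 h3 h4
  refine ⟨?_, ?_, (sec z).eventually h3, ?_⟩
  · exact SmNear.comp_eq (g := Function.uncurry G) (f := fun y => (z.1, y)) h1
      ((smNear_const z.1 z.2).prodMk (smNear_id z.2)) rfl
  · exact SmNear.comp_eq (g := Function.uncurry G') (f := fun y => (z.1, y)) h2
      ((smNear_const z.1 (G z.1 z.2)).prodMk (smNear_id (G z.1 z.2))) rfl
  · exact ((Continuous.prodMk_right z.1).tendsto' (G z.1 z.2) _ rfl).eventually h4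

end LocalInverses

/-! ### Source, target and jet prolongation are smooth -/

section JetSmoothness

variable {E E' E'' : Type*} [NormedAddCommGroup E] [NormedSpace ℝ E]
  [NormedAddCommGroup E'] [NormedSpace ℝ E'] [NormedAddCommGroup E''] [NormedSpace ℝ E'']
  {M N P : Type*} [TopologicalSpace M] [ChartedSpace E M]
  [TopologicalSpace N] [ChartedSpace E' N] [TopologicalSpace P] [ChartedSpace E'' P]
  [IsManifold 𝓘(ℝ, E) ∞ M] [IsManifold 𝓘(ℝ, E') ∞ N] [IsManifold 𝓘(ℝ, E'') ∞ P]
  {EA HA A : Type*} [NormedAddCommGroup EA] [NormedSpace ℝ EA] [TopologicalSpace HA]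
  [TopologicalSpace A] [ChartedSpace HA A] {I : ModelWithCorners ℝ EA HA}
  {q : ℕ}

namespace Jet

lemma exists_of (j : Jet E E' M N q) :
    ∃ f, SmoothNear E E' f j.src ∧ j = of E E' q f j.src := by
  refine ⟨j.rep.toFun, ?_, ?_⟩
  · rw [← rep_src]; exact j.rep.smooth
  · conv_lhs => rw [← of_rep j]
    rw [rep_src]

lemma of_congr {f g : M → N} {x : M} (hf : SmoothNear E E' f x) (h : g =ᶠ[𝓝 x] f) :
    of E E' q g x = of E E' q f x := by
  have hg : SmoothNear E E' g x := SmNear.congr hf h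
  have h0 := h.self_of_nhds
  rw [of_eq hf, of_eq hg, mk_eq_iff]
  refine sameJet_of_chart rfl h0 (chart_mem_atlas E x) (chart_mem_atlas E' (g x))
    (mem_chart_source E x) (mem_chart_source E' (g x)) fun i _ => ?_
  dsimp only
  have ht : Tendsto (chartAt E x).symm (𝓝 (chartAt E x x)) (𝓝 x) := by
    have := ((chartAt E x).continuousAt_symm (mem_chart_target E x)).tendsto
    rwa [(chartAt E x).left_inv (mem_chart_source E x)] at this
  refine (Filter.EventuallyEq.iteratedFDeriv ℝ ?_ i).self_of_nhds
  filter_upwards [ht.eventually h] with y hy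
  simp only [Function.comp, hy]

lemma chartAt_apply (j₀ j : Jet E E' M N q) :
    chartAt (E × jetCoord E E' q) j₀ j = coord (chartAt E j₀.src) (chartAt E' j₀.tgt) j := rfl

lemma chartAt_symm_apply (j₀ : Jet E E' M N q) (c : E × jetCoord E E' q) :
    (chartAt (E × jetCoord E E' q) j₀).symm c =
      ofCoord (chartAt E j₀.src) (chartAt E' j₀.tgt) c := rfl

lemma mem_chartAt_source (j₀ j : Jet E E' M N q) :
    j ∈ (chartAt (E × jetCoord E E' q) j₀).source ↔
      j.src ∈ (chartAt E j₀.src).source ∧ j.tgt ∈ (chartAt E' j₀.tgt).source := Iff.rfl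

lemma smNear_chartAt (j : Jet E E' M N q) :
    SmNear 𝓘(ℝ, E × jetCoord E E' q) 𝓘(ℝ, E × jetCoord E E' q)
      (chartAt (E × jetCoord E E' q) j) j :=
  smNear_of_contMDiffOn (contMDiffOn_chart (I := 𝓘(ℝ, E × jetCoord E E' q)) (n := ∞))
    ((chartAt _ j).open_source.mem_nhds (mem_chart_source _ j))

lemma smNear_chart_symm {x : M} :
    SmNear 𝓘(ℝ, E) 𝓘(ℝ, E) (chartAt E x).symm (chartAt E x x) :=
  smNear_of_contMDiffOn (contMDiffOn_chart_symm (I := 𝓘(ℝ, E)) (n := ∞))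
    ((chartAt E x).open_target.mem_nhds (mem_chart_target E x))

lemma smNear_chart {x : M} : SmNear 𝓘(ℝ, E) 𝓘(ℝ, E) (chartAt E x) x :=
  smNear_of_contMDiffOn (contMDiffOn_chart (I := 𝓘(ℝ, E)) (n := ∞))
    ((chartAt E x).open_source.mem_nhds (mem_chart_source E x))

lemma smNear_src (j : Jet E E' M N q) :
    SmNear 𝓘(ℝ, E × jetCoord E E' q) 𝓘(ℝ, E) (src : Jet E E' M N q → M) j := by
  have h := (smNear_chart_symm (E := E) (x := j.src)).comp_eq
    ((ContDiff.smNear (contDiff_fst (𝕜 := ℝ) (E := E) (F := jetCoord E E' q))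
      (chartAt (E × jetCoord E E' q) j j)).comp (smNear_chartAt j)) rfl
  refine h.congr ?_
  filter_upwards [(chartAt (E × jetCoord E E' q) j).open_source.mem_nhds
    (mem_chart_source _ j)] with k hk
  exact ((chartAt E j.src).left_inv hk.1).symm

lemma contDiff_value :
    ContDiff ℝ ∞ (fun c : E × jetCoord E E' q => c.2.1 0 0) := by
  have h1 : ContDiff ℝ ∞ (fun p : jetCoord E E' q => p.1) :=
    ContinuousLinearMap.contDiff (𝕜 := ℝ) (E := jetCoord E E' q)
      (F := ∀ i : Fin (q + 1), E [×(i : ℕ)]→L[ℝ] E') (jetCoord E E' q).subtypeL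
  have h2 := (contDiff_pi.1 h1 0).comp (contDiff_snd (𝕜 := ℝ) (E := E) (F := jetCoord E E' q))
  exact (ContinuousMultilinearMap.apply ℝ (fun _ : Fin ((0 : Fin (q + 1)) : ℕ) => E) E'
      0).contDiff.comp h2

lemma coord_value {f : M → N} {x : M} (h : SmoothNear E E' f x)
    {e : OpenPartialHomeomorph M E} (he : e ∈ atlas E M)
    {e' : OpenPartialHomeomorph N E'} (he' : e' ∈ atlas E' N)
    (hx : x ∈ e.source) (hy : f x ∈ e'.source) :
    (coord e e' (of E E' q f x)).2.1 0 0 = e' (f x) := by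
  rw [coord_of h he he' hx hy, symmetrize_of_mem (derivs_mem h he he' hx hy)]
  refine (iteratedFDeriv_zero_apply (𝕜 := ℝ) (f := e' ∘ f ∘ e.symm) (x := e x) 0).trans ?_
  simp [hx]

/-- In jet coordinates the target is the derivative of order zero, and evaluating it is linear in
the coordinates. -/
lemma smNear_tgt (j : Jet E E' M N q) :
    SmNear 𝓘(ℝ, E × jetCoord E E' q) 𝓘(ℝ, E') (tgt : Jet E E' M N q → N) j := by
  have key : ∀ k ∈ (chartAt (E × jetCoord E E' q) j).source,
      (coord (chartAt E j.src) (chartAt E' j.tgt) k).2.1 0 0 = chartAt E' j.tgt k.tgt := by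
    rintro k ⟨h1, h2⟩
    obtain ⟨f, hf, hk⟩ := exists_of k
    have ht : k.tgt = f k.src := by conv_lhs => rw [hk, tgt_of]
    conv_lhs => rw [hk]
    rw [coord_value hf (chart_mem_atlas E _) (chart_mem_atlas E' _) h1 (ht ▸ h2), ht]
  have hv := (ContDiff.smNear (contDiff_value (E := E) (E' := E') (q := q))
      (chartAt (E × jetCoord E E' q) j j)).comp (smNear_chartAt j)
  have h := (smNear_chart_symm (E := E') (x := j.tgt)).comp_eq hv
    (key j (mem_chart_source _ j))
  refine h.congr ?_
  filter_upwards [(chartAt (E × jetCoord E E' q) j).open_source.mem_nhds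
    (mem_chart_source _ j)] with k hk
  have : (chartAt E' j.tgt).symm (chartAt E' j.tgt k.tgt) = k.tgt :=
    (chartAt E' j.tgt).left_inv hk.2
  rw [chartAt_apply, key k hk, this]

/-- The sections `x ↦ j_q(G_a)(x)` depend smoothly on parameters. -/
lemma smNear_of [IsManifold I ∞ A] [I.Boundaryless] {G : A → M → N} {c : A → M} {a : A}
    (hG : SmNear (I.prod 𝓘(ℝ, E)) 𝓘(ℝ, E') (Function.uncurry G) (a, c a))
    (hc : SmNear I 𝓘(ℝ, E) c a) :
    SmNear I 𝓘(ℝ, E × jetCoord E E' q) (fun b => of E E' q (G b) (c b)) a := by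
  -- The hypotheses persist at nearby parameters `b`, so smoothness at the single point `b` is all
  -- that remains to be shown.
  have hne : ∀ᶠ b in 𝓝 a, SmNear (I.prod 𝓘(ℝ, E)) 𝓘(ℝ, E') (Function.uncurry G) (b, c b) ∧
      SmNear I 𝓘(ℝ, E) c b := by
    have ht : Tendsto (fun b => (b, c b)) (𝓝 a) (𝓝 (a, c a)) :=
      ((smNear_id a).prodMk hc).continuousAt
    exact (ht.eventually hG.eventually).and hc.eventually
  filter_upwards [hne] with b ⟨hG, hc⟩
  clear hne
  set e := chartAt E (c b)
  set e' := chartAt E' (G b (c b))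
  have he : e ∈ atlas E M := chart_mem_atlas _ _
  have he' : e' ∈ atlas E' N := chart_mem_atlas _ _
  set ψ := extChartAt I b
  have hψ : ψ.symm (ψ b) = b := extChartAt_to_inv b
  have hec : e.symm (e (c b)) = c b := e.left_inv (mem_chart_source E (c b))
  have cc : Tendsto c (𝓝 b) (𝓝 (c b)) := hc.continuousAt
  have hloc : SmNear 𝓘(ℝ, EA × E) 𝓘(ℝ, E')
      (fun z : EA × E => e' (G (ψ.symm z.1) (e.symm z.2))) (ψ b, e (c b)) := by
    have h1 : SmNear (𝓘(ℝ, EA).prod 𝓘(ℝ, E)) (I.prod 𝓘(ℝ, E))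
        (fun z : EA × E => (ψ.symm z.1, e.symm z.2)) (ψ b, e (c b)) :=
      ((smNear_extChartAt_symm b).comp_eq (smNear_fst _) rfl).prodMk
        ((smNear_chart_symm (x := c b)).comp_eq (smNear_snd _) rfl)
    have h2 : SmNear (𝓘(ℝ, EA).prod 𝓘(ℝ, E)) 𝓘(ℝ, E')
        (fun z : EA × E => G (ψ.symm z.1) (e.symm z.2)) (ψ b, e (c b)) :=
      SmNear.comp_eq (g := Function.uncurry G) hG h1 (by simp [hψ, hec])
    have h3 : SmNear (𝓘(ℝ, EA).prod 𝓘(ℝ, E)) 𝓘(ℝ, E')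
        (fun z : EA × E => e' (G (ψ.symm z.1) (e.symm z.2))) (ψ b, e (c b)) :=
      SmNear.comp_eq (smNear_chart (E := E') (x := G b (c b))) h2 (by simp only [hψ, hec])
    exact smNear_prod_iff.1 h3
  have hf : ∀ i : ℕ, ContMDiffAt I 𝓘(ℝ, E [×i]→L[ℝ] E') ∞ (fun p => iteratedFDeriv ℝ i
      (fun y => e' (G (ψ.symm (ψ p)) (e.symm y))) (e (c p))) b := by
    intro i
    have h1 := (contDiffAt_iteratedFDeriv_param
      (f := fun (v : EA) (y : E) => e' (G (ψ.symm v) (e.symm y))) hloc.contDiffAt i).contMDiffAt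
    have h2 : ContMDiffAt I 𝓘(ℝ, EA × E) ∞ (fun p => (ψ p, e (c p))) b :=
      ((smNear_extChartAt b).prodMk_space ((smNear_chart (x := c b)).comp hc)).contMDiffAt
    exact ContMDiffAt.comp (g := fun z : EA × E => iteratedFDeriv ℝ i
      (fun y => e' (G (ψ.symm z.1) (e.symm y))) z.2) b h1 h2
  have hcoord : ContMDiffAt I 𝓘(ℝ, E × jetCoord E E' q) ∞ (fun p => (e (c p),
      symmetrize E E' q fun i : Fin (q + 1) => iteratedFDeriv ℝ i
        (fun y => e' (G (ψ.symm (ψ p)) (e.symm y))) (e (c p)))) b := by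
    refine ((smNear_chart (x := c b)).comp hc).contMDiffAt.prodMk_space ?_
    have h2 : ContMDiffAt I 𝓘(ℝ, ∀ i : Fin (q + 1), E [×(i : ℕ)]→L[ℝ] E') ∞ (fun p =>
      fun i : Fin (q + 1) => iteratedFDeriv ℝ i
        (fun y => e' (G (ψ.symm (ψ p)) (e.symm y))) (e (c p))) b :=
      contMDiffAt_pi_space.2 fun i => hf i
    exact ContMDiffAt.comp b (contDiff_symmetrize (E := E) (E' := E') q).contMDiff.contMDiffAt h2
  -- The jet is abstracted to a variable so that its source and target can be rewritten inside the
  -- preferred chart, which then becomes the chart built from `e` and `e'`.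
  obtain ⟨j₀, hj₀⟩ : ∃ j, j = of E E' q (G b) (c b) := ⟨_, rfl⟩
  have hs : j₀.src = c b := by rw [hj₀, src_of]
  have ht : j₀.tgt = G b (c b) := by rw [hj₀, tgt_of]
  have hfin : ContMDiffAt I 𝓘(ℝ, E × jetCoord E E' q) ∞ (fun p =>
      coord e e' (of E E' q (G p) (c p))) b := by
    refine hcoord.congr_of_eventuallyEq ?_
    have hct : Tendsto (fun b => (b, c b)) (𝓝 b) (𝓝 (b, c b)) :=
      ((smNear_id b).prodMk hc).continuousAt
    have hGt : Tendsto (fun b => G b (c b)) (𝓝 b) (𝓝 (G b (c b))) := hG.continuousAt.tendsto.comp hct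
    filter_upwards [extChartAt_source_mem_nhds (I := I) b, hct.eventually hG.eventually,
      cc.eventually (e.open_source.mem_nhds (mem_chart_source E (c b))),
      hGt.eventually (e'.open_source.mem_nhds (mem_chart_source E' _))] with p h1 h2 h3 h4
    have hsm : SmoothNear E E' (G p) (c p) :=
      SmNear.comp_eq (g := Function.uncurry G) (f := fun y => (p, y)) h2
        ((smNear_const p (c p)).prodMk (smNear_id (c p))) rfl
    rw [coord_of hsm he he' h3 h4]
    have : ψ.symm (ψ p) = p := ψ.left_inv h1
    rw [this]
    rfl
  have hcs : ∀ p, chartAt (E × jetCoord E E' q) j₀ (of E E' q (G p) (c p)) =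
      coord e e' (of E E' q (G p) (c p)) := by
    intro p
    rw [chartAt_apply, hs, ht]
  have hsym : ContMDiffAt 𝓘(ℝ, E × jetCoord E E' q) 𝓘(ℝ, E × jetCoord E E' q) ∞
      (chartAt (E × jetCoord E E' q) j₀).symm (coord e e' (of E E' q (G b) (c b))) := by
    rw [← hcs, ← hj₀]
    exact (contMDiffOn_chart_symm (I := 𝓘(ℝ, E × jetCoord E E' q)) (n := ∞)).contMDiffAt
      ((chartAt _ j₀).open_target.mem_nhds (mem_chart_target _ j₀))
  refine (ContMDiffAt.comp b hsym hfin).congr_of_eventuallyEq ?_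
  have hct : Tendsto (fun b => (b, c b)) (𝓝 b) (𝓝 (b, c b)) :=
    ((smNear_id b).prodMk hc).continuousAt
  have hGt : Tendsto (fun b => G b (c b)) (𝓝 b) (𝓝 (G b (c b))) := hG.continuousAt.tendsto.comp hct
  filter_upwards [cc.eventually (e.open_source.mem_nhds (mem_chart_source E (c b))),
      hGt.eventually (e'.open_source.mem_nhds (mem_chart_source E' _))] with p h3 h4
  simp only [Function.comp]
  rw [← hcs]
  refine ((chartAt _ j₀).left_inv ?_).symm
  rw [mem_chartAt_source, hs, ht, src_of, tgt_of]
  exact ⟨h3, h4⟩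

end Jet

end JetSmoothness

/-! ### Smooth families of representatives for nearby jets -/

section JetFamilies

variable {E E' E'' : Type*} [NormedAddCommGroup E] [NormedSpace ℝ E]
  [NormedAddCommGroup E'] [NormedSpace ℝ E'] [NormedAddCommGroup E''] [NormedSpace ℝ E'']
  {M N P : Type*} [TopologicalSpace M] [ChartedSpace E M]
  [TopologicalSpace N] [ChartedSpace E' N] [TopologicalSpace P] [ChartedSpace E'' P]
  [IsManifold 𝓘(ℝ, E) ∞ M] [IsManifold 𝓘(ℝ, E') ∞ N] [IsManifold 𝓘(ℝ, E'') ∞ P]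
  {q : ℕ}

namespace Jet

lemma chart_tendsto_symm {x : M} :
    Tendsto (chartAt E x).symm (𝓝 (chartAt E x x)) (𝓝 x) := by
  have := ((chartAt E x).continuousAt_symm (mem_chart_target E x)).tendsto
  rwa [(chartAt E x).left_inv (mem_chart_source E x)] at this

/-- Jets near a given one are represented by a smooth family of maps, which extends a given
representative. -/
lemma exists_family {φ₀ : M → N} {x₀ : M} (hφ : SmoothNear E E' φ₀ x₀) (q : ℕ) :
    ∃ G : Jet E E' M N q → M → N,
      SmNear (𝓘(ℝ, E × jetCoord E E' q).prod 𝓘(ℝ, E)) 𝓘(ℝ, E') (Function.uncurry G)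
        (of E E' q φ₀ x₀, x₀) ∧
      (∀ᶠ j in 𝓝 (of E E' q φ₀ x₀), of E E' q (G j) j.src = j) ∧
      ∀ᶠ y in 𝓝 x₀, G (of E E' q φ₀ x₀) y = φ₀ y := by
  obtain ⟨j₀, hj₀⟩ : ∃ j, j = of E E' q φ₀ x₀ := ⟨_, rfl⟩
  have hs : j₀.src = x₀ := by rw [hj₀, src_of]
  have ht : j₀.tgt = φ₀ x₀ := by rw [hj₀, tgt_of]
  rw [← hj₀]
  set e := chartAt E x₀
  set e' := chartAt E' (φ₀ x₀)
  have he : e ∈ atlas E M := chart_mem_atlas _ _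
  have he' : e' ∈ atlas E' N := chart_mem_atlas _ _
  have hx : x₀ ∈ e.source := mem_chart_source _ _
  have hy : φ₀ x₀ ∈ e'.source := mem_chart_source _ _
  set c : Jet E E' M N q → E × jetCoord E E' q := coord e e' with hc
  have hcc : ∀ j, chartAt (E × jetCoord E E' q) j₀ j = c j := by
    intro j
    rw [chartAt_apply, hs, ht]
  have hc1 : ∀ j, (c j).1 = e j.src := fun j => rfl
  have hcs : SmNear 𝓘(ℝ, E × jetCoord E E' q) 𝓘(ℝ, E × jetCoord E E' q) c j₀ :=
    (smNear_chartAt j₀).congr (Eventually.of_forall fun j => (hcc j).symm)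
  have hc0 : c j₀ = (e x₀, ⟨_, derivs_mem (q := q) hφ he he' hx hy⟩) := by
    rw [hj₀, hc, coord_of hφ he he' hx hy, symmetrize_of_mem]
  set f : E → E' := e' ∘ φ₀ ∘ e.symm with hf
  have hfs : SmNear 𝓘(ℝ, E) 𝓘(ℝ, E') f (e x₀) := by
    have h1 : e.symm (e x₀) = x₀ := e.left_inv hx
    exact (smNear_chart (E := E') (x := φ₀ x₀)).comp_eq
      (SmNear.comp_eq (g := φ₀) hφ (smNear_chart_symm (x := x₀)) h1)
      (by
        change φ₀ (e.symm (e x₀)) = φ₀ x₀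
        rw [h1])
  -- The translate of `f` carries its jet from `e x₀` to the source coordinate `c.1`, and the
  -- polynomial adds the difference between the wanted derivatives and those of `f`. At the
  -- coordinates of `j₀` both corrections disappear, so the family extends `φ₀`.
  set u : (E × jetCoord E E' q) × E → E' := fun z =>
    f (z.2 - z.1.1 + e x₀) + taylorPoly z.1.1 (z.1.2 - (c j₀).2).1 z.2 with hu
  have hu0 : ∀ y, u (c j₀, y) = f y := by
    intro y
    simp [hu, hc0, taylorPoly]
  have hus : SmNear 𝓘(ℝ, (E × jetCoord E E' q) × E) 𝓘(ℝ, E') u (c j₀, e x₀) := by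
    refine SmNear.add (SmNear.comp_eq hfs (ContDiff.smNear (by fun_prop) _) ?_)
      (ContDiff.smNear ?_ _)
    · simp [hc0]
    · exact (contDiff_taylorPoly (E := E) (E' := E') q).comp (f := fun z : (E × jetCoord E E' q) × E =>
        ((z.1.1, z.1.2 - (c j₀).2), z.2)) (by fun_prop)
  have hfx : f (e x₀) = e' (φ₀ x₀) := by simp [hf, hx]
  have hG : SmNear (𝓘(ℝ, E × jetCoord E E' q).prod 𝓘(ℝ, E)) 𝓘(ℝ, E')
      (Function.uncurry fun (j : Jet E E' M N q) (y : M) => e'.symm (u (c j, e y))) (j₀, x₀) := by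
    refine (smNear_chart_symm (E := E') (x := φ₀ x₀)).comp_eq (f := fun z :
      Jet E E' M N q × M => u (c z.1, e z.2)) (hus.comp_eq (f := fun z :
      Jet E E' M N q × M => (c z.1, e z.2)) (SmNear.prodMk_space
      (hcs.comp_eq (smNear_fst _) rfl) ((smNear_chart (x := x₀)).comp_eq (smNear_snd _) rfl))
      rfl) ?_
    simp only [hu0, hfx]
    rfl
  refine ⟨fun j y => e'.symm (u (c j, e y)), hG, ?_, ?_⟩
  · have hct : Tendsto (fun j : Jet E E' M N q => (j, j.src)) (𝓝 j₀) (𝓝 (j₀, x₀)) := by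
      have := ((smNear_id (I := 𝓘(ℝ, E × jetCoord E E' q)) j₀).prodMk
        (smNear_src j₀)).continuousAt.tendsto
      rwa [hs] at this
    have hcu : Tendsto (fun j : Jet E E' M N q => (c j, e j.src)) (𝓝 j₀) (𝓝 (c j₀, e x₀)) := by
      have h2 : Tendsto c (𝓝 j₀) (𝓝 (c j₀)) := hcs.continuousAt
      have h3 : Tendsto (fun j => (c j).1) (𝓝 j₀) (𝓝 (c j₀).1) :=
        (continuous_fst.tendsto _).comp h2
      have h4 : (c j₀).1 = e x₀ := by rw [hc0]
      rw [h4] at h3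
      exact h2.prodMk_nhds h3
    have hut : Tendsto (fun j : Jet E E' M N q => u (c j, e j.src)) (𝓝 j₀) (𝓝 (e' (φ₀ x₀))) := by
      have h2 := hus.continuousAt.tendsto.comp hcu
      rwa [hu0, hfx] at h2
    filter_upwards [hct.eventually hG.eventually,
      hut.eventually (e'.open_target.mem_nhds (e'.map_source hy)),
      (chartAt (E × jetCoord E E' q) j₀).open_source.mem_nhds (mem_chart_source _ j₀),
      hcu.eventually hus.eventually] with j h1 h2 h3 hju
    have hsm : SmoothNear E E' (fun y => e'.symm (u (c j, e y))) j.src :=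
      SmNear.comp_eq (f := fun y => (j, y)) h1
        ((smNear_const j j.src).prodMk (smNear_id j.src)) rfl
    have hjs : j.src ∈ e.source := by have := h3.1; rwa [hs] at this
    have hjt : e'.symm (u (c j, e j.src)) ∈ e'.source := e'.map_target h2
    have h4 : of E E' q (fun y => e'.symm (u (c j, e y))) j.src ∈
        (chartAt (E × jetCoord E E' q) j₀).source := by
      rw [mem_chartAt_source, src_of, tgt_of, hs, ht]
      exact ⟨hjs, hjt⟩
    refine (chartAt (E × jetCoord E E' q) j₀).injOn h4 h3 ?_
    rw [hcc, hcc]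
    conv_lhs => rw [hc, coord_of hsm he he' hjs hjt]
    -- In the charts the representative is a translate of `f` plus a polynomial, and its derivatives
    -- at the source can be read off from the two summands.
    have hloc : e' ∘ (fun y => e'.symm (u (c j, e y))) ∘ e.symm =ᶠ[𝓝 (e j.src)]
        (fun v => f (v + (e x₀ - (c j).1))) + taylorPoly (c j).1 ((c j).2 - (c j₀).2).1 := by
      have c3 : ContinuousAt (fun v => u (c j, v)) (e j.src) :=
        hju.continuousAt.comp (f := fun v => (c j, v)) (by fun_prop)
      filter_upwards [e.open_target.mem_nhds (e.map_source hjs),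
        c3.eventually (e'.open_target.mem_nhds h2)] with v hv hv'
      simp only [Function.comp, Pi.add_apply]
      rw [e.right_inv hv, e'.right_inv hv']
      simp only [hu]
      congr 2
      abel
    have hp : e j.src + (e x₀ - (c j).1) = e x₀ := by
      rw [hc1]; abel
    refine Prod.ext rfl ?_
    have hi : (fun i : Fin (q + 1) => iteratedFDeriv ℝ i
        (e' ∘ (fun y => e'.symm (u (c j, e y))) ∘ e.symm) (e j.src)) = (c j).2.1 := by
      funext i
      rw [(hloc.iteratedFDeriv ℝ i).self_of_nhds, iteratedFDeriv_add_apply,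
        iteratedFDeriv_comp_add_right, hp]
      · have h5 : iteratedFDeriv ℝ i f (e x₀) = (c j₀).2.1 i := by rw [hc0]
        have h6 := iteratedFDeriv_taylorPoly (c j).1 ((c j).2 - (c j₀).2) i
        rw [h5, ← hc1, h6]
        simp
      · have := hfs.contDiffAt.of_le (nat_le_infty i)
        rw [← hp] at this
        exact ContDiffAt.comp (g := f) (e j.src) this (by fun_prop)
      · exact ((contDiff_taylorPoly_snd (c j).1 ((c j).2 - (c j₀).2)).of_le
          (nat_le_infty i)).contDiffAt
    dsimp only
    rw [hi, symmetrize_of_mem (c j).2.2]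
  · have : ∀ᶠ y in 𝓝 x₀, φ₀ y ∈ e'.source :=
      hφ.self_of_nhds.continuousAt.eventually (e'.open_source.mem_nhds hy)
    filter_upwards [e.open_source.mem_nhds hx, this] with y h1 h2
    rw [hu0, hf]
    simp only [Function.comp]
    rw [e.left_inv h1, e'.left_inv h2]

end Jet

end JetFamilies

/-! ### Projection, lifting and composition of jets; 1-jets of prolongations -/

section JetMaps

variable {E E' E'' : Type*} [NormedAddCommGroup E] [NormedSpace ℝ E]
  [NormedAddCommGroup E'] [NormedSpace ℝ E'] [NormedAddCommGroup E''] [NormedSpace ℝ E'']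
  {M N P : Type*} [TopologicalSpace M] [ChartedSpace E M]
  [TopologicalSpace N] [ChartedSpace E' N] [TopologicalSpace P] [ChartedSpace E'' P]
  [IsManifold 𝓘(ℝ, E) ∞ M] [IsManifold 𝓘(ℝ, E') ∞ N] [IsManifold 𝓘(ℝ, E'') ∞ P]
  {q : ℕ}

namespace Jet

lemma src_proj (j : Jet E E' M N (q + 1)) : j.proj.src = j.src := by
  obtain ⟨f, hf, h⟩ := exists_of j
  rw [h, proj_of hf, src_of, src_of]

lemma tgt_proj (j : Jet E E' M N (q + 1)) : j.proj.tgt = j.tgt := by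
  obtain ⟨f, hf, h⟩ := exists_of j
  rw [h, proj_of hf, tgt_of, tgt_of]

lemma tendsto_src (j : Jet E E' M N q) : Tendsto src (𝓝 j) (𝓝 j.src) :=
  (smNear_src j).continuousAt

lemma tendsto_tgt (j : Jet E E' M N q) : Tendsto tgt (𝓝 j) (𝓝 j.tgt) :=
  (smNear_tgt j).continuousAt

lemma family_smoothNear {A EA HA : Type*} [NormedAddCommGroup EA] [NormedSpace ℝ EA]
    [TopologicalSpace HA] [TopologicalSpace A] [ChartedSpace HA A] {I : ModelWithCorners ℝ EA HA}
    {G : A → M → N} {a : A} {x : M}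
    (h : SmNear (I.prod 𝓘(ℝ, E)) 𝓘(ℝ, E') (Function.uncurry G) (a, x)) :
    SmoothNear E E' (G a) x :=
  SmNear.comp_eq (g := Function.uncurry G) (f := fun y => (a, y)) h
    ((smNear_const a x).prodMk (smNear_id x)) rfl

lemma tendsto_graph_src (j : Jet E E' M N q) :
    Tendsto (fun k => (k, k.src)) (𝓝 j) (𝓝 (j, j.src)) :=
  Filter.tendsto_id.prodMk_nhds (tendsto_src j)

lemma smNear_of_family {r : ℕ} {G : Jet E E' M N q → M → N} {j : Jet E E' M N q}
    (hG : SmNear (𝓘(ℝ, E × jetCoord E E' q).prod 𝓘(ℝ, E)) 𝓘(ℝ, E') (Function.uncurry G)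
      (j, j.src)) :
    SmNear 𝓘(ℝ, E × jetCoord E E' q) 𝓘(ℝ, E × jetCoord E E' r)
      (fun k => of E E' r (G k) k.src) j :=
  smNear_of hG (smNear_src j)

/-- One smooth family of representatives of the `(q+1)`-jets near `j` also represents their
projections. -/
lemma smNear_proj (j : Jet E E' M N (q + 1)) :
    SmNear 𝓘(ℝ, E × jetCoord E E' (q + 1)) 𝓘(ℝ, E × jetCoord E E' q) proj j := by
  obtain ⟨f, hf, h⟩ := exists_of j
  obtain ⟨G, hG, h1, -⟩ := exists_family hf (q + 1)
  rw [← h] at hG h1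
  refine (smNear_of_family (r := q) hG).congr ?_
  filter_upwards [h1, (tendsto_graph_src j).eventually hG.eventually] with k hk hk'
  conv_lhs => rw [← hk]
  exact proj_of (family_smoothNear hk')

/-- Smooth lifts of `q`-jets to `(q+1)`-jets. -/
lemma exists_lift (j : Jet E E' M N (q + 1)) :
    ∃ l : Jet E E' M N q → Jet E E' M N (q + 1),
      SmNear 𝓘(ℝ, E × jetCoord E E' q) 𝓘(ℝ, E × jetCoord E E' (q + 1)) l j.proj ∧
      l j.proj = j ∧ ∀ᶠ k in 𝓝 j.proj, (l k).proj = k := by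
  obtain ⟨f, hf, h⟩ := exists_of j
  obtain ⟨G, hG, h1, h2⟩ := exists_family hf q
  have hp : of E E' q f j.src = j.proj := by
    conv_rhs => rw [h, proj_of hf]
  rw [hp] at hG h1 h2
  have hG' := hG
  rw [← src_proj] at hG'
  refine ⟨fun k => of E E' (q + 1) (G k) k.src, smNear_of_family hG', ?_, ?_⟩
  -- The family extends the given representative `f` of `j`, not just its `q`-jet; therefore the
  -- lift passes through `j` itself.
  · change of E E' (q + 1) (G j.proj) j.proj.src = j
    rw [src_proj, of_congr hf h2, ← h]
  · filter_upwards [h1, (tendsto_graph_src j.proj).eventually hG'.eventually] with k hk hk'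
    rw [proj_of (family_smoothNear hk'), hk]

lemma tgt_comp {b : Jet E' E'' N P q} {a : Jet E E' M N q} (h : b.src = a.tgt) :
    (b.comp a).tgt = b.tgt := by
  unfold comp
  rw [tgt_of]
  simp only [Function.comp]
  rw [← rep_tgt b, h, ← rep_tgt a]

/-- Composing families of representatives is possible without the matching condition and gives the
smooth local extension; it computes the composite of jets where source and target match. -/
lemma smOn_comp {b : Jet E' E'' N P q} {a : Jet E E' M N q} (h : b.src = a.tgt) :
    SmOn (𝓘(ℝ, E' × jetCoord E' E'' q).prod 𝓘(ℝ, E × jetCoord E E' q))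
      𝓘(ℝ, E × jetCoord E E'' q)
      {p : Jet E' E'' N P q × Jet E E' M N q | p.1.src = p.2.tgt} (fun p => p.1.comp p.2)
      (b, a) := by
  obtain ⟨f, hf, ha⟩ := exists_of a
  obtain ⟨g, hg, hb⟩ := exists_of b
  obtain ⟨F, hF, hF1, -⟩ := exists_family hf q
  obtain ⟨G, hG, hG1, -⟩ := exists_family hg q
  rw [← ha] at hF hF1
  rw [← hb] at hG hG1
  have hFa : F a a.src = b.src := by
    have := congrArg tgt hF1.self_of_nhds
    rw [tgt_of] at this
    rw [this, h]
  have s1 : SmNear ((𝓘(ℝ, E' × jetCoord E' E'' q).prod 𝓘(ℝ, E × jetCoord E E' q)).prod 𝓘(ℝ, E))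
      𝓘(ℝ, E') (fun z : (Jet E' E'' N P q × Jet E E' M N q) × M => F z.1.2 z.2)
      ((b, a), a.src) :=
    SmNear.comp_eq (g := Function.uncurry F)
      (f := fun z : (Jet E' E'' N P q × Jet E E' M N q) × M => (z.1.2, z.2)) hF
      ((smNear_fst _).snd.prodMk (smNear_snd _)) rfl
  have s2 : SmNear ((𝓘(ℝ, E' × jetCoord E' E'' q).prod 𝓘(ℝ, E × jetCoord E E' q)).prod 𝓘(ℝ, E))
      𝓘(ℝ, E'') (Function.uncurry fun (p : Jet E' E'' N P q × Jet E E' M N q) (x : M) =>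
        G p.1 (F p.2 x)) ((b, a), a.src) :=
    SmNear.comp_eq (g := Function.uncurry G)
      (f := fun z : (Jet E' E'' N P q × Jet E E' M N q) × M => (z.1.1, F z.1.2 z.2)) hG
      ((smNear_fst _).fst.prodMk s1) (by simp [hFa])
  refine ⟨fun p => of E E'' q (fun x => G p.1 (F p.2 x)) p.2.src,
    smNear_of s2 ((smNear_src a).comp_eq (smNear_snd _) rfl), ?_⟩
  have t1 : Tendsto (fun p : Jet E' E'' N P q × Jet E E' M N q => p.1) (𝓝 (b, a)) (𝓝 b) :=
    continuous_fst.tendsto _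
  have t2 : Tendsto (fun p : Jet E' E'' N P q × Jet E E' M N q => p.2) (𝓝 (b, a)) (𝓝 a) :=
    continuous_snd.tendsto _
  filter_upwards [mem_nhdsWithin_of_mem_nhds (t1.eventually hG1),
    mem_nhdsWithin_of_mem_nhds (t2.eventually hF1),
    mem_nhdsWithin_of_mem_nhds (t1.eventually ((tendsto_graph_src b).eventually hG.eventually)),
    mem_nhdsWithin_of_mem_nhds (t2.eventually ((tendsto_graph_src a).eventually hF.eventually)),
    self_mem_nhdsWithin] with p h1 h2 h3 h4 (h5 : p.1.src = p.2.tgt)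
  have h6 : F p.2 p.2.src = p.1.src := by
    rw [h5]
    conv_rhs => rw [← h2, tgt_of]
  conv_lhs => rw [← h1, ← h2, ← h6]
  exact comp_of (h6 ▸ family_smoothNear h3) (family_smoothNear h4)

/-- Agreement in all pairs of charts reduces to agreement in the preferred pair, since coordinate
changes act on both sides alike. -/
lemma of_eq_of_iff {f g : M → N} {x : M} (hf : SmoothNear E E' f x) (hg : SmoothNear E E' g x) :
    of E E' q f x = of E E' q g x ↔ f x = g x ∧
      ∀ i ≤ q, iteratedFDeriv ℝ i (chartAt E' (f x) ∘ f ∘ (chartAt E x).symm) (chartAt E x x) =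
        iteratedFDeriv ℝ i (chartAt E' (f x) ∘ g ∘ (chartAt E x).symm) (chartAt E x x) := by
  rw [of_eq hf, of_eq hg, mk_eq_iff]
  exact ⟨fun h => ⟨h.2.1, h.2.2 _ (chart_mem_atlas E x) _ (chart_mem_atlas E' (f x))
      (mem_chart_source E x) (mem_chart_source E' (f x))⟩,
    fun h => sameJet_of_chart rfl h.1 (chart_mem_atlas E x) (chart_mem_atlas E' (f x))
      (mem_chart_source E x) (mem_chart_source E' (f x)) h.2⟩

lemma of_le {r : ℕ} {f g : M → N} {x : M} (hf : SmoothNear E E' f x) (hg : SmoothNear E E' g x)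
    (hr : r ≤ q) (h : of E E' q f x = of E E' q g x) : of E E' r f x = of E E' r g x := by
  rw [of_eq_of_iff hf hg] at h ⊢
  exact ⟨h.1, fun i hi => h.2 i (hi.trans hr)⟩

lemma hasD_iff {f : M → N} {x : M} {T : E →L[ℝ] E'} :
    HasD 𝓘(ℝ, E) 𝓘(ℝ, E') f x T ↔ ContinuousAt f x ∧
      HasFDerivAt (chartAt E' (f x) ∘ f ∘ (chartAt E x).symm) T (chartAt E x x) := by
  rw [hasD_iff_chart]
  simp only [extChartAt, OpenPartialHomeomorph.extend, modelWithCornersSelf_partialEquiv,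
    PartialEquiv.trans_refl]
  rfl

/-- Equality of 1-jets means equality of the values and of the derivatives. -/
lemma of_one_eq_iff {f g : M → N} {x : M} (hf : SmoothNear E E' f x)
    (hg : SmoothNear E E' g x) :
    of E E' 1 f x = of E E' 1 g x ↔ f x = g x ∧
      ∃ T, HasD 𝓘(ℝ, E) 𝓘(ℝ, E') f x T ∧ HasD 𝓘(ℝ, E) 𝓘(ℝ, E') g x T := by
  rw [of_eq_of_iff hf hg]
  refine and_congr_right fun h0 => ?_
  have hd : DifferentiableAt ℝ (chartAt E' (f x) ∘ f ∘ (chartAt E x).symm) (chartAt E x x) :=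
    (contDiffAt_coord hf (chart_mem_atlas E x) (chart_mem_atlas E' (f x))
      (mem_chart_source E x) (mem_chart_source E' (f x))).differentiableAt (by simp)
  have hd' : DifferentiableAt ℝ (chartAt E' (f x) ∘ g ∘ (chartAt E x).symm) (chartAt E x x) :=
    (contDiffAt_coord hg (chart_mem_atlas E x) (chart_mem_atlas E' (f x))
      (mem_chart_source E x) (h0 ▸ mem_chart_source E' (f x))).differentiableAt (by simp)
  have e0 : (chartAt E' (f x) ∘ f ∘ (chartAt E x).symm) (chartAt E x x) =
      (chartAt E' (f x) ∘ g ∘ (chartAt E x).symm) (chartAt E x x) := by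
    simp [h0]
  constructor
  · intro h
    refine ⟨_, hasD_iff.2 ⟨hf.self_of_nhds.continuousAt, hd.hasFDerivAt⟩,
      hasD_iff.2 ⟨hg.self_of_nhds.continuousAt, ?_⟩⟩
    have h1 := h 1 le_rfl
    have : fderiv ℝ (chartAt E' (f x) ∘ f ∘ (chartAt E x).symm) (chartAt E x x) =
        fderiv ℝ (chartAt E' (f x) ∘ g ∘ (chartAt E x).symm) (chartAt E x x) := by
      ext v
      have := congrArg (fun φ => φ (fun _ => v)) h1
      simpa only [iteratedFDeriv_one_apply] using this
    rw [this, ← h0]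
    exact hd'.hasFDerivAt
  · rintro ⟨T, h1, h2⟩ i hi
    have h1 := (hasD_iff.1 h1).2
    have h2 := (hasD_iff.1 h2).2
    rw [← h0] at h2
    interval_cases i
    · ext v
      simpa only [iteratedFDeriv_zero_apply] using e0
    · ext v
      rw [iteratedFDeriv_one_apply, iteratedFDeriv_one_apply, h1.fderiv, h2.fderiv]

lemma hasFDerivAt_prodMk_symmetrize
    {f : E → ∀ i : Fin (q + 1), E [×(i : ℕ)]→L[ℝ] E'} {x : E}
    {g : E →L[ℝ] (∀ i : Fin (q + 1), E [×(i : ℕ)]→L[ℝ] E')} (h : HasFDerivAt f g x) :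
    HasFDerivAt (F := E × jetCoord E E' q) (fun v => (v, symmetrize E E' q (f v)))
      ((ContinuousLinearMap.id ℝ E).prod ((symmetrize E E' q).comp g)) x := by
  have h2 := ContinuousLinearMap.hasFDerivAt (𝕜 := ℝ)
    (E := ∀ i : Fin (q + 1), E [×(i : ℕ)]→L[ℝ] E') (F := jetCoord E E' q) (x := f x)
    (symmetrize E E' q)
  have h3 := HasFDerivAt.comp (𝕜 := ℝ) (E := E)
    (F := ∀ i : Fin (q + 1), E [×(i : ℕ)]→L[ℝ] E') (G := jetCoord E E' q)
    (g := symmetrize E E' q) x h2 h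
  exact HasFDerivAt.prodMk (F := E) (G := jetCoord E E' q) (hasFDerivAt_id (𝕜 := ℝ) x) h3

/-- The derivative of a jet prolongation in coordinates. -/
lemma hasD_of {f : M → N} {x : M} (hf : SmoothNear E E' f x) :
    HasD 𝓘(ℝ, E) 𝓘(ℝ, E × jetCoord E E' q) (fun y => of E E' q f y) x
      ((ContinuousLinearMap.id ℝ E).prod ((symmetrize E E' q).comp
        (ContinuousLinearMap.pi fun i : Fin (q + 1) => fderiv ℝ
          (iteratedFDeriv ℝ i (chartAt E' (f x) ∘ f ∘ (chartAt E x).symm)) (chartAt E x x)))) := by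
  have hs : SmNear 𝓘(ℝ, E) 𝓘(ℝ, E × jetCoord E E' q) (fun y => of E E' q f y) x :=
    smNear_of (I := 𝓘(ℝ, E)) (G := fun _ => f) (c := fun y => y)
      (SmNear.comp_eq (g := f) (f := fun z : M × M => z.2) hf (smNear_snd _) rfl) (smNear_id x)
  refine hasD_iff.2 ⟨hs.continuousAt, ?_⟩
  set e := chartAt E x
  set e' := chartAt E' (f x)
  have he : e ∈ atlas E M := chart_mem_atlas _ _
  have he' : e' ∈ atlas E' N := chart_mem_atlas _ _
  have hx : x ∈ e.source := mem_chart_source _ _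
  have hy : f x ∈ e'.source := mem_chart_source _ _
  have hloc : (chartAt (E × jetCoord E E' q) (of E E' q f x)) ∘ (fun y => of E E' q f y) ∘ e.symm
      =ᶠ[𝓝 (e x)] fun v => (v, symmetrize E E' q fun i : Fin (q + 1) =>
        iteratedFDeriv ℝ i (e' ∘ f ∘ e.symm) v) := by
    have hc : ∀ᶠ y in 𝓝 x, f y ∈ e'.source :=
      hf.self_of_nhds.continuousAt.eventually (e'.open_source.mem_nhds hy)
    filter_upwards [e.open_target.mem_nhds (e.map_source hx), chart_tendsto_symm.eventually hc,
      chart_tendsto_symm.eventually (SmNear.eventually hf)] with v h1 h2 h3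
    simp only [Function.comp]
    rw [chartAt_apply, src_of, tgt_of]
    have := coord_of (q := q) h3 he he' (e.map_target h1) h2
    rw [e.right_inv h1] at this
    exact this
  refine HasFDerivAt.congr_of_eventuallyEq (hasFDerivAt_prodMk_symmetrize ?_) hloc
  refine hasFDerivAt_pi.2 fun i => ?_
  have hc := contDiffAt_coord hf he he' hx hy
  have : ContDiffAt ℝ 1 (iteratedFDeriv ℝ i (e' ∘ f ∘ e.symm)) (e x) :=
    hc.iteratedFDeriv_right (m := 1) (by
      have := nat_le_infty (1 + i)
      exact_mod_cast this)
  exact (this.differentiableAt (by simp)).hasFDerivAt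

lemma smNear_of_self {f : M → N} {x : M} (hf : SmoothNear E E' f x) :
    SmNear 𝓘(ℝ, E) 𝓘(ℝ, E × jetCoord E E' q) (fun y => of E E' q f y) x :=
  smNear_of (I := 𝓘(ℝ, E)) (G := fun _ => f) (c := fun y => y)
    (SmNear.comp_eq (g := f) (f := fun z : M × M => z.2) hf (smNear_snd _) rfl) (smNear_id x)

/-- A `(q+1)`-jet determines the 1-jet of the `q`-jet prolongation. -/
lemma of_one_of {f g : M → N} {x : M} (hf : SmoothNear E E' f x) (hg : SmoothNear E E' g x)
    (h : of E E' (q + 1) f x = of E E' (q + 1) g x) :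
    of E (E × jetCoord E E' q) 1 (fun y => of E E' q f y) x =
      of E (E × jetCoord E E' q) 1 (fun y => of E E' q g y) x := by
  have hq := of_le hf hg (Nat.le_succ q) h
  rw [of_one_eq_iff (smNear_of_self hf) (smNear_of_self hg)]
  refine ⟨hq, _, hasD_of hf, ?_⟩
  have h2 := hasD_of (q := q) hg
  rw [of_eq_of_iff hf hg] at h
  rw [← h.1] at h2
  convert h2 using 4
  funext i
  have c1 := contDiffAt_coord hf (chart_mem_atlas E x) (chart_mem_atlas E' (f x))
      (mem_chart_source E x) (mem_chart_source E' (f x))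
  have c2 := contDiffAt_coord hg (chart_mem_atlas E x) (chart_mem_atlas E' (f x))
      (mem_chart_source E x) (h.1 ▸ mem_chart_source E' (f x))
  ext v w
  -- The derivative of the `i`-th derivative in the direction `v` is the derivative of order `i + 1`
  -- with `v` as first argument, and `i + 1 ≤ q + 1`.
  have := congrArg (fun φ => φ (Fin.cons v w)) (h.2 (i + 1) (by omega))
  simpa only [iteratedFDeriv_succ_apply_left, Fin.cons_zero, Fin.tail_cons] using this

/-- 1-jets of composites depend only on the 1-jets of the components. -/
lemma of_one_congr {E₃ Q : Type*} [NormedAddCommGroup E₃] [NormedSpace ℝ E₃] [TopologicalSpace Q]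
    [ChartedSpace E₃ Q] [IsManifold 𝓘(ℝ, E₃) ∞ Q] {f f' : M → N} {g g' : M → P} {x : M}
    {h : N × P → Q} (hf : SmoothNear E E' f x) (hf' : SmoothNear E E' f' x)
    (hg : SmoothNear E E'' g x) (hg' : SmoothNear E E'' g' x)
    (hh : SmNear (𝓘(ℝ, E').prod 𝓘(ℝ, E'')) 𝓘(ℝ, E₃) h (f x, g x))
    (e1 : of E E' 1 f x = of E E' 1 f' x) (e2 : of E E'' 1 g x = of E E'' 1 g' x) :
    of E E₃ 1 (fun y => h (f y, g y)) x = of E E₃ 1 (fun y => h (f' y, g' y)) x := by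
  obtain ⟨h1, S, hS, hS'⟩ := (of_one_eq_iff hf hf').1 e1
  obtain ⟨h2, T, hT, hT'⟩ := (of_one_eq_iff hg hg').1 e2
  have h3 : (f' x, g' x) = (f x, g x) := by rw [h1, h2]
  have s1 : SmoothNear E E₃ (fun y => h (f y, g y)) x :=
    SmNear.comp_eq (f := fun y => (f y, g y)) hh (SmNear.prodMk hf hg) rfl
  have s2 : SmoothNear E E₃ (fun y => h (f' y, g' y)) x :=
    SmNear.comp_eq hh (SmNear.prodMk hf' hg') h3
  obtain ⟨D, hD⟩ := hh.exists_hasD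
  rw [of_one_eq_iff s1 s2]
  exact ⟨by rw [h1, h2], _, hD.comp_eq (f := fun y => (f y, g y)) (hS.prodMk hT) rfl, hD.comp_eq (hS'.prodMk hT') h3⟩

lemma of_one_congr_left {f f' : M → N} {x : M}
    {h : N → P} (hf : SmoothNear E E' f x) (hf' : SmoothNear E E' f' x)
    (hh : SmNear 𝓘(ℝ, E') 𝓘(ℝ, E'') h (f x))
    (e1 : of E E' 1 f x = of E E' 1 f' x) :
    of E E'' 1 (fun y => h (f y)) x = of E E'' 1 (fun y => h (f' y)) x := by
  have h1 := congrArg tgt e1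
  rw [tgt_of, tgt_of] at h1
  have := congrArg (comp (of E' E'' 1 h (f x))) e1
  rwa [comp_of (E := E) hh hf, h1, comp_of (E := E) (h1 ▸ hh) hf'] at this

end Jet

end JetMaps

/-- The model of the manifold of `q`-jets of maps between manifolds of dimensions `n` and `d`. -/
abbrev jetModel (n d q : ℕ) :
    ModelWithCorners ℝ (Euc n × jetCoord (Euc n) (Euc d) q)
      (Euc n × jetCoord (Euc n) (Euc d) q) :=
  𝓘(ℝ, Euc n × jetCoord (Euc n) (Euc d) q)

/-! ### Local invertibility depends on the 1-jet -/

section LocInvJets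

variable {E E' : Type*} [NormedAddCommGroup E] [NormedSpace ℝ E] [CompleteSpace E]
  [NormedAddCommGroup E'] [NormedSpace ℝ E']
  {M N : Type*} [TopologicalSpace M] [ChartedSpace E M]
  [TopologicalSpace N] [ChartedSpace E' N]
  [IsManifold 𝓘(ℝ, E) ∞ M] [IsManifold 𝓘(ℝ, E') ∞ N]

lemma LocInv.exists_equiv {φ : M → N} {ψ : N → M} {x : M}
    (h : LocInv 𝓘(ℝ, E) 𝓘(ℝ, E') φ ψ x) :
    ∃ T : E ≃L[ℝ] E', HasD 𝓘(ℝ, E) 𝓘(ℝ, E') φ x (T : E →L[ℝ] E') := by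
  obtain ⟨T, hT⟩ := h.smooth.exists_hasD
  obtain ⟨S, hS⟩ := h.smooth_inv.exists_hasD
  have e1 : S.comp T = ContinuousLinearMap.id ℝ E :=
    (hS.comp hT).unique ((hasD_id x).congr h.left_inv)
  have e2 : T.comp S = ContinuousLinearMap.id ℝ E' :=
    (hT.comp_eq hS h.left_inv.self_of_nhds).unique ((hasD_id (φ x)).congr h.right_inv)
  exact ⟨ContinuousLinearEquiv.equivOfInverse T S (fun v => congrArg (fun f => f v) e1)
    (fun v => congrArg (fun f => f v) e2), hT⟩

/-- The inverse function theorem only asks for the derivative, which the 1-jet determines. So every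
smooth representative of the jet of a local diffeomorphism, of order at least one, is itself a local
diffeomorphism. -/
lemma exists_locInv_of_jet_eq {φ φ' : M → N} {ψ : N → M} {x : M} (hφ : SmoothNear E E' φ x)
    (h : LocInv 𝓘(ℝ, E) 𝓘(ℝ, E') φ' ψ x) (he : Jet.of E E' 1 φ x = Jet.of E E' 1 φ' x) :
    ∃ ψ', LocInv 𝓘(ℝ, E) 𝓘(ℝ, E') φ ψ' x := by
  obtain ⟨T, hT⟩ := h.exists_equiv
  obtain ⟨-, T', h1, h2⟩ := (Jet.of_one_eq_iff hφ h.smooth).1 he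
  rw [h2.unique hT] at h1
  exact locInv_of_hasD hφ h1

end LocInvJets

/-! ### Finite dimension of jet coordinates -/

section FiniteDimensional

variable {E E' : Type*} [NormedAddCommGroup E] [NormedSpace ℝ E] [FiniteDimensional ℝ E]
  [NormedAddCommGroup E'] [NormedSpace ℝ E'] [FiniteDimensional ℝ E']

variable (E E') in
lemma finiteDimensional_jetCoord (q : ℕ) : FiniteDimensional ℝ (jetCoord E E' q) := by
  have h (i : ℕ) : FiniteDimensional ℝ (E [×i]→L[ℝ] E') :=
    FiniteDimensional.of_injective
      (ContinuousMultilinearMap.toMultilinearMapLinear :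
        (E [×i]→L[ℝ] E') →ₗ[ℝ] MultilinearMap ℝ (fun _ : Fin i => E) E')
      ContinuousMultilinearMap.toMultilinearMap_injective
  have (i : Fin (q + 1)) : FiniteDimensional ℝ (E [×(i : ℕ)]→L[ℝ] E') := h i
  exact FiniteDimensional.finiteDimensional_submodule (jetCoord E E' q)

/-- Needed for the inverse function theorem for families that are parametrized by jets. -/
lemma completeSpace_jetSpace (n d q : ℕ) :
    CompleteSpace (Euc n × jetCoord (Euc n) (Euc d) q) := by
  have := finiteDimensional_jetCoord (Euc n) (Euc d) q
  have : CompleteSpace (jetCoord (Euc n) (Euc d) q) := FiniteDimensional.complete ℝ _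
  infer_instance

end FiniteDimensional

/-! ### Groupoid laws, inverses, isotropy groups and kernels -/

section GroupoidLaws

variable {n : ℕ} {X : Type*} [TopologicalSpace X] [ChartedSpace (Euc n) X]
  [IsManifold 𝓘(ℝ, Euc n) ∞ X] {q : ℕ}

/-- Local diffeomorphisms of an `n`-manifold, with a chosen local inverse. -/
abbrev LocDiff (n : ℕ) {X : Type*} [TopologicalSpace X] [ChartedSpace (Euc n) X] (φ ψ : X → X)
    (x : X) : Prop :=
  LocInv 𝓘(ℝ, Euc n) 𝓘(ℝ, Euc n) φ ψ x

lemma LocInv.jet_mem {φ ψ : X → X} {x : X} (h : LocDiff n φ ψ x) :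
    Jet.of (Euc n) (Euc n) q φ x ∈ fullJetGroupoid n X q :=
  ⟨φ, x, h.isLocalDiffeomorphAt, rfl⟩

lemma exists_locDiff {f : SelfJet n X q} (hf : f ∈ fullJetGroupoid n X q) :
    ∃ φ ψ, LocDiff n φ ψ f.src ∧ f = Jet.of (Euc n) (Euc n) q φ f.src := by
  obtain ⟨φ, x, h, rfl⟩ := hf
  obtain ⟨ψ, hψ⟩ := exists_locInv h
  exact ⟨φ, ψ, by rwa [Jet.src_of], by rw [Jet.src_of]⟩

lemma locInv_id (x : X) : LocDiff n id id x :=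
  ⟨smNear_id x, smNear_id x, Eventually.of_forall fun _ => rfl, Eventually.of_forall fun _ => rfl⟩

lemma unitJet_mem (x : X) : unitJet n q x ∈ fullJetGroupoid n X q := (locInv_id x).jet_mem

@[simp] lemma src_unitJet (x : X) : (unitJet n q x).src = x := Jet.src_of _ _

@[simp] lemma tgt_unitJet (x : X) : (unitJet n q x).tgt = x := Jet.tgt_of _ _

lemma jet_comp_assoc {a b c : SelfJet n X q} (h1 : c.src = b.tgt) (h2 : b.src = a.tgt) :
    c.comp (b.comp a) = (c.comp b).comp a := by
  obtain ⟨f, hf, ha⟩ := Jet.exists_of a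
  obtain ⟨g, hg, hb⟩ := Jet.exists_of b
  obtain ⟨k, hk, hc⟩ := Jet.exists_of c
  rw [ha, Jet.tgt_of] at h2
  rw [hb, Jet.tgt_of] at h1
  rw [h1] at hk hc
  rw [h2] at hg hb hk hc
  rw [ha, hb, hc, Jet.comp_of hg hf, Jet.comp_of hk hg]
  exact (Jet.comp_of (f := g ∘ f) hk (hg.comp hf)).trans
    (Jet.comp_of (g := k ∘ g) (SmoothNear.comp hk hg) hf).symm

lemma jet_comp_unit (f : SelfJet n X q) : f.comp (unitJet n q f.src) = f := by
  obtain ⟨g, hg, h⟩ := Jet.exists_of f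
  conv_lhs => rw [h, Jet.src_of]
  exact (Jet.comp_of (g := g) (f := id) hg (smNear_id _)).trans h.symm

lemma unit_jet_comp (f : SelfJet n X q) : (unitJet n q f.tgt).comp f = f := by
  obtain ⟨g, hg, h⟩ := Jet.exists_of f
  conv_lhs => rw [h, Jet.tgt_of]
  exact (Jet.comp_of (g := id) (f := g) (smNear_id _) hg).trans h.symm

lemma LocInv.comp_jet {φ ψ : X → X} {x : X} (h : LocDiff n φ ψ x) :
    (Jet.of (Euc n) (Euc n) q ψ (φ x)).comp (Jet.of (Euc n) (Euc n) q φ x) = unitJet n q x := by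
  rw [Jet.comp_of h.smooth_inv h.smooth]
  exact Jet.of_congr (smNear_id x) h.left_inv

lemma proj_comp_jet {a b : SelfJet n X (q + 1)} (h : b.src = a.tgt) :
    (b.comp a).proj = b.proj.comp a.proj := by
  obtain ⟨f, hf, ha⟩ := Jet.exists_of a
  obtain ⟨g, hg, hb⟩ := Jet.exists_of b
  rw [ha, Jet.tgt_of] at h
  rw [h] at hg hb
  rw [ha, hb, Jet.comp_of hg hf, Jet.proj_of (hg.comp hf), Jet.proj_of hg, Jet.proj_of hf,
    Jet.comp_of hg hf]

@[simp] lemma proj_unitJet (x : X) : (unitJet n (q + 1) x).proj = unitJet n q x :=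
  Jet.proj_of (smNear_id x)

lemma proj_mem {f : SelfJet n X (q + 1)} (hf : f ∈ fullJetGroupoid n X (q + 1)) :
    f.proj ∈ fullJetGroupoid n X q := by
  obtain ⟨φ, ψ, h, hf⟩ := exists_locDiff hf
  rw [hf, Jet.proj_of h.smooth]
  exact h.jet_mem

lemma exists_lift_mem {f : SelfJet n X q} (hf : f ∈ fullJetGroupoid n X q) :
    ∃ g ∈ fullJetGroupoid n X (q + 1), g.proj = f := by
  obtain ⟨φ, ψ, h, hf⟩ := exists_locDiff hf
  exact ⟨_, h.jet_mem, by rw [Jet.proj_of h.smooth, ← hf]⟩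

lemma mem_of_proj_mem {f : SelfJet n X (q + 2)}
    (hf : f.proj ∈ fullJetGroupoid n X (q + 1)) : f ∈ fullJetGroupoid n X (q + 2) := by
  obtain ⟨φ, ψ, h, hp⟩ := exists_locDiff hf
  obtain ⟨g, hg, hf'⟩ := Jet.exists_of f
  rw [Jet.src_proj] at h hp
  have : f.proj = Jet.of (Euc n) (Euc n) (q + 1) g f.src := by
    conv_lhs => rw [hf', Jet.proj_of hg]
  obtain ⟨ψ', h'⟩ := exists_locInv_of_jet_eq hg h
    (Jet.of_le hg h.smooth (Nat.le_add_left 1 q) (this.symm.trans hp))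
  rw [hf']
  exact LocInv.jet_mem h'

/-- The inverse of `f` in the full jet groupoid. -/
def jetInv (f : SelfJet n X q) : SelfJet n X q :=
  open Classical in
  if h : ∃ g ∈ fullJetGroupoid n X q, g.src = f.tgt ∧ g.tgt = f.src ∧
    g.comp f = unitJet n q f.src then h.choose else f

/-- Left inverses in the groupoid are unique, so the choice in `jetInv` can only be the jet of the
local inverse. -/
lemma jetInv_of {φ ψ : X → X} {x : X} (h : LocDiff n φ ψ x) :
    jetInv (Jet.of (Euc n) (Euc n) q φ x) = Jet.of (Euc n) (Euc n) q ψ (φ x) := by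
  have hx : ψ (φ x) = x := h.left_inv.self_of_nhds
  have hex : ∃ g ∈ fullJetGroupoid n X q, g.src = (Jet.of (Euc n) (Euc n) q φ x).tgt ∧
      g.tgt = (Jet.of (Euc n) (Euc n) q φ x).src ∧
      g.comp (Jet.of (Euc n) (Euc n) q φ x) = unitJet n q (Jet.of (Euc n) (Euc n) q φ x).src :=
    ⟨_, h.symm.jet_mem, by simp, by simp [hx], by rw [h.comp_jet, Jet.src_of]⟩
  unfold jetInv
  rw [dif_pos hex]
  obtain ⟨h1, h2, h3, h4⟩ := hex.choose_spec
  set g := hex.choose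
  rw [Jet.tgt_of] at h2
  rw [Jet.src_of] at h3 h4
  have h5 := h.symm.comp_jet (q := q)
  rw [hx] at h5
  calc g = g.comp (unitJet n q g.src) := (jet_comp_unit g).symm
    _ = g.comp ((Jet.of (Euc n) (Euc n) q φ x).comp (Jet.of (Euc n) (Euc n) q ψ (φ x))) := by
        rw [h5, h2]
    _ = (g.comp (Jet.of (Euc n) (Euc n) q φ x)).comp (Jet.of (Euc n) (Euc n) q ψ (φ x)) :=
        jet_comp_assoc (by simp [h2]) (by simp [hx])
    _ = _ := by
        rw [h4]
        have := unit_jet_comp (Jet.of (Euc n) (Euc n) q ψ (φ x))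
        rwa [Jet.tgt_of, hx] at this

section
variable {f g : SelfJet n X q} (hf : f ∈ fullJetGroupoid n X q)
include hf

lemma jetInv_mem : jetInv f ∈ fullJetGroupoid n X q := by
  obtain ⟨φ, ψ, h, hf⟩ := exists_locDiff hf
  rw [hf, jetInv_of h]
  exact h.symm.jet_mem

lemma src_jetInv : (jetInv f).src = f.tgt := by
  obtain ⟨φ, ψ, h, hf⟩ := exists_locDiff hf
  rw [hf, jetInv_of h, Jet.src_of, Jet.tgt_of]

lemma tgt_jetInv : (jetInv f).tgt = f.src := by
  obtain ⟨φ, ψ, h, hf⟩ := exists_locDiff hf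
  have := h.left_inv.self_of_nhds
  rw [hf, jetInv_of h, Jet.src_of, Jet.tgt_of, this]

lemma jetInv_comp : (jetInv f).comp f = unitJet n q f.src := by
  obtain ⟨φ, ψ, h, hf⟩ := exists_locDiff hf
  rw [hf, jetInv_of h, h.comp_jet, Jet.src_of]

lemma comp_jetInv : f.comp (jetInv f) = unitJet n q f.tgt := by
  obtain ⟨φ, ψ, h, hf⟩ := exists_locDiff hf
  have hx := h.left_inv.self_of_nhds
  have := h.symm.comp_jet (q := q)
  rw [hx] at this
  rw [hf, jetInv_of h, this, Jet.tgt_of]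

lemma comp_mem (hg : g ∈ fullJetGroupoid n X q) (h : f.src = g.tgt) :
    f.comp g ∈ fullJetGroupoid n X q := (comp_mem_fullJetGroupoid hf hg h).1

lemma jetInv_comp_cancel (h : f.tgt = g.tgt) : f.comp ((jetInv f).comp g) = g := by
  rw [jet_comp_assoc (tgt_jetInv hf).symm ((src_jetInv hf).trans h),
    comp_jetInv hf, h, unit_jet_comp]

lemma comp_jetInv_comp (h : f.src = g.tgt) : (jetInv f).comp (f.comp g) = g := by
  rw [jet_comp_assoc (src_jetInv hf) h, jetInv_comp hf, h, unit_jet_comp]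

lemma comp_comp_jetInv (h : g.src = f.tgt) : (g.comp f).comp (jetInv f) = g := by
  rw [← jet_comp_assoc h (tgt_jetInv hf).symm, comp_jetInv hf, ← h, jet_comp_unit]

lemma comp_jetInv_comp_cancel (h : g.src = f.src) : (g.comp (jetInv f)).comp f = g := by
  rw [← jet_comp_assoc (h.trans (tgt_jetInv hf).symm) (src_jetInv hf), jetInv_comp hf, ← h,
    jet_comp_unit]

end

lemma proj_jetInv {f : SelfJet n X (q + 1)} (hf : f ∈ fullJetGroupoid n X (q + 1)) :
    (jetInv f).proj = jetInv f.proj := by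
  obtain ⟨φ, ψ, h, hf⟩ := exists_locDiff hf
  rw [hf, jetInv_of h, Jet.proj_of h.smooth, Jet.proj_of h.smooth_inv, jetInv_of h]

/-- The full jet groupoid is open, and inversion is smooth. -/
lemma smNear_jetInv {f : SelfJet n X q} (hf : f ∈ fullJetGroupoid n X q) :
    (∀ᶠ g in 𝓝 f, g ∈ fullJetGroupoid n X q) ∧
      SmNear (jetModel n n q) (jetModel n n q) (jetInv : SelfJet n X q → SelfJet n X q) f := by
  obtain ⟨φ, ψ, h, hfe⟩ := exists_locDiff hf
  obtain ⟨G, hG, h1, h2⟩ := Jet.exists_family h.smooth q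
  rw [← hfe] at hG h1 h2
  have h0 : G f f.src = φ f.src := h2.self_of_nhds
  have hGf : LocDiff n (G f) ψ f.src := by
    refine ⟨Jet.family_smoothNear hG, h0 ▸ h.smooth_inv, ?_, ?_⟩
    · filter_upwards [h.left_inv, h2] with y hy hy'
      rw [hy', hy]
    · have ht : Tendsto ψ (𝓝 (G f f.src)) (𝓝 f.src) := by
        have := h.smooth_inv.continuousAt.tendsto
        rwa [h.left_inv.self_of_nhds, ← h0] at this
      filter_upwards [h0 ▸ h.right_inv, ht.eventually h2] with z hz hz'
      rw [hz', hz]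
  have := completeSpace_jetSpace n n q
  -- The members of the family near `f` are local diffeomorphisms, which makes the groupoid open;
  -- the jets of the inverse family at the targets are the inverse jets, and they depend smoothly on
  -- `g`.
  obtain ⟨G', hG', hl, hr⟩ := exists_family_inverse hG hGf
  have hL := (Jet.tendsto_graph_src f).eventually (family_locInv hG hG' hl hr)
  have htgt : f.tgt = G f f.src := by
    rw [h0]; conv_lhs => rw [hfe, Jet.tgt_of]
  refine ⟨?_, ?_⟩
  · filter_upwards [hL, h1] with g hg hg1
    rw [← hg1]
    exact LocInv.jet_mem hg
  · rw [← htgt] at hG'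
    refine (Jet.smNear_of (q := q) hG' (Jet.smNear_tgt f)).congr ?_
    filter_upwards [hL, h1] with g hg hg1
    conv_lhs => rw [← hg1, jetInv_of hg]
    congr 1
    conv_rhs => rw [← hg1, Jet.tgt_of]

lemma eventually_mem {f : SelfJet n X q} (hf : f ∈ fullJetGroupoid n X q) :
    ∀ᶠ g in 𝓝 f, g ∈ fullJetGroupoid n X q := (smNear_jetInv hf).1

lemma isotropy_jetInv {x : X} {g : SelfJet n X q} (hg : g ∈ isotropy n q x) :
    jetInv g ∈ isotropy n q x :=
  ⟨jetInv_mem hg.1, (src_jetInv hg.1).trans hg.2.2, (tgt_jetInv hg.1).trans hg.2.1⟩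

lemma isotropy_comp {x : X} {g h : SelfJet n X q} (hg : g ∈ isotropy n q x)
    (hh : h ∈ isotropy n q x) : g.comp h ∈ isotropy n q x :=
  ⟨comp_mem hg.1 hh.1 (hg.2.1.trans hh.2.2.symm), (Jet.src_comp _ _).trans hh.2.1,
    (Jet.tgt_comp (hg.2.1.trans hh.2.2.symm)).trans hg.2.2⟩

lemma isotropy_unit (x : X) : unitJet n q x ∈ isotropy n q x :=
  ⟨unitJet_mem x, src_unitJet x, tgt_unitJet x⟩

lemma isotropy_proj {x : X} {g : SelfJet n X (q + 1)} (hg : g ∈ isotropy n (q + 1) x) :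
    g.proj ∈ isotropy n q x :=
  ⟨proj_mem hg.1, (Jet.src_proj g).trans hg.2.1, (Jet.tgt_proj g).trans hg.2.2⟩

lemma kernel_jetInv {x : X} {k : SelfJet n X (q + 1)} (hk : k ∈ kernel n q x) :
    jetInv k ∈ kernel n q x := by
  refine ⟨isotropy_jetInv hk.1, ?_⟩
  rw [proj_jetInv hk.1.1, hk.2]
  exact (jetInv_of (locInv_id x)).trans rfl

lemma kernel_comp {x : X} {k l : SelfJet n X (q + 1)} (hk : k ∈ kernel n q x)
    (hl : l ∈ kernel n q x) : k.comp l ∈ kernel n q x := by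
  refine ⟨isotropy_comp hk.1 hl.1, ?_⟩
  rw [proj_comp_jet (hk.1.2.1.trans hl.1.2.2.symm), hk.2, hl.2]
  have := unit_jet_comp (unitJet n q x)
  rwa [tgt_unitJet] at this

/-- Two arrows with the same projection differ by an element of the kernel. -/
lemma jetInv_comp_mem_kernel {f g : SelfJet n X (q + 1)} (hf : f ∈ fullJetGroupoid n X (q + 1))
    (hg : g ∈ fullJetGroupoid n X (q + 1)) (h : f.proj = g.proj) :
    (jetInv f).comp g ∈ kernel n q f.src := by
  have hs : f.src = g.src := by rw [← Jet.src_proj, h, Jet.src_proj]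
  have ht : f.tgt = g.tgt := by rw [← Jet.tgt_proj, h, Jet.tgt_proj]
  have hm : (jetInv f).src = g.tgt := (src_jetInv hf).trans ht
  refine ⟨⟨comp_mem (jetInv_mem hf) hg hm, (Jet.src_comp _ _).trans hs.symm,
    (Jet.tgt_comp hm).trans (tgt_jetInv hf)⟩, ?_⟩
  rw [proj_comp_jet hm, proj_jetInv hf, ← h, jetInv_comp (proj_mem hf), Jet.src_proj]

end GroupoidLaws

/-! ### The action of `Π_{q+1}` on 1-jets of sections -/

section ProlongedAction

variable {n d r q : ℕ} {X B : Type*} [TopologicalSpace X] [ChartedSpace (Euc n) X]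
  [TopologicalSpace B] [ChartedSpace (Euc d) B]

/-- Coordinates of a bundle `π : B → X` near any point: diffeomorphisms over `X` of open subsets
of `B` to open subsets of `X × ℝʳ`. -/
def HasFibredCharts (n d r : ℕ) {X B : Type*} [TopologicalSpace X] [ChartedSpace (Euc n) X]
    [TopologicalSpace B] [ChartedSpace (Euc d) B] (π : B → X) : Prop :=
  ∀ b : B, ∃ Φ : OpenPartialHomeomorph B (X × Euc r), b ∈ Φ.source ∧
    (∀ c ∈ Φ.source, (Φ c).1 = π c) ∧
    ContMDiffOn 𝓘(ℝ, Euc d) (𝓘(ℝ, Euc n).prod 𝓘(ℝ, Euc r)) ∞ Φ Φ.source ∧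
    ContMDiffOn (𝓘(ℝ, Euc n).prod 𝓘(ℝ, Euc r)) 𝓘(ℝ, Euc d) ∞ Φ.symm Φ.target

lemma IsSmoothFibreBundle.hasFibredCharts {F : Type*} [TopologicalSpace F]
    [ChartedSpace (Euc r) F] [IsManifold 𝓘(ℝ, Euc r) ∞ F] {π : B → X}
    (h : IsSmoothFibreBundle n d r F π) : HasFibredCharts n d r π := by
  intro b
  obtain ⟨e, he, h1, h2⟩ := h (π b)
  have hb : b ∈ e.source := e.mem_source.2 he
  set c := chartAt (Euc r) (e b).2
  set C : OpenPartialHomeomorph (X × F) (X × Euc r) := (OpenPartialHomeomorph.refl X).prod c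
  have hCs : ∀ p, p ∈ C.source ↔ p.2 ∈ c.source := fun p => by simp [C]
  have hCt : ∀ p, p ∈ C.target ↔ p.2 ∈ c.target := fun p => by simp [C]
  have hc1 : ContMDiffOn (𝓘(ℝ, Euc n).prod 𝓘(ℝ, Euc r)) (𝓘(ℝ, Euc n).prod 𝓘(ℝ, Euc r)) ∞ C
      C.source :=
    contMDiffOn_fst.prodMk ((contMDiffOn_chart (I := 𝓘(ℝ, Euc r)) (n := ∞)).comp
      contMDiffOn_snd fun p hp => (hCs p).1 hp)
  have hc2 : ContMDiffOn (𝓘(ℝ, Euc n).prod 𝓘(ℝ, Euc r)) (𝓘(ℝ, Euc n).prod 𝓘(ℝ, Euc r)) ∞ C.symm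
      C.target :=
    contMDiffOn_fst.prodMk ((contMDiffOn_chart_symm (I := 𝓘(ℝ, Euc r)) (n := ∞)).comp
      contMDiffOn_snd fun p hp => (hCt p).1 hp)
  refine ⟨e.toOpenPartialHomeomorph.trans C, ?_, ?_, ?_, ?_⟩
  · rw [OpenPartialHomeomorph.trans_source]
    exact ⟨hb, (hCs _).2 (mem_chart_source _ _)⟩
  · intro z hz
    rw [OpenPartialHomeomorph.trans_source] at hz
    exact e.coe_fst hz.1
  · rw [OpenPartialHomeomorph.trans_source]
    exact hc1.comp (h1.mono inter_subset_left) fun _ hz => hz.2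
  · rw [OpenPartialHomeomorph.trans_target]
    exact h2.comp (hc2.mono inter_subset_left) fun _ hz => hz.2

variable [IsManifold 𝓘(ℝ, Euc n) ∞ X] [IsManifold 𝓘(ℝ, Euc d) ∞ B] {π : B → X}

/-- `s` is a smooth section of `π` near `x`. -/
structure IsSec (n d : ℕ) {X B : Type*} [TopologicalSpace X] [ChartedSpace (Euc n) X]
    [TopologicalSpace B] [ChartedSpace (Euc d) B] (π : B → X) (s : X → B) (x : X) : Prop where
  smooth : SmoothNear (Euc n) (Euc d) s x
  sec : ∀ᶠ y in 𝓝 x, π (s y) = y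

lemma IsSec.mem {s : X → B} {x : X} (h : IsSec n d π s x) (k : ℕ) :
    Jet.of (Euc n) (Euc d) k s x ∈ sectionJets n d k π :=
  ⟨s, x, h.smooth, h.sec, rfl⟩

lemma exists_sec {k : ℕ} {w : Jet (Euc n) (Euc d) X B k} (hw : w ∈ sectionJets n d k π) :
    ∃ s, IsSec n d π s w.src ∧ w = Jet.of (Euc n) (Euc d) k s w.src := by
  obtain ⟨s, x, h1, h2, rfl⟩ := hw
  rw [Jet.src_of]
  exact ⟨s, ⟨h1, h2⟩, rfl⟩

lemma π_tgt {k : ℕ} {w : Jet (Euc n) (Euc d) X B k} (hw : w ∈ sectionJets n d k π) :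
    π w.tgt = w.src := by
  obtain ⟨s, h, hs⟩ := exists_sec hw
  have := h.sec.self_of_nhds
  rw [hs, Jet.tgt_of, Jet.src_of, this]

lemma HasFibredCharts.smNear_π (hF : HasFibredCharts n d r π) (b : B) :
    SmNear 𝓘(ℝ, Euc d) 𝓘(ℝ, Euc n) π b := by
  obtain ⟨Φ, hb, h1, h2, -⟩ := hF b
  have hs := Φ.open_source.mem_nhds hb
  refine (smNear_of_contMDiffOn h2 hs).fst.congr ?_
  filter_upwards [hs] with c hc
  exact (h1 c hc).symm

namespace JetAction

variable (A : JetAction n d q π)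

lemma smOn_act {b : B} {f : SelfJet n X q} (hf : f ∈ fullJetGroupoid n X q) (hb : π b = f.tgt) :
    SmOn (𝓘(ℝ, Euc d).prod (jetModel n n q)) 𝓘(ℝ, Euc d)
      {p : B × SelfJet n X q | p.2 ∈ fullJetGroupoid n X q ∧ π p.1 = p.2.tgt}
      (fun p => A.act p.1 p.2) (b, f) :=
  smoothOnSubset_iff_smOn.1 A.smooth (b, f) ⟨hf, hb⟩

lemma isSec_act {s : X → B} {φ ψ : X → X} {x : X} (hs : IsSec n d π s (φ x))
    (hφ : LocDiff n φ ψ x) :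
    IsSec n d π (fun y => A.act (s (φ y)) (Jet.of (Euc n) (Euc n) q φ y)) x := by
  have hse := hφ.smooth.continuousAt.eventually hs.sec
  refine ⟨?_, ?_⟩
  · refine SmOn.comp_smNear (f := fun y => (s (φ y), Jet.of (Euc n) (Euc n) q φ y))
      (A.smOn_act hφ.jet_mem (by simpa using hs.sec.self_of_nhds))
      ((SmNear.comp hs.smooth hφ.smooth).prodMk (Jet.smNear_of_self hφ.smooth)) ?_
    filter_upwards [hse, hφ.eventually] with y h1 h2
    exact ⟨h2.jet_mem, by simp [h1]⟩
  · filter_upwards [hse, hφ.eventually] with y h1 h2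
    rw [A.π_act _ _ h2.jet_mem (by simp [h1]), Jet.src_of]

lemma prolongedAct_of {s : X → B} {φ ψ : X → X} {x : X} (hs : IsSec n d π s (φ x))
    (hφ : LocDiff n φ ψ x) :
    A.ProlongedAct (Jet.of (Euc n) (Euc d) 1 s (φ x)) (Jet.of (Euc n) (Euc n) (q + 1) φ x)
      (Jet.of (Euc n) (Euc d) 1 (fun y => A.act (s (φ y)) (Jet.of (Euc n) (Euc n) q φ y)) x) :=
  ⟨s, φ, x, hs.smooth, hs.sec, hφ.isLocalDiffeomorphAt, rfl, rfl, rfl⟩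

/-- Near the point in question the action extends to a smooth map `g` on `B × J_q`, and the result
is the 1-jet of `g(s ∘ φ, j_q(φ))`. The 1-jet of `s ∘ φ` is determined by `w` and the 1-jet of `φ`,
that of `j_q(φ)` by `j_{q+1}(φ)`. -/
lemma prolongedAct_unique {w : Jet (Euc n) (Euc d) X B 1} {f : SelfJet n X (q + 1)}
    {w₁ w₂ : Jet (Euc n) (Euc d) X B 1} (h₁ : A.ProlongedAct w f w₁)
    (h₂ : A.ProlongedAct w f w₂) : w₁ = w₂ := by
  obtain ⟨s, φ, x, s1, s2, s3, rfl, rfl, rfl⟩ := h₁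
  obtain ⟨s', φ', x', s1', s2', s3', hw, hf, rfl⟩ := h₂
  obtain ⟨ψ, hφ⟩ := exists_locInv s3
  obtain ⟨ψ', hφ'⟩ := exists_locInv s3'
  have hx := congrArg Jet.src hf
  have hφx := congrArg Jet.tgt hf
  rw [Jet.src_of, Jet.src_of] at hx
  subst hx
  rw [Jet.tgt_of, Jet.tgt_of] at hφx
  rw [← hφx] at hw s1' s2'
  have hs : IsSec n d π s (φ x) := ⟨s1, s2⟩
  have hs' : IsSec n d π s' (φ' x) := hφx ▸ ⟨s1', s2'⟩
  obtain ⟨g, hg, he⟩ := A.smOn_act (b := s (φ x)) (hφ.jet_mem (q := q))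
    (by simpa using hs.sec.self_of_nhds)
  have hq : Jet.of (Euc n) (Euc n) q φ x = Jet.of (Euc n) (Euc n) q φ' x :=
    Jet.of_le hφ.smooth hφ'.smooth (Nat.le_succ q) hf
  have hsx : s (φ x) = s' (φ' x) := by
    have := congrArg Jet.tgt hw
    rw [Jet.tgt_of, Jet.tgt_of] at this
    rw [this, hφx]
  -- Replaces the action, defined only along the matching condition, by its smooth extension `g`,
  -- for which the chain rule is available.
  have key : ∀ {s : X → B} {φ ψ : X → X}, IsSec n d π s (φ x) → LocDiff n φ ψ x →
      (fun p : B × SelfJet n X q => A.act p.1 p.2) =ᶠ[𝓝[{p | p.2 ∈ fullJetGroupoid n X q ∧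
        π p.1 = p.2.tgt}] (s (φ x), Jet.of (Euc n) (Euc n) q φ x)] g →
      Jet.of (Euc n) (Euc d) 1 (fun y => A.act (s (φ y)) (Jet.of (Euc n) (Euc n) q φ y)) x =
        Jet.of (Euc n) (Euc d) 1 (fun y => g (s (φ y), Jet.of (Euc n) (Euc n) q φ y)) x := by
    intro s φ ψ hs hφ he
    refine (Jet.of_congr (A.isSec_act hs hφ).smooth ?_).symm
    have ht : Tendsto (fun y => (s (φ y), Jet.of (Euc n) (Euc n) q φ y)) (𝓝 x)
        (𝓝[{p | p.2 ∈ fullJetGroupoid n X q ∧ π p.1 = p.2.tgt}]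
          (s (φ x), Jet.of (Euc n) (Euc n) q φ x)) := by
      refine tendsto_nhdsWithin_iff.2 ⟨((SmNear.comp hs.smooth hφ.smooth).prodMk
        (Jet.smNear_of_self hφ.smooth)).continuousAt, ?_⟩
      filter_upwards [hφ.smooth.continuousAt.eventually hs.sec, hφ.eventually] with y h1 h2
      exact ⟨h2.jet_mem, by simp [h1]⟩
    filter_upwards [ht.eventually he] with y hy
    exact hy.symm
  rw [key hs hφ he, key hs' hφ' (by rw [← hsx, ← hq]; exact he)]
  have c1 : Jet.of (Euc n) (Euc d) 1 (s ∘ φ) x = Jet.of (Euc n) (Euc d) 1 (s' ∘ φ') x := by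
    rw [← Jet.comp_of hs.smooth hφ.smooth, ← Jet.comp_of hs'.smooth hφ'.smooth, hw, hφx,
      Jet.of_le hφ.smooth hφ'.smooth (Nat.le_add_left 1 q) hf]
  exact Jet.of_one_congr (f := s ∘ φ) (f' := s' ∘ φ') (SmoothNear.comp hs.smooth hφ.smooth)
    (SmoothNear.comp hs'.smooth hφ'.smooth) (Jet.smNear_of_self hφ.smooth)
    (Jet.smNear_of_self hφ'.smooth) hg c1 (Jet.of_one_of hφ.smooth hφ'.smooth hf)

/-- The prolonged action on 1-jets of sections, as a function. -/
def pact (w : Jet (Euc n) (Euc d) X B 1) (f : SelfJet n X (q + 1)) : Jet (Euc n) (Euc d) X B 1 :=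
  open Classical in
  if h : ∃ w', A.ProlongedAct w f w' then h.choose else w

lemma pact_eq {w : Jet (Euc n) (Euc d) X B 1} {f : SelfJet n X (q + 1)}
    {w' : Jet (Euc n) (Euc d) X B 1} (h : A.ProlongedAct w f w') : A.pact w f = w' := by
  have hex : ∃ w', A.ProlongedAct w f w' := ⟨w', h⟩
  unfold pact
  rw [dif_pos hex]
  exact A.prolongedAct_unique hex.choose_spec h

lemma pact_of {s : X → B} {φ ψ : X → X} {x : X} (hs : IsSec n d π s (φ x))
    (hφ : LocDiff n φ ψ x) :
    A.pact (Jet.of (Euc n) (Euc d) 1 s (φ x)) (Jet.of (Euc n) (Euc n) (q + 1) φ x) =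
      Jet.of (Euc n) (Euc d) 1 (fun y => A.act (s (φ y)) (Jet.of (Euc n) (Euc n) q φ y)) x :=
  A.pact_eq (A.prolongedAct_of hs hφ)

/-- The pairs `(w, f)` for which `w f` is defined. -/
def pactDomain (n d q : ℕ) {X B : Type*} [TopologicalSpace X] [ChartedSpace (Euc n) X]
    [TopologicalSpace B] [ChartedSpace (Euc d) B] (π : B → X) :
    Set (Jet (Euc n) (Euc d) X B 1 × SelfJet n X (q + 1)) :=
  {p | p.1 ∈ sectionJets n d 1 π ∧ p.2 ∈ fullJetGroupoid n X (q + 1) ∧ p.1.src = p.2.tgt}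

lemma exists_rep_of_mem {w : Jet (Euc n) (Euc d) X B 1} {f : SelfJet n X (q + 1)}
    (h : (w, f) ∈ pactDomain n d q π) :
    ∃ s φ ψ x, IsSec n d π s (φ x) ∧ LocDiff n φ ψ x ∧ w = Jet.of (Euc n) (Euc d) 1 s (φ x) ∧
      f = Jet.of (Euc n) (Euc n) (q + 1) φ x := by
  obtain ⟨hw, hf, hs⟩ := h
  obtain ⟨s, h1, h2⟩ := exists_sec hw
  obtain ⟨φ, ψ, h3, h4⟩ := exists_locDiff hf
  dsimp only at hs h1 h2 h3 h4
  have : w.src = φ f.src := by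
    rw [hs]; conv_lhs => rw [h4, Jet.tgt_of]
  rw [this] at h1 h2
  exact ⟨s, φ, ψ, f.src, h1, h3, h2, h4⟩

lemma prolongedAct_iff {w : Jet (Euc n) (Euc d) X B 1} {f : SelfJet n X (q + 1)}
    {w' : Jet (Euc n) (Euc d) X B 1} :
    A.ProlongedAct w f w' ↔ (w, f) ∈ pactDomain n d q π ∧ A.pact w f = w' := by
  constructor
  · intro h
    refine ⟨?_, A.pact_eq h⟩
    obtain ⟨s, φ, x, h1, h2, h3, rfl, rfl, rfl⟩ := h
    exact ⟨⟨s, φ x, h1, h2, rfl⟩, ⟨φ, x, h3, rfl⟩, by simp⟩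
  · rintro ⟨h, rfl⟩
    obtain ⟨s, φ, ψ, x, h1, h2, rfl, rfl⟩ := exists_rep_of_mem h
    rw [A.pact_of h1 h2]
    exact A.prolongedAct_of h1 h2

section
variable {w : Jet (Euc n) (Euc d) X B 1} {f : SelfJet n X (q + 1)}
  (h : (w, f) ∈ pactDomain n d q π)
include h

lemma pact_mem : A.pact w f ∈ sectionJets n d 1 π := by
  obtain ⟨s, φ, ψ, x, h1, h2, rfl, rfl⟩ := exists_rep_of_mem h
  rw [A.pact_of h1 h2]
  exact (A.isSec_act h1 h2).mem 1

lemma src_pact : (A.pact w f).src = f.src := by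
  obtain ⟨s, φ, ψ, x, h1, h2, rfl, rfl⟩ := exists_rep_of_mem h
  rw [A.pact_of h1 h2, Jet.src_of, Jet.src_of]

lemma tgt_pact : (A.pact w f).tgt = A.act w.tgt f.proj := by
  obtain ⟨s, φ, ψ, x, h1, h2, rfl, rfl⟩ := exists_rep_of_mem h
  rw [A.pact_of h1 h2, Jet.tgt_of, Jet.tgt_of, Jet.proj_of h2.smooth]

/-- Both sides are 1-jets of local sections, and these coincide near the source since the action
respects the composition of the `q`-jets at every nearby point. -/
lemma pact_comp {g : SelfJet n X (q + 1)} (hg : g ∈ fullJetGroupoid n X (q + 1))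
    (hfg : f.src = g.tgt) : A.pact w (f.comp g) = A.pact (A.pact w f) g := by
  obtain ⟨s, φ, ψ, x, h1, h2, rfl, rfl⟩ := exists_rep_of_mem h
  obtain ⟨φ', ψ', h3, h4⟩ := exists_locDiff hg
  have hx : x = φ' g.src := by
    rw [Jet.src_of] at hfg
    rw [hfg, h4, Jet.tgt_of, Jet.src_of]
  rw [h4]
  generalize g.src = y at h3 hx
  subst hx
  have h5 := LocInv.comp h2 h3
  rw [Jet.comp_of h2.smooth h3.smooth, A.pact_of h1 h2, A.pact_of (A.isSec_act h1 h2) h3]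
  refine (A.pact_of (φ := φ ∘ φ') h1 h5).trans (Jet.of_congr ?_ ?_)
  · exact (A.isSec_act (A.isSec_act h1 h2) h3).smooth
  · filter_upwards [h3.eventually, h3.smooth.continuousAt.eventually h2.eventually,
      h5.smooth.continuousAt.eventually h1.sec] with z e1 e2 e3
    rw [← Jet.comp_of e2.smooth e1.smooth, A.act_comp _ _ e2.jet_mem _ e1.jet_mem]
    · rfl
    · simpa using e3
    · simp

end

lemma pact_unit {w : Jet (Euc n) (Euc d) X B 1} (hw : w ∈ sectionJets n d 1 π) :
    A.pact w (unitJet n (q + 1) w.src) = w := by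
  obtain ⟨s, h1, h2⟩ := exists_sec hw
  conv_rhs => rw [h2]
  conv_lhs => rw [h2, Jet.src_of]
  refine (A.pact_of (φ := id) h1 (locInv_id _)).trans (Jet.of_congr h1.smooth ?_)
  filter_upwards [h1.sec] with y hy
  have := A.act_unit (s y)
  rwa [hy] at this

lemma mem_pactDomain_pact {w : Jet (Euc n) (Euc d) X B 1} {f g : SelfJet n X (q + 1)}
    (h : (w, f) ∈ pactDomain n d q π) (hg : g ∈ fullJetGroupoid n X (q + 1))
    (hfg : f.src = g.tgt) : (A.pact w f, g) ∈ pactDomain n d q π :=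
  ⟨A.pact_mem h, hg, (A.src_pact h).trans hfg⟩

/-- Jets of sections near a given one are represented by a smooth family of sections. -/
lemma exists_section_family (hF : HasFibredCharts n d r π) {w : Jet (Euc n) (Euc d) X B 1}
    (hw : w ∈ sectionJets n d 1 π) :
    ∃ S : Jet (Euc n) (Euc d) X B 1 → X → B,
      SmNear ((jetModel n d 1).prod 𝓘(ℝ, Euc n)) 𝓘(ℝ, Euc d) (Function.uncurry S) (w, w.src) ∧
      (∀ᶠ p in 𝓝 (w, w.src), π (S p.1 p.2) = p.2) ∧
      ∀ᶠ v in 𝓝 w, v ∈ sectionJets n d 1 π → Jet.of (Euc n) (Euc d) 1 (S v) v.src = v := by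
  obtain ⟨s, hs, hws⟩ := exists_sec hw
  obtain ⟨G, hG, hG1, -⟩ := Jet.exists_family hs.smooth 1
  rw [← hws] at hG hG1
  obtain ⟨Φ, hb, h1, h2, h3⟩ := hF w.tgt
  have hΦs := smNear_of_contMDiffOn h2 (Φ.open_source.mem_nhds hb)
  have hΦt := smNear_of_contMDiffOn h3 (Φ.open_target.mem_nhds (Φ.map_source hb))
  have hGw : G w w.src = w.tgt := by
    have := congrArg Jet.tgt hG1.self_of_nhds
    rwa [Jet.tgt_of] at this
  have hπw : ((w.src, (Φ w.tgt).2) : X × Euc r) = Φ w.tgt :=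
    Prod.ext ((h1 _ hb).trans (π_tgt hw)).symm rfl
  -- In a fibred chart, `k` moves the point `b` to the fibre over `x` and keeps its vertical
  -- coordinate. It turns any family of maps into a family of sections and fixes maps that are
  -- already sections.
  set k : X × B → B := fun p => Φ.symm (p.1, (Φ p.2).2) with hk
  have hks : SmNear (𝓘(ℝ, Euc n).prod 𝓘(ℝ, Euc d)) 𝓘(ℝ, Euc d) k (w.src, w.tgt) :=
    hΦt.comp_eq (f := fun p : X × B => (p.1, (Φ p.2).2))
      ((smNear_fst _).prodMk (hΦs.comp_eq (smNear_snd _) rfl).snd) hπw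
  have hS : SmNear ((jetModel n d 1).prod 𝓘(ℝ, Euc n)) 𝓘(ℝ, Euc d)
      (Function.uncurry fun v x => k (x, G v x)) (w, w.src) :=
    hks.comp_eq (f := fun p : Jet (Euc n) (Euc d) X B 1 × X => (p.2, G p.1 p.2))
      ((smNear_snd _).prodMk hG) (by rw [hGw])
  refine ⟨fun v x => k (x, G v x), hS, ?_, ?_⟩
  · have ht : Tendsto (fun p : Jet (Euc n) (Euc d) X B 1 × X => (p.2, (Φ (G p.1 p.2)).2))
        (𝓝 (w, w.src)) (𝓝 (Φ w.tgt)) := by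
      have : SmNear ((jetModel n d 1).prod 𝓘(ℝ, Euc n)) (𝓘(ℝ, Euc n).prod 𝓘(ℝ, Euc r))
          (fun p : Jet (Euc n) (Euc d) X B 1 × X => (p.2, (Φ (G p.1 p.2)).2)) (w, w.src) :=
        (smNear_snd _).prodMk (hΦs.comp_eq (f := Function.uncurry G) hG hGw).snd
      have := this.continuousAt.tendsto
      dsimp only at this
      rwa [hGw, hπw] at this
    filter_upwards [ht.eventually (Φ.open_target.mem_nhds (Φ.map_source hb))] with p hp
    have h4 := h1 _ (Φ.map_target hp)
    rw [Φ.right_inv hp] at h4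
    exact h4.symm
  · have ht : Tendsto (fun v : Jet (Euc n) (Euc d) X B 1 => (v.src, v.tgt)) (𝓝 w)
        (𝓝 (w.src, w.tgt)) := (Jet.tendsto_src w).prodMk_nhds (Jet.tendsto_tgt w)
    filter_upwards [hG1, (Jet.tendsto_graph_src w).eventually hG.eventually,
      ht.eventually hks.eventually, (Jet.tendsto_tgt w).eventually (Φ.open_source.mem_nhds hb)]
      with v e1 e2 e3 e4 hv
    obtain ⟨s', hs', hvs⟩ := exists_sec hv
    have e5 := Jet.family_smoothNear e2
    have e6 : G v v.src = v.tgt := by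
      conv_rhs => rw [← e1, Jet.tgt_of]
    have e7 : s' v.src = v.tgt := by
      conv_rhs => rw [hvs, Jet.tgt_of]
    -- `G v` and the section `s'` have the same 1-jet, hence also their images under `k`; and `k`
    -- leaves `s'` unchanged.
    have step : Jet.of (Euc n) (Euc d) 1 (fun x => k (x, G v x)) v.src =
        Jet.of (Euc n) (Euc d) 1 (fun x => k (x, s' x)) v.src :=
      Jet.of_one_congr (f := fun x => x) (f' := fun x => x) (g := G v) (g' := s') (smNear_id _)
        (smNear_id _) e5 hs'.smooth (by rw [e6]; exact e3) rfl (e1.trans hvs)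
    rw [step]
    conv_rhs => rw [hvs]
    refine Jet.of_congr hs'.smooth ?_
    have e8 : ∀ᶠ x in 𝓝 v.src, s' x ∈ Φ.source :=
      hs'.smooth.self_of_nhds.continuousAt.eventually (Φ.open_source.mem_nhds (e7 ▸ e4))
    filter_upwards [hs'.sec, e8] with x hx hx'
    have e9 : ((x, (Φ (s' x)).2) : X × Euc r) = Φ (s' x) :=
      Prod.ext ((h1 _ hx').trans hx).symm rfl
    simp only [hk]
    rw [e9, Φ.left_inv hx']

set_option maxHeartbeats 1600000 in
/-- The prolonged action is smooth. -/
lemma smOn_pact (hF : HasFibredCharts n d r π) {w : Jet (Euc n) (Euc d) X B 1}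
    {f : SelfJet n X (q + 1)} (h : (w, f) ∈ pactDomain n d q π) :
    SmOn ((jetModel n d 1).prod (jetModel n n (q + 1))) (jetModel n d 1) (pactDomain n d q π)
      (fun p => A.pact p.1 p.2) (w, f) := by
  obtain ⟨hw, hf, hwf⟩ := h
  dsimp only at hw hf hwf
  obtain ⟨S, hS, hS1, hS2⟩ := exists_section_family hF hw
  obtain ⟨φ, ψ, hφ, hfφ⟩ := exists_locDiff hf
  obtain ⟨G, hG, hG1, hG2⟩ := Jet.exists_family hφ.smooth (q + 1)
  rw [← hfφ] at hG hG1 hG2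
  have hGf : G f f.src = w.src := by
    have := congrArg Jet.tgt hG1.self_of_nhds
    rw [Jet.tgt_of] at this
    rw [this, hwf]
  have hfq : Jet.of (Euc n) (Euc n) q (G f) f.src = f.proj := by
    rw [← Jet.proj_of (Jet.family_smoothNear hG), hG1.self_of_nhds]
  have hSw : S w w.src = w.tgt := by
    have := congrArg Jet.tgt (hS2.self_of_nhds hw)
    rwa [Jet.tgt_of] at this
  have hπ : π w.tgt = f.proj.tgt := by rw [π_tgt hw, hwf, Jet.tgt_proj]
  -- The smooth extension of the action, evaluated on a family of sections and a family of maps,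
  -- gives a family of maps `X → B` without any matching condition; its 1-jets are the local
  -- extension of the prolonged action.
  obtain ⟨g, hg, hge⟩ := A.smOn_act (proj_mem hf) hπ
  let I₀ := ((jetModel n d 1).prod (jetModel n n (q + 1))).prod 𝓘(ℝ, Euc n)
  have s1 : SmNear I₀ 𝓘(ℝ, Euc n)
      (fun z : (Jet (Euc n) (Euc d) X B 1 × SelfJet n X (q + 1)) × X => G z.1.2 z.2)
      ((w, f), f.src) :=
    SmNear.comp_eq (g := Function.uncurry G) hG ((smNear_fst _).snd.prodMk (smNear_snd _)) rfl
  have s2 : SmNear I₀ 𝓘(ℝ, Euc d)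
      (fun z : (Jet (Euc n) (Euc d) X B 1 × SelfJet n X (q + 1)) × X => S z.1.1 (G z.1.2 z.2))
      ((w, f), f.src) :=
    SmNear.comp_eq (g := Function.uncurry S) hS ((smNear_fst _).fst.prodMk s1) (by simp [hGf])
  have s3 : SmNear I₀ (jetModel n n q)
      (fun z : (Jet (Euc n) (Euc d) X B 1 × SelfJet n X (q + 1)) × X =>
        Jet.of (Euc n) (Euc n) q (G z.1.2) z.2) ((w, f), f.src) := by
    refine Jet.smNear_of (I := I₀) (G := fun z : (Jet (Euc n) (Euc d) X B 1 ×
      SelfJet n X (q + 1)) × X => G z.1.2) ?_ (smNear_snd _)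
    exact SmNear.comp_eq (g := Function.uncurry G) hG
      ((smNear_fst _).fst.snd.prodMk (smNear_snd _)) rfl
  have hpt : (S w (G f f.src), Jet.of (Euc n) (Euc n) q (G f) f.src) = (w.tgt, f.proj) := by
    rw [hGf, hSw, hfq]
  have s4 : SmNear I₀ 𝓘(ℝ, Euc d) (Function.uncurry
      fun (p : Jet (Euc n) (Euc d) X B 1 × SelfJet n X (q + 1)) x =>
        g (S p.1 (G p.2 x), Jet.of (Euc n) (Euc n) q (G p.2) x)) ((w, f), f.src) :=
    hg.comp_eq (s2.prodMk s3) hpt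
  refine ⟨_, Jet.smNear_of (q := 1) s4 ((Jet.smNear_src f).comp_eq (smNear_snd (w, f)) rfl), ?_⟩
  rw [EventuallyEq, eventually_nhdsWithin_iff] at hge
  have hgr : Tendsto (fun p : Jet (Euc n) (Euc d) X B 1 × SelfJet n X (q + 1) => (p, p.2.src))
      (𝓝 (w, f)) (𝓝 ((w, f), f.src)) :=
    Filter.tendsto_id.prodMk_nhds ((Jet.tendsto_src f).comp (continuous_snd.tendsto _))
  have hcont : Tendsto (fun z : (Jet (Euc n) (Euc d) X B 1 × SelfJet n X (q + 1)) × X =>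
      (S z.1.1 (G z.1.2 z.2), Jet.of (Euc n) (Euc n) q (G z.1.2) z.2)) (𝓝 ((w, f), f.src))
      (𝓝 (w.tgt, f.proj)) := by
    have := (s2.prodMk s3).continuousAt.tendsto
    dsimp only at this
    rwa [hpt] at this
  have ev1 := hgr.eventually (eventually_eventually_nhds.2 (hcont.eventually hge))
  have hcont2 : Tendsto (fun z : (Jet (Euc n) (Euc d) X B 1 × SelfJet n X (q + 1)) × X =>
      (z.1.1, G z.1.2 z.2)) (𝓝 ((w, f), f.src)) (𝓝 (w, w.src)) := by
    have := (((smNear_fst (I := (jetModel n d 1).prod (jetModel n n (q + 1)))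
      (J := 𝓘(ℝ, Euc n)) ((w, f), f.src)).fst).prodMk s1).continuousAt.tendsto
    dsimp only at this
    rwa [hGf] at this
  have ev2 := hgr.eventually (eventually_eventually_nhds.2 (hcont2.eventually hS1))
  have ev3 := hgr.eventually (hcont2.eventually hS.eventually)
  have t1 : Tendsto (fun p : Jet (Euc n) (Euc d) X B 1 × SelfJet n X (q + 1) => p.1)
      (𝓝 (w, f)) (𝓝 w) := continuous_fst.tendsto _
  have t2 : Tendsto (fun p : Jet (Euc n) (Euc d) X B 1 × SelfJet n X (q + 1) => p.2)
      (𝓝 (w, f)) (𝓝 f) := continuous_snd.tendsto _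
  have hGe := (Jet.tendsto_graph_src f).eventually hG.eventually
  filter_upwards [mem_nhdsWithin_of_mem_nhds ev1, mem_nhdsWithin_of_mem_nhds ev2,
    mem_nhdsWithin_of_mem_nhds ev3, mem_nhdsWithin_of_mem_nhds (t1.eventually hS2),
    mem_nhdsWithin_of_mem_nhds (t2.eventually (hG1.and hGe)), self_mem_nhdsWithin]
    with ⟨v, k⟩ e1 e2 e3 e4 ⟨e5, e6⟩ ⟨hv, hk, hvk⟩
  dsimp only at e1 e2 e3 e4 e5 e6 hv hk hvk ⊢
  have hkG := Jet.family_smoothNear e6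
  have hkv : G k k.src = v.src := by
    rw [hvk]; conv_rhs => rw [← e5, Jet.tgt_of]
  obtain ⟨φ', ψ', hφ', hkφ'⟩ := exists_locDiff hk
  -- The member `G k` is merely a smooth representative of `k`; it is invertible because `k` also
  -- has a diffeomorphism as representative.
  obtain ⟨ψ₁, hL⟩ := exists_locInv_of_jet_eq hkG hφ'
    (Jet.of_le hkG hφ'.smooth (Nat.le_add_left 1 q) (e5.trans hkφ'))
  have sl : ∀ (x : X), Tendsto (fun y : X => ((v, k), y)) (𝓝 x) (𝓝 ((v, k), x)) := fun x =>
    (Continuous.prodMk_right (v, k)).tendsto' _ _ rfl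
  -- The section property of `S v` is known along `G k`; the local inverse of `G k` transfers it to
  -- a neighbourhood of the target.
  have e2' : ∀ᶠ y in 𝓝 k.src, π (S v (G k y)) = G k y := (sl _).eventually e2
  have hsec : IsSec n d π (S v) (G k k.src) := by
    refine ⟨Jet.family_smoothNear e3, ?_⟩
    have hψt : Tendsto ψ₁ (𝓝 (G k k.src)) (𝓝 k.src) := by
      have := hL.smooth_inv.continuousAt.tendsto
      rwa [hL.left_inv.self_of_nhds] at this
    filter_upwards [hψt.eventually e2', hL.right_inv] with y hy hy'
    rwa [hy'] at hy
  have hfin := A.pact_of hsec hL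
  rw [e5, hkv, e4 hv] at hfin
  rw [hfin]
  refine (Jet.of_congr (A.isSec_act hsec hL).smooth ?_).symm
  filter_upwards [(sl _).eventually e1, e2', hL.eventually] with y h1 h2 h3
  exact (h1 ⟨h3.jet_mem, by simp [h2]⟩).symm

end JetAction

end ProlongedAction

/-! ### Rank arguments: submersions or thin images -/

section Rank

variable {V W : Type*} [NormedAddCommGroup V] [NormedSpace ℝ V] [FiniteDimensional ℝ V]
  [NormedAddCommGroup W] [NormedSpace ℝ W] [FiniteDimensional ℝ W]

/-- A smooth map with surjective derivative has smooth local sections. -/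
lemma exists_local_section_space {f : V → W} {p : V} (hf : SmNear 𝓘(ℝ, V) 𝓘(ℝ, W) f p)
    {T : V →L[ℝ] W} (hT : HasFDerivAt f T p) (hs : Function.Surjective T) :
    ∃ s : W → V, SmNear 𝓘(ℝ, W) 𝓘(ℝ, V) s (f p) ∧ s (f p) = p ∧ ∀ᶠ z in 𝓝 (f p), f (s z) = z := by
  obtain ⟨R, hR⟩ := (T : V →ₗ[ℝ] W).exists_rightInverse_of_surjective (LinearMap.range_eq_top.2 hs)
  set L : W →L[ℝ] V := LinearMap.toContinuousLinearMap R
  have hL : ∀ w, T (L w) = w := fun w => LinearMap.congr_fun hR w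
  -- The map is restricted to the affine subspace through `p` along the image of a linear right
  -- inverse of the derivative; there its derivative is the identity.
  have hd : HasFDerivAt (fun w => p + L w) L (0 : W) := L.hasFDerivAt.const_add p
  have hs1 : SmNear 𝓘(ℝ, W) 𝓘(ℝ, V) (fun w => p + L w) (0 : W) :=
    ContDiff.smNear (contDiff_const.add L.contDiff) 0
  have h0 : p + L 0 = p := by simp
  have hc : HasFDerivAt (fun w => f (p + L w)) (T.comp L) (0 : W) :=
    HasFDerivAt.comp (g := f) (0 : W) (by rwa [h0]) hd
  have hid : T.comp L = ((ContinuousLinearEquiv.refl ℝ W : W ≃L[ℝ] W) : W →L[ℝ] W) := by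
    ext w; simp [hL]
  rw [hid] at hc
  obtain ⟨g, g1, g2, g3⟩ := smNear_inverse_space
    (hf.comp_eq (f := fun w => p + L w) hs1 h0) hc
  simp only [h0] at g1 g3
  have g0 : g (f p) = 0 := by simpa [h0] using g2.self_of_nhds
  refine ⟨fun z => p + L (g z), SmNear.comp_eq (g := fun w => p + L w) hs1 g1 g0, ?_, g3⟩
  simp [g0]

open Module in
/-- If the rank of the derivative of `f` is maximal at `p`, but smaller than the dimension of the
target, then the image of a neighbourhood of `p` is thin. -/
lemma exists_nhds_interior_image_empty {f : V → W} {p : V} (hf : ∀ᶠ v in 𝓝 p, ContDiffAt ℝ ∞ f v)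
    (hr : ∀ᶠ v in 𝓝 p, finrank ℝ (LinearMap.range (fderiv ℝ f v : V →ₗ[ℝ] W)) ≤
      finrank ℝ (LinearMap.range (fderiv ℝ f p : V →ₗ[ℝ] W)))
    (hlt : finrank ℝ (LinearMap.range (fderiv ℝ f p : V →ₗ[ℝ] W)) < finrank ℝ W) :
    ∃ N ∈ 𝓝 p, interior (f '' N) = ∅ := by
  set T := fderiv ℝ f p
  set R := LinearMap.range (T : V →ₗ[ℝ] W)
  set K := LinearMap.ker (T : V →ₗ[ℝ] W)
  obtain ⟨P, hP⟩ := Submodule.ClosedComplemented.of_finiteDimensional R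
  obtain ⟨Q, hQ⟩ := Submodule.ClosedComplemented.of_finiteDimensional K
  set L : V →L[ℝ] R × K := (P.comp T).prod Q
  have hPT : ∀ v, P (T v) = ⟨T v, LinearMap.mem_range_self (T : V →ₗ[ℝ] W) v⟩ :=
    fun v => hP ⟨T v, LinearMap.mem_range_self (T : V →ₗ[ℝ] W) v⟩
  have hLi : Function.Injective L := by
    refine (injective_iff_map_eq_zero L).2 fun v hv => ?_
    have h1 : P (T v) = 0 := congrArg Prod.fst hv
    have h2 : Q v = 0 := congrArg Prod.snd hv
    rw [hPT] at h1
    have h3 : T v = 0 := congrArg Subtype.val h1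
    have h4 := hQ ⟨v, h3⟩
    rw [h2] at h4
    exact (congrArg Subtype.val h4).symm
  have hdim : finrank ℝ V = finrank ℝ (R × K) := by
    rw [finrank_prod]
    exact (LinearMap.finrank_range_add_finrank_ker (T : V →ₗ[ℝ] W)).symm
  set e : V ≃L[ℝ] R × K := (LinearEquiv.ofInjectiveOfFinrankEq (L : V →ₗ[ℝ] R × K) hLi
    hdim).toContinuousLinearEquiv
  have he : (e : V →L[ℝ] R × K) = L := by ext1 v; rfl
  have hTd : HasFDerivAt f T p := (hf.self_of_nhds.differentiableAt (by simp)).hasFDerivAt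
  -- The coordinates of the constant rank theorem: the component of `f` in the range of the
  -- derivative at `p`, and the component of the variable in its kernel.
  set ψ : V → R × K := fun v => (P (f v), Q (v - p))
  have hψd : HasFDerivAt ψ (e : V →L[ℝ] R × K) p := by
    rw [he]
    exact (P.hasFDerivAt.comp p hTd).prodMk
      (Q.hasFDerivAt.comp p ((hasFDerivAt_id p).sub_const p))
  have hψs : SmNear 𝓘(ℝ, V) 𝓘(ℝ, R × K) ψ p := by
    refine SmNear.prodMk_space (SmNear.clm P (smNear_iff_contDiffAt.2 hf)) (SmNear.clm Q ?_)
    exact ContDiff.smNear (contDiff_id.sub contDiff_const) p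
  obtain ⟨g, g1, g2, g3⟩ := smNear_inverse_space hψs hψd
  have gp : g (ψ p) = p := g2.self_of_nhds
  have hgt : Tendsto g (𝓝 (ψ p)) (𝓝 p) := by
    have := g1.continuousAt.tendsto
    rwa [gp] at this
  set F : R × K → W := fun z => f (g z)
  have hgood : ∀ᶠ z in 𝓝 (ψ p), ContDiffAt ℝ ∞ F z ∧ P (F z) = z.1 ∧
      ∀ κ : K, fderiv ℝ F z (0, κ) = 0 := by
    have g3' := eventually_eventually_nhds.2 g3
    filter_upwards [hgt.eventually hf, hgt.eventually hr, smNear_iff_contDiffAt.1 g1, g3']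
      with z z1 z2 z3 z4
    have hF : ContDiffAt ℝ ∞ F z := ContDiffAt.comp z z1 z3
    refine ⟨hF, congrArg Prod.fst z4.self_of_nhds, fun κ => ?_⟩
    have hfd := (z1.differentiableAt (by simp)).hasFDerivAt
    have hgd := (z3.differentiableAt (by simp)).hasFDerivAt
    have hFd : fderiv ℝ F z = (fderiv ℝ f (g z)).comp (fderiv ℝ g z) :=
      (HasFDerivAt.comp z hfd hgd).fderiv
    set D := fderiv ℝ F z
    have hPD : ∀ w, P (D w) = w.1 := by
      have h1 : HasFDerivAt (fun z => P (F z)) (P.comp D) z :=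
        P.hasFDerivAt.comp z (hF.differentiableAt (by simp)).hasFDerivAt
      have h2 : HasFDerivAt (fun z => P (F z)) (ContinuousLinearMap.fst ℝ R K) z :=
        (hasFDerivAt_fst (𝕜 := ℝ) (p := z)).congr_of_eventuallyEq (by
          filter_upwards [z4] with y hy
          exact congrArg Prod.fst hy)
      intro w
      exact congrArg (fun A : R × K →L[ℝ] R => A w) (h1.unique h2)
    have hle : finrank ℝ (LinearMap.range (D : R × K →ₗ[ℝ] W)) ≤ finrank ℝ R := by
      refine le_trans (Submodule.finrank_mono ?_) z2
      rw [hFd]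
      rintro _ ⟨w, rfl⟩
      exact ⟨_, rfl⟩
    set P' : LinearMap.range (D : R × K →ₗ[ℝ] W) →ₗ[ℝ] R :=
      (P : W →ₗ[ℝ] R).comp (Submodule.subtype _)
    have hsurj : Function.Surjective P' := fun u =>
      ⟨⟨D (u, 0), LinearMap.mem_range_self (D : R × K →ₗ[ℝ] W) (u, 0)⟩, hPD (u, 0)⟩
    -- `P ∘ D` is the first projection, so the rank of `D` is at least `dim R`; by maximality it is
    -- equal. Hence `P` is injective on the range of `D`, and `D (0, κ)`, on which `P` vanishes, is
    -- zero.
    have heq : finrank ℝ (LinearMap.range (D : R × K →ₗ[ℝ] W)) = finrank ℝ R :=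
      le_antisymm hle (LinearMap.finrank_le_finrank_of_surjective hsurj)
    have hinj := (LinearMap.injective_iff_surjective_of_finrank_eq_finrank heq).2 hsurj
    have : (⟨D (0, κ), LinearMap.mem_range_self (D : R × K →ₗ[ℝ] W) (0, κ)⟩ :
        LinearMap.range (D : R × K →ₗ[ℝ] W)) = 0 := by
      apply hinj
      rw [map_zero]
      exact hPD (0, κ)
    exact congrArg Subtype.val this
  obtain ⟨ε, hε, hball⟩ := Metric.eventually_nhds_iff_ball.1 hgood
  have hψp : ψ p = (P (f p), 0) := by simp [ψ]
  have hmem : ∀ {u : R} {k : K}, u ∈ Metric.ball (P (f p)) ε → k ∈ Metric.ball (0 : K) ε →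
      (u, k) ∈ Metric.ball (ψ p) ε := fun hu hk => by
    rw [hψp, ← ball_prod_same]
    exact ⟨hu, hk⟩
  have h0 : (0 : K) ∈ Metric.ball (0 : K) ε := Metric.mem_ball_self hε
  -- The partial derivative in the kernel direction vanishes on a convex ball, so `f` depends only
  -- on the coordinate in `R`.
  have hconst : ∀ u ∈ Metric.ball (P (f p)) ε, ∀ k ∈ Metric.ball (0 : K) ε,
      F (u, k) = F (u, 0) := by
    intro u hu k hk
    have hd : ∀ k ∈ Metric.ball (0 : K) ε, HasFDerivAt (fun k => F (u, k)) (0 : K →L[ℝ] W) k := by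
      intro k hk
      obtain ⟨b1, -, b3⟩ := hball _ (hmem hu hk)
      have := HasFDerivAt.comp (g := F) k (b1.differentiableAt (by simp)).hasFDerivAt
        (hasFDerivAt_prodMk_right (𝕜 := ℝ) u k)
      have hz : (fderiv ℝ F (u, k)).comp (ContinuousLinearMap.inr ℝ R K) = 0 := by
        ext1 κ
        exact b3 κ
      rw [hz] at this
      exact this
    exact (convex_ball (0 : K) ε).is_const_of_fderivWithin_eq_zero (𝕜 := ℝ)
      (f := fun k => F (u, k)) (fun k hk => (hd k hk).differentiableAt.differentiableWithinAt)
      (fun k hk => by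
        rw [fderivWithin_of_isOpen Metric.isOpen_ball hk]; exact (hd k hk).fderiv) hk h0
  refine ⟨{v | g (ψ v) = v ∧ ψ v ∈ Metric.ball (ψ p) ε}, ?_, ?_⟩
  · exact g2.and (hψs.continuousAt.eventually (Metric.ball_mem_nhds _ hε))
  have hsub : f '' {v | g (ψ v) = v ∧ ψ v ∈ Metric.ball (ψ p) ε} ⊆
      (fun u => F (u, 0)) '' Metric.ball (P (f p)) ε := by
    rintro _ ⟨v, ⟨hv1, hv2⟩, rfl⟩
    rw [hψp, ← ball_prod_same] at hv2
    refine ⟨P (f v), hv2.1, ?_⟩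
    have := hconst _ hv2.1 _ hv2.2
    dsimp only
    rw [← this]
    exact congrArg f hv1
  -- The image is that of a ball in `R` under a smooth map, and `dim R < dim W`; a dimension count
  -- for Hausdorff dimension makes the complement dense.
  have hdense : Dense ((fun u => F (u, 0)) '' Metric.ball (P (f p)) ε)ᶜ := by
    refine ContDiffOn.dense_compl_image_of_dimH_lt_finrank (s := Metric.ball (P (f p)) ε) ?_
      (convex_ball _ _) Subset.rfl ?_
    · intro u hu
      have hF := (hball _ (hmem hu h0)).1
      have : ContDiffAt ℝ ∞ (fun u : R => F (u, 0)) u :=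
        ContDiffAt.comp (g := F) (f := fun u : R => (u, (0 : K))) u hF (by fun_prop)
      exact (this.of_le (by norm_cast)).contDiffWithinAt
    · rw [Real.dimH_of_nonempty_interior
        (by rw [Metric.isOpen_ball.interior_eq]; exact ⟨_, Metric.mem_ball_self hε⟩)]
      exact_mod_cast hlt
  have := interior_mono hsub
  rw [interior_eq_empty_iff_dense_compl.2 hdense] at this
  exact subset_empty_iff.1 this

open Module in
-- The rank is a bounded function with natural values, so it attains its maximum on `U`. At such a
-- point it is either full or gives a thin image.
lemma exists_surjective_or_interior_image_empty {f : V → W} {U : Set V} (hU : IsOpen U)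
    (hne : U.Nonempty) (hf : ∀ v ∈ U, ContDiffAt ℝ ∞ f v) :
    ∃ p ∈ U, Function.Surjective (fderiv ℝ f p) ∨ ∃ N ∈ 𝓝 p, interior (f '' N) = ∅ := by
  set ρ : V → ℕ := fun v => finrank ℝ (LinearMap.range (fderiv ℝ f v : V →ₗ[ℝ] W))
  have hb : BddAbove (ρ '' U) := ⟨finrank ℝ W, by
    rintro _ ⟨v, -, rfl⟩
    exact Submodule.finrank_le _⟩
  obtain ⟨p, hp, hmax⟩ := Nat.sSup_mem (hne.image ρ) hb
  refine ⟨p, hp, ?_⟩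
  have hle : ∀ v ∈ U, ρ v ≤ ρ p := fun v hv => by
    rw [hmax]; exact le_csSup hb ⟨v, hv, rfl⟩
  rcases (Submodule.finrank_le (LinearMap.range (fderiv ℝ f p : V →ₗ[ℝ] W))).lt_or_eq with h | h
  · right
    refine exists_nhds_interior_image_empty ?_ ?_ h
    · filter_upwards [hU.mem_nhds hp] using hf
    · filter_upwards [hU.mem_nhds hp] using hle
  · left
    exact LinearMap.range_eq_top.1 (Submodule.eq_top_of_finrank_eq h)

end Rank

/-! ### Parametrized isotropy groups and translation of orbit sections -/

section LocalSections

variable {n d r q : ℕ} {X B : Type*} [TopologicalSpace X] [ChartedSpace (Euc n) X]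
  [TopologicalSpace B] [ChartedSpace (Euc d) B]
  [IsManifold 𝓘(ℝ, Euc n) ∞ X] [IsManifold 𝓘(ℝ, Euc d) ∞ B] {π : B → X}

/-- The jets of chart translations that carry `x` to `y`. Multiplying by them corrects the target of
an arrow to `y`, and acting by their inverses moves nearby fibres to the fibre over `y`. -/
lemma exists_translation (q : ℕ) (y : X) :
    ∃ θ : X → SelfJet n X q, SmNear 𝓘(ℝ, Euc n) (jetModel n n q) θ y ∧ θ y = unitJet n q y ∧
      ∀ᶠ x in 𝓝 y, θ x ∈ fullJetGroupoid n X q ∧ (θ x).src = x ∧ (θ x).tgt = y := by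
  set χ := chartAt (Euc n) y
  have hy : y ∈ χ.source := mem_chart_source _ _
  set G : X → X → X := fun x z => χ.symm (χ z - χ x + χ y) with hGdef
  have hχ : SmNear 𝓘(ℝ, Euc n) 𝓘(ℝ, Euc n) χ y := Jet.smNear_chart
  have hG : SmNear (𝓘(ℝ, Euc n).prod 𝓘(ℝ, Euc n)) 𝓘(ℝ, Euc n) (Function.uncurry G) (y, y) := by
    refine SmNear.comp_eq (f := fun p : X × X => χ p.2 - χ p.1 + χ y)
      Jet.smNear_chart_symm (SmNear.add (SmNear.sub ?_ ?_) (smNear_const _ _)) (by simp [χ])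
    · exact hχ.comp_eq (smNear_snd _) rfl
    · exact hχ.comp_eq (smNear_fst _) rfl
  have hGxx : ∀ x, G x x = y := fun x => by simp [hGdef, hy]
  have hid : G y =ᶠ[𝓝 y] id := by
    filter_upwards [χ.open_source.mem_nhds hy] with z hz
    simp [hGdef, hz]
  have hlid : LocDiff n (G y) id y := by
    refine ⟨(smNear_id y).congr hid, by rw [hGxx]; exact smNear_id y, hid, ?_⟩
    rw [hGxx]; exact hid
  obtain ⟨G', h1, h2, h3⟩ := exists_family_inverse hG hlid
  have hl := family_locInv hG h1 h2 h3
  have hdiag : Tendsto (fun x : X => (x, x)) (𝓝 y) (𝓝 (y, y)) :=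
    Filter.tendsto_id.prodMk_nhds Filter.tendsto_id
  refine ⟨fun x => Jet.of (Euc n) (Euc n) q (G x) x, Jet.smNear_of hG (smNear_id y),
    Jet.of_congr (SmNear.congr (smNear_id y) (Eventually.of_forall fun _ => rfl)) hid, ?_⟩
  filter_upwards [hdiag.eventually hl] with x hx
  exact ⟨LocInv.jet_mem hx, by simp, by simp [hGxx]⟩

lemma jetInv_comp_mem {f g : SelfJet n X q} (hf : f ∈ fullJetGroupoid n X q)
    (hg : g ∈ fullJetGroupoid n X q) (h : f.tgt = g.tgt) :
    (jetInv f).comp g ∈ fullJetGroupoid n X q ∧ ((jetInv f).comp g).tgt = f.src :=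
  ⟨comp_mem (jetInv_mem hf) hg ((src_jetInv hf).trans h),
    (Jet.tgt_comp ((src_jetInv hf).trans h)).trans (tgt_jetInv hf)⟩

set_option maxHeartbeats 1000000 in
/-- Local parametrizations of the isotropy group. -/
lemma exists_isotropy_parametrization (q : ℕ) (y : X) :
    ∃ (g : jetCoord (Euc n) (Euc n) q → SelfJet n X q) (U : Set (jetCoord (Euc n) (Euc n) q)),
      IsOpen U ∧ U.Nonempty ∧ ∀ p ∈ U,
        SmNear 𝓘(ℝ, jetCoord (Euc n) (Euc n) q) (jetModel n n q) g p ∧ g p ∈ isotropy n q y ∧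
        ∀ N ∈ 𝓝 p, ∀ᶠ h in 𝓝[isotropy n q y] g p, h ∈ g '' N := by
  obtain ⟨θ, hθ, hθy, hθe⟩ := exists_translation (n := n) q y
  set e := unitJet n q y with he
  have hes : e.src = y := Jet.src_of _ _
  have het : e.tgt = y := Jet.tgt_of _ _
  set c := chartAt (Euc n × jetCoord (Euc n) (Euc n) q) e with hc
  have hec : e ∈ c.source := mem_chart_source _ _
  have hcfst : ∀ k : SelfJet n X q, k.src = y → (c k).1 = chartAt (Euc n) y y := by
    intro k hk
    rw [hc, Jet.chartAt_apply, hes]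
    change chartAt (Euc n) y k.src = _
    rw [hk]
  set a := chartAt (Euc n) y y
  set p₀ := (c e).2
  have hp₀ : (a, p₀) = c e := Prod.ext (hcfst e hes).symm rfl
  -- Fixing the first coordinate fixes the source at `y`; the target is still free.
  set f : jetCoord (Euc n) (Euc n) q → SelfJet n X q := fun p => c.symm (a, p)
  have hfp₀ : f p₀ = e := by
    change c.symm (a, p₀) = e
    rw [hp₀, c.left_inv hec]
  have hfsrc : ∀ p, (f p).src = y := by
    intro p
    change (c.symm (a, p)).src = y
    rw [hc, Jet.chartAt_symm_apply, hes]
    change (Jet.of _ _ _ _ _).src = y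
    rw [Jet.src_of]
    exact (chartAt (Euc n) y).left_inv (mem_chart_source _ _)
  have hcs : SmNear (jetModel n n q) (jetModel n n q) c.symm (c e) :=
    smNear_of_contMDiffOn (contMDiffOn_chart_symm (I := jetModel n n q) (n := ∞))
      (c.open_target.mem_nhds (c.map_source hec))
  have hap : SmNear 𝓘(ℝ, jetCoord (Euc n) (Euc n) q)
      𝓘(ℝ, Euc n × jetCoord (Euc n) (Euc n) q) (fun p => (a, p)) p₀ :=
    (smNear_const a p₀).prodMk_space (smNear_id p₀)
  have hf : SmNear 𝓘(ℝ, jetCoord (Euc n) (Euc n) q) (jetModel n n q) f p₀ :=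
    hcs.comp_eq hap hp₀
  have htgt : Tendsto (fun p => (f p).tgt) (𝓝 p₀) (𝓝 y) := by
    have h1 := (Jet.tendsto_tgt (f p₀)).comp hf.continuousAt.tendsto
    rwa [hfp₀, het] at h1
  have hft : Tendsto f (𝓝 p₀) (𝓝 e) := by
    have := hf.continuousAt.tendsto
    rwa [hfp₀] at this
  have hct : (a, p₀) ∈ c.target := by
    rw [hp₀]
    exact c.map_source hec
  have hgood : ∀ᶠ p in 𝓝 p₀, SmNear 𝓘(ℝ, jetCoord (Euc n) (Euc n) q) (jetModel n n q) f p ∧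
      f p ∈ fullJetGroupoid n X q ∧ f p ∈ c.source ∧ (a, p) ∈ c.target ∧
      SmNear 𝓘(ℝ, Euc n) (jetModel n n q) θ (f p).tgt ∧
      ∀ᶠ x in 𝓝 (f p).tgt, θ x ∈ fullJetGroupoid n X q ∧ (θ x).src = x ∧ (θ x).tgt = y := by
    filter_upwards [hf.eventually, hft.eventually (eventually_mem (unitJet_mem y)),
      hft.eventually (c.open_source.mem_nhds hec),
      hap.continuousAt.eventually (c.open_target.mem_nhds hct),
      htgt.eventually hθ.eventually, htgt.eventually (eventually_eventually_nhds.2 hθe)]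
      with p h1 h2 h3 h4 h5 h6
    exact ⟨h1, h2, h3, h4, h5, h6⟩
  obtain ⟨U, hU, hUo, hpU⟩ := eventually_nhds_iff.1 hgood
  -- The target is brought back to `y` by a translation. The parametrization is not injective, since
  -- the coordinates of the target are superfluous; only openness onto the isotropy group is used.
  refine ⟨fun p => (θ (f p).tgt).comp (f p), U, hUo, ⟨p₀, hpU⟩, fun p hp => ?_⟩
  obtain ⟨h1, h2, h3, h4, h5, h6⟩ := hU p hp
  obtain ⟨h7, h8, h9⟩ := h6.self_of_nhds
  have hft' : Tendsto (fun p => (f p).tgt) (𝓝 p) (𝓝 (f p).tgt) :=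
    (Jet.tendsto_tgt _).comp h1.continuousAt.tendsto
  refine ⟨?_, ⟨comp_mem h7 h2 h8, by rw [Jet.src_comp, hfsrc], by rw [Jet.tgt_comp h8, h9]⟩, ?_⟩
  · refine SmOn.comp_smNear (f := fun p => (θ (f p).tgt, f p)) (Jet.smOn_comp h8)
      ((h5.comp_eq ((Jet.smNear_tgt (f p)).comp h1) rfl).prodMk h1) ?_
    filter_upwards [hft'.eventually h6] with p' hp'
    exact hp'.2.1
  · intro N hN
    have hgp : (θ (f p).tgt).comp (f p) ∈ isotropy n q y :=
      ⟨comp_mem h7 h2 h8, by rw [Jet.src_comp, hfsrc], by rw [Jet.tgt_comp h8, h9]⟩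
    set x := (f p).tgt
    -- For `h` near `g p` in the isotropy group, `θ(x)⁻¹ h` has source `y`, lies near `f p`, and has
    -- target exactly `x`; its coordinates are a preimage of `h`.
    have hk : Tendsto (fun h => (jetInv (θ x)).comp h)
        (𝓝[isotropy n q y] ((θ x).comp (f p))) (𝓝 (f p)) := by
      have hst : (jetInv (θ x)).src = ((θ x).comp (f p)).tgt := by
        rw [src_jetInv h7, Jet.tgt_comp h8]
      have := SmOn.comp (I := jetModel n n q) (x := (θ x).comp (f p)) (S := isotropy n q y)
        (f := fun h => (jetInv (θ x), h)) hgp (Jet.smOn_comp hst)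
        (((smNear_const _ _).prodMk (smNear_id _)).smOn _) (by
          filter_upwards [self_mem_nhdsWithin] with h hh
          exact (src_jetInv h7).trans (h9.trans hh.2.2.symm))
      have h10 := this.tendsto hgp
      dsimp only at h10
      rwa [comp_jetInv_comp h7 h8] at h10
    have hcp : Tendsto (fun k => (c k).2) (𝓝 (f p)) (𝓝 p) := by
      have := (continuous_snd.tendsto _).comp (c.continuousAt h3).tendsto
      have h10 : (c (f p)).2 = p := by
        change (c (c.symm (a, p))).2 = p
        rw [c.right_inv h4]
      rwa [h10] at this
    filter_upwards [self_mem_nhdsWithin, (hcp.comp hk).eventually hN,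
      hk.eventually (c.open_source.mem_nhds h3)] with h hh hhN hhc
    have htt : (θ x).tgt = h.tgt := h9.trans hh.2.2.symm
    refine ⟨_, hhN, ?_⟩
    set k := (jetInv (θ x)).comp h
    have hks : k.src = y := (Jet.src_comp _ _).trans hh.2.1
    have hfk : f (c k).2 = k := by
      change c.symm (a, (c k).2) = k
      rw [show (a, (c k).2) = c k from Prod.ext (hcfst k hks).symm rfl, c.left_inv hhc]
    change (θ (f (c k).2).tgt).comp (f (c k).2) = h
    rw [hfk, (jetInv_comp_mem h7 hh.1 htt).2, h8]
    exact jetInv_comp_cancel h7 htt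

/-- A jet chart domain is a condition on source and target only, so a single chart contains the
whole isotropy group and embeds it into a second countable vector space. -/
lemma isLindelof_isotropy (q : ℕ) (y : X) : IsLindelof (isotropy n q y : Set (SelfJet n X q)) := by
  set e := unitJet n q y with he
  set c := chartAt (Euc n × jetCoord (Euc n) (Euc n) q) e
  have hsub : isotropy n q y ⊆ c.source := by
    intro g hg
    rw [Jet.mem_chartAt_source, hg.2.1, hg.2.2, he, unitJet, Jet.src_of, Jet.tgt_of]
    exact ⟨mem_chart_source _ _, mem_chart_source _ _⟩
  have := finiteDimensional_jetCoord (Euc n) (Euc n) q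
  have : ProperSpace (jetCoord (Euc n) (Euc n) q) := FiniteDimensional.proper_real _
  have : SecondCountableTopology (jetCoord (Euc n) (Euc n) q) := secondCountable_of_proper
  have : SecondCountableTopology (Euc n × jetCoord (Euc n) (Euc n) q) := inferInstance
  have h1 : IsLindelof (c '' isotropy n q y) := HereditarilyLindelofSpace.isLindelof _
  have h2 := h1.image_of_continuousOn (f := c.symm) (c.continuousOn_symm.mono (by
    rintro _ ⟨g, hg, rfl⟩; exact c.map_source (hsub hg)))
  convert h2 using 1
  rw [image_image]
  refine ((image_congr fun g hg => ?_).trans (image_id _)).symm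
  exact c.left_inv (hsub hg)

namespace JetAction

variable (A : JetAction n d q π)

lemma act_jetInv_of_act {b : B} {f : SelfJet n X q} (hf : f ∈ fullJetGroupoid n X q)
    (hb : π b = f.tgt) : A.act (A.act b f) (jetInv f) = b := by
  rw [← A.act_comp b f hf _ (jetInv_mem hf) hb (tgt_jetInv hf).symm, comp_jetInv hf, ← hb,
    A.act_unit]

lemma act_act_jetInv {b : B} {f : SelfJet n X q} (hf : f ∈ fullJetGroupoid n X q)
    (hb : π b = f.src) : A.act (A.act b (jetInv f)) f = b := by
  rw [← A.act_comp b _ (jetInv_mem hf) f hf (hb.trans (tgt_jetInv hf).symm) (src_jetInv hf),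
    jetInv_comp hf, ← hb, A.act_unit]

/-- `τ` is a smooth local section through `g` of the orbit map `f ↦ u₀ f`. -/
structure IsOrbitSection (u₀ : B) (τ : B → SelfJet n X q) (b : B) : Prop where
  smooth : SmNear 𝓘(ℝ, Euc d) (jetModel n n q) τ b
  sec : ∀ᶠ c in 𝓝 b, τ c ∈ fullJetGroupoid n X q ∧ (τ c).src = π c ∧ (τ c).tgt = π u₀ ∧
    A.act u₀ (τ c) = c

/-- Local sections of an orbit map can be moved by the groupoid. -/
lemma IsOrbitSection.translate {A : JetAction n d q π} (hF : HasFibredCharts n d r π)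
    {u₀ b : B} {τ : B → SelfJet n X q} (h : A.IsOrbitSection u₀ τ b) {g : SelfJet n X q}
    (hg : g ∈ fullJetGroupoid n X q) (hgt : g.tgt = π u₀) :
    ∃ τ', A.IsOrbitSection u₀ τ' (A.act u₀ g) ∧ τ' (A.act u₀ g) = g := by
  obtain ⟨hτm, hτs, hτt, hτa⟩ := h.sec.self_of_nhds
  have htt : (τ b).tgt = g.tgt := hτt.trans hgt.symm
  -- The arrow `k` leads from the value of the given section at `b` to `g`. It is extended to a
  -- local bisection `γ = j_q(φ)`, and the new section is `c ↦ τ(c γ(π c)⁻¹) γ(π c)`.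
  set k := (jetInv (τ b)).comp g with hk
  obtain ⟨hkm, hkt⟩ := jetInv_comp_mem hτm hg htt
  have hks : k.src = g.src := Jet.src_comp _ _
  have hτk : (τ b).comp k = g := jetInv_comp_cancel hτm htt
  obtain ⟨φ, ψ, hφ, hkφ⟩ := exists_locDiff hkm
  set γ : X → SelfJet n X q := fun x => Jet.of (Euc n) (Euc n) q φ x
  have hγk : γ k.src = k := hkφ.symm
  have hγs : SmNear 𝓘(ℝ, Euc n) (jetModel n n q) γ k.src := Jet.smNear_of_self hφ.smooth
  have hγe : ∀ᶠ x in 𝓝 k.src, γ x ∈ fullJetGroupoid n X q := by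
    filter_upwards [hφ.eventually] with x hx
    exact hx.jet_mem
  have hγsrc : ∀ x, (γ x).src = x := fun x => Jet.src_of _ _
  set b' := A.act u₀ g
  have hb' : π b' = k.src := by rw [hks]; exact A.π_act _ _ hg hgt.symm
  have hbk : A.act b k = b' := by
    conv_lhs => rw [← hτa]
    rw [← A.act_comp _ _ hτm _ hkm hτt.symm hkt.symm, hτk]
  have hπ := hF.smNear_π b'
  have hγπ : SmNear 𝓘(ℝ, Euc d) (jetModel n n q) (fun c => γ (π c)) b' := hγs.comp_eq hπ hb'
  have hev : ∀ᶠ c in 𝓝 b', γ (π c) ∈ fullJetGroupoid n X q := by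
    have := hπ.continuousAt.tendsto
    rw [hb'] at this
    exact this.eventually hγe
  have hγb : γ (π b') = k := by rw [hb', hγk]
  have hinv : SmNear 𝓘(ℝ, Euc d) (jetModel n n q) (fun c => jetInv (γ (π c))) b' :=
    (smNear_jetInv hkm).2.comp_eq hγπ hγb
  set β : B → B := fun c => A.act c (jetInv (γ (π c)))
  have hβb : β b' = b := by
    change A.act b' (jetInv (γ (π b'))) = b
    rw [hγb, ← hbk]
    exact A.act_jetInv_of_act hkm (hτs.symm.trans hkt.symm)
  have hβ : SmNear 𝓘(ℝ, Euc d) 𝓘(ℝ, Euc d) β b' := by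
    refine SmOn.comp_smNear (f := fun c => (c, jetInv (γ (π c))))
      (A.smOn_act (jetInv_mem hev.self_of_nhds) ?_) ((smNear_id _).prodMk hinv) ?_
    · rw [tgt_jetInv hev.self_of_nhds, hγsrc]
    · filter_upwards [hev] with c hc
      exact ⟨jetInv_mem hc, ((tgt_jetInv hc).trans (hγsrc _)).symm⟩
  have hβt : Tendsto β (𝓝 b') (𝓝 b) := by
    have := hβ.continuousAt.tendsto
    rwa [hβb] at this
  have hβπ : ∀ᶠ c in 𝓝 b', π (β c) = (γ (π c)).tgt := by
    filter_upwards [hev] with c hc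
    exact (A.π_act _ _ (jetInv_mem hc) (by rw [tgt_jetInv hc, hγsrc])).trans (src_jetInv hc)
  refine ⟨fun c => (τ (β c)).comp (γ (π c)), ⟨?_, ?_⟩, ?_⟩
  · refine SmOn.comp_smNear (f := fun c => (τ (β c), γ (π c))) (Jet.smOn_comp ?_)
      ((h.smooth.comp_eq hβ hβb).prodMk hγπ) ?_
    · rw [hβb, hγb]; exact hτs.trans (hτs.symm.trans hkt.symm)
    · filter_upwards [hβt.eventually h.sec, hβπ] with c h1 h2
      exact h1.2.1.trans h2
  · filter_upwards [hβt.eventually h.sec, hβπ, hev] with c ⟨h1, h2, h3, h4⟩ h5 h6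
    have h7 : (τ (β c)).src = (γ (π c)).tgt := h2.trans h5
    refine ⟨comp_mem h1 h6 h7, by rw [Jet.src_comp, hγsrc], by rw [Jet.tgt_comp h7, h3], ?_⟩
    rw [A.act_comp _ _ h1 _ h6 h3.symm h7, h4]
    exact A.act_act_jetInv h6 (hγsrc _).symm
  · change (τ (β b')).comp (γ (π b')) = g
    rw [hβb, hγb, hτk]

end JetAction

end LocalSections

/-! ### Smooth local sections of the orbit maps -/

section OrbitSections

variable {n d r q : ℕ} {X B : Type*} [TopologicalSpace X] [ChartedSpace (Euc n) X]
  [TopologicalSpace B] [ChartedSpace (Euc d) B]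
  [IsManifold 𝓘(ℝ, Euc n) ∞ X] [IsManifold 𝓘(ℝ, Euc d) ∞ B] {π : B → X}

namespace JetAction

variable (A : JetAction n d q π)

lemma smNear_act_left {u₀ : B} {V : Type*} [NormedAddCommGroup V] [NormedSpace ℝ V]
    {g : V → SelfJet n X q} {p : V} (hg : SmNear 𝓘(ℝ, V) (jetModel n n q) g p)
    (hgm : ∀ᶠ v in 𝓝 p, g v ∈ isotropy n q (π u₀)) :
    SmNear 𝓘(ℝ, V) 𝓘(ℝ, Euc d) (fun v => A.act u₀ (g v)) p := by
  have h0 := hgm.self_of_nhds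
  refine SmOn.comp_smNear (f := fun v => (u₀, g v)) (A.smOn_act h0.1 h0.2.2.symm)
    ((smNear_const _ _).prodMk hg) ?_
  filter_upwards [hgm] with v hv
  exact ⟨hv.1, hv.2.2.symm⟩

/-- Elements of the isotropy group reach only the fibre over `π u₀`. A point in a neighbouring fibre
is first moved to this fibre by an inverse translation, then reached through a local section of the
submersion `v ↦` vertical coordinate of `u₀ g(v)`, and then moved back. -/
lemma exists_isOrbitSection_of_surjective (hF : HasFibredCharts n d r π) {u₀ : B}
    {V : Type*} [NormedAddCommGroup V] [NormedSpace ℝ V] [FiniteDimensional ℝ V]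
    {g : V → SelfJet n X q} {p : V} (hg : SmNear 𝓘(ℝ, V) (jetModel n n q) g p)
    (hgm : ∀ᶠ v in 𝓝 p, g v ∈ isotropy n q (π u₀))
    {Φ : OpenPartialHomeomorph B (X × Euc r)} (hΦ : A.act u₀ (g p) ∈ Φ.source)
    (hΦ1 : ∀ c ∈ Φ.source, (Φ c).1 = π c)
    (hΦ2 : ContMDiffOn 𝓘(ℝ, Euc d) (𝓘(ℝ, Euc n).prod 𝓘(ℝ, Euc r)) ∞ Φ Φ.source)
    {T : V →L[ℝ] Euc r} (hT : HasFDerivAt (fun v => (Φ (A.act u₀ (g v))).2) T p)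
    (hs : Function.Surjective T) :
    ∃ τ, A.IsOrbitSection u₀ τ (A.act u₀ (g p)) := by
  set b := A.act u₀ (g p)
  have hgp := hgm.self_of_nhds
  have hb : π b = π u₀ := (A.π_act _ _ hgp.1 hgp.2.2.symm).trans hgp.2.1
  have hΦs := smNear_of_contMDiffOn hΦ2 (Φ.open_source.mem_nhds hΦ)
  have hα := A.smNear_act_left hg hgm
  have ho : SmNear 𝓘(ℝ, V) 𝓘(ℝ, Euc r) (fun v => (Φ (A.act u₀ (g v))).2) p :=
    (SmNear.comp_eq hΦs hα rfl).snd
  obtain ⟨s, s1, s2, s3⟩ := exists_local_section_space ho hT hs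
  obtain ⟨θ, hθ, hθy, hθe⟩ := exists_translation (n := n) q (π u₀)
  have hπ := hF.smNear_π b
  have hπt : Tendsto π (𝓝 b) (𝓝 (π u₀)) := by
    have := hπ.continuousAt.tendsto
    rwa [hb] at this
  have hθπ : SmNear 𝓘(ℝ, Euc d) (jetModel n n q) (fun c => θ (π c)) b := hθ.comp_eq hπ hb
  have hθb : θ (π b) = unitJet n q (π u₀) := by rw [hb, hθy]
  have hinv : SmNear 𝓘(ℝ, Euc d) (jetModel n n q) (fun c => jetInv (θ (π c))) b :=
    (smNear_jetInv (unitJet_mem _)).2.comp_eq hθπ hθb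
  have hev := hπt.eventually hθe
  -- The transport to the fibre over `π u₀`; it fixes `b`, where the translation is a unit.
  set β : B → B := fun c => A.act c (jetInv (θ (π c)))
  have hβb : β b = b := by
    have h1 := A.act_act_jetInv (b := b) (unitJet_mem (π u₀)) (by rw [hb]; simp [unitJet])
    have h2 : A.act b (unitJet n q (π u₀)) = b := by rw [← hb, A.act_unit]
    have h3 := A.act_jetInv_of_act (b := b) (unitJet_mem (q := q) (π u₀))
      (by rw [hb]; simp [unitJet])
    rw [h2] at h3
    change A.act b (jetInv (θ (π b))) = b
    rw [hθb, h3]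
  have hβ : SmNear 𝓘(ℝ, Euc d) 𝓘(ℝ, Euc d) β b := by
    have h0 := hev.self_of_nhds
    refine SmOn.comp_smNear (f := fun c => (c, jetInv (θ (π c))))
      (A.smOn_act (jetInv_mem h0.1) ((tgt_jetInv h0.1).trans h0.2.1).symm)
      ((smNear_id _).prodMk hinv) ?_
    filter_upwards [hev] with c hc
    exact ⟨jetInv_mem hc.1, ((tgt_jetInv hc.1).trans hc.2.1).symm⟩
  have hβt : Tendsto β (𝓝 b) (𝓝 b) := by
    have := hβ.continuousAt.tendsto
    rwa [hβb] at this
  have hv : SmNear 𝓘(ℝ, Euc d) 𝓘(ℝ, Euc r) (fun c => (Φ (β c)).2) b :=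
    (SmNear.comp_eq hΦs hβ hβb).snd
  have hsv : SmNear 𝓘(ℝ, Euc d) 𝓘(ℝ, V) (fun c => s (Φ (β c)).2) b :=
    s1.comp_eq hv (by rw [hβb])
  have hsb : s (Φ (β b)).2 = p := by rw [hβb]; exact s2
  have hgs : SmNear 𝓘(ℝ, Euc d) (jetModel n n q) (fun c => g (s (Φ (β c)).2)) b :=
    hg.comp_eq hsv hsb
  have hst : Tendsto (fun c => s (Φ (β c)).2) (𝓝 b) (𝓝 p) := by
    have := hsv.continuousAt.tendsto
    rwa [hsb] at this
  have hvt : Tendsto (fun c => (Φ (β c)).2) (𝓝 b) (𝓝 (Φ b).2) := by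
    have := hv.continuousAt.tendsto
    rwa [hβb] at this
  have hgs' := hst.eventually hgm
  refine ⟨fun c => (g (s (Φ (β c)).2)).comp (θ (π c)), ⟨?_, ?_⟩⟩
  · have h0 := hev.self_of_nhds
    have h1 := hgs'.self_of_nhds
    refine SmOn.comp_smNear (f := fun c => (g (s (Φ (β c)).2), θ (π c)))
      (Jet.smOn_comp (h1.2.1.trans h0.2.2.symm)) (hgs.prodMk hθπ) ?_
    filter_upwards [hgs', hev] with c h1 h2
    exact h1.2.1.trans h2.2.2.symm
  · filter_upwards [hgs', hev, hvt.eventually s3, hβt.eventually (Φ.open_source.mem_nhds hΦ),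
      hst.eventually (hα.continuousAt.eventually (Φ.open_source.mem_nhds hΦ))]
      with c h1 h2 h3 h4 h5
    have h6 := h1.2.1.trans h2.2.2.symm
    refine ⟨comp_mem h1.1 h2.1 h6, by rw [Jet.src_comp, h2.2.1],
      by rw [Jet.tgt_comp h6, h1.2.2], ?_⟩
    -- Both points lie over `π u₀` and have the same vertical coordinate.
    have h7 : A.act u₀ (g (s (Φ (β c)).2)) = β c := by
      apply Φ.injOn h5 h4
      refine Prod.ext ?_ h3
      rw [hΦ1 _ h5, hΦ1 _ h4, A.π_act _ _ h1.1 h1.2.2.symm, h1.2.1]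
      change _ = π (A.act c (jetInv (θ (π c))))
      rw [A.π_act _ _ (jetInv_mem h2.1) ((tgt_jetInv h2.1).trans h2.2.1).symm,
        src_jetInv h2.1, h2.2.2]
    rw [A.act_comp _ _ h1.1 _ h2.1 h1.2.2.symm h6, h7]
    exact A.act_act_jetInv h2.1 h2.2.1.symm

/-- The orbit of a neighbourhood in the isotropy group is not thin in the fibre. -/
lemma interior_image_nonempty [T2Space X] [T2Space B] (hF : HasFibredCharts n d r π)
    (hA : A.IsHomogeneous) {u₀ : B}
    {V : Type*} [NormedAddCommGroup V] [NormedSpace ℝ V] [FiniteDimensional ℝ V]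
    {g : V → SelfJet n X q} {p : V} {N : Set V} (hN : IsCompact N) (hpN : p ∈ N)
    (hg : ∀ v ∈ N, SmNear 𝓘(ℝ, V) (jetModel n n q) g v)
    (hgm : ∀ v ∈ N, ∀ᶠ w in 𝓝 v, g w ∈ isotropy n q (π u₀))
    (hgN : ∀ᶠ h in 𝓝[isotropy n q (π u₀)] g p, h ∈ g '' N)
    {Φ : OpenPartialHomeomorph B (X × Euc r)} (hΦ : ∀ v ∈ N, A.act u₀ (g v) ∈ Φ.source)
    (hΦ1 : ∀ c ∈ Φ.source, (Φ c).1 = π c) :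
    (interior ((fun v => (Φ (A.act u₀ (g v))).2) '' N)).Nonempty := by
  have hgN' : ∀ v ∈ N, g v ∈ isotropy n q (π u₀) := fun v hv => (hgm v hv).self_of_nhds
  have hgp := hgN' p hpN
  set K : Set B := (fun v => A.act u₀ (g v)) '' N
  have hK : IsCompact K := hN.image_of_continuousOn fun v hv =>
    (A.smNear_act_left (hg v hv) (hgm v hv)).continuousAt.continuousWithinAt
  have hKπ : ∀ k ∈ K, π k = π u₀ := by
    rintro _ ⟨v, hv, rfl⟩
    exact (A.π_act _ _ (hgN' v hv).1 (hgN' v hv).2.2.symm).trans (hgN' v hv).2.1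
  -- Each `h` has a neighbourhood in the isotropy group contained in `g(N) g(p)⁻¹ h`. By the
  -- Lindelöf property countably many of these cover the group.
  obtain ⟨t, htc, hti, htcov⟩ := (isLindelof_isotropy (n := n) q (π u₀)).elim_nhds_subcover
    (fun h => {f | f ∈ isotropy n q (π u₀) → f.comp ((jetInv h).comp (g p)) ∈ g '' N}) (by
      intro h hh
      have hk : (jetInv h).comp (g p) ∈ isotropy n q (π u₀) :=
        isotropy_comp (isotropy_jetInv hh) hgp
      have hval : h.comp ((jetInv h).comp (g p)) = g p :=
        jetInv_comp_cancel hh.1 (hh.2.2.trans hgp.2.2.symm)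
      have hsm := SmOn.comp (I := jetModel n n q) (x := h) (S := isotropy n q (π u₀))
        (f := fun f => (f, (jetInv h).comp (g p))) hh
        (Jet.smOn_comp (hh.2.1.trans hk.2.2.symm))
        (((smNear_id _).prodMk (smNear_const _ _)).smOn _) (by
          filter_upwards [self_mem_nhdsWithin] with f hf
          exact hf.2.1.trans hk.2.2.symm)
      have htd := hsm.tendsto hh
      dsimp only at htd
      rw [hval] at htd
      have htd' : Tendsto (fun f : SelfJet n X q => f.comp ((jetInv h).comp (g p)))
          (𝓝[isotropy n q (π u₀)] h) (𝓝[isotropy n q (π u₀)] (g p)) := by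
        refine tendsto_nhdsWithin_iff.2 ⟨htd, ?_⟩
        filter_upwards [self_mem_nhdsWithin] with f hf
        exact isotropy_comp hf hk
      exact eventually_nhdsWithin_iff.1 (htd'.eventually hgN))
  -- By transitivity the fibre is the union of the countably many compact sets `K κ(h)`, where `κ(h)
  -- = g(p)⁻¹ h` and `K = u₀ g(N)`.
  set κ : SelfJet n X q → SelfJet n X q := fun h => (jetInv (g p)).comp h
  have hκ : ∀ h ∈ isotropy n q (π u₀), κ h ∈ isotropy n q (π u₀) := fun h hh =>
    isotropy_comp (isotropy_jetInv hgp) hh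
  have hact : ∀ h ∈ isotropy n q (π u₀), ContinuousOn (fun b => A.act b h) (π ⁻¹' {π u₀}) := by
    intro h hh b hb
    have := SmOn.comp (I := 𝓘(ℝ, Euc d)) (x := b) (S := π ⁻¹' {π u₀}) (f := fun c => (c, h)) hb
      (A.smOn_act hh.1 (hb.trans hh.2.2.symm))
      (((smNear_id _).prodMk (smNear_const _ _)).smOn _) (by
        filter_upwards [self_mem_nhdsWithin] with c hc
        exact ⟨hh.1, hc.trans hh.2.2.symm⟩)
    exact this.tendsto hb
  have hcont : Continuous π := continuous_iff_continuousAt.2 fun b => (hF.smNear_π b).continuousAt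
  have hclosed : IsClosed (π ⁻¹' {π u₀}) := isClosed_singleton.preimage hcont
  have : LocallyCompactSpace B := ChartedSpace.locallyCompactSpace (Euc d) B
  have : LocallyCompactSpace (π ⁻¹' {π u₀}) := hclosed.locallyCompactSpace
  have : Nonempty (π ⁻¹' {π u₀}) := ⟨⟨u₀, rfl⟩⟩
  have : Countable t := htc.to_subtype
  -- Baire's theorem in the fibre, which is closed in a locally compact Hausdorff manifold: one of
  -- the translates has interior points.
  obtain ⟨⟨h, hht⟩, ⟨b₁, hb₁⟩, hb₁i⟩ := nonempty_interior_of_iUnion_of_closed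
    (f := fun h : t => ((↑) : π ⁻¹' {π u₀} → B) ⁻¹' ((fun b => A.act b (κ h)) '' K))
    (fun h => ((hK.image_of_continuousOn ((hact _ (hκ _ (hti _ h.2))).mono
      fun k hk => hKπ k hk)).isClosed).preimage continuous_subtype_val) (by
    refine eq_univ_of_forall fun ⟨b, hb⟩ => ?_
    obtain ⟨f, hf, hfb⟩ := hA u₀ b (Eq.symm hb)
    obtain ⟨h, hht, hfh⟩ := mem_iUnion₂.1 (htcov hf)
    obtain ⟨v, hv, hgv⟩ := hfh hf
    refine mem_iUnion.2 ⟨⟨h, hht⟩, A.act u₀ (g v), ⟨v, hv, rfl⟩, ?_⟩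
    have hh := hti h hht
    dsimp only
    rw [← A.act_comp _ _ (hgN' v hv).1 _ (hκ h hh).1 (hgN' v hv).2.2.symm
      ((hgN' v hv).2.1.trans (hκ h hh).2.2.symm), hgv, ← hfb]
    congr 1
    have e1 : ((jetInv h).comp (g p)).comp (κ h) = unitJet n q (π u₀) := by
      change ((jetInv h).comp (g p)).comp ((jetInv (g p)).comp h) = _
      rw [jet_comp_assoc ((Jet.src_comp _ _).trans (tgt_jetInv hgp.1).symm)
          ((src_jetInv hgp.1).trans (hgp.2.2.trans hh.2.2.symm)),
        comp_comp_jetInv hgp.1 ((src_jetInv hh.1).trans (hh.2.2.trans hgp.2.2.symm)),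
        jetInv_comp hh.1, hh.2.1]
    have hk : (jetInv h).comp (g p) ∈ isotropy n q (π u₀) :=
        isotropy_comp (isotropy_jetInv hh) hgp
    rw [← jet_comp_assoc (hf.2.1.trans hk.2.2.symm) (hk.2.1.trans (hκ h hh).2.2.symm), e1,
      ← hf.2.1, jet_comp_unit])
  obtain ⟨W, hW, hWo, hb₁W⟩ := mem_interior.1 hb₁i
  obtain ⟨W', hW'o, rfl⟩ := isOpen_induced_iff.1 hWo
  have hh := hκ h (hti h hht)
  obtain ⟨_, ⟨v₁, hv₁, rfl⟩, hvb⟩ := hW hb₁W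
  set b₀ := A.act u₀ (g v₁) with hb₀
  have hb₀π : π b₀ = π u₀ := hKπ _ ⟨v₁, hv₁, rfl⟩
  have hb₀Φ : b₀ ∈ Φ.source := hΦ v₁ hv₁
  refine ⟨(Φ b₀).2, mem_interior_iff_mem_nhds.2 ?_⟩
  have hpt : ((π u₀, (Φ b₀).2) : X × Euc r) = Φ b₀ :=
    Prod.ext ((hΦ1 _ hb₀Φ).trans hb₀π).symm rfl
  have hline : Tendsto (fun z : Euc r => ((π u₀, z) : X × Euc r)) (𝓝 (Φ b₀).2) (𝓝 (Φ b₀)) := by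
    rw [← hpt]
    exact (Continuous.prodMk_right (π u₀)).tendsto _
  have htar := hline.eventually (Φ.open_target.mem_nhds (Φ.map_source hb₀Φ))
  have hsymm : Tendsto (fun z : Euc r => Φ.symm (π u₀, z)) (𝓝 (Φ b₀).2) (𝓝 b₀) := by
    have := (Φ.continuousAt_symm (Φ.map_source hb₀Φ)).tendsto.comp hline
    rwa [Φ.left_inv hb₀Φ] at this
  have hπs : ∀ᶠ z in 𝓝 (Φ b₀).2, π (Φ.symm (π u₀, z)) = π u₀ := by
    filter_upwards [htar] with z hz
    rw [← hΦ1 _ (Φ.map_target hz), Φ.right_inv hz]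
  have hsymm' : Tendsto (fun z : Euc r => Φ.symm (π u₀, z)) (𝓝 (Φ b₀).2)
      (𝓝[π ⁻¹' {π u₀}] b₀) := tendsto_nhdsWithin_iff.2 ⟨hsymm, hπs⟩
  -- Acting by `κ(h)` sends the fibre points near `b₀` into the interior found above; undoing it
  -- shows that they belong to `K`, so the vertical coordinates of `K` fill a neighbourhood.
  have hb₁eq : A.act b₀ (κ h) = b₁ := hvb
  have htr : Tendsto (fun z : Euc r => A.act (Φ.symm (π u₀, z)) (κ h)) (𝓝 (Φ b₀).2) (𝓝 b₁) := by
    have := (hact _ hh b₀ hb₀π).tendsto.comp hsymm'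
    rwa [hb₁eq] at this
  filter_upwards [htar, hπs, htr.eventually (hW'o.mem_nhds hb₁W)] with z h1 h2 h3
  have h4 : π (A.act (Φ.symm (π u₀, z)) (κ h)) = π u₀ :=
    (A.π_act _ _ hh.1 (h2.trans hh.2.2.symm)).trans hh.2.1
  obtain ⟨_, ⟨v, hv, rfl⟩, hvz⟩ := hW (a := ⟨_, h4⟩) h3
  refine ⟨v, hv, ?_⟩
  have h5 : A.act u₀ (g v) = Φ.symm (π u₀, z) := by
    have e1 := A.act_jetInv_of_act hh.1 ((hKπ _ ⟨v, hv, rfl⟩).trans hh.2.2.symm)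
    have e2 := A.act_jetInv_of_act hh.1 (h2.trans hh.2.2.symm)
    exact e1.symm.trans ((congrArg (fun b => A.act b (jetInv (κ h))) hvz).trans e2)
  dsimp only
  rw [h5, Φ.right_inv h1]

/-- The orbit maps of a homogeneous action have smooth local sections. -/
theorem exists_isOrbitSection [T2Space X] [T2Space B] (hF : HasFibredCharts n d r π)
    (hA : A.IsHomogeneous) (u₀ : B) {f : SelfJet n X q} (hf : f ∈ fullJetGroupoid n X q)
    (hft : f.tgt = π u₀) :
    ∃ τ, A.IsOrbitSection u₀ τ (A.act u₀ f) ∧ τ (A.act u₀ f) = f := by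
  -- A local section at any one point suffices, because it can be translated to every other point of
  -- the orbit.
  suffices h : ∃ b τ, A.IsOrbitSection u₀ τ b by
    obtain ⟨b, τ, h⟩ := h
    exact h.translate hF hf hft
  obtain ⟨g, U, hU, ⟨p₁, hp₁⟩, hgU⟩ := exists_isotropy_parametrization (n := n) q (π u₀)
  have := finiteDimensional_jetCoord (Euc n) (Euc n) q
  obtain ⟨Φ, hb, hΦ1, hΦ2, -⟩ := hF (A.act u₀ (g p₁))
  have hgm : ∀ v ∈ U, ∀ᶠ w in 𝓝 v, g w ∈ isotropy n q (π u₀) := fun v hv => by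
    filter_upwards [hU.mem_nhds hv] with w hw
    exact (hgU w hw).2.1
  have hα : ∀ v ∈ U, SmNear 𝓘(ℝ, jetCoord (Euc n) (Euc n) q) 𝓘(ℝ, Euc d)
      (fun v => A.act u₀ (g v)) v := fun v hv => A.smNear_act_left (hgU v hv).1 (hgm v hv)
  have hU' : IsOpen (U ∩ (fun v => A.act u₀ (g v)) ⁻¹' Φ.source) :=
    ContinuousOn.isOpen_inter_preimage
      (fun v hv => (hα v hv).continuousAt.continuousWithinAt) hU Φ.open_source
  have ho : ∀ v ∈ U ∩ (fun v => A.act u₀ (g v)) ⁻¹' Φ.source,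
      ContDiffAt ℝ ∞ (fun v => (Φ (A.act u₀ (g v))).2) v := fun v hv =>
    (SmNear.comp_eq (smNear_of_contMDiffOn hΦ2 (Φ.open_source.mem_nhds hv.2))
      (hα v hv.1) rfl).snd.contDiffAt
  obtain ⟨p, hp, h | ⟨N, hN, hNi⟩⟩ :=
    exists_surjective_or_interior_image_empty hU' ⟨p₁, hp₁, hb⟩ ho
  · exact ⟨_, A.exists_isOrbitSection_of_surjective hF (hgU p hp.1).1 (hgm p hp.1) hp.2 hΦ1 hΦ2
      ((ho p hp).differentiableAt (by simp)).hasFDerivAt h⟩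
  -- A closed ball inside the thin neighbourhood is compact, so its image has interior points by the
  -- Baire argument; but the image is contained in a set without interior.
  · exfalso
    have : ProperSpace (jetCoord (Euc n) (Euc n) q) := FiniteDimensional.proper_real _
    obtain ⟨ε, hε, hεN⟩ := Metric.nhds_basis_closedBall.mem_iff.1
      (inter_mem hN (hU'.mem_nhds hp))
    have hcb := Metric.closedBall_mem_nhds p hε
    have := A.interior_image_nonempty (r := r) (u₀ := u₀) (g := g) (p := p) hF hA
      (isCompact_closedBall p ε)
      (mem_of_mem_nhds hcb) (fun v hv => (hgU v (hεN hv).2.1).1)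
      (fun v hv => hgm v (hεN hv).2.1) ((hgU p hp.1).2.2 _ hcb)
      (fun v hv => (hεN hv).2.2) hΦ1
    have h2 := this.mono (interior_mono (image_mono fun v hv => (hεN hv).1))
    rw [hNi] at h2
    exact h2.ne_empty rfl

end JetAction

end OrbitSections

/-! ### The affine space of 1-jets of sections through a point -/

lemma SmNear.fderiv_param {EA HA A E E' : Type*} [NormedAddCommGroup EA] [NormedSpace ℝ EA]
    [TopologicalSpace HA] [TopologicalSpace A] [ChartedSpace HA A] {I : ModelWithCorners ℝ EA HA}
    [IsManifold I ∞ A] [I.Boundaryless] [NormedAddCommGroup E] [NormedSpace ℝ E]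
    [NormedAddCommGroup E'] [NormedSpace ℝ E'] {F : A → E → E'} {p : A} {v : E}
    (hF : SmNear (I.prod 𝓘(ℝ, E)) 𝓘(ℝ, E') (Function.uncurry F) (p, v)) :
    SmNear I 𝓘(ℝ, E →L[ℝ] E') (fun a => fderiv ℝ (F a) v) p := by
  set ξ := extChartAt I p
  have h1 : SmNear (𝓘(ℝ, EA).prod 𝓘(ℝ, E)) 𝓘(ℝ, E')
      (Function.uncurry fun e w => F (ξ.symm e) w) (ξ p, v) :=
    hF.comp_eq (f := fun z : EA × E => (ξ.symm z.1, z.2))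
      (((smNear_extChartAt_symm p).comp_eq (smNear_fst _) rfl).prodMk (smNear_snd _))
      (by rw [extChartAt_to_inv])
  have h2 : SmNear 𝓘(ℝ, EA) 𝓘(ℝ, E →L[ℝ] E') (fun e => fderiv ℝ (F (ξ.symm e)) v) (ξ p) := by
    rw [smNear_iff_contDiffAt]
    have h3 := smNear_iff_contDiffAt.1 (smNear_prod_iff.1 h1)
    have h4 : Tendsto (fun e : EA => (e, v)) (𝓝 (ξ p)) (𝓝 (ξ p, v)) :=
      (Continuous.prodMk_left v).tendsto _
    filter_upwards [h4.eventually h3] with e he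
    exact ContDiffAt.fderiv (n := ∞) (f := fun e w => F (ξ.symm e) w) (g := fun _ => v) he
      contDiffAt_const le_rfl
  refine (h2.comp_eq (smNear_extChartAt p) rfl).congr ?_
  filter_upwards [extChartAt_source_mem_nhds (I := I) p] with a ha
  rw [ξ.left_inv ha]

section FibreJets

variable {n d r q : ℕ} {X B : Type*} [TopologicalSpace X] [ChartedSpace (Euc n) X]
  [TopologicalSpace B] [ChartedSpace (Euc d) B]

/-- The 1-jets of sections through `u`. -/
def jetsThrough (n d : ℕ) {X B : Type*} [TopologicalSpace X] [ChartedSpace (Euc n) X]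
    [TopologicalSpace B] [ChartedSpace (Euc d) B] (π : B → X) (u : B) :
    Set (Jet (Euc n) (Euc d) X B 1) :=
  {w | w ∈ sectionJets n d 1 π ∧ w.tgt = u}

variable [IsManifold 𝓘(ℝ, Euc n) ∞ X] [IsManifold 𝓘(ℝ, Euc d) ∞ B] {π : B → X}

lemma src_of_mem_jetsThrough {u : B} {w : Jet (Euc n) (Euc d) X B 1}
    (hw : w ∈ jetsThrough n d π u) : w.src = π u := by
  rw [← hw.2, π_tgt hw.1]

lemma exists_sec_of_mem_jetsThrough {u : B} {w : Jet (Euc n) (Euc d) X B 1}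
    (hw : w ∈ jetsThrough n d π u) :
    ∃ s, IsSec n d π s (π u) ∧ s (π u) = u ∧ w = Jet.of (Euc n) (Euc d) 1 s (π u) := by
  obtain ⟨s, h1, h2⟩ := exists_sec hw.1
  rw [src_of_mem_jetsThrough hw] at h1 h2
  refine ⟨s, h1, ?_, h2⟩
  conv_rhs => rw [← hw.2, h2, Jet.tgt_of]

/-- The 1-jets of sections through `u` form an affine space, with the vertical derivative
as a coordinate. -/
lemma exists_jetsThrough_coordinates (hF : HasFibredCharts n d r π) (u : B) :
    ∃ (κ : B → Euc r) (T : Jet (Euc n) (Euc d) X B 1 → Euc n →L[ℝ] Euc r)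
      (J : (Euc n →L[ℝ] Euc r) → Jet (Euc n) (Euc d) X B 1),
      SmNear 𝓘(ℝ, Euc d) 𝓘(ℝ, Euc r) κ u ∧
      (∀ w ∈ jetsThrough n d π u,
        SmOn (jetModel n d 1) 𝓘(ℝ, Euc n →L[ℝ] Euc r) (jetsThrough n d π u) T w) ∧
      (∀ L, SmNear 𝓘(ℝ, Euc n →L[ℝ] Euc r) (jetModel n d 1) J L ∧ J L ∈ jetsThrough n d π u ∧
        T (J L) = L) ∧
      (∀ w ∈ jetsThrough n d π u, J (T w) = w) ∧
      ∀ s, SmoothNear (Euc n) (Euc d) s (π u) → s (π u) = u →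
        HasD 𝓘(ℝ, Euc n) 𝓘(ℝ, Euc r) (fun x => κ (s x)) (π u)
          (T (Jet.of (Euc n) (Euc d) 1 s (π u))) := by
  obtain ⟨Φ, hu, h1, h2, h3⟩ := hF u
  set y := π u
  set χ := chartAt (Euc n) y
  have hχ : SmNear 𝓘(ℝ, Euc n) 𝓘(ℝ, Euc n) χ y := Jet.smNear_chart
  have hΦ := smNear_of_contMDiffOn h2 (Φ.open_source.mem_nhds hu)
  have hΦu : Φ u = (y, (Φ u).2) := Prod.ext (h1 u hu) rfl
  have hΦs : SmNear (𝓘(ℝ, Euc n).prod 𝓘(ℝ, Euc r)) 𝓘(ℝ, Euc d) Φ.symm (y, (Φ u).2) := by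
    rw [← hΦu]
    exact smNear_of_contMDiffOn h3 (Φ.open_target.mem_nhds (Φ.map_source hu))
  set κ : B → Euc r := fun b => (Φ b).2 with hκdef
  have hκ : SmNear 𝓘(ℝ, Euc d) 𝓘(ℝ, Euc r) κ u := hΦ.snd
  -- The definition uses an arbitrary representative; `hT` shows that for jets through `u` every
  -- representative gives the same derivative.
  set T : Jet (Euc n) (Euc d) X B 1 → Euc n →L[ℝ] Euc r := fun w =>
    fderiv ℝ (fun v => κ (w.rep.toFun (χ.symm v))) (χ y)
  have hchart : ∀ {f : X → Euc r} {L : Euc n →L[ℝ] Euc r},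
      HasD 𝓘(ℝ, Euc n) 𝓘(ℝ, Euc r) f y L → HasFDerivAt (fun v => f (χ.symm v)) L (χ y) :=
    fun h => (Jet.hasD_iff.1 h).2
  have hT : ∀ s, SmoothNear (Euc n) (Euc d) s y → s y = u →
      HasD 𝓘(ℝ, Euc n) 𝓘(ℝ, Euc r) (fun x => κ (s x)) y
        (T (Jet.of (Euc n) (Euc d) 1 s y)) := by
    intro s hs hsu
    set w := Jet.of (Euc n) (Euc d) 1 s y with hw
    have hsrc : w.rep.src = y := by rw [Jet.rep_src, hw, Jet.src_of]
    have hrep : Jet.of (Euc n) (Euc d) 1 w.rep.toFun y = w := by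
      conv_rhs => rw [← Jet.of_rep w, hsrc]
    have hreps : SmoothNear (Euc n) (Euc d) w.rep.toFun y := hsrc ▸ w.rep.smooth
    obtain ⟨e1, T₀, e2, e3⟩ := (Jet.of_one_eq_iff hreps hs).1 (hrep.trans hw)
    obtain ⟨K, hK⟩ := hκ.exists_hasD
    have e4 := HasD.comp_eq hK e2 (e1.trans hsu)
    have e5 := HasD.comp_eq hK e3 hsu
    have : T w = K.comp T₀ := (hchart e4).fderiv
    rw [this]
    exact e5
  have hTeq : ∀ s, SmoothNear (Euc n) (Euc d) s y → s y = u → ∀ {L : Euc n →L[ℝ] Euc r},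
      HasD 𝓘(ℝ, Euc n) 𝓘(ℝ, Euc r) (fun x => κ (s x)) y L →
      T (Jet.of (Euc n) (Euc d) 1 s y) = L := fun s hs hsu L h => (hT s hs hsu).unique h
  -- The section through `u` that is affine with linear part `L` in the fibred chart.
  set sec : (Euc n →L[ℝ] Euc r) → X → B := fun L x => Φ.symm (x, (Φ u).2 + L (χ x - χ y))
    with hsec
  have hsecy : ∀ L, sec L y = u := fun L => by
    simp only [hsec, sub_self, map_zero, add_zero]
    rw [← hΦu, Φ.left_inv hu]
  have happ : ContDiff ℝ ∞ (fun z : (Euc n →L[ℝ] Euc r) × Euc n => z.1 z.2) :=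
    isBoundedBilinearMap_apply.contDiff
  have hin : ∀ L, SmNear (𝓘(ℝ, Euc n →L[ℝ] Euc r).prod 𝓘(ℝ, Euc n))
      (𝓘(ℝ, Euc n).prod 𝓘(ℝ, Euc r))
      (fun p : (Euc n →L[ℝ] Euc r) × X => (p.2, (Φ u).2 + p.1 (χ p.2 - χ y))) (L, y) := by
    intro L
    refine (smNear_snd _).prodMk (SmNear.add (smNear_const _ _) ?_)
    refine SmNear.comp_eq (f := fun p : (Euc n →L[ℝ] Euc r) × X => (p.1, χ p.2 - χ y))
      (ContDiff.smNear happ _) ((smNear_fst _).prodMk_space (SmNear.sub ?_ (smNear_const _ _))) rfl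
    exact hχ.comp_eq (smNear_snd _) rfl
  have hin0 : ∀ L : Euc n →L[ℝ] Euc r, (Φ u).2 + L (χ y - χ y) = (Φ u).2 := by simp
  have hsecs : ∀ L, SmNear (𝓘(ℝ, Euc n →L[ℝ] Euc r).prod 𝓘(ℝ, Euc n)) 𝓘(ℝ, Euc d)
      (Function.uncurry sec) (L, y) := fun L => hΦs.comp_eq (hin L) (by simp)
  have hsl : ∀ L : Euc n →L[ℝ] Euc r, Tendsto (fun x : X => (L, x)) (𝓝 y) (𝓝 (L, y)) :=
    fun L => (Continuous.prodMk_right L).tendsto _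
  have htar : ∀ L : Euc n →L[ℝ] Euc r, ∀ᶠ x in 𝓝 y,
      ((x, (Φ u).2 + L (χ x - χ y)) : X × Euc r) ∈ Φ.target := by
    intro L
    refine (hsl L).eventually ((hin L).continuousAt.eventually (Φ.open_target.mem_nhds ?_))
    simp only [sub_self, map_zero, add_zero]
    rw [← hΦu]
    exact Φ.map_source hu
  have hsecIs : ∀ L, IsSec n d π (sec L) y := fun L => by
    refine ⟨Jet.family_smoothNear (hsecs L), ?_⟩
    filter_upwards [htar L] with x hx
    simp only [hsec]
    rw [← h1 _ (Φ.map_target hx), Φ.right_inv hx]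
  have hTsec : ∀ L, T (Jet.of (Euc n) (Euc d) 1 (sec L) y) = L := by
    intro L
    refine hTeq _ (hsecIs L).smooth (hsecy L) ?_
    refine HasD.congr (f := fun x => (Φ u).2 + L (χ x - χ y)) ?_ ?_
    · rw [Jet.hasD_iff]
      constructor
      · exact ((hin L).continuousAt.tendsto.comp (hsl L)).snd_nhds
      · have : HasFDerivAt (fun v : Euc n => (Φ u).2 + L (v - χ y)) L (χ y) := by
          have h5 : HasFDerivAt (fun v : Euc n => v - χ y) (ContinuousLinearMap.id ℝ (Euc n))
            (χ y) := (hasFDerivAt_id _).sub_const _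
          exact (L.hasFDerivAt.comp (χ y) h5).const_add _
        refine this.congr_of_eventuallyEq ?_
        filter_upwards [χ.open_target.mem_nhds (χ.map_source (mem_chart_source _ y))] with v hv
        change (Φ u).2 + L (χ (χ.symm v) - χ y) = _
        rw [χ.right_inv hv]
    · filter_upwards [htar L] with x hx
      simp only [hκdef, hsec]
      rw [Φ.right_inv hx]
  refine ⟨κ, T, fun L => Jet.of (Euc n) (Euc d) 1 (sec L) y, hκ, ?_, ?_, ?_, hT⟩
  · intro w hw
    -- Chosen representatives do not vary smoothly with the jet, so they are replaced near `w` by a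
    -- smooth family of sections, which yields the same derivative.
    obtain ⟨S, hS, -, hS2⟩ := JetAction.exists_section_family hF hw.1
    have hwy := src_of_mem_jetsThrough hw
    rw [hwy] at hS
    have hSw : S w y = u := by
      have := congrArg Jet.tgt (hS2.self_of_nhds hw.1)
      rwa [Jet.tgt_of, hw.2, hwy] at this
    refine ⟨fun w => fderiv ℝ (fun v => κ (S w (χ.symm v))) (χ y), ?_, ?_⟩
    · refine SmNear.fderiv_param (F := fun w v => κ (S w (χ.symm v))) ?_
      have hχs : SmNear ((jetModel n d 1).prod 𝓘(ℝ, Euc n)) ((jetModel n d 1).prod 𝓘(ℝ, Euc n))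
          (fun p : Jet (Euc n) (Euc d) X B 1 × Euc n => (p.1, χ.symm p.2)) (w, χ y) :=
        (smNear_fst _).prodMk (SmNear.comp_eq Jet.smNear_chart_symm (smNear_snd _) rfl)
      have hl : χ.symm (χ y) = y := χ.left_inv (mem_chart_source _ y)
      refine SmNear.comp_eq (f := fun p : Jet (Euc n) (Euc d) X B 1 × Euc n =>
        S p.1 (χ.symm p.2)) hκ (SmNear.comp_eq (g := Function.uncurry S) hS hχs ?_) ?_
      · rw [hl]
      · simp only [hl, hSw]
    · have ht : Tendsto (fun w : Jet (Euc n) (Euc d) X B 1 => (w, y)) (𝓝 w) (𝓝 (w, y)) :=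
        (Continuous.prodMk_left y).tendsto _
      filter_upwards [self_mem_nhdsWithin, mem_nhdsWithin_of_mem_nhds hS2,
        mem_nhdsWithin_of_mem_nhds (ht.eventually hS.eventually)] with w' hw' e1 e2
      have e3 := Jet.family_smoothNear e2
      have e4 := e1 hw'.1
      rw [src_of_mem_jetsThrough hw'] at e4
      have e5 : S w' y = u := by
        have := congrArg Jet.tgt e4
        rwa [Jet.tgt_of, hw'.2] at this
      have e6 := hT _ e3 e5
      change Jet.of (Euc n) (Euc d) 1 (S w') y = w' at e4
      rw [e4] at e6
      exact (hchart e6).fderiv.symm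
  · intro L
    exact ⟨Jet.smNear_of (hsecs L) (smNear_const _ _),
      ⟨(hsecIs L).mem 1, by rw [Jet.tgt_of, hsecy]⟩, hTsec L⟩
  · intro w hw
    obtain ⟨s, hs, hsu, rfl⟩ := exists_sec_of_mem_jetsThrough hw
    set L := T (Jet.of (Euc n) (Euc d) 1 s y)
    rw [Jet.of_one_eq_iff (hsecIs L).smooth hs.smooth]
    refine ⟨(hsecy L).trans hsu.symm, ?_⟩
    -- A section is recovered in the fibred chart from `x` and its vertical coordinate, so its full
    -- derivative is determined by the vertical derivative.
    obtain ⟨D, hD⟩ := hΦs.exists_hasD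
    have key : ∀ s', IsSec n d π s' y → s' y = u →
        HasD 𝓘(ℝ, Euc n) 𝓘(ℝ, Euc r) (fun x => κ (s' x)) y L →
        HasD 𝓘(ℝ, Euc n) 𝓘(ℝ, Euc d) s' y
          (D.comp ((ContinuousLinearMap.id ℝ (Euc n)).prod L)) := by
      intro s' hs' hsu' hL
      refine (HasD.comp_eq hD (HasD.prodMk (hasD_id y) hL) ?_).congr ?_
      · simp only [hsu', hκdef]
      · have : ∀ᶠ x in 𝓝 y, s' x ∈ Φ.source :=
          hs'.smooth.self_of_nhds.continuousAt.eventually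
            (Φ.open_source.mem_nhds (hsu' ▸ hu))
        filter_upwards [hs'.sec, this] with x e1 e2
        have e3 : ((x, κ (s' x)) : X × Euc r) = Φ (s' x) :=
          Prod.ext ((h1 _ e2).trans e1).symm rfl
        rw [e3, Φ.left_inv e2]
    exact ⟨_, key _ (hsecIs L) (hsecy L) (by
      have := hT _ (hsecIs L).smooth (hsecy L)
      rwa [hTsec] at this), key _ hs hsu (hT _ hs.smooth hsu)⟩

end FibreJets

/-! ### Linearity of the derivative of a jet -/

section JetDerivative

variable {E E' : Type*} [NormedAddCommGroup E] [NormedSpace ℝ E]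
  [NormedAddCommGroup E'] [NormedSpace ℝ E']

/-- The derivative at `a` of the family of derivatives of `h` up to order `q`. -/
def jetDeriv (q : ℕ) (h : E → E') (a : E) :
    E →L[ℝ] (∀ i : Fin (q + 1), E [×(i : ℕ)]→L[ℝ] E') :=
  ContinuousLinearMap.pi fun i : Fin (q + 1) => fderiv ℝ (iteratedFDeriv ℝ i h) a

lemma jetDeriv_congr {q : ℕ} {h h' : E → E'} {a : E} (hh : h =ᶠ[𝓝 a] h') :
    jetDeriv q h a = jetDeriv q h' a := by
  unfold jetDeriv
  congr 1
  funext i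
  exact (hh.iteratedFDeriv ℝ i).fderiv_eq

lemma differentiableAt_iteratedFDeriv {h : E → E'} {a : E} (hh : ContDiffAt ℝ ∞ h a) (i : ℕ) :
    DifferentiableAt ℝ (iteratedFDeriv ℝ i h) a :=
  ((hh.of_le (nat_le_infty (1 + i))).iteratedFDeriv_right (m := 1)
    (by push_cast; exact le_rfl)).differentiableAt (by simp)

/-- Smoothness is required near `a` and not just at `a`, because the formula for the iterated
derivative of a sum is itself differentiated. -/
lemma jetDeriv_add {q : ℕ} {h h' : E → E'} {a : E} (hh : ∀ᶠ z in 𝓝 a, ContDiffAt ℝ ∞ h z)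
    (hh' : ∀ᶠ z in 𝓝 a, ContDiffAt ℝ ∞ h' z) :
    jetDeriv q (h + h') a = jetDeriv q h a + jetDeriv q h' a := by
  have key : ∀ i : ℕ, fderiv ℝ (iteratedFDeriv ℝ i (h + h')) a =
      fderiv ℝ (iteratedFDeriv ℝ i h) a + fderiv ℝ (iteratedFDeriv ℝ i h') a := fun i => by
    rw [← fderiv_add (differentiableAt_iteratedFDeriv hh.self_of_nhds i)
      (differentiableAt_iteratedFDeriv hh'.self_of_nhds i)]
    apply Filter.EventuallyEq.fderiv_eq
    filter_upwards [hh, hh'] with z h1 h2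
    exact iteratedFDeriv_add_apply (h1.of_le (nat_le_infty i)) (h2.of_le (nat_le_infty i))
  ext v i : 2
  simp [jetDeriv, key]

lemma jetDeriv_smul {q : ℕ} {h : E → E'} {a : E} (hh : ∀ᶠ z in 𝓝 a, ContDiffAt ℝ ∞ h z) (c : ℝ) :
    jetDeriv q (c • h) a = c • jetDeriv q h a := by
  have key : ∀ i : ℕ, fderiv ℝ (iteratedFDeriv ℝ i (c • h)) a =
      c • fderiv ℝ (iteratedFDeriv ℝ i h) a := fun i => by
    rw [← fderiv_const_smul (differentiableAt_iteratedFDeriv hh.self_of_nhds i)]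
    apply Filter.EventuallyEq.fderiv_eq
    filter_upwards [hh] with z h1
    exact iteratedFDeriv_const_smul_apply (h1.of_le (nat_le_infty i))
  ext v i : 2
  simp [jetDeriv, key]

variable (E') in
/-- The submodule of all `Ξ (jetDeriv q h a)` for germs `h` that vanish to order `q` at `a`. -/
def vanishingJetImage {H : Type*} [AddCommGroup H] [Module ℝ H] (q : ℕ) (a : E)
    (Ξ : (E →L[ℝ] (∀ i : Fin (q + 1), E [×(i : ℕ)]→L[ℝ] E')) →ₗ[ℝ] H) : Submodule ℝ H where
  carrier := {v | ∃ h : E → E', (∀ᶠ z in 𝓝 a, ContDiffAt ℝ ∞ h z) ∧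
    (∀ i ≤ q, iteratedFDeriv ℝ i h a = 0) ∧ v = Ξ (jetDeriv q h a)}
  add_mem' := by
    rintro _ _ ⟨h, h1, h2, rfl⟩ ⟨h', h1', h2', rfl⟩
    refine ⟨h + h', ?_, fun i hi => ?_, by rw [jetDeriv_add h1 h1', map_add]⟩
    · filter_upwards [h1, h1'] with z e1 e2 using e1.add e2
    · rw [iteratedFDeriv_add_apply (h1.self_of_nhds.of_le (nat_le_infty i))
        (h1'.self_of_nhds.of_le (nat_le_infty i)), h2 i hi, h2' i hi, add_zero]
  zero_mem' := by
    refine ⟨0, Eventually.of_forall fun z => contDiffAt_const, fun i _ => ?_, ?_⟩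
    · simp
    · have : jetDeriv q (0 : E → E') a = 0 := by
        ext v i : 2
        simp [jetDeriv]
      rw [this, map_zero]
  smul_mem' := by
    rintro c _ ⟨h, h1, h2, rfl⟩
    refine ⟨c • h, ?_, fun i hi => ?_, by rw [jetDeriv_smul h1, map_smul]⟩
    · filter_upwards [h1] with z e1 using e1.const_smul c
    · rw [iteratedFDeriv_const_smul_apply (h1.self_of_nhds.of_le (nat_le_infty i)), h2 i hi,
        smul_zero]

end JetDerivative

/-! ### The vertical derivative along a kernel orbit -/

section KernelOrbits

variable {n d r q : ℕ} {X B : Type*} [TopologicalSpace X] [ChartedSpace (Euc n) X]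
  [TopologicalSpace B] [ChartedSpace (Euc d) B]
  [IsManifold 𝓘(ℝ, Euc n) ∞ X] [IsManifold 𝓘(ℝ, Euc d) ∞ B] {π : B → X}

lemma kernel_unit (y : X) : unitJet n (q + 1) y ∈ kernel n q y :=
  ⟨isotropy_unit y, Jet.proj_of (SmNear.congr (smNear_id y) (Eventually.of_forall fun _ => rfl))⟩

lemma smoothNear_id (y : X) : SmoothNear (Euc n) (Euc n) (id : X → X) y :=
  SmNear.congr (smNear_id y) (Eventually.of_forall fun _ => rfl)

namespace JetAction

variable (A : JetAction n d q π)

lemma mem_pactDomain_kernel {u : B} {w : Jet (Euc n) (Euc d) X B 1} (hw : w ∈ jetsThrough n d π u)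
    {k : SelfJet n X (q + 1)} (hk : k ∈ kernel n q (π u)) : (w, k) ∈ pactDomain n d q π :=
  ⟨hw.1, hk.1.1, (src_of_mem_jetsThrough hw).trans hk.1.2.2.symm⟩

/-- The value of a jet only sees the projection of `k`, which is a unit. -/
lemma pact_kernel_mem {u : B} {w : Jet (Euc n) (Euc d) X B 1} (hw : w ∈ jetsThrough n d π u)
    {k : SelfJet n X (q + 1)} (hk : k ∈ kernel n q (π u)) :
    A.pact w k ∈ jetsThrough n d π u :=
  ⟨A.pact_mem (mem_pactDomain_kernel hw hk), by
    rw [A.tgt_pact (mem_pactDomain_kernel hw hk), hk.2, hw.2, A.act_unit]⟩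

/-- The vertical derivative of a jet in a kernel orbit. -/
lemma exists_vertical_derivative {u : B} {κ : B → Euc r}
    (hκ : SmNear 𝓘(ℝ, Euc d) 𝓘(ℝ, Euc r) κ u)
    {T : Jet (Euc n) (Euc d) X B 1 → Euc n →L[ℝ] Euc r}
    (hT : ∀ s, SmoothNear (Euc n) (Euc d) s (π u) → s (π u) = u →
        HasD 𝓘(ℝ, Euc n) 𝓘(ℝ, Euc r) (fun x => κ (s x)) (π u)
          (T (Jet.of (Euc n) (Euc d) 1 s (π u)))) :
    ∃ Γ : Euc d × (Euc n × jetCoord (Euc n) (Euc n) q) →L[ℝ] Euc r,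
      ∀ {s : X → B} {φ ψ : X → X} {D : Euc n →L[ℝ] Euc d}
        {S : Euc n →L[ℝ] Euc n × jetCoord (Euc n) (Euc n) q},
        IsSec n d π s (π u) → s (π u) = u → LocDiff n φ ψ (π u) → φ (π u) = π u →
        Jet.of (Euc n) (Euc n) q φ (π u) = unitJet n q (π u) →
        HasD 𝓘(ℝ, Euc n) 𝓘(ℝ, Euc n) φ (π u) (ContinuousLinearMap.id ℝ (Euc n)) →
        HasD 𝓘(ℝ, Euc n) 𝓘(ℝ, Euc d) s (π u) D →
        HasD 𝓘(ℝ, Euc n) (jetModel n n q) (fun x => Jet.of (Euc n) (Euc n) q φ x) (π u) S →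
        T (A.pact (Jet.of (Euc n) (Euc d) 1 s (π u)) (Jet.of (Euc n) (Euc n) (q + 1) φ (π u))) =
          Γ.comp (D.prod S) := by
  set y := π u
  have hdom : ((u, unitJet n q y) : B × SelfJet n X q) ∈
      {p : B × SelfJet n X q | p.2 ∈ fullJetGroupoid n X q ∧ π p.1 = p.2.tgt} :=
    ⟨unitJet_mem _, (tgt_unitJet y).symm⟩
  obtain ⟨g, hg, hge⟩ := A.smOn_act hdom.1 hdom.2
  have hgu : g (u, unitJet n q y) = u := by
    have := hge.eq_of_nhdsWithin hdom
    rw [← this]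
    exact A.act_unit u
  have hκg : SmNear (𝓘(ℝ, Euc d).prod (jetModel n n q)) 𝓘(ℝ, Euc r) (fun p => κ (g p))
      (u, unitJet n q y) := hκ.comp_eq hg hgu
  -- One derivative, taken at `u` and the unit, serves all `s` and `φ` in question, since they share
  -- these values at the point.
  obtain ⟨Γ, hΓ⟩ := hκg.exists_hasD
  refine ⟨Γ, ?_⟩
  intro s φ ψ D S hs hsu hφ hφy hφq hid hD hS
  have hs' : IsSec n d π s (φ y) := by rw [hφy]; exact hs
  have hpact := A.pact_of hs' hφ
  rw [hφy] at hpact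
  rw [hpact]
  have hval : A.act (s (φ y)) (Jet.of (Euc n) (Euc n) q φ y) = u := by
    rw [hφq, hφy, hsu]; exact A.act_unit u
  refine (hT _ (A.isSec_act hs' hφ).smooth hval).unique ?_
  -- As `φ` has the identity as derivative, it enters only through the derivative `S` of its jet
  -- prolongation.
  have hsφ : HasD 𝓘(ℝ, Euc n) 𝓘(ℝ, Euc d) (fun x => s (φ x)) y D := by
    have := HasD.comp_eq hD hid hφy
    rwa [ContinuousLinearMap.comp_id] at this
  have hpt : (s (φ y), Jet.of (Euc n) (Euc n) q φ y) = (u, unitJet n q y) := by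
    rw [hφy, hsu, hφq]
  refine (HasD.comp_eq hΓ (hsφ.prodMk hS) hpt).congr ?_
  have ht : Tendsto (fun x => (s (φ x), Jet.of (Euc n) (Euc n) q φ x)) (𝓝 y)
      (𝓝[{p | p.2 ∈ fullJetGroupoid n X q ∧ π p.1 = p.2.tgt}] (u, unitJet n q y)) := by
    refine tendsto_nhdsWithin_iff.2 ⟨?_, ?_⟩
    · have := ((SmNear.comp hs'.smooth hφ.smooth).prodMk
        (Jet.smNear_of_self (q := q) hφ.smooth)).continuousAt.tendsto
      rwa [hpt] at this
    · filter_upwards [hφ.smooth.continuousAt.eventually hs'.sec, hφ.eventually] with x h1 h2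
      exact ⟨h2.jet_mem, by simp [h1]⟩
  filter_upwards [ht.eventually hge] with x hx
  exact congrArg κ hx

end JetAction

end KernelOrbits

/-! ### Affine dependence on the jet component -/

section LinearAlgebra

variable {E E₁ E₂ E₃ F G : Type*} [NormedAddCommGroup E] [NormedSpace ℝ E]
  [NormedAddCommGroup E₁] [NormedSpace ℝ E₁] [NormedAddCommGroup E₂] [NormedSpace ℝ E₂]
  [NormedAddCommGroup E₃] [NormedSpace ℝ E₃] [NormedAddCommGroup F] [NormedSpace ℝ F]
  [NormedAddCommGroup G] [NormedSpace ℝ G]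

/-- Composition with a continuous linear map. -/
def postcomp (L : G →L[ℝ] F) : (E →L[ℝ] G) →ₗ[ℝ] (E →L[ℝ] F) where
  toFun D := L.comp D
  map_add' D D' := L.comp_add D D'
  map_smul' c D := L.comp_smul c D

/-- Isolates the effect of a change of the last component. Applied to the highest derivatives, it
shows that the kernel translates the vertical derivative by an amount that depends neither on the
section nor on its derivative. -/
lemma comp_prod_prod_add (Γ : E₁ × (E₂ × E₃) →L[ℝ] F) (D₁ : E →L[ℝ] E₁)
    (D₂ : E →L[ℝ] E₂) (a b : E →L[ℝ] E₃) :
    Γ.comp (D₁.prod (D₂.prod (a + b))) = Γ.comp (D₁.prod (D₂.prod a)) +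
      postcomp (Γ.comp ((ContinuousLinearMap.inr ℝ E₁ (E₂ × E₃)).comp
        (ContinuousLinearMap.inr ℝ E₂ E₃))) b := by
  ext1 v
  change Γ (D₁ v, D₂ v, a v + b v) = Γ (D₁ v, D₂ v, a v) + Γ (0, 0, b v)
  rw [← map_add]
  simp

/-- Symmetrization of the values of a linear map. -/
def symmetrizeComp (n q : ℕ) :=
  postcomp (E := Euc n) (G := ∀ i : Fin (q + 1), Euc n [×(i : ℕ)]→L[ℝ] Euc n)
    (F := jetCoord (Euc n) (Euc n) q) (symmetrize (Euc n) (Euc n) q)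

end LinearAlgebra

/-! ### Kernel orbits are cosets, and linear invariants separate them -/

section KernelInvariants

variable {n d r q : ℕ} {X B : Type*} [TopologicalSpace X] [ChartedSpace (Euc n) X]
  [TopologicalSpace B] [ChartedSpace (Euc d) B]
  [IsManifold 𝓘(ℝ, Euc n) ∞ X] [IsManifold 𝓘(ℝ, Euc d) ∞ B] {π : B → X}

/-- A local diffeomorphism whose `q`-jet is a unit, in coordinates. -/
lemma exists_locDiff_of_vanishing (hq : 1 ≤ q) {y : X} {h : Euc n → Euc n}
    (hs : ∀ᶠ z in 𝓝 (chartAt (Euc n) y y), ContDiffAt ℝ ∞ h z)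
    (h0 : ∀ i ≤ q, iteratedFDeriv ℝ i h (chartAt (Euc n) y y) = 0) :
    ∃ φ ψ : X → X, LocDiff n φ ψ y ∧ φ y = y ∧
      Jet.of (Euc n) (Euc n) q φ y = unitJet n q y ∧
      chartAt (Euc n) y ∘ φ ∘ (chartAt (Euc n) y).symm =ᶠ[𝓝 (chartAt (Euc n) y y)]
        (chartAt (Euc n) y ∘ id ∘ (chartAt (Euc n) y).symm) + h := by
  set χ := chartAt (Euc n) y
  have hy : y ∈ χ.source := mem_chart_source _ _
  have hχ : SmNear 𝓘(ℝ, Euc n) 𝓘(ℝ, Euc n) χ y := Jet.smNear_chart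
  have hh : SmNear 𝓘(ℝ, Euc n) 𝓘(ℝ, Euc n) h (χ y) := smNear_iff_contDiffAt.2 hs
  have ha : h (χ y) = 0 := by
    have := h0 0 (Nat.zero_le _)
    have h2 := congrArg (fun m => m 0) this
    simpa using h2
  -- The map `id + h` in the chart.
  set φ : X → X := fun x => χ.symm (χ x + h (χ x))
  have hφy : φ y = y := by simp [φ, ha, hy]
  have hin : SmNear 𝓘(ℝ, Euc n) 𝓘(ℝ, Euc n) (fun x => χ x + h (χ x)) y :=
    SmNear.add hχ (hh.comp_eq hχ rfl)
  have hφ : SmoothNear (Euc n) (Euc n) φ y :=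
    SmNear.comp_eq (f := fun x => χ x + h (χ x)) Jet.smNear_chart_symm hin (by simp [ha, χ])
  have htar : ∀ᶠ x in 𝓝 y, χ x + h (χ x) ∈ χ.target :=
    hin.continuousAt.eventually (χ.open_target.mem_nhds (by simp [ha, χ.map_source hy]))
  have hcs : Tendsto χ.symm (𝓝 (χ y)) (𝓝 y) := Jet.chart_tendsto_symm
  have hcoord : χ ∘ φ ∘ χ.symm =ᶠ[𝓝 (χ y)] (χ ∘ id ∘ χ.symm) + h := by
    filter_upwards [hcs.eventually htar, χ.open_target.mem_nhds (χ.map_source hy)] with z h1 h2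
    simp only [Function.comp, Pi.add_apply, id, φ]
    rw [χ.right_inv h1, χ.right_inv h2]
  have hidc : ContDiffAt ℝ ∞ (χ ∘ id ∘ χ.symm) (χ y) := by
    refine contDiffAt_id.congr_of_eventuallyEq ?_
    filter_upwards [χ.open_target.mem_nhds (χ.map_source hy)] with z hz
    exact χ.right_inv hz
  have hjet : Jet.of (Euc n) (Euc n) q φ y = unitJet n q y := by
    refine (Jet.of_eq_of_iff hφ (smoothNear_id y)).2 ⟨hφy, fun i hi => ?_⟩
    rw [hφy]
    rw [(hcoord.iteratedFDeriv ℝ i).self_of_nhds, iteratedFDeriv_add_apply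
      (hidc.of_le (nat_le_infty i)) (hs.self_of_nhds.of_le (nat_le_infty i)), h0 i hi, add_zero]
  -- This is where `1 ≤ q` matters: the 1-jet is that of the identity, so the map is invertible near
  -- `y`.
  obtain ⟨ψ, hψ⟩ := exists_locInv_of_jet_eq hφ (locInv_id y)
    (Jet.of_le hφ (smoothNear_id y) hq hjet)
  exact ⟨φ, ψ, hψ, hφy, hjet, hcoord⟩

lemma hasD_id_of_jet_eq (hq : 1 ≤ q) {φ ψ : X → X} {y : X} (hφ : LocDiff n φ ψ y)
    (hj : Jet.of (Euc n) (Euc n) q φ y = unitJet n q y) :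
    HasD 𝓘(ℝ, Euc n) 𝓘(ℝ, Euc n) φ y (ContinuousLinearMap.id ℝ (Euc n)) := by
  obtain ⟨-, T, h1, h2⟩ := (Jet.of_one_eq_iff hφ.smooth (smoothNear_id y)).1
    (Jet.of_le hφ.smooth (smoothNear_id y) hq hj)
  rwa [h2.unique (hasD_id y)] at h1

set_option maxHeartbeats 1000000 in
-- The general formula refers to the chart at `φ y`; at a fixed point this is the chart at `y`, so
-- that different `φ` can be compared.
lemma hasD_jet_of_fixed {φ : X → X} {y : X} (hφ : SmoothNear (Euc n) (Euc n) φ y)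
    (hφy : φ y = y) :
    HasD 𝓘(ℝ, Euc n) (jetModel n n q) (fun x => Jet.of (Euc n) (Euc n) q φ x) y
      ((ContinuousLinearMap.id ℝ (Euc n)).prod (symmetrizeComp n q
        (jetDeriv q (chartAt (Euc n) y ∘ φ ∘ (chartAt (Euc n) y).symm) (chartAt (Euc n) y y)))) := by
  have := Jet.hasD_of (q := q) hφ
  rw [hφy] at this
  exact this

namespace JetAction

variable (A : JetAction n d q π)

set_option maxHeartbeats 1000000 in
/-- In the vertical coordinate, the kernel of `Π_{q+1} → Π_q` acts by translations by the
elements of a linear subspace. -/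
lemma exists_kernel_translations (hq : 1 ≤ q) {u : B} {κ : B → Euc r}
    (hκ : SmNear 𝓘(ℝ, Euc d) 𝓘(ℝ, Euc r) κ u)
    {T : Jet (Euc n) (Euc d) X B 1 → Euc n →L[ℝ] Euc r}
    {J : (Euc n →L[ℝ] Euc r) → Jet (Euc n) (Euc d) X B 1}
    (hJ : ∀ w ∈ jetsThrough n d π u, J (T w) = w)
    (hT : ∀ s, SmoothNear (Euc n) (Euc d) s (π u) → s (π u) = u →
        HasD 𝓘(ℝ, Euc n) 𝓘(ℝ, Euc r) (fun x => κ (s x)) (π u)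
          (T (Jet.of (Euc n) (Euc d) 1 s (π u)))) :
    ∃ V : Submodule ℝ (Euc n →L[ℝ] Euc r), ∀ w ∈ jetsThrough n d π u,
      ∀ w' ∈ jetsThrough n d π u, T w' - T w ∈ V ↔ ∃ k ∈ kernel n q (π u), A.pact w k = w' := by
  set y := π u
  set χ := chartAt (Euc n) y
  obtain ⟨Γ, hΓ⟩ := A.exists_vertical_derivative (q := q) hκ hT
  set Γ' := Γ.comp ((ContinuousLinearMap.inr ℝ (Euc d) (Euc n × jetCoord (Euc n) (Euc n) q)).comp
    (ContinuousLinearMap.inr ℝ (Euc n) (jetCoord (Euc n) (Euc n) q)))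
  -- The linear map from the derivative of the jet of `h` to the translation of the vertical
  -- derivative.
  set Ξ := (postcomp (E := Euc n) Γ').comp (symmetrizeComp n q)
  have hid : Jet.of (Euc n) (Euc n) q id y = unitJet n q y := rfl
  have hidD : HasD 𝓘(ℝ, Euc n) 𝓘(ℝ, Euc n) (id : X → X) y (ContinuousLinearMap.id ℝ (Euc n)) :=
    hasD_id y
  -- The formula for the vertical derivative is applied to `φ` and to the identity, which fixes the
  -- jet of `s`. The two instances differ only in the derivative of the jet of `h`, where `φ = id +
  -- h`.
  have key : ∀ {s : X → B} {φ ψ : X → X}, IsSec n d π s y → s y = u → LocDiff n φ ψ y →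
      φ y = y → Jet.of (Euc n) (Euc n) q φ y = unitJet n q y →
      ∀ {h : Euc n → Euc n}, (∀ᶠ z in 𝓝 (χ y), ContDiffAt ℝ ∞ h z) →
      χ ∘ φ ∘ χ.symm =ᶠ[𝓝 (χ y)] (χ ∘ id ∘ χ.symm) + h →
      T (A.pact (Jet.of (Euc n) (Euc d) 1 s y) (Jet.of (Euc n) (Euc n) (q + 1) φ y)) =
        T (Jet.of (Euc n) (Euc d) 1 s y) + Ξ (jetDeriv q h (χ y)) := by
    intro s φ ψ hs hsu hφ hφy hφq h hh hφh
    obtain ⟨D, hD⟩ := SmNear.exists_hasD hs.smooth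
    have e1 := hΓ hs hsu hφ hφy hφq (hasD_id_of_jet_eq hq hφ hφq) hD
      (hasD_jet_of_fixed hφ.smooth hφy)
    have e2 := hΓ hs hsu (locInv_id y) rfl hid hidD hD (hasD_jet_of_fixed (smoothNear_id y) rfl)
    have e3 : A.pact (Jet.of (Euc n) (Euc d) 1 s y) (Jet.of (Euc n) (Euc n) (q + 1) id y) =
        Jet.of (Euc n) (Euc d) 1 s y := by
      have := A.pact_unit (hs.mem 1)
      rwa [Jet.src_of] at this
    rw [e3] at e2
    have hidc : ∀ᶠ z in 𝓝 (χ y), ContDiffAt ℝ ∞ (χ ∘ id ∘ χ.symm) z := by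
      have : χ.target ∈ 𝓝 (χ y) := χ.open_target.mem_nhds (χ.map_source (mem_chart_source _ _))
      filter_upwards [eventually_mem_nhds_iff.2 this] with z hz
      refine contDiffAt_id.congr_of_eventuallyEq ?_
      filter_upwards [hz] with z hz
      exact χ.right_inv hz
    rw [e1, e2, jetDeriv_congr hφh, jetDeriv_add hidc hh, map_add]
    exact comp_prod_prod_add Γ D (ContinuousLinearMap.id ℝ (Euc n))
      (symmetrizeComp n q (jetDeriv q (χ ∘ id ∘ χ.symm) (χ y)))
      (symmetrizeComp n q (jetDeriv q h (χ y)))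
  refine ⟨vanishingJetImage (Euc n) q (χ y) Ξ, fun w hw w' hw' => ⟨?_, ?_⟩⟩
  · rintro ⟨h, h1, h2, h3⟩
    obtain ⟨s, hs, hsu, rfl⟩ := exists_sec_of_mem_jetsThrough hw
    obtain ⟨φ, ψ, hφ, hφy, hφq, hφh⟩ := exists_locDiff_of_vanishing hq h1 h2
    have hk : Jet.of (Euc n) (Euc n) (q + 1) φ y ∈ kernel n q y :=
      ⟨⟨hφ.jet_mem, Jet.src_of _ _, (Jet.tgt_of _ _).trans hφy⟩,
        (Jet.proj_of hφ.smooth).trans hφq⟩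
    refine ⟨_, hk, ?_⟩
    rw [← hJ _ (A.pact_kernel_mem hw hk), ← hJ _ hw', key hs hsu hφ hφy hφq h1 hφh, ← h3]
    congr 1
    abel
  · rintro ⟨k, hk, rfl⟩
    obtain ⟨s, hs, hsu, rfl⟩ := exists_sec_of_mem_jetsThrough hw
    obtain ⟨φ, ψ, hφ, hkφ⟩ := exists_locDiff hk.1.1
    rw [hk.1.2.1] at hφ hkφ
    have hφy : φ y = y := by rw [← Jet.tgt_of (q := q + 1) (E := Euc n) (E' := Euc n) φ y, ← hkφ,
      hk.1.2.2]
    have hφq : Jet.of (Euc n) (Euc n) q φ y = unitJet n q y := by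
      rw [← Jet.proj_of hφ.smooth, ← hkφ, hk.2]
    have hc : ∀ {φ : X → X}, SmoothNear (Euc n) (Euc n) φ y → φ y = y →
        ∀ᶠ z in 𝓝 (χ y), ContDiffAt ℝ ∞ (χ ∘ φ ∘ χ.symm) z := by
      intro φ hφ hφy
      have h1 : SmNear 𝓘(ℝ, Euc n) 𝓘(ℝ, Euc n) (fun z => φ (χ.symm z)) (χ y) :=
        SmNear.comp_eq hφ Jet.smNear_chart_symm (χ.left_inv (mem_chart_source _ y))
      exact smNear_iff_contDiffAt.1 (SmNear.comp_eq (g := χ) Jet.smNear_chart h1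
        (by
          change φ (χ.symm (χ y)) = y
          rw [χ.left_inv (mem_chart_source _ y), hφy]))
    have h1 := hc hφ.smooth hφy
    have h2 := hc (smoothNear_id y) rfl
    obtain ⟨-, hd⟩ := (Jet.of_eq_of_iff hφ.smooth (smoothNear_id y)).1 hφq
    rw [hφy] at hd
    have hh : ∀ᶠ z in 𝓝 (χ y), ContDiffAt ℝ ∞ (χ ∘ φ ∘ χ.symm - χ ∘ id ∘ χ.symm) z := by
      filter_upwards [h1, h2] with z e1 e2 using e1.sub e2
    -- For an element of the kernel, `h` is the difference of the coordinate expressions of `φ` and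
    -- the identity; it vanishes to order `q` since the `q`-jets agree.
    refine ⟨χ ∘ φ ∘ χ.symm - χ ∘ id ∘ χ.symm, hh, fun i hi => ?_, ?_⟩
    · rw [iteratedFDeriv_sub_apply (h1.self_of_nhds.of_le (nat_le_infty i))
        (h2.self_of_nhds.of_le (nat_le_infty i)), hd i hi, sub_self]
    · rw [hkφ, key hs hsu hφ hφy hφq hh (by rw [add_sub_cancel])]
      exact add_sub_cancel_left _ _

/-- A 0-jet consists of source and target, so the isotropy group of order zero is trivial and
transitivity leaves only one point in each fibre. -/
lemma subsingleton_fibre_of_order_zero (A : JetAction n d 0 π) (hA : A.IsHomogeneous) {b c : B}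
    (h : π b = π c) : b = c := by
  obtain ⟨g, hg, hgc⟩ := hA b c h
  obtain ⟨φ, ψ, hφ, hgφ⟩ := exists_locDiff hg.1
  have : g = unitJet n 0 (π b) := by
    rw [hg.2.1] at hφ hgφ
    have h1 : φ (π b) = π b := by
      rw [← Jet.tgt_of (q := 0) (E := Euc n) (E' := Euc n) φ (π b), ← hgφ, hg.2.2]
    rw [hgφ]
    refine (Jet.of_eq_of_iff hφ.smooth (smoothNear_id _)).2 ⟨h1, fun i hi => ?_⟩
    obtain rfl : i = 0 := Nat.le_zero.1 hi
    ext v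
    simp [h1]
  rw [← hgc, this, A.act_unit]

/-- Smooth invariants that separate the orbits of the kernel of `Π_{q+1} → Π_q` on the 1-jets of
sections through a given point. -/
theorem exists_kernel_invariants (hF : HasFibredCharts n d r π) (hA : A.IsHomogeneous) (u : B) :
    ∃ (m : ℕ) (μ : Jet (Euc n) (Euc d) X B 1 → Euc m),
      (∀ w ∈ jetsThrough n d π u,
        SmOn (jetModel n d 1) 𝓘(ℝ, Euc m) (jetsThrough n d π u) μ w) ∧
      (∀ w ∈ jetsThrough n d π u, ∀ w' ∈ jetsThrough n d π u,
        μ w = μ w' ↔ ∃ k ∈ kernel n q (π u), A.pact w k = w') ∧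
      ∀ w ∈ jetsThrough n d π u, ∃ ζ : Euc m → Jet (Euc n) (Euc d) X B 1,
        (∀ v, SmNear 𝓘(ℝ, Euc m) (jetModel n d 1) ζ v ∧ ζ v ∈ jetsThrough n d π u ∧
          μ (ζ v) = v) ∧ ζ (μ w) = w := by
  obtain ⟨κ, T, J, hκ, hTs, hJ, hJT, hT⟩ := exists_jetsThrough_coordinates hF u
  obtain ⟨V, hV⟩ : ∃ V : Submodule ℝ (Euc n →L[ℝ] Euc r), ∀ w ∈ jetsThrough n d π u,
      ∀ w' ∈ jetsThrough n d π u, T w' - T w ∈ V ↔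
        ∃ k ∈ kernel n q (π u), A.pact w k = w' := by
    -- For `q = 0` the kernel is not described by maps `id + h`. But then all local sections near `π
    -- u` coincide, there is one jet through `u`, and any subspace would do.
    rcases Nat.eq_zero_or_pos q with rfl | hq
    · refine ⟨⊤, fun w hw w' hw' => ⟨fun _ => ⟨_, kernel_unit _, ?_⟩, fun _ => trivial⟩⟩
      obtain ⟨s, hs, hsu, rfl⟩ := exists_sec_of_mem_jetsThrough hw
      obtain ⟨s', hs', hsu', rfl⟩ := exists_sec_of_mem_jetsThrough hw'
      have h1 := A.pact_unit (hs.mem 1)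
      rw [Jet.src_of] at h1
      rw [h1]
      refine Jet.of_congr hs'.smooth ?_
      filter_upwards [hs.sec, hs'.sec] with x e1 e2
      exact A.subsingleton_fibre_of_order_zero hA (e1.trans e2.symm)
    · exact A.exists_kernel_translations hq hκ hJT hT
  -- The invariant is the projection to a complement `W` of the subspace of translations, along that
  -- subspace.
  obtain ⟨W, hW⟩ := V.exists_isCompl
  set m := Module.finrank ℝ W
  have hm : Module.finrank ℝ W = Module.finrank ℝ (Euc m) := by rw [finrank_euclideanSpace_fin]
  set e : W ≃L[ℝ] Euc m := ContinuousLinearEquiv.ofFinrankEq (𝕜 := ℝ) (E := W) (F := Euc m) hm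
  set P : (Euc n →L[ℝ] Euc r) →ₗ[ℝ] W := W.projectionOnto V hW.symm
  set μ' : (Euc n →L[ℝ] Euc r) →L[ℝ] Euc m :=
    LinearMap.toContinuousLinearMap (e.toLinearEquiv.toLinearMap.comp P)
  set R : Euc m →L[ℝ] (Euc n →L[ℝ] Euc r) := W.subtypeL.comp (e.symm : Euc m →L[ℝ] W)
  have hμR : ∀ v, μ' (R v) = v := fun v => by
    change e (P (e.symm v : W)) = v
    rw [show P ((e.symm v : W) : Euc n →L[ℝ] Euc r) = e.symm v from
      Submodule.projectionOnto_apply_left hW.symm _]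
    exact e.apply_symm_apply v
  have hker : ∀ L, μ' L = 0 ↔ L ∈ V := fun L => by
    change e (P L) = 0 ↔ _
    rw [map_eq_zero_iff e e.injective]
    exact Submodule.projectionOnto_apply_eq_zero_iff hW.symm
  refine ⟨m, fun w => μ' (T w), fun w hw => ?_, fun w hw w' hw' => ?_, fun w hw => ?_⟩
  · exact SmNear.comp_smOn hw (ContDiff.smNear μ'.contDiff (T w)) (hTs w hw)
  · rw [← hV w hw w' hw', ← hker, map_sub, sub_eq_zero, eq_comm]
  -- The jet `w` is moved along `W` only, so this section of the invariant passes through `w` at the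
  -- value of `w`.
  · refine ⟨fun v => J (T w + R (v - μ' (T w))), fun v => ⟨?_, (hJ _).2.1, ?_⟩, ?_⟩
    · refine SmNear.comp_eq (f := fun v => T w + R (v - μ' (T w))) (hJ _).1 ?_ rfl
      exact ContDiff.smNear (contDiff_const.add (R.contDiff.comp
        (contDiff_id.sub contDiff_const))) v
    · dsimp only
      rw [(hJ _).2.2, map_add, hμR, add_sub_cancel]
    · dsimp only
      rw [sub_self, map_zero, add_zero, hJT w hw]

end JetAction

end KernelInvariants

/-! ### Quotient manifolds from slices -/

section Quotients

variable {E H M E' H' N E'' H'' P V Q : Type*}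
  [NormedAddCommGroup E] [NormedSpace ℝ E] [TopologicalSpace H]
  [TopologicalSpace M] [ChartedSpace H M] {I : ModelWithCorners ℝ E H}
  [NormedAddCommGroup E'] [NormedSpace ℝ E'] [TopologicalSpace H']
  [TopologicalSpace N] [ChartedSpace H' N] {J : ModelWithCorners ℝ E' H'}
  [NormedAddCommGroup E''] [NormedSpace ℝ E''] [TopologicalSpace H'']
  [TopologicalSpace P] [ChartedSpace H'' P] {K : ModelWithCorners ℝ E'' H''}
  [NormedAddCommGroup V] [NormedSpace ℝ V]

/-- Coordinates `κ` on a part `U` of a quotient `p : S → Q` of a subset of a manifold, together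
with a smooth section `σ` of the quotient map in these coordinates. -/
structure QuotientSlice (I : ModelWithCorners ℝ E H) (V : Type*) [NormedAddCommGroup V]
    [NormedSpace ℝ V] {S : Set M} (p : S → Q) where
  U : Set Q
  Ω : Set V
  κ : M → V
  σ : V → M
  isOpen_target : IsOpen Ω
  isOpen_preimage : IsOpen (p ⁻¹' U)
  smooth : ∀ w : S, p w ∈ U → SmOn I 𝓘(ℝ, V) S κ w
  mem : ∀ w : S, p w ∈ U → κ w ∈ Ω
  inj : ∀ w w' : S, p w ∈ U → p w' ∈ U → κ w = κ w' → p w = p w'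
  congr : ∀ w w' : S, p w ∈ U → p w = p w' → κ w = κ w'
  smooth_symm : ∀ v ∈ Ω, SmNear 𝓘(ℝ, V) I σ v
  symm_mem : ∀ v ∈ Ω, ∃ h : σ v ∈ S, p ⟨σ v, h⟩ ∈ U ∧ κ (σ v) = v

namespace QuotientSlice

variable {S : Set M} {p : S → Q} (hp : Function.Surjective p) [Nonempty Q]

/-- The chart of the quotient that is given by a slice. -/
def chart (s : QuotientSlice I V p) : PartialEquiv Q V where
  toFun z := s.κ ((Function.surjInv hp z : S) : M)
  invFun v := open Classical in
    if h : s.σ v ∈ S then p ⟨s.σ v, h⟩ else Classical.arbitrary Q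
  source := s.U
  target := s.Ω
  map_source' z hz := s.mem _ (by rwa [Function.surjInv_eq hp])
  map_target' v hv := by
    obtain ⟨h1, h2, h3⟩ := s.symm_mem v hv
    rwa [dif_pos h1]
  left_inv' z hz := by
    have h0 : p (Function.surjInv hp z) ∈ s.U := by rwa [Function.surjInv_eq hp]
    obtain ⟨h1, h2, h3⟩ := s.symm_mem _ (s.mem _ h0)
    exact (dif_pos h1).trans ((s.inj ⟨_, h1⟩ _ h2 h0 h3).trans (Function.surjInv_eq hp z))
  right_inv' v hv := by
    obtain ⟨h1, h2, h3⟩ := s.symm_mem v hv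
    rw [dif_pos h1]
    exact (s.congr ⟨_, h1⟩ _ h2 (Function.surjInv_eq hp _).symm).symm.trans h3

lemma chart_apply (s : QuotientSlice I V p) (w : S) (hw : p w ∈ s.U) : s.chart hp (p w) = s.κ w :=
  (s.congr w _ hw (Function.surjInv_eq hp _).symm).symm

lemma chart_symm_apply (s : QuotientSlice I V p) {v : V} (h : s.σ v ∈ S) :
    (s.chart hp).symm v = p ⟨s.σ v, h⟩ := dif_pos h

/-- Read through the section `σ` of `s`, the overlap is the preimage of an open set of `M` that cuts
out the saturated part of `S` over `t.U`. -/
lemma isOpen_chart_trans (s t : QuotientSlice I V p) :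
    IsOpen ((s.chart hp).symm.trans (t.chart hp)).source := by
  obtain ⟨O, hO, hOt⟩ := isOpen_induced_iff.1 t.isOpen_preimage
  have : ((s.chart hp).symm.trans (t.chart hp)).source = s.Ω ∩ s.σ ⁻¹' O := by
    ext v
    rw [PartialEquiv.trans_source]
    refine and_congr_right fun hv => ?_
    obtain ⟨h1, h2, h3⟩ := s.symm_mem v hv
    change (s.chart hp).symm v ∈ t.U ↔ _
    rw [s.chart_symm_apply hp h1]
    exact (Set.ext_iff.1 hOt ⟨_, h1⟩).symm
  rw [this]
  exact ContinuousOn.isOpen_inter_preimage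
    (fun v hv => (s.smooth_symm v hv).continuousAt.continuousWithinAt) s.isOpen_target hO

/-- The transition map is the coordinate of `t` on the section of `s`, a composite of smooth maps in
which the quotient no longer occurs. -/
lemma smNear_chart_trans (s t : QuotientSlice I V p) {v : V}
    (hv : v ∈ ((s.chart hp).symm.trans (t.chart hp)).source) :
    SmNear 𝓘(ℝ, V) 𝓘(ℝ, V) (t.chart hp ∘ (s.chart hp).symm) v := by
  have hev : ∀ᶠ w in 𝓝 v, w ∈ ((s.chart hp).symm.trans (t.chart hp)).source :=
    (isOpen_chart_trans hp s t).mem_nhds hv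
  have key : ∀ w ∈ ((s.chart hp).symm.trans (t.chart hp)).source,
      ∃ h : s.σ w ∈ S, p ⟨s.σ w, h⟩ ∈ t.U := by
    intro w hw
    rw [PartialEquiv.trans_source] at hw
    obtain ⟨h1, -, -⟩ := s.symm_mem w hw.1
    refine ⟨h1, ?_⟩
    rw [← s.chart_symm_apply hp h1]
    exact hw.2
  obtain ⟨h1, h2⟩ := key v hv
  refine SmNear.congr (f := fun w => t.κ (s.σ w))
    (SmOn.comp_smNear (f := s.σ) (t.smooth ⟨_, h1⟩ h2) (s.smooth_symm v hv.1) ?_) ?_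
  · filter_upwards [hev] with w hw
    exact (key w hw).1
  · filter_upwards [hev] with w hw
    obtain ⟨h1, h2⟩ := key w hw
    simp only [Function.comp]
    rw [s.chart_symm_apply hp h1, t.chart_apply hp _ h2]

end QuotientSlice

/-- The slice charts define the topology and the atlas at once. In a slice chart, `p` is the
coordinate `κ`, hence smooth, and `σ` is a local section; the condition `σ (κ x) = x` makes it pass
through `x`. -/
lemma exists_quotient_manifold_of_nonempty {S : Set M} {p : S → Q} (hp : Function.Surjective p) [Nonempty Q]
    (hs : ∀ x : S, ∃ s : QuotientSlice I V p, p x ∈ s.U ∧ s.σ (s.κ x) = x) :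
    ∃ (_ : TopologicalSpace Q) (_ : ChartedSpace V Q), IsManifold 𝓘(ℝ, V) ∞ Q ∧
      IsSubmersionOnSubset I 𝓘(ℝ, V) p := by
  choose sl hsl1 hsl2 using hs
  let c : ChartedSpaceCore V Q :=
    { atlas := {e | ∃ s : QuotientSlice I V p, e = s.chart hp}
      chartAt := fun z => (sl (Function.surjInv hp z)).chart hp
      mem_chart_source := fun z => by
        have := hsl1 (Function.surjInv hp z)
        rwa [Function.surjInv_eq hp] at this
      chart_mem_atlas := fun z => ⟨_, rfl⟩
      open_source := by
        rintro _ _ ⟨s, rfl⟩ ⟨t, rfl⟩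
        exact QuotientSlice.isOpen_chart_trans hp s t
      continuousOn_toFun := by
        rintro _ _ ⟨s, rfl⟩ ⟨t, rfl⟩ v hv
        exact (QuotientSlice.smNear_chart_trans hp s t hv).continuousAt.continuousWithinAt }
  let _ := c.toTopologicalSpace
  let _ := c.toChartedSpace
  have hman : IsManifold 𝓘(ℝ, V) ∞ Q := by
    apply isManifold_of_contDiffOn
    intro a b ha hb
    change a ∈ ⋃ (e : PartialEquiv Q V) (he : e ∈ c.atlas), _ at ha
    change b ∈ ⋃ (e : PartialEquiv Q V) (he : e ∈ c.atlas), _ at hb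
    simp only [mem_iUnion, mem_singleton_iff] at ha hb
    obtain ⟨_, ⟨s, rfl⟩, rfl⟩ := ha
    obtain ⟨_, ⟨t, rfl⟩, rfl⟩ := hb
    intro v hv
    have hv' : v ∈ ((s.chart hp).symm.trans (t.chart hp)).source := by
      rw [PartialEquiv.trans_source]
      rw [modelWithCornersSelf_coe, modelWithCornersSelf_coe_symm, range_id, inter_univ,
        preimage_id, OpenPartialHomeomorph.trans_source] at hv
      exact hv
    exact (QuotientSlice.smNear_chart_trans hp s t hv').contDiffAt.contDiffWithinAt
  refine ⟨_, _, hman, ?_⟩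
  have hchart : ∀ s : QuotientSlice I V p, ∃ e ∈ IsManifold.maximalAtlas 𝓘(ℝ, V) ∞ Q,
      e.source = s.U ∧ e.target = s.Ω ∧ (∀ w : S, p w ∈ s.U → e (p w) = s.κ w) ∧
      ∀ v (h : s.σ v ∈ S), e.symm v = p ⟨s.σ v, h⟩ := by
    intro s
    refine ⟨c.openPartialHomeomorph (s.chart hp) ⟨s, rfl⟩, ?_, rfl, rfl, s.chart_apply hp,
      fun v h => s.chart_symm_apply hp h⟩
    refine IsManifold.subset_maximalAtlas ?_
    change _ ∈ ⋃ (e : PartialEquiv Q V) (he : e ∈ c.atlas), {c.openPartialHomeomorph e he}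
    simp only [mem_iUnion, mem_singleton_iff]
    exact ⟨_, ⟨s, rfl⟩, rfl⟩
  have key : ∀ x : S, ∃ s : QuotientSlice I V p, ∃ e ∈ IsManifold.maximalAtlas 𝓘(ℝ, V) ∞ Q,
      (p x ∈ s.U ∧ s.σ (s.κ x) = x) ∧
      e.source = s.U ∧ e.target = s.Ω ∧ (∀ w : S, p w ∈ s.U → e (p w) = s.κ w) ∧
      ∀ v (h : s.σ v ∈ S), e.symm v = p ⟨s.σ v, h⟩ := fun x => by
    obtain ⟨e, he⟩ := hchart (sl x)
    exact ⟨sl x, e, he.1, ⟨hsl1 x, hsl2 x⟩, he.2⟩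
  constructor
  · refine smoothOnSubset_of_smOn fun x => ?_
    obtain ⟨s, e, he, ⟨hx1, hx2⟩, h1, h2, h3, h4⟩ := key x
    -- The value off `S` is irrelevant; it exists because `Q` is nonempty.
    refine ⟨fun m => open Classical in if h : m ∈ S then p ⟨m, h⟩ else Classical.arbitrary Q, ?_,
      fun y => dif_pos y.2⟩
    have hes : SmNear 𝓘(ℝ, V) 𝓘(ℝ, V) e.symm (s.κ x) :=
      smNear_of_contMDiffOn (contMDiffOn_symm_of_mem_maximalAtlas he)
        (e.open_target.mem_nhds (h2 ▸ s.mem x hx1))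
    refine (SmNear.comp_smOn x.2 hes (s.smooth x hx1)).congr ?_
    obtain ⟨O, hO, hOs⟩ := isOpen_induced_iff.1 s.isOpen_preimage
    have hxO : (x : M) ∈ O := (Set.ext_iff.1 hOs x).2 hx1
    filter_upwards [self_mem_nhdsWithin, mem_nhdsWithin_of_mem_nhds (hO.mem_nhds hxO)] with m hm hmO
    have hmU : p ⟨m, hm⟩ ∈ s.U := (Set.ext_iff.1 hOs ⟨m, hm⟩).1 hmO
    rw [dif_pos hm, ← h3 _ hmU, e.left_inv (h1 ▸ hmU)]
  · intro x
    obtain ⟨s, e, he, ⟨hx1, hx2⟩, h1, h2, h3, h4⟩ := key x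
    have hcon : ContMDiffOn 𝓘(ℝ, V) 𝓘(ℝ, V) ∞ e e.source := contMDiffOn_of_mem_maximalAtlas he
    have hσ : ∀ z ∈ s.U, ∃ h : s.σ (e z) ∈ S, p ⟨_, h⟩ = z := by
      intro z hz
      obtain ⟨h5, -, -⟩ := s.symm_mem (e z) (h2 ▸ e.map_source (h1 ▸ hz))
      refine ⟨h5, ?_⟩
      rw [← h4, e.left_inv (h1 ▸ hz)]
    refine ⟨s.U, by rw [← h1]; exact e.open_source.mem_nhds (h1 ▸ hx1),
      fun z => open Classical in if h : s.σ (e z) ∈ S then ⟨_, h⟩ else x, ?_, ?_, ?_⟩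
    · have h5 : s.σ (e (p x)) = x := by rw [h3 x hx1, hx2]
      have h6 : s.σ (e (p x)) ∈ S := by rw [h5]; exact x.2
      exact (dif_pos h6).trans (Subtype.ext h5)
    · intro z hz
      have hz' : z ∈ e.source := h1 ▸ hz
      have hsm : ContMDiffWithinAt 𝓘(ℝ, V) I ∞ (fun z => s.σ (e z)) s.U z := by
        have h6 := (s.smooth_symm (e z) (h2 ▸ e.map_source hz')).contMDiffAt
        exact ContMDiffAt.comp_contMDiffWithinAt z h6 ((hcon z hz').mono h1.symm.subset)
      refine hsm.congr (fun y hy => ?_) ?_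
      · exact congrArg Subtype.val (dif_pos (hσ y hy).1)
      · exact congrArg Subtype.val (dif_pos (hσ z hz).1)
    · intro z hz
      exact (congrArg p (dif_pos (hσ z hz).1)).trans (hσ z hz).2

/-- A quotient with slices through all points is a quotient manifold. -/
theorem exists_quotient_manifold {S : Set M} {p : S → Q} (hp : Function.Surjective p)
    (hs : ∀ x : S, ∃ s : QuotientSlice I V p, p x ∈ s.U ∧ s.σ (s.κ x) = x) :
    ∃ (_ : TopologicalSpace Q) (_ : ChartedSpace V Q), IsManifold 𝓘(ℝ, V) ∞ Q ∧
      IsSubmersionOnSubset I 𝓘(ℝ, V) p := by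
  rcases isEmpty_or_nonempty Q with hQ | hQ
  · let _ : TopologicalSpace Q := ⊥
    let _ : ChartedSpace V Q := ChartedSpace.empty V Q
    refine ⟨_, _, isManifold_of_contDiffOn _ _ _ ?_, ?_, ?_⟩
    · intro e e' he
      exact he.elim
    · exact fun x => hQ.elim (p x)
    · exact fun x => hQ.elim (p x)
  · exact exists_quotient_manifold_of_nonempty hp hs

section Submersion

variable [TopologicalSpace Q] [ChartedSpace V Q] {S : Set M} {p : S → Q}

lemma IsSubmersionOnSubset.exists_section (h : IsSubmersionOnSubset I 𝓘(ℝ, V) p) (x : S) :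
    ∃ σ : Q → S, σ (p x) = x ∧ SmNear 𝓘(ℝ, V) I (fun z => (σ z : M)) (p x) ∧
      ∀ᶠ z in 𝓝 (p x), p (σ z) = z := by
  obtain ⟨W, hW, σ, h1, h2, h3⟩ := h.2 x
  exact ⟨σ, h1, smNear_of_contMDiffOn h2 hW, by filter_upwards [hW] with z hz using h3 z hz⟩

/-- Smooth maps on the total space of a submersion descend. -/
lemma IsSubmersionOnSubset.descend (h : IsSubmersionOnSubset I 𝓘(ℝ, V) p) {f : Q → N} {g : M → N}
    {x : S} (hg : SmOn I J S g x) (hfg : ∀ᶠ w : S in 𝓝 x, f (p w) = g w) :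
    SmNear 𝓘(ℝ, V) J f (p x) := by
  obtain ⟨σ, h1, h2, h3⟩ := h.exists_section x
  have hg' : SmOn I J S g ((σ (p x) : S) : M) := by rwa [h1]
  refine SmNear.congr (f := fun z : Q => g (σ z : M)) (hg'.comp_smNear (f := fun z : Q => (σ z : M))
    h2 (Eventually.of_forall fun z : Q => (σ z).2)) ?_
  have ht : Tendsto σ (𝓝 (p x)) (𝓝 x) := by
    rw [tendsto_subtype_rng]
    have := h2.continuousAt.tendsto
    rwa [h1] at this
  filter_upwards [h3, ht.eventually hfg] with z hz1 hz2
  rw [← hz2, hz1]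

lemma IsSubmersionOnSubset.continuous (h : IsSubmersionOnSubset I 𝓘(ℝ, V) p) : Continuous p := by
  refine continuous_iff_continuousAt.2 fun x => ?_
  obtain ⟨U, hU, g, hg, hgp⟩ := h.1 x
  have h1 : ContinuousAt g x := (hg.contMDiffAt hU).continuousAt
  have h2 : Tendsto (fun y : S => g y) (𝓝 x) (𝓝 (p x)) := by
    rw [← hgp x (mem_of_mem_nhds hU)]
    exact h1.tendsto.comp continuousAt_subtype_val
  refine h2.congr' ?_
  filter_upwards [continuousAt_subtype_val.preimage_mem_nhds hU] with y hy
  exact hgp y hy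

/-- A continuous local section through `x` maps points near `p x` into any given neighbourhood of
`x`, so the image of that neighbourhood is a neighbourhood of `p x`. -/
lemma IsSubmersionOnSubset.isOpenMap (h : IsSubmersionOnSubset I 𝓘(ℝ, V) p) : IsOpenMap p := by
  refine isOpenMap_iff_nhds_le.2 fun x => ?_
  obtain ⟨σ, h1, h2, h3⟩ := h.exists_section x
  intro O hO
  have ht : Tendsto σ (𝓝 (p x)) (𝓝 x) := by
    rw [tendsto_subtype_rng]
    have := h2.continuousAt.tendsto
    rwa [h1] at this
  filter_upwards [h3, ht.eventually (mem_map.1 hO)] with z hz1 hz2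
  have : p (σ z) ∈ O := hz2
  rwa [hz1] at this

lemma IsSubmersionOnSubset.secondCountableTopology (h : IsSubmersionOnSubset I 𝓘(ℝ, V) p)
    (hp : Function.Surjective p) [SecondCountableTopology M] : SecondCountableTopology Q :=
  (h.isOpenMap.isQuotientMap h.continuous hp).secondCountableTopology h.isOpenMap

end Submersion

lemma exists_disjoint_of_continuousOn {Q Y : Type*} [TopologicalSpace Q] [TopologicalSpace Y]
    [T2Space Y] {U : Set Q} (hU : IsOpen U) {g : Q → Y} (hg : ContinuousOn g U) {z z' : Q}
    (hz : z ∈ U) (hz' : z' ∈ U) (hne : g z ≠ g z') :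
    ∃ u v : Set Q, IsOpen u ∧ IsOpen v ∧ z ∈ u ∧ z' ∈ v ∧ Disjoint u v := by
  obtain ⟨a, b, ha, hb, hza, hzb, hab⟩ := t2_separation hne
  exact ⟨U ∩ g ⁻¹' a, U ∩ g ⁻¹' b, hg.isOpen_inter_preimage hU ha, hg.isOpen_inter_preimage hU hb,
    ⟨hz, hza⟩, ⟨hz', hzb⟩, (hab.preimage g).mono inter_subset_right inter_subset_right⟩

/-- Change the coordinates of a slice by a linear isomorphism. -/
def QuotientSlice.trans {V' : Type*} [NormedAddCommGroup V'] [NormedSpace ℝ V'] {S : Set M}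
    {p : S → Q} (s : QuotientSlice I V p) (e : V ≃L[ℝ] V') : QuotientSlice I V' p where
  U := s.U
  Ω := e.symm ⁻¹' s.Ω
  κ := fun x => e (s.κ x)
  σ := fun v => s.σ (e.symm v)
  isOpen_target := s.isOpen_target.preimage e.symm.continuous
  isOpen_preimage := s.isOpen_preimage
  smooth w hw := SmNear.comp_smOn w.2 (ContDiff.smNear e.contDiff _) (s.smooth w hw)
  mem w hw := by
    rw [mem_preimage, e.symm_apply_apply]
    exact s.mem w hw
  inj w w' hw hw' h := s.inj w w' hw hw' (e.injective h)
  congr w w' hw h := congrArg e (s.congr w w' hw h)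
  smooth_symm v hv := SmNear.comp (s.smooth_symm _ hv) (ContDiff.smNear e.symm.contDiff v)
  symm_mem v hv := by
    obtain ⟨h1, h2, h3⟩ := s.symm_mem _ hv
    exact ⟨h1, h2, by rw [h3, e.apply_symm_apply]⟩

/-- The slice coordinate descends to a continuous injection of an open subset of `Q` into a
Hausdorff space. -/
lemma QuotientSlice.exists_disjoint [TopologicalSpace Q] [ChartedSpace V Q] {V' : Type*}
    [NormedAddCommGroup V'] [NormedSpace ℝ V'] {S : Set M} {p : S → Q}
    (hp : Function.Surjective p) (h : IsSubmersionOnSubset I 𝓘(ℝ, V) p)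
    (s : QuotientSlice I V' p) {z z' : Q} (hz : z ∈ s.U) (hz' : z' ∈ s.U) (hne : z ≠ z') :
    ∃ u v : Set Q, IsOpen u ∧ IsOpen v ∧ z ∈ u ∧ z' ∈ v ∧ Disjoint u v := by
  have : Nonempty Q := ⟨z⟩
  have hU : IsOpen s.U := ((h.isOpenMap.isQuotientMap h.continuous hp).isOpen_preimage).1
    s.isOpen_preimage
  refine exists_disjoint_of_continuousOn hU (g := s.chart hp) (fun y hy => ?_) hz hz' ?_
  · obtain ⟨w, rfl⟩ := hp y
    refine (SmNear.continuousAt (I := 𝓘(ℝ, V)) (J := 𝓘(ℝ, V')) (h.descend (s.smooth w hy)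
      ?_)).continuousWithinAt
    filter_upwards [s.isOpen_preimage.mem_nhds hy] with x hx
    exact s.chart_apply hp x hx
  · obtain ⟨w, rfl⟩ := hp z
    obtain ⟨w', rfl⟩ := hp z'
    rw [s.chart_apply hp w hz, s.chart_apply hp w' hz']
    exact fun h => hne (s.inj w w' hz hz' h)

end Quotients

/-! ### Second countability of jet manifolds -/

section SecondCountable

variable {E E' M N : Type*} [NormedAddCommGroup E] [NormedSpace ℝ E] [FiniteDimensional ℝ E]
  [NormedAddCommGroup E'] [NormedSpace ℝ E'] [FiniteDimensional ℝ E']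
  [TopologicalSpace M] [ChartedSpace E M] [TopologicalSpace N] [ChartedSpace E' N]
  [IsManifold 𝓘(ℝ, E) ∞ M] [IsManifold 𝓘(ℝ, E') ∞ N]
  [SecondCountableTopology M] [SecondCountableTopology N]

/-- Chart domains of jets are given by source and target, so a countable cover of `M × N` by
products of chart domains yields a countable atlas; jets of constant maps serve as its base points.
-/
lemma secondCountableTopology_jet (q : ℕ) : SecondCountableTopology (Jet E E' M N q) := by
  have := finiteDimensional_jetCoord E E' q
  have : ProperSpace (jetCoord E E' q) := FiniteDimensional.proper_real _
  have : ProperSpace E := FiniteDimensional.proper_real _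
  have : SecondCountableTopology E := secondCountable_of_proper
  have : SecondCountableTopology (jetCoord E E' q) := secondCountable_of_proper
  have : SecondCountableTopology (E × jetCoord E E' q) := inferInstance
  obtain ⟨t, ht, htc⟩ := TopologicalSpace.countable_cover_nhds
    (f := fun p : M × N => (chartAt E p.1).source ×ˢ (chartAt E' p.2).source) fun p =>
      prod_mem_nhds (chart_source_mem_nhds E p.1) (chart_source_mem_nhds E' p.2)
  refine ChartedSpace.secondCountable_of_countable_cover (E × jetCoord E E' q)
    (s := (fun p : M × N => Jet.of E E' q (fun _ => p.2) p.1) '' t) ?_ (ht.image _)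
  refine eq_univ_of_forall fun j => ?_
  obtain ⟨p, hp, h1, h2⟩ := mem_iUnion₂.1 (htc ▸ mem_univ (j.src, j.tgt))
  refine mem_iUnion₂.2 ⟨_, ⟨p, hp, rfl⟩, ?_⟩
  rw [Jet.mem_chartAt_source, Jet.src_of, Jet.tgt_of]
  exact ⟨h1, h2⟩

end SecondCountable

/-! ### The manifold `F_1` -/

section KernelQuotient

variable {n d r q : ℕ} {X B : Type*} [TopologicalSpace X] [ChartedSpace (Euc n) X]
  [TopologicalSpace B] [ChartedSpace (Euc d) B]
  [IsManifold 𝓘(ℝ, Euc n) ∞ X] [IsManifold 𝓘(ℝ, Euc d) ∞ B] {π : B → X}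

/-- Kernels of a groupoid morphism are normal: conjugation by an arrow carries the kernel at its
target to the kernel at its source. -/
lemma kernel_conj {x y : X} {g k : SelfJet n X (q + 1)} (hg : g ∈ fullJetGroupoid n X (q + 1))
    (hgs : g.src = x) (hgt : g.tgt = y) (hk : k ∈ kernel n q y) :
    (jetInv g).comp (k.comp g) ∈ kernel n q x := by
  obtain ⟨⟨h1, h2, h3⟩, h4⟩ := hk
  have e1 : (k.comp g).tgt = g.tgt := by rw [Jet.tgt_comp (h2.trans hgt.symm), h3, hgt]
  have e2 := comp_mem h1 hg (h2.trans hgt.symm)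
  have e3 : (jetInv g).src = (k.comp g).tgt := (src_jetInv hg).trans e1.symm
  refine ⟨⟨comp_mem (jetInv_mem hg) e2 e3, ?_, ?_⟩, ?_⟩
  · rw [Jet.src_comp, Jet.src_comp, hgs]
  · rw [Jet.tgt_comp e3, tgt_jetInv hg, hgs]
  · rw [proj_comp_jet e3, proj_comp_jet (h2.trans hgt.symm), h4, proj_jetInv hg, ← hgt,
      ← Jet.tgt_proj, unit_jet_comp, jetInv_comp (proj_mem hg), Jet.src_proj, hgs]

lemma kernel_conj_jetInv {x y : X} {g k : SelfJet n X (q + 1)}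
    (hg : g ∈ fullJetGroupoid n X (q + 1)) (hgs : g.src = x) (hgt : g.tgt = y)
    (hk : k ∈ kernel n q x) : g.comp (k.comp (jetInv g)) ∈ kernel n q y := by
  obtain ⟨⟨h1, h2, h3⟩, h4⟩ := hk
  have e0 : k.src = (jetInv g).tgt := by rw [h2, tgt_jetInv hg, hgs]
  have e1 : g.src = (k.comp (jetInv g)).tgt := by rw [Jet.tgt_comp e0, h3, hgs]
  have e2 := comp_mem h1 (jetInv_mem hg) e0
  refine ⟨⟨comp_mem hg e2 e1, ?_, ?_⟩, ?_⟩
  · rw [Jet.src_comp, Jet.src_comp, src_jetInv hg, hgt]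
  · rw [Jet.tgt_comp e1, hgt]
  · rw [proj_comp_jet e1, proj_comp_jet e0, h4, proj_jetInv hg]
    have e3 : (jetInv g.proj).tgt = x := by rw [tgt_jetInv (proj_mem hg), Jet.src_proj, hgs]
    rw [← e3, unit_jet_comp, comp_jetInv (proj_mem hg), Jet.tgt_proj, hgt]

namespace JetAction

variable (A : JetAction n d q π)

lemma mem_pactDomain_isotropy {y : X} {w : Jet (Euc n) (Euc d) X B 1}
    (hw : w ∈ sectionJetsAt n d π y) {g : SelfJet n X (q + 1)} (hg : g ∈ isotropy n (q + 1) y) :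
    (w, g) ∈ pactDomain n d q π := ⟨hw.1, hg.1, hw.2.trans hg.2.2.symm⟩

lemma pact_mem_sectionJetsAt {y : X} {w : Jet (Euc n) (Euc d) X B 1}
    (hw : w ∈ sectionJetsAt n d π y) {g : SelfJet n X (q + 1)} (hg : g ∈ isotropy n (q + 1) y) :
    A.pact w g ∈ sectionJetsAt n d π y :=
  ⟨A.pact_mem (mem_pactDomain_isotropy hw hg),
    (A.src_pact (mem_pactDomain_isotropy hw hg)).trans hg.2.1⟩

lemma pact_jetInv_of_pact {w : Jet (Euc n) (Euc d) X B 1} {f : SelfJet n X (q + 1)}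
    (h : (w, f) ∈ pactDomain n d q π) : A.pact (A.pact w f) (jetInv f) = w := by
  have hf : f ∈ fullJetGroupoid n X (q + 1) := h.2.1
  have hs : w.src = f.tgt := h.2.2
  rw [← A.pact_comp h (jetInv_mem hf) (tgt_jetInv hf).symm, comp_jetInv hf, ← hs, A.pact_unit h.1]

lemma pact_pact_jetInv {w : Jet (Euc n) (Euc d) X B 1} {f : SelfJet n X (q + 1)}
    (hw : w ∈ sectionJets n d 1 π) (hf : f ∈ fullJetGroupoid n X (q + 1)) (h : w.src = f.src) :
    A.pact (A.pact w (jetInv f)) f = w := by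
  have hd : (w, jetInv f) ∈ pactDomain n d q π := ⟨hw, jetInv_mem hf, h.trans (tgt_jetInv hf).symm⟩
  rw [← A.pact_comp hd hf (src_jetInv hf), jetInv_comp hf, ← h, A.pact_unit hw]

lemma tgt_pact_kernel {y : X} {w : Jet (Euc n) (Euc d) X B 1} (hw : w ∈ sectionJetsAt n d π y)
    {k : SelfJet n X (q + 1)} (hk : k ∈ kernel n q y) : (A.pact w k).tgt = w.tgt := by
  rw [A.tgt_pact (mem_pactDomain_isotropy hw hk.1), hk.2, ← hw.2, ← π_tgt hw.1, A.act_unit]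

/-- The kernel is a group, so the relation that defines the quotient is already an equivalence
relation. -/
lemma toF₁_eq_iff {y : X} (w w' : sectionJetsAt n d π y) :
    A.toF₁ y w = A.toF₁ y w' ↔ ∃ k ∈ kernel n q y, A.pact w k = w' := by
  have hiff : ∀ w w' : sectionJetsAt n d π y, (∃ k ∈ kernel n q y, A.ProlongedAct w k w') ↔
      ∃ k ∈ kernel n q y, A.pact w k = w' := fun w w' =>
    exists_congr fun k => and_congr_right fun hk =>
      A.prolongedAct_iff.trans (and_iff_right (mem_pactDomain_isotropy w.2 hk.1))
  rw [← hiff]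
  refine Equivalence.quot_mk_eq_iff (r := fun w w' : sectionJetsAt n d π y =>
    ∃ k ∈ kernel n q y, A.ProlongedAct w k w') ⟨fun w => ?_, fun {w w'} h => ?_,
      fun {a b c} h h' => ?_⟩ w w'
  · rw [hiff]
    have h1 := A.pact_unit w.2.1
    rw [w.2.2] at h1
    exact ⟨_, kernel_unit y, h1⟩
  · rw [hiff] at h ⊢
    obtain ⟨k, hk, h⟩ := h
    exact ⟨_, kernel_jetInv hk, by
      rw [← h, A.pact_jetInv_of_pact (mem_pactDomain_isotropy w.2 hk.1)]⟩
  · rw [hiff] at h h' ⊢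
    obtain ⟨k, hk, h⟩ := h
    obtain ⟨l, hl, h'⟩ := h'
    exact ⟨_, kernel_comp hk hl, by
      rw [A.pact_comp (mem_pactDomain_isotropy a.2 hk.1) hl.1.1 (hk.1.2.1.trans hl.1.2.2.symm), h,
        h']⟩

lemma toF₁_surjective (y : X) : Function.Surjective (A.toF₁ y) := Quot.mk_surjective

/-- The value in `B` of a class of 1-jets of sections. -/
def value {y : X} : A.F₁ y → B :=
  Quot.lift (fun w => w.1.tgt) (by
    rintro w w' ⟨k, hk, h⟩
    obtain ⟨h1, h2⟩ := A.prolongedAct_iff.1 h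
    rw [← h2, A.tgt_pact_kernel w.2 hk])

section Slices

variable [T2Space X] [T2Space B]

/-- Orbit sections consist of `q`-jets, but 1-jets of sections are moved by `(q+1)`-jets; the orbit
section is therefore followed by a smooth lift of jets. -/
lemma exists_lift_orbitSection (hF : HasFibredCharts n d r π) (hA : A.IsHomogeneous) {u₀ b₀ : B}
    (hb₀ : π b₀ = π u₀) : ∃ (τ : B → SelfJet n X (q + 1)) (W : Set B), IsOpen W ∧ b₀ ∈ W ∧
      ∀ b ∈ W, SmNear 𝓘(ℝ, Euc d) (jetModel n n (q + 1)) τ b ∧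
        (τ b ∈ fullJetGroupoid n X (q + 1) ∧ (τ b).src = π b ∧ (τ b).tgt = π u₀ ∧
          A.act u₀ (τ b).proj = b) := by
  obtain ⟨g, hg, hgb⟩ := hA u₀ b₀ hb₀.symm
  obtain ⟨τ, hτ, hτg⟩ := A.exists_isOrbitSection hF hA u₀ hg.1 hg.2.2
  rw [hgb] at hτ hτg
  obtain ⟨h, hh, hhg⟩ := exists_lift_mem hg.1
  obtain ⟨l, hl, hlh, hlp⟩ := Jet.exists_lift h
  rw [hhg, ← hτg] at hl hlh hlp
  have h1 : SmNear 𝓘(ℝ, Euc d) (jetModel n n (q + 1)) (fun b => l (τ b)) b₀ := hl.comp hτ.smooth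
  have h2 : ∀ᶠ b in 𝓝 b₀, l (τ b) ∈ fullJetGroupoid n X (q + 1) := by
    refine h1.continuousAt.eventually (eventually_mem (f := l (τ b₀)) ?_)
    rwa [hlh]
  obtain ⟨W, hW, hWo, hbW⟩ := eventually_nhds_iff.1 (h1.eventually.and (h2.and
    ((hτ.smooth.continuousAt.eventually hlp).and hτ.sec)))
  refine ⟨fun b => l (τ b), W, hWo, hbW, fun b hb => ?_⟩
  obtain ⟨e1, e2, e3, e4, e5, e6, e7⟩ := hW b hb
  refine ⟨e1, e2, ?_, ?_, ?_⟩
  · rw [← Jet.src_proj, e3, e5]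
  · rw [← Jet.tgt_proj, e3, e6]
  · rw [e3, e7]

set_option maxHeartbeats 1000000 in
/-- Slices for the action of the kernel of `Π_{q+1} → Π_q` on a fibre of the bundle of 1-jets of
sections. -/
lemma exists_kernel_slices (hF : HasFibredCharts n d r π) (hA : A.IsHomogeneous) (u₀ : B) :
    ∃ r₁ : ℕ, ∀ w : sectionJetsAt n d π (π u₀),
      ∃ s : QuotientSlice (jetModel n d 1) (Euc r₁) (A.toF₁ (π u₀)),
        (∀ z, A.value z = w.1.tgt → z ∈ s.U) ∧ s.σ (s.κ w) = w := by
  obtain ⟨m, μ, hμ1, hμ2, hμ3⟩ := A.exists_kernel_invariants hF hA u₀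
  set y := π u₀ with hy
  -- The invariants are taken once, at `u₀`, and all other jets are moved there; so all slices have
  -- the same dimension.
  refine ⟨r + m, fun w₀ => ?_⟩
  have hπ : ∀ w ∈ sectionJetsAt n d π y, π w.tgt = y := fun w hw => (π_tgt hw.1).trans hw.2
  obtain ⟨τ, W, hW, hw₀W, hτ⟩ := A.exists_lift_orbitSection hF hA (hπ w₀ w₀.2)
  obtain ⟨Φ, hΦ0, hΦ1, hΦ2, hΦ3⟩ := hF w₀.1.tgt
  -- moving a jet to one through `u₀`, and back
  set N : Jet (Euc n) (Euc d) X B 1 → Jet (Euc n) (Euc d) X B 1 :=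
    fun w => A.pact w (jetInv (τ w.tgt)) with hN
  have hiso : ∀ b ∈ W, π b = y → τ b ∈ isotropy n (q + 1) y := fun b hb hby =>
    ⟨(hτ b hb).2.1, (hτ b hb).2.2.1.trans hby, (hτ b hb).2.2.2.1⟩
  have hNmem : ∀ w ∈ sectionJetsAt n d π y, w.tgt ∈ W → N w ∈ jetsThrough n d π u₀ := by
    intro w hw hwW
    have h1 := hiso _ hwW (hπ w hw)
    have h2 := mem_pactDomain_isotropy hw (isotropy_jetInv h1)
    refine ⟨A.pact_mem h2, ?_⟩
    rw [A.tgt_pact h2, proj_jetInv h1.1]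
    have h3 := A.act_jetInv_of_act (proj_mem h1.1) (b := u₀) (by rw [Jet.tgt_proj, h1.2.2])
    rwa [(hτ _ hwW).2.2.2.2] at h3
  have hback : ∀ w ∈ sectionJetsAt n d π y, w.tgt ∈ W → A.pact (N w) (τ w.tgt) = w := by
    intro w hw hwW
    have h1 := hiso _ hwW (hπ w hw)
    exact A.pact_pact_jetInv hw.1 h1.1 (hw.2.trans h1.2.1.symm)
  have hthrough : ∀ w ∈ jetsThrough n d π u₀, w ∈ sectionJetsAt n d π y := fun w hw =>
    ⟨hw.1, src_of_mem_jetsThrough hw⟩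
  have hmove : ∀ w ∈ jetsThrough n d π u₀, ∀ b ∈ W, π b = y →
      A.pact w (τ b) ∈ sectionJetsAt n d π y ∧ (A.pact w (τ b)).tgt = b ∧
        N (A.pact w (τ b)) = w := by
    intro w hw b hb hby
    have h1 := hiso _ hb hby
    have h2 := mem_pactDomain_isotropy (hthrough w hw) h1
    have h3 : (A.pact w (τ b)).tgt = b := by
      rw [A.tgt_pact h2, hw.2, (hτ b hb).2.2.2.2]
    refine ⟨A.pact_mem_sectionJetsAt (hthrough w hw) h1, h3, ?_⟩
    rw [hN]
    dsimp only
    rw [h3, A.pact_jetInv_of_pact h2]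
  -- Two jets with the same value are moved by the same arrow, and conjugation by it exchanges their
  -- kernel orbits with those of the moved jets.
  have hNk : ∀ w ∈ sectionJetsAt n d π y, ∀ w' ∈ sectionJetsAt n d π y, w.tgt ∈ W →
      w.tgt = w'.tgt → (μ (N w) = μ (N w') ↔ ∃ k ∈ kernel n q y, A.pact w k = w') := by
    intro w hw w' hw' hwW ht
    have h1 := hiso _ hwW (hπ w hw)
    have h1' := isotropy_jetInv h1
    have hNw := hNmem w hw hwW
    have hNw' := hNmem w' hw' (ht ▸ hwW)
    rw [hμ2 _ hNw _ hNw']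
    constructor
    · rintro ⟨k, hk, h⟩
      refine ⟨_, kernel_conj h1.1 h1.2.1 h1.2.2 hk, ?_⟩
      rw [A.pact_comp (mem_pactDomain_isotropy hw h1') (comp_mem hk.1.1 h1.1
          (hk.1.2.1.trans h1.2.2.symm)) (by
            rw [src_jetInv h1.1, Jet.tgt_comp (hk.1.2.1.trans h1.2.2.symm), h1.2.2, hk.1.2.2]),
        A.pact_comp (mem_pactDomain_isotropy (hthrough _ hNw) hk.1) h1.1
          (hk.1.2.1.trans h1.2.2.symm), h, ht, hback w' hw' (ht ▸ hwW)]
    · rintro ⟨k, hk, h⟩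
      have e0 : k.src = (jetInv (τ w.tgt)).tgt := hk.1.2.1.trans h1'.2.2.symm
      refine ⟨_, kernel_conj_jetInv h1.1 h1.2.1 h1.2.2 hk, ?_⟩
      rw [A.pact_comp (mem_pactDomain_isotropy (hthrough _ hNw) h1) (comp_mem hk.1.1 h1'.1 e0)
          (by rw [Jet.tgt_comp e0, h1.2.1, hk.1.2.2]), hback w hw hwW,
        A.pact_comp (mem_pactDomain_isotropy hw hk.1) h1'.1 e0, h]
      simp only [hN, ht]
  obtain ⟨ζ, hζ, hζ0⟩ := hμ3 (N w₀) (hNmem _ w₀.2 hw₀W)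
  set Ω : Set (Euc r × Euc m) := {v | (y, v.1) ∈ Φ.target ∧ Φ.symm (y, v.1) ∈ W} with hΩ
  have hΩo : IsOpen Ω := by
    have h1 : IsOpen (Φ.target ∩ Φ.symm ⁻¹' W) := Φ.isOpen_inter_preimage_symm hW
    exact h1.preimage (continuous_const.prodMk continuous_fst)
  have hπΦ : ∀ v : Euc r, (y, v) ∈ Φ.target → π (Φ.symm (y, v)) = y := fun v hv => by
    rw [← hΦ1 _ (Φ.map_target hv), Φ.right_inv hv]
  have hΦeq : ∀ b ∈ Φ.source, π b = y → (y, (Φ b).2) = Φ b := fun b hb hby =>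
    Prod.ext ((hΦ1 b hb).trans hby).symm rfl
  have e : (Euc r × Euc m) ≃L[ℝ] Euc (r + m) := ContinuousLinearEquiv.ofFinrankEq (by simp)
  -- Coordinates of a class: where its value lies in the fibre, and the invariant of the jet after
  -- moving it to `u₀`. The inverse takes a jet through `u₀` with the given invariant and moves it
  -- to the given value.
  let s : QuotientSlice (jetModel n d 1) (Euc r × Euc m) (A.toF₁ y) :=
    { U := {z | A.value z ∈ Φ.source ∩ W}
      Ω := Ω
      κ := fun w => ((Φ w.tgt).2, μ (N w))
      σ := fun v => A.pact (ζ v.2) (τ (Φ.symm (y, v.1)))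
      isOpen_target := hΩo
      isOpen_preimage := by
        have h1 : Continuous fun w : sectionJetsAt n d π y => w.1.tgt :=
          continuous_iff_continuousAt.2 fun w =>
            (Jet.tendsto_tgt w.1).comp continuousAt_subtype_val
        exact (Φ.open_source.inter hW).preimage h1
      smooth := by
        rintro ⟨w, hw⟩ ⟨hwΦ, hwW⟩
        have hwΦ' : w.tgt ∈ Φ.source := hwΦ
        have hwW' : w.tgt ∈ W := hwW
        have h1 := hiso _ hwW' (hπ w hw)
        have ht : ∀ᶠ v in 𝓝[sectionJetsAt n d π y] w, v.tgt ∈ W :=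
          mem_nhdsWithin_of_mem_nhds ((Jet.tendsto_tgt w).eventually (hW.mem_nhds hwW'))
        refine SmOn.prodMk_space (I := jetModel n d 1)
          (f := fun w => (Φ w.tgt).2) (g := fun w => μ (N w)) ?_ ?_
        · have h2 : SmNear (jetModel n d 1) (𝓘(ℝ, Euc n).prod 𝓘(ℝ, Euc r)) (fun v => Φ v.tgt) w :=
            SmNear.comp (f := Jet.tgt) (smNear_of_contMDiffOn hΦ2
              (Φ.open_source.mem_nhds hwΦ')) (Jet.smNear_tgt w)
          exact h2.snd.smOn _
        · have h2 : SmNear (jetModel n d 1) (jetModel n n (q + 1)) (fun v => jetInv (τ v.tgt)) w :=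
            SmNear.comp (f := fun v : Jet (Euc n) (Euc d) X B 1 => τ v.tgt) (smNear_jetInv h1.1).2
              (SmNear.comp (f := Jet.tgt) (hτ _ hwW').1 (Jet.smNear_tgt w))
          have h3 : SmOn (jetModel n d 1) (jetModel n d 1) (sectionJetsAt n d π y) N w := by
            refine SmOn.comp (f := fun v => (v, jetInv (τ v.tgt))) hw
              (A.smOn_pact hF (mem_pactDomain_isotropy hw (isotropy_jetInv h1)))
              (((smNear_id w).prodMk h2).smOn _) ?_
            filter_upwards [self_mem_nhdsWithin, ht] with v hv hvW
            exact mem_pactDomain_isotropy hv (isotropy_jetInv (hiso _ hvW (hπ v hv)))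
          refine SmOn.comp hw (hμ1 _ (hNmem w hw hwW')) h3 ?_
          filter_upwards [self_mem_nhdsWithin, ht] with v hv hvW
          exact hNmem v hv hvW
      mem := by
        rintro ⟨w, hw⟩ ⟨hwΦ, hwW⟩
        have hwΦ' : w.tgt ∈ Φ.source := hwΦ
        have h1 := hΦeq w.tgt hwΦ' (hπ w hw)
        change (y, (Φ w.tgt).2) ∈ Φ.target ∧ Φ.symm (y, (Φ w.tgt).2) ∈ W
        rw [h1]
        exact ⟨Φ.map_source hwΦ', by rw [Φ.left_inv hwΦ']; exact hwW⟩
      inj := by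
        rintro ⟨w, hw⟩ ⟨w', hw'⟩ ⟨hwΦ, hwW⟩ ⟨hwΦ', hwW'⟩ h
        obtain ⟨h1, h2⟩ := Prod.mk.inj h
        have ht : w.tgt = w'.tgt := by
          refine Φ.injOn hwΦ hwΦ' ?_
          change Φ w.tgt = Φ w'.tgt
          rw [← hΦeq w.tgt hwΦ (hπ w hw), ← hΦeq w'.tgt hwΦ' (hπ w' hw'), h1]
        exact (A.toF₁_eq_iff _ _).2 ((hNk w hw w' hw' hwW ht).1 h2)
      congr := by
        rintro ⟨w, hw⟩ ⟨w', hw'⟩ ⟨hwΦ, hwW⟩ h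
        have ht : w.tgt = w'.tgt := congrArg A.value h
        refine Prod.ext ?_ ((hNk w hw w' hw' hwW ht).2 ((A.toF₁_eq_iff _ _).1 h))
        dsimp only
        rw [ht]
      smooth_symm := by
        rintro v ⟨hv1, hv2⟩
        have h1 := hiso _ hv2 (hπΦ _ hv1)
        have h2 : SmNear 𝓘(ℝ, Euc r × Euc m) (jetModel n d 1) (fun v => ζ v.2) v :=
          SmNear.comp (f := Prod.snd) (hζ v.2).1 (ContDiff.smNear contDiff_snd v)
        have h3 : SmNear 𝓘(ℝ, Euc r × Euc m) 𝓘(ℝ, Euc d) (fun v => Φ.symm (y, v.1)) v :=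
          SmNear.comp (f := fun v : Euc r × Euc m => (y, v.1)) (smNear_of_contMDiffOn hΦ3
            (Φ.open_target.mem_nhds hv1)) ((smNear_const y v).prodMk
              (ContDiff.smNear contDiff_fst v))
        have h4 : SmNear 𝓘(ℝ, Euc r × Euc m) (jetModel n n (q + 1))
            (fun v => τ (Φ.symm (y, v.1))) v :=
          SmNear.comp (f := fun v : Euc r × Euc m => Φ.symm (y, v.1)) (hτ _ hv2).1 h3
        refine SmOn.comp_smNear (f := fun v : Euc r × Euc m => (ζ v.2, τ (Φ.symm (y, v.1))))
          (A.smOn_pact hF (mem_pactDomain_isotropy (hthrough _ (hζ v.2).2.1) h1))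
          (h2.prodMk h4) ?_
        filter_upwards [hΩo.mem_nhds ⟨hv1, hv2⟩] with v' hv'
        exact mem_pactDomain_isotropy (hthrough _ (hζ v'.2).2.1) (hiso _ hv'.2 (hπΦ _ hv'.1))
      symm_mem := by
        rintro v ⟨hv1, hv2⟩
        obtain ⟨h1, h2, h3⟩ := hmove _ (hζ v.2).2.1 _ hv2 (hπΦ _ hv1)
        refine ⟨h1, ⟨?_, ?_⟩, ?_⟩
        · change (A.pact (ζ v.2) (τ (Φ.symm (y, v.1)))).tgt ∈ Φ.source
          rw [h2]
          exact Φ.map_target hv1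
        · change (A.pact (ζ v.2) (τ (Φ.symm (y, v.1)))).tgt ∈ W
          rw [h2]
          exact hv2
        · rw [h2, h3, Φ.right_inv hv1, (hζ v.2).2.2] }
  refine ⟨s.trans e, fun z hz => ?_, ?_⟩
  · change A.value z ∈ Φ.source ∩ W
    rw [hz]
    exact ⟨hΦ0, hw₀W⟩
  · change s.σ (e.symm (e (s.κ w₀))) = w₀
    rw [e.symm_apply_apply]
    change A.pact (ζ (μ (N w₀))) (τ (Φ.symm (y, (Φ w₀.1.tgt).2))) = w₀
    rw [hΦeq _ hΦ0 (hπ w₀ w₀.2), Φ.left_inv hΦ0, hζ0, hback _ w₀.2 hw₀W]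

end Slices

/-- The quotient of a fibre of the bundle of 1-jets of sections by the kernel of
`Π_{q+1} → Π_q` is a manifold. -/
theorem exists_F₁_manifold [T2Space X] [T2Space B]
    [SecondCountableTopology X] [SecondCountableTopology B]
    (hF : HasFibredCharts n d r π) (hA : A.IsHomogeneous) (y : X) :
    ∃ (r₁ : ℕ) (_ : TopologicalSpace (A.F₁ y)) (_ : ChartedSpace (Euc r₁) (A.F₁ y)),
      SmoothManifold r₁ (A.F₁ y) ∧
      IsSubmersionOnSubset (jetModel n d 1) 𝓘(ℝ, Euc r₁) (A.toF₁ y) := by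
  obtain ⟨r₁, hs⟩ : ∃ r₁ : ℕ, ∀ w : sectionJetsAt n d π y,
      ∃ s : QuotientSlice (jetModel n d 1) (Euc r₁) (A.toF₁ y),
        (∀ z, A.value z = w.1.tgt → z ∈ s.U) ∧ s.σ (s.κ w) = w := by
    by_cases h : ∃ u₀, π u₀ = y
    · obtain ⟨u₀, rfl⟩ := h
      exact A.exists_kernel_slices hF hA u₀
    -- Over an empty fibre there are no jets, and any dimension will do.
    · exact ⟨0, fun w => (h ⟨_, (π_tgt w.2.1).trans w.2.2⟩).elim⟩
  have hp := A.toF₁_surjective y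
  obtain ⟨t, c, hm, hsub⟩ := exists_quotient_manifold hp fun w => by
    obtain ⟨s, h1, h2⟩ := hs w
    exact ⟨s, h1 _ rfl, h2⟩
  have hval : Continuous (A.value (y := y)) := continuous_iff_continuousAt.2 fun z => by
    obtain ⟨w, rfl⟩ := hp z
    exact (hsub.descend ((Jet.smNear_tgt w.1).smOn _)
      (Eventually.of_forall fun v => rfl)).continuousAt
  have : SecondCountableTopology (Jet (Euc n) (Euc d) X B 1) := secondCountableTopology_jet 1
  have hT2 : T2Space (A.F₁ y) := ⟨fun z z' hne => ?_⟩
  · have := hsub.secondCountableTopology hp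
    exact ⟨r₁, t, c, {}, hsub⟩
  -- Hausdorff property: classes with different values are separated in `B`, and classes with the
  -- same value lie in a common slice.
  by_cases hv : A.value z = A.value z'
  · obtain ⟨w, rfl⟩ := hp z
    obtain ⟨s, h1, -⟩ := hs w
    exact s.exists_disjoint hp hsub (h1 _ rfl) (h1 _ hv.symm) hne
  · exact exists_disjoint_of_continuousOn isOpen_univ hval.continuousOn (mem_univ z) (mem_univ z')
      hv

end JetAction

end KernelQuotient

lemma SmoothOnSubset.comp_smNear {E H M E' H' N E'' H'' P : Type*}
    [NormedAddCommGroup E] [NormedSpace ℝ E] [TopologicalSpace H]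
    [TopologicalSpace M] [ChartedSpace H M] {I : ModelWithCorners ℝ E H}
    [NormedAddCommGroup E'] [NormedSpace ℝ E'] [TopologicalSpace H']
    [TopologicalSpace N] [ChartedSpace H' N] {J : ModelWithCorners ℝ E' H'}
    [NormedAddCommGroup E''] [NormedSpace ℝ E''] [TopologicalSpace H'']
    [TopologicalSpace P] [ChartedSpace H'' P] {K : ModelWithCorners ℝ E'' H''}
    {S : Set M} {f : S → N} (hf : SmoothOnSubset I J f) {γ : P → S} {a : P}
    (hγ : SmNear K I (fun b => (γ b : M)) a) : SmNear K J (fun b => f (γ b)) a := by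
  obtain ⟨U, hU, g, hg, hgf⟩ := hf (γ a)
  refine SmNear.congr (f := fun b => g (γ b))
    (SmNear.comp (f := fun b => (γ b : M)) (smNear_of_contMDiffOn hg hU) hγ) ?_
  filter_upwards [hγ.continuousAt.eventually hU] with b hb
  exact (hgf _ hb).symm

/-! ### Arrows to `y₀` and smooth sections of the principal bundle -/

section PrincipalBundle

variable {n k : ℕ} {X : Type*} [TopologicalSpace X] [ChartedSpace (Euc n) X]
  [IsManifold 𝓘(ℝ, Euc n) ∞ X] {y₀ : X}

/-- A chart at `x`, a translation, and the inverse of a chart at `y`. The groupoid is thus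
transitive even if `X` is not connected. -/
lemma locDiff_chart_trans (x y : X) : ∃ φ ψ : X → X, LocDiff n φ ψ x ∧ φ x = y := by
  set χ := chartAt (Euc n) x
  set χ' := chartAt (Euc n) y
  have h1 : LocInv 𝓘(ℝ, Euc n) 𝓘(ℝ, Euc n) χ χ.symm x :=
    ⟨Jet.smNear_chart, Jet.smNear_chart_symm,
      by filter_upwards [chart_source_mem_nhds (Euc n) x] with z hz using χ.left_inv hz,
      by filter_upwards [chart_target_mem_nhds (Euc n) x] with z hz using χ.right_inv hz⟩
  have h2 : LocInv 𝓘(ℝ, Euc n) 𝓘(ℝ, Euc n) (fun v => v + (χ' y - χ x))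
      (fun v => v - (χ' y - χ x)) (χ x) :=
    ⟨ContDiff.smNear (contDiff_id.add contDiff_const) _,
      ContDiff.smNear (contDiff_id.sub contDiff_const) _,
      Eventually.of_forall fun v => add_sub_cancel_right _ _,
      Eventually.of_forall fun v => sub_add_cancel _ _⟩
  have h3 : LocInv 𝓘(ℝ, Euc n) 𝓘(ℝ, Euc n) χ'.symm χ' (χ' y) :=
    LocInv.symm ⟨Jet.smNear_chart, Jet.smNear_chart_symm,
      by filter_upwards [chart_source_mem_nhds (Euc n) y] with z hz using χ'.left_inv hz,
      by filter_upwards [chart_target_mem_nhds (Euc n) y] with z hz using χ'.right_inv hz⟩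
  have e : χ x + (χ' y - χ x) = χ' y := by abel
  refine ⟨_, _, LocInv.comp (φ := χ) (φ' := fun v => χ'.symm (v + (χ' y - χ x)))
    (LocInv.comp (φ' := χ'.symm) (φ := fun v => v + (χ' y - χ x)) (e.symm ▸ h3) h2) h1, ?_⟩
  rw [e, χ'.left_inv (mem_chart_source _ _)]

lemma exists_mem_principalBundle (k : ℕ) (y₀ x : X) : ∃ f : principalBundle n k y₀, f.1.src = x := by
  obtain ⟨φ, ψ, h, hx⟩ := locDiff_chart_trans (n := n) x y₀
  exact ⟨⟨_, h.jet_mem, (Jet.tgt_of _ _).trans hx⟩, Jet.src_of _ _⟩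

lemma comp_jetInv_mem_isotropy (f f' : principalBundle n k y₀) (h : f.1.src = f'.1.src) :
    f.1.comp (jetInv f'.1) ∈ isotropy n k y₀ := by
  have e : f.1.src = (jetInv f'.1).tgt := h.trans (tgt_jetInv f'.2.1).symm
  exact ⟨comp_mem f.2.1 (jetInv_mem f'.2.1) e, by rw [Jet.src_comp, src_jetInv f'.2.1, f'.2.2],
    by rw [Jet.tgt_comp e, f.2.2]⟩

/-- The principal bundle has a section that is smooth near a point, with a given value there. -/
lemma exists_principal_section (f₀ : principalBundle n k y₀) :
    ∃ θ : X → principalBundle n k y₀, (∀ x, (θ x).1.src = x) ∧ θ f₀.1.src = f₀ ∧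
      SmNear 𝓘(ℝ, Euc n) (jetModel n n k) (fun x => (θ x).1) f₀.1.src := by
  obtain ⟨φ, ψ, hφ, hf₀⟩ := exists_locDiff f₀.2.1
  set x₀ := f₀.1.src with hx₀
  have hφx : φ x₀ = y₀ := by
    rw [← f₀.2.2, hf₀, Jet.tgt_of]
  obtain ⟨t, ht, hty, hte⟩ := exists_translation (n := n) k y₀
  have hcont : Tendsto φ (𝓝 x₀) (𝓝 y₀) := by
    have := hφ.smooth.continuousAt.tendsto
    rwa [hφx] at this
  -- The jets of `φ` have varying targets; translations bring these back to `y₀`.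
  set θ₀ : X → SelfJet n X k := fun x => (t (φ x)).comp (Jet.of (Euc n) (Euc n) k φ x) with hθ₀
  have hval : θ₀ x₀ = f₀.1 := by
    have h1 := unit_jet_comp f₀.1
    rw [f₀.2.2] at h1
    simp only [hθ₀]
    rw [hφx, hty, ← hf₀, h1]
  have hmem : ∀ᶠ x in 𝓝 x₀, θ₀ x ∈ principalBundle n k y₀ ∧ (θ₀ x).src = x := by
    filter_upwards [hcont.eventually hte, hφ.eventually] with x h1 h2
    have e : (t (φ x)).src = (Jet.of (Euc n) (Euc n) k φ x).tgt := by rw [h1.2.1, Jet.tgt_of]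
    exact ⟨⟨comp_mem h1.1 h2.jet_mem e, (Jet.tgt_comp e).trans h1.2.2⟩, by
      rw [Jet.src_comp, Jet.src_of]⟩
  have hsm : SmNear 𝓘(ℝ, Euc n) (jetModel n n k) θ₀ x₀ := by
    have e : (t (φ x₀)).src = (Jet.of (Euc n) (Euc n) k φ x₀).tgt := by
      rw [(hcont.eventually hte).self_of_nhds.2.1, Jet.tgt_of]
    refine SmOn.comp_smNear (f := fun x => (t (φ x), Jet.of (Euc n) (Euc n) k φ x))
      (Jet.smOn_comp e) ((SmNear.comp_eq ht hφ.smooth hφx).prodMk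
        (Jet.smNear_of_self hφ.smooth)) ?_
    filter_upwards [hcont.eventually hte] with x h1
    rw [h1.2.1, Jet.tgt_of]
  -- Away from the point the section is continued by arbitrary arrows to `y₀`, so that it is defined
  -- on all of `X`.
  choose θ₁ hθ₁ using exists_mem_principalBundle (n := n) k y₀
  classical
  refine ⟨fun x => if h : θ₀ x ∈ principalBundle n k y₀ ∧ (θ₀ x).src = x then ⟨_, h.1⟩ else θ₁ x,
    fun x => ?_, ?_, hsm.congr ?_⟩
  · dsimp only
    split_ifs with h
    · exact h.2
    · exact hθ₁ x
  · exact (dif_pos hmem.self_of_nhds).trans (Subtype.ext hval)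
  · filter_upwards [hmem] with x hx
    exact congrArg Subtype.val (dif_pos hx)

end PrincipalBundle

/-! ### Associated bundles as smooth fibre bundles -/

section AssociatedBundle

variable {n k r₁ : ℕ} {X Z : Type*} [TopologicalSpace X] [ChartedSpace (Euc n) X]
  [TopologicalSpace Z] [ChartedSpace (Euc r₁) Z]
  [IsManifold 𝓘(ℝ, Euc n) ∞ X] [IsManifold 𝓘(ℝ, Euc r₁) ∞ Z] {y₀ : X}

/-- `a` is a smooth right action of an isotropy group with graph `ρ`. -/
structure IsIsotropyAction (r₁ : ℕ) {k : ℕ} {Z : Type*} [TopologicalSpace Z]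
    [ChartedSpace (Euc r₁) Z] (y₀ : X) (ρ : Z → SelfJet n X k → Z → Prop)
    (a : Z → SelfJet n X k → Z) : Prop where
  iff : ∀ z z', ∀ g ∈ isotropy n k y₀, ρ z g z' ↔ a z g = z'
  unit : ∀ z, a z (unitJet n k y₀) = z
  comp : ∀ z, ∀ g ∈ isotropy n k y₀, ∀ h ∈ isotropy n k y₀, a z (g.comp h) = a (a z g) h
  smooth : ∀ z, ∀ g ∈ isotropy n k y₀, SmOn (𝓘(ℝ, Euc r₁).prod (jetModel n n k)) 𝓘(ℝ, Euc r₁)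
    {p : Z × SelfJet n X k | p.2 ∈ isotropy n k y₀} (fun p => a p.1 p.2) (z, g)

variable {ρ : Z → SelfJet n X k → Z → Prop} {a : Z → SelfJet n X k → Z}

namespace AssocBundle

lemma mk_surjective (u : AssocBundle y₀ ρ) : ∃ f z, u = mk ρ f z := by
  obtain ⟨⟨f, z⟩, h⟩ := Quot.exists_rep u
  exact ⟨f, z, h.symm⟩

@[simp] lemma base_mk (f : principalBundle n k y₀) (z : Z) : (mk ρ f z).base = f.1.src := rfl

lemma quotientMap_surjective : Function.Surjective (quotientMap (y₀ := y₀) ρ) := fun u => by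
  obtain ⟨f, z, rfl⟩ := mk_surjective u
  exact ⟨⟨(f.1, z), f.2⟩, rfl⟩

end AssocBundle

namespace IsIsotropyAction

variable (ha : IsIsotropyAction r₁ y₀ ρ a)

include ha

/-- The cocycle identity `(f f'⁻¹)(f' f''⁻¹) = f f''⁻¹`, which makes the comparison of
representatives transitive. -/
lemma act_comp_jetInv (z : Z) (f f' f'' : principalBundle n k y₀) (h : f.1.src = f'.1.src)
    (h' : f'.1.src = f''.1.src) :
    a (a z (f.1.comp (jetInv f'.1))) (f'.1.comp (jetInv f''.1)) = a z (f.1.comp (jetInv f''.1)) := by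
  rw [← ha.comp _ _ (comp_jetInv_mem_isotropy f f' h) _ (comp_jetInv_mem_isotropy f' f'' h'),
    jet_comp_assoc, comp_jetInv_comp_cancel f'.2.1 h]
  · rw [Jet.src_comp, src_jetInv f'.2.1, f'.2.2]
  · rw [h', tgt_jetInv f''.2.1]

lemma act_comp_jetInv_self (z : Z) (f : principalBundle n k y₀) :
    a z (f.1.comp (jetInv f.1)) = z := by
  rw [comp_jetInv f.2.1, f.2.2, ha.unit]

/-- The only isotropy element `g` with `f = g f'` is `f f'⁻¹`. In this explicit form the generating
relation is seen to be an equivalence relation already. -/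
lemma mk_eq_iff {f f' : principalBundle n k y₀} {z z' : Z} :
    AssocBundle.mk ρ f z = AssocBundle.mk ρ f' z' ↔ f.1.src = f'.1.src ∧ a z (f.1.comp (jetInv f'.1)) = z' := by
  have hiff : ∀ p p' : principalBundle n k y₀ × Z,
      (∃ g ∈ isotropy n k y₀, p.1.1 = g.comp p'.1.1 ∧ ρ p.2 g p'.2) ↔
        p.1.1.src = p'.1.1.src ∧ a p.2 (p.1.1.comp (jetInv p'.1.1)) = p'.2 := by
    rintro ⟨f, z⟩ ⟨f', z'⟩
    dsimp only
    constructor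
    · rintro ⟨g, hg, h1, h2⟩
      rw [ha.iff _ _ _ hg] at h2
      refine ⟨by rw [h1, Jet.src_comp], ?_⟩
      rw [h1, comp_comp_jetInv f'.2.1 (hg.2.1.trans f'.2.2.symm), h2]
    · rintro ⟨h1, h2⟩
      have h3 := comp_jetInv_mem_isotropy f f' h1
      exact ⟨_, h3, (comp_jetInv_comp_cancel f'.2.1 h1).symm, (ha.iff _ _ _ h3).2 h2⟩
  refine Iff.trans (Equivalence.quot_mk_eq_iff (r := fun p p' : principalBundle n k y₀ × Z =>
    ∃ g ∈ isotropy n k y₀, p.1.1 = g.comp p'.1.1 ∧ ρ p.2 g p'.2)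
    ⟨fun p => ?_, fun {p p'} h => ?_, fun {p p' p''} h h' => ?_⟩ (f, z) (f', z'))
    (hiff (f, z) (f', z'))
  · rw [hiff]
    exact ⟨rfl, ha.act_comp_jetInv_self _ _⟩
  · rw [hiff] at h ⊢
    refine ⟨h.1.symm, ?_⟩
    rw [← h.2, ha.act_comp_jetInv _ _ _ _ h.1 h.1.symm, ha.act_comp_jetInv_self]
  · rw [hiff] at h h' ⊢
    exact ⟨h.1.trans h'.1, by rw [← ha.act_comp_jetInv _ _ _ _ h.1 h'.1, h.2, h'.2]⟩

end IsIsotropyAction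

/-- The fibre coordinate of a point of an associated bundle with respect to a section of the
principal bundle. -/
def fibreCoord (ha : IsIsotropyAction r₁ y₀ ρ a) {θ : X → principalBundle n k y₀}
    (hθ : ∀ x, (θ x).1.src = x) : AssocBundle y₀ ρ → Z :=
  Quot.lift (fun p => a p.2 (p.1.1.comp (jetInv (θ p.1.1.src).1))) (by
    rintro ⟨f, z⟩ ⟨f', z'⟩ h
    have h' : AssocBundle.mk ρ f z = AssocBundle.mk ρ f' z' := Quot.sound h
    obtain ⟨h1, h2⟩ := ha.mk_eq_iff.1 h'
    dsimp only
    rw [← h2, ha.act_comp_jetInv _ _ _ _ h1 (hθ _).symm, h1])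

section Coordinates

open AssocBundle

variable (ha : IsIsotropyAction r₁ y₀ ρ a) {θ : X → principalBundle n k y₀}
  (hθ : ∀ x, (θ x).1.src = x)

lemma fibreCoord_mk (f : principalBundle n k y₀) (z : Z) :
    fibreCoord ha hθ (mk ρ f z) = a z (f.1.comp (jetInv (θ f.1.src).1)) := rfl

lemma fibreCoord_section (x : X) (z : Z) : fibreCoord ha hθ (mk ρ (θ x) z) = z := by
  rw [fibreCoord_mk, hθ, ha.act_comp_jetInv_self]

lemma mk_section_fibreCoord (u : AssocBundle y₀ ρ) :
    mk ρ (θ u.base) (fibreCoord ha hθ u) = u := by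
  obtain ⟨f, z, rfl⟩ := mk_surjective u
  rw [base_mk, fibreCoord_mk]
  refine (ha.mk_eq_iff.2 ⟨(hθ _).symm, rfl⟩).symm

include ha hθ in
lemma smOn_fibreCoord {f : principalBundle n k y₀} {z : Z}
    (hs : SmNear 𝓘(ℝ, Euc n) (jetModel n n k) (fun x => (θ x).1) f.1.src) :
    SmOn ((jetModel n n k).prod 𝓘(ℝ, Euc r₁)) 𝓘(ℝ, Euc r₁)
      {p : SelfJet n X k × Z | p.1 ∈ principalBundle n k y₀}
      (fun p => a p.2 (p.1.comp (jetInv (θ p.1.src).1))) (f.1, z) := by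
  have h1 : SmNear ((jetModel n n k).prod 𝓘(ℝ, Euc r₁)) (jetModel n n k)
      (fun p : SelfJet n X k × Z => jetInv (θ p.1.src).1) (f.1, z) :=
    SmNear.comp (f := fun p : SelfJet n X k × Z => (θ p.1.src).1)
      (smNear_jetInv (θ f.1.src).2.1).2
      (SmNear.comp (f := fun p : SelfJet n X k × Z => p.1.src) hs
        (SmNear.comp (f := Prod.fst) (Jet.smNear_src f.1) (smNear_fst (f.1, z))))
  have hx : (f.1, z) ∈ {p : SelfJet n X k × Z | p.1 ∈ principalBundle n k y₀} := f.2
  have e : ∀ g ∈ principalBundle n k y₀, g.src = (jetInv (θ g.src).1).tgt := fun g hg => by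
    rw [tgt_jetInv (θ g.src).2.1, hθ]
  have h2 : SmOn ((jetModel n n k).prod 𝓘(ℝ, Euc r₁)) (jetModel n n k)
      {p : SelfJet n X k × Z | p.1 ∈ principalBundle n k y₀}
      (fun p => p.1.comp (jetInv (θ p.1.src).1)) (f.1, z) := by
    refine SmOn.comp (f := fun p : SelfJet n X k × Z => (p.1, jetInv (θ p.1.src).1)) hx
      (Jet.smOn_comp (e _ f.2)) (((smNear_fst (f.1, z)).prodMk h1).smOn _) ?_
    filter_upwards [self_mem_nhdsWithin] with p hp using e _ hp
  refine SmOn.comp (f := fun p : SelfJet n X k × Z => (p.2, p.1.comp (jetInv (θ p.1.src).1))) hx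
    (ha.smooth z _ (comp_jetInv_mem_isotropy f _ (hθ _).symm))
    (((smNear_snd (f.1, z)).smOn _).prodMk h2) ?_
  filter_upwards [self_mem_nhdsWithin] with p hp
  exact comp_jetInv_mem_isotropy ⟨p.1, hp⟩ _ (hθ _).symm

end Coordinates

lemma isOpen_smNear {E H M E' H' N : Type*} [NormedAddCommGroup E] [NormedSpace ℝ E]
    [TopologicalSpace H] [TopologicalSpace M] [ChartedSpace H M] {I : ModelWithCorners ℝ E H}
    [NormedAddCommGroup E'] [NormedSpace ℝ E'] [TopologicalSpace H']
    [TopologicalSpace N] [ChartedSpace H' N] {J : ModelWithCorners ℝ E' H'} (f : M → N) :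
    IsOpen {x | SmNear I J f x} :=
  isOpen_iff_eventually.2 fun _ h => h.eventually

open AssocBundle in
/-- Coordinates of an associated bundle near a point. -/
lemma exists_assocBundle_slice (ha : IsIsotropyAction r₁ y₀ ρ a)
    (x : {p : SelfJet n X k × Z | p.1 ∈ principalBundle n k y₀}) :
    ∃ s : QuotientSlice ((jetModel n n k).prod 𝓘(ℝ, Euc r₁)) (Euc (n + r₁))
      (quotientMap (y₀ := y₀) ρ), quotientMap ρ x ∈ s.U ∧ s.σ (s.κ x) = x := by
  obtain ⟨⟨f₀, z₀⟩, hf₀⟩ := x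
  obtain ⟨θ, hθ, hθ0, hθs⟩ := exists_principal_section ⟨f₀, hf₀⟩
  dsimp only at hθ0 hθs
  -- The section is global but smooth only near the source of `f₀`; the slice lives over the open
  -- set where it is smooth.
  set V : Set X := {x | SmNear 𝓘(ℝ, Euc n) (jetModel n n k) (fun x => (θ x).1) x} with hV
  have hVo : IsOpen V := isOpen_smNear _
  set χ := chartAt (Euc n) f₀.src with hχ
  set ξ := chartAt (Euc r₁) z₀ with hξ
  have hχs : ∀ x ∈ χ.source, SmNear 𝓘(ℝ, Euc n) 𝓘(ℝ, Euc n) χ x := fun x hx =>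
    smNear_of_contMDiffOn contMDiffOn_chart (χ.open_source.mem_nhds hx)
  have hχt : ∀ v ∈ χ.target, SmNear 𝓘(ℝ, Euc n) 𝓘(ℝ, Euc n) χ.symm v := fun v hv =>
    smNear_of_contMDiffOn contMDiffOn_chart_symm (χ.open_target.mem_nhds hv)
  have hξs : ∀ x ∈ ξ.source, SmNear 𝓘(ℝ, Euc r₁) 𝓘(ℝ, Euc r₁) ξ x := fun x hx =>
    smNear_of_contMDiffOn contMDiffOn_chart (ξ.open_source.mem_nhds hx)
  have hξt : ∀ v ∈ ξ.target, SmNear 𝓘(ℝ, Euc r₁) 𝓘(ℝ, Euc r₁) ξ.symm v := fun v hv =>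
    smNear_of_contMDiffOn contMDiffOn_chart_symm (ξ.open_target.mem_nhds hv)
  have e : (Euc n × Euc r₁) ≃L[ℝ] Euc (n + r₁) := ContinuousLinearEquiv.ofFinrankEq (by simp)
  set S := {p : SelfJet n X k × Z | p.1 ∈ principalBundle n k y₀} with hS
  set N : SelfJet n X k × Z → Z := fun p => a p.2 (p.1.comp (jetInv (θ p.1.src).1)) with hN
  have hNs : ∀ p ∈ S, p.1.src ∈ V →
      SmOn ((jetModel n n k).prod 𝓘(ℝ, Euc r₁)) 𝓘(ℝ, Euc r₁) S N p := fun p hp hpV =>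
    smOn_fibreCoord ha hθ (f := ⟨p.1, hp⟩) (z := p.2) hpV
  have hsrc : ∀ p : SelfJet n X k × Z, SmNear ((jetModel n n k).prod 𝓘(ℝ, Euc r₁)) 𝓘(ℝ, Euc n)
      (fun p : SelfJet n X k × Z => p.1.src) p := fun p =>
    SmNear.comp (f := Prod.fst) (Jet.smNear_src p.1) (smNear_fst p)
  have hsec : ∀ v z, (θ (χ.symm v)).1.src = χ.symm v ∧ N ((θ (χ.symm v)).1, z) = z := fun v z =>
    ⟨hθ _, fibreCoord_section ha hθ _ _⟩
  -- Every class over `V` has a unique representative `[θ(x), z]`; the coordinates are those of `x`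
  -- and of `z`.
  let s : QuotientSlice ((jetModel n n k).prod 𝓘(ℝ, Euc r₁)) (Euc n × Euc r₁)
      (quotientMap (y₀ := y₀) ρ) :=
    { U := {u | u.base ∈ V ∩ χ.source ∧ fibreCoord ha hθ u ∈ ξ.source}
      Ω := (χ.target ∩ χ.symm ⁻¹' V) ×ˢ ξ.target
      κ := fun p => (χ p.1.src, ξ (N p))
      σ := fun v => ((θ (χ.symm v.1)).1, ξ.symm v.2)
      isOpen_target := (χ.isOpen_inter_preimage_symm hVo).prod ξ.open_target
      isOpen_preimage := by
        refine isOpen_iff_eventually.2 ?_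
        rintro ⟨p, hp⟩ ⟨h1, h2⟩
        have h3 : ∀ᶠ v in 𝓝[S] p, v.1.src ∈ V ∩ χ.source ∧ N v ∈ ξ.source :=
          (((hsrc p).continuousAt.eventually
            ((hVo.inter χ.open_source).mem_nhds h1)).filter_mono nhdsWithin_le_nhds).and
            (((hNs p hp h1.1).tendsto hp).eventually (ξ.open_source.mem_nhds h2))
        rw [nhdsWithin_eq_map_subtype_coe hp] at h3
        exact h3
      smooth := by
        rintro ⟨p, hp⟩ ⟨h1, h2⟩
        change p.1.src ∈ V ∩ χ.source at h1
        exact SmOn.prodMk_space (I := (jetModel n n k).prod 𝓘(ℝ, Euc r₁))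
          (f := fun p : SelfJet n X k × Z => χ p.1.src)
          (g := fun p => ξ (N p)) ((SmNear.comp (f := fun p : SelfJet n X k × Z => p.1.src)
            (hχs _ h1.2) (hsrc p)).smOn _)
          (SmNear.comp_smOn hp (hξs _ h2) (hNs p hp h1.1))
      mem := by
        rintro ⟨p, hp⟩ ⟨h1, h2⟩
        change p.1.src ∈ V ∩ χ.source at h1
        exact ⟨⟨χ.map_source h1.2, by change χ.symm (χ p.1.src) ∈ V; rw [χ.left_inv h1.2]; exact h1.1⟩,
          ξ.map_source h2⟩
      inj := by
        rintro ⟨p, hp⟩ ⟨p', hp'⟩ ⟨h1, h2⟩ ⟨h1', h2'⟩ h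
        obtain ⟨h3, h4⟩ := Prod.mk.inj h
        have h5 := χ.injOn h1.2 h1'.2 h3
        have h6 := ξ.injOn h2 h2' h4
        rw [← mk_section_fibreCoord ha hθ (quotientMap ρ ⟨p, hp⟩),
          ← mk_section_fibreCoord ha hθ (quotientMap ρ ⟨p', hp'⟩), h6]
        exact congrArg (fun x => mk ρ (θ x) _) h5
      congr := by
        rintro ⟨p, hp⟩ ⟨p', hp'⟩ ⟨h1, h2⟩ h
        have h3 : p.1.src = p'.1.src := congrArg base h
        have h4 : N p = N p' := congrArg (fibreCoord ha hθ) h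
        simp only [h3, h4]
      smooth_symm := by
        rintro v ⟨⟨hv1, hv2⟩, hv3⟩
        exact (SmNear.comp (f := fun v : Euc n × Euc r₁ => χ.symm v.1) (g := fun x => (θ x).1) hv2
          (SmNear.comp (f := fun v : Euc n × Euc r₁ => v.1) (hχt _ hv1)
            (ContDiff.smNear contDiff_fst v))).prodMk
          (SmNear.comp (f := fun v : Euc n × Euc r₁ => v.2) (hξt _ hv3)
            (ContDiff.smNear contDiff_snd v))
      symm_mem := by
        rintro v ⟨⟨hv1, hv2⟩, hv3⟩
        obtain ⟨h1, h2⟩ := hsec v.1 (ξ.symm v.2)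
        refine ⟨(θ (χ.symm v.1)).2, ⟨?_, ?_⟩, ?_⟩
        · change (θ (χ.symm v.1)).1.src ∈ V ∩ χ.source
          rw [h1]
          exact ⟨hv2, χ.map_target hv1⟩
        · change N ((θ (χ.symm v.1)).1, ξ.symm v.2) ∈ ξ.source
          rw [h2]
          exact ξ.map_target hv3
        · rw [h1, h2, χ.right_inv hv1, ξ.right_inv hv3] }
  have hN0 : N (f₀, z₀) = z₀ := by
    simp only [hN, hθ0]
    exact ha.act_comp_jetInv_self z₀ ⟨f₀, hf₀⟩
  refine ⟨s.trans e, ⟨⟨hθs, mem_chart_source _ _⟩, ?_⟩, ?_⟩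
  · change N (f₀, z₀) ∈ ξ.source
    rw [hN0]
    exact mem_chart_source _ _
  · change s.σ (e.symm (e (s.κ (f₀, z₀)))) = (f₀, z₀)
    rw [e.symm_apply_apply]
    change ((θ (χ.symm (χ f₀.src))).1, ξ.symm (ξ (N (f₀, z₀)))) = (f₀, z₀)
    rw [χ.left_inv (mem_chart_source _ _), hN0, ξ.left_inv (mem_chart_source _ _), hθ0]

open AssocBundle in
/-- Associated bundles are smooth fibre bundles. -/
theorem exists_assocBundle_manifold [T2Space X] [SecondCountableTopology X] [T2Space Z]
    [SecondCountableTopology Z] (ha : IsIsotropyAction r₁ y₀ ρ a) :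
    ∃ (_ : TopologicalSpace (AssocBundle y₀ ρ))
      (_ : ChartedSpace (Euc (n + r₁)) (AssocBundle y₀ ρ)),
      SmoothManifold (n + r₁) (AssocBundle y₀ ρ) ∧
      IsSubmersionOnSubset ((jetModel n n k).prod 𝓘(ℝ, Euc r₁)) 𝓘(ℝ, Euc (n + r₁))
        (quotientMap (y₀ := y₀) ρ) ∧
      IsSmoothFibreBundle n (n + r₁) r₁ Z (base : AssocBundle y₀ ρ → X) := by
  have hp := quotientMap_surjective (y₀ := y₀) (ρ := ρ)
  obtain ⟨t, c, hm, hsub⟩ := exists_quotient_manifold hp (exists_assocBundle_slice ha)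
  have hbase : ∀ u : AssocBundle y₀ ρ, SmNear 𝓘(ℝ, Euc (n + r₁)) 𝓘(ℝ, Euc n) base u := fun u => by
    obtain ⟨p, rfl⟩ := hp u
    exact hsub.descend ((SmNear.comp (f := Prod.fst) (Jet.smNear_src p.1.1)
      (smNear_fst p.1)).smOn _) (Eventually.of_forall fun v => rfl)
  have hbasec : Continuous (base : AssocBundle y₀ ρ → X) :=
    continuous_iff_continuousAt.2 fun u => (hbase u).continuousAt
  have htriv : ∀ x : X, ∃ (θ : X → principalBundle n k y₀) (hθ : ∀ x, (θ x).1.src = x) (V : Set X),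
      IsOpen V ∧ x ∈ V ∧
      (∀ u, base u ∈ V → SmNear 𝓘(ℝ, Euc (n + r₁)) 𝓘(ℝ, Euc r₁) (fibreCoord ha hθ) u) ∧
      ∀ p : X × Z, p.1 ∈ V → SmNear (𝓘(ℝ, Euc n).prod 𝓘(ℝ, Euc r₁)) 𝓘(ℝ, Euc (n + r₁))
        (fun p : X × Z => mk ρ (θ p.1) p.2) p := by
    intro x
    obtain ⟨f, rfl⟩ := exists_mem_principalBundle (n := n) k y₀ x
    obtain ⟨θ, hθ, -, hθs⟩ := exists_principal_section f
    refine ⟨θ, hθ, _, isOpen_smNear (I := 𝓘(ℝ, Euc n)) (J := jetModel n n k)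
      (fun x => (θ x).1), hθs, fun u hu => ?_, fun p hpV => ?_⟩
    · obtain ⟨p, rfl⟩ := hp u
      exact hsub.descend (smOn_fibreCoord ha hθ (f := ⟨p.1.1, p.2⟩) (z := p.1.2) hu)
        (Eventually.of_forall fun v => rfl)
    · exact hsub.1.comp_smNear (γ := fun p : X × Z => ⟨((θ p.1).1, p.2), (θ p.1).2⟩)
        ((SmNear.comp (f := Prod.fst) (g := fun x => (θ x).1) hpV (smNear_fst p)).prodMk
          (smNear_snd p))
  have hT2 : T2Space (AssocBundle y₀ ρ) := ⟨fun u u' hne => ?_⟩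
  · have : SecondCountableTopology (SelfJet n X k) := secondCountableTopology_jet k
    have := hsub.secondCountableTopology hp
    refine ⟨t, c, {}, hsub, fun x => ?_⟩
    obtain ⟨θ, hθ, V, hV, hxV, h1, h2⟩ := htriv x
    refine ⟨{ toFun := fun u => (u.base, fibreCoord ha hθ u)
              invFun := fun p => mk ρ (θ p.1) p.2
              source := base ⁻¹' V
              target := V ×ˢ univ
              map_source' := fun u hu => ⟨hu, mem_univ _⟩
              map_target' := fun p hp' => by
                change (θ p.1).1.src ∈ V
                rw [hθ]
                exact hp'.1
              left_inv' := fun u _ => mk_section_fibreCoord ha hθ u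
              right_inv' := fun p _ => Prod.ext (hθ _) (fibreCoord_section ha hθ _ _)
              open_source := hV.preimage hbasec
              open_target := hV.prod isOpen_univ
              continuousOn_toFun := fun u hu =>
                (((hbase u).prodMk (h1 u hu)).continuousAt).continuousWithinAt
              continuousOn_invFun := fun p hp' => ((h2 p hp'.1).continuousAt).continuousWithinAt
              baseSet := V
              open_baseSet := hV
              source_eq := rfl
              target_eq := rfl
              proj_toFun := fun _ _ => rfl }, hxV, fun u hu => ?_, fun p hp' => ?_⟩
    · exact ((hbase u).prodMk (h1 u hu)).contMDiffAt.contMDiffWithinAt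
    · exact (h2 p hp'.1).contMDiffAt.contMDiffWithinAt
  -- Hausdorff property: points over different base points are separated in `X`, points of one fibre
  -- by their fibre coordinate.
  · by_cases hb : u.base = u'.base
    · obtain ⟨θ, hθ, V, hV, hxV, h1, -⟩ := htriv u.base
      refine exists_disjoint_of_continuousOn (hV.preimage hbasec) (g := fibreCoord ha hθ)
        (fun v hv => (h1 v hv).continuousAt.continuousWithinAt) hxV
        (by rw [mem_preimage, ← hb]; exact hxV) fun h => hne ?_
      rw [← mk_section_fibreCoord ha hθ u, ← mk_section_fibreCoord ha hθ u', h, hb]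
    · exact exists_disjoint_of_continuousOn isOpen_univ hbasec.continuousOn (mem_univ u)
        (mem_univ u') hb

end AssociatedBundle

lemma SmoothOnSubset.exists_extension {E H M E' H' N : Type*}
    [NormedAddCommGroup E] [NormedSpace ℝ E] [TopologicalSpace H]
    [TopologicalSpace M] [ChartedSpace H M] {I : ModelWithCorners ℝ E H}
    [NormedAddCommGroup E'] [NormedSpace ℝ E'] [TopologicalSpace H']
    [TopologicalSpace N] [ChartedSpace H' N] {J : ModelWithCorners ℝ E' H'}
    {S : Set M} {f : S → N} (hf : SmoothOnSubset I J f) (x : S) :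
    ∃ g : M → N, (∀ y : S, g y = f y) ∧ ∀ y ∈ S, SmOn I J S g y := by
  classical
  set g : M → N := fun m => if h : m ∈ S then f ⟨m, h⟩ else f x
  have h : ∀ y : S, g y = f y := fun y => dif_pos y.2
  exact ⟨g, h, fun y hy => hf.smOn h hy⟩

/-! ### The isotropy actions on `F_1` -/

section IsotropyActions

variable {n d r q r₁ : ℕ} {X B : Type*} [TopologicalSpace X] [ChartedSpace (Euc n) X]
  [TopologicalSpace B] [ChartedSpace (Euc d) B]
  [IsManifold 𝓘(ℝ, Euc n) ∞ X] [IsManifold 𝓘(ℝ, Euc d) ∞ B] {π : B → X}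

namespace JetAction

variable (A : JetAction n d q π) (y : X)

/-- The action of `Π_{q+1}(y, y)` on `F₁`, as a function. -/
def actF₁ (z : A.F₁ y) (g : SelfJet n X (q + 1)) : A.F₁ y :=
  open Classical in
  if hg : g ∈ isotropy n (q + 1) y then
    A.toF₁ y ⟨A.pact (Quot.out z : sectionJetsAt n d π y).1 g,
      A.pact_mem_sectionJetsAt (Quot.out z : sectionJetsAt n d π y).2 hg⟩
  else z

variable {y}

/-- Independence of the representative is normality of the kernel: `(w k) g = (w g)(g⁻¹ k g)`. -/
lemma actF₁_toF₁ (w : sectionJetsAt n d π y) {g : SelfJet n X (q + 1)}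
    (hg : g ∈ isotropy n (q + 1) y) :
    A.actF₁ y (A.toF₁ y w) g = A.toF₁ y ⟨A.pact w.1 g, A.pact_mem_sectionJetsAt w.2 hg⟩ := by
  unfold actF₁
  rw [dif_pos hg]
  set v : sectionJetsAt n d π y := Quot.out (A.toF₁ y w) with hv
  have h : A.toF₁ y v = A.toF₁ y w := Quot.out_eq _
  obtain ⟨k, hk, hkw⟩ := (A.toF₁_eq_iff v w).1 h
  refine (A.toF₁_eq_iff _ _).2 ⟨_, kernel_conj hg.1 hg.2.1 hg.2.2 hk, ?_⟩
  have e : k.src = g.tgt := hk.1.2.1.trans hg.2.2.symm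
  have h1 := mem_pactDomain_isotropy v.2 hg
  have e2 : (jetInv g).src = (k.comp g).tgt := by
    rw [src_jetInv hg.1, Jet.tgt_comp e, hg.2.2, hk.1.2.2]
  dsimp only
  rw [← A.pact_comp h1 (comp_mem (jetInv_mem hg.1) (comp_mem hk.1.1 hg.1 e) e2)
      (by rw [Jet.tgt_comp e2, tgt_jetInv hg.1]),
    jetInv_comp_cancel hg.1 (by rw [Jet.tgt_comp e, hg.2.2, hk.1.2.2]),
    A.pact_comp (mem_pactDomain_isotropy v.2 hk.1) hg.1 e, hkw]

lemma actF₁_comp (z : A.F₁ y) {g h : SelfJet n X (q + 1)} (hg : g ∈ isotropy n (q + 1) y)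
    (hh : h ∈ isotropy n (q + 1) y) :
    A.actF₁ y z (g.comp h) = A.actF₁ y (A.actF₁ y z g) h := by
  obtain ⟨w, rfl⟩ := A.toF₁_surjective y z
  rw [A.actF₁_toF₁ w hg, A.actF₁_toF₁ _ hh, A.actF₁_toF₁ w (isotropy_comp hg hh)]
  congr 2
  exact A.pact_comp (mem_pactDomain_isotropy w.2 hg) hh.1 (hg.2.1.trans hh.2.2.symm)

lemma actF₁_kernel (z : A.F₁ y) {k : SelfJet n X (q + 1)} (hk : k ∈ kernel n q y) :
    A.actF₁ y z k = z := by
  obtain ⟨w, rfl⟩ := A.toF₁_surjective y z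
  rw [A.actF₁_toF₁ w hk.1]
  refine (A.toF₁_eq_iff _ _).2 ⟨_, kernel_jetInv hk, ?_⟩
  exact A.pact_jetInv_of_pact (mem_pactDomain_isotropy w.2 hk.1)

/-- Two lifts of the same `q`-jet differ by `g⁻¹ h` in the kernel, which acts trivially on the
quotient. So the action descends to order `q`. -/
lemma actF₁_eq_of_proj_eq (z : A.F₁ y) {g h : SelfJet n X (q + 1)}
    (hg : g ∈ isotropy n (q + 1) y) (hh : h ∈ isotropy n (q + 1) y) (hgh : g.proj = h.proj) :
    A.actF₁ y z g = A.actF₁ y z h := by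
  have hk : (jetInv g).comp h ∈ kernel n q y := by
    rw [← hg.2.1]
    exact jetInv_comp_mem_kernel hg.1 hh.1 hgh
  conv_rhs => rw [← jetInv_comp_cancel hg.1 (g := h) (hg.2.2.trans hh.2.2.symm)]
  rw [A.actF₁_comp z hg hk.1, A.actF₁_kernel _ hk]

lemma actF₁_iff (z z' : A.F₁ y) {g : SelfJet n X (q + 1)} (hg : g ∈ isotropy n (q + 1) y) :
    A.ActF₁ y z g z' ↔ A.actF₁ y z g = z' := by
  constructor
  · rintro ⟨w, w', rfl, rfl, h⟩
    rw [A.actF₁_toF₁ w hg]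
    congr 1
    exact Subtype.ext (A.pact_eq h)
  · rintro rfl
    obtain ⟨w, rfl⟩ := A.toF₁_surjective y z
    exact ⟨w, _, rfl, (A.actF₁_toF₁ w hg).symm,
      A.prolongedAct_iff.2 ⟨mem_pactDomain_isotropy w.2 hg, rfl⟩⟩

lemma exists_isotropy_lift {g : SelfJet n X q} (hg : g ∈ isotropy n q y) :
    ∃ h ∈ isotropy n (q + 1) y, h.proj = g := by
  obtain ⟨h, hh, rfl⟩ := exists_lift_mem hg.1
  exact ⟨h, ⟨hh, (Jet.src_proj h).symm.trans hg.2.1, (Jet.tgt_proj h).symm.trans hg.2.2⟩, rfl⟩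

variable (y) in
/-- The action of `Π_q(y, y)` on `F₁`, as a function. -/
def actF₁q (z : A.F₁ y) (g : SelfJet n X q) : A.F₁ y :=
  open Classical in
  if hg : g ∈ isotropy n q y then A.actF₁ y z (exists_isotropy_lift hg).choose else z

lemma actF₁q_proj (z : A.F₁ y) {g : SelfJet n X (q + 1)} (hg : g ∈ isotropy n (q + 1) y) :
    A.actF₁q y z g.proj = A.actF₁ y z g := by
  have h := isotropy_proj hg
  unfold actF₁q
  rw [dif_pos h]
  obtain ⟨h1, h2⟩ := (exists_isotropy_lift h).choose_spec
  exact A.actF₁_eq_of_proj_eq z h1 hg h2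

variable [TopologicalSpace (A.F₁ y)] [ChartedSpace (Euc r₁) (A.F₁ y)]

/-- For smoothness, a class is lifted to a jet by a local section of the submersion onto `F_1`, the
jet is acted upon, and the result is projected again. -/
lemma isIsotropyAction_actF₁ (hF : HasFibredCharts n d r π)
    (hsub : IsSubmersionOnSubset (jetModel n d 1) 𝓘(ℝ, Euc r₁) (A.toF₁ y)) :
    IsIsotropyAction r₁ y (A.ActF₁ y) (A.actF₁ y) where
  iff z z' g hg := A.actF₁_iff z z' hg
  unit z := A.actF₁_kernel z (kernel_unit y)
  comp z g hg h hh := A.actF₁_comp z hg hh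
  smooth z g hg := by
    obtain ⟨w, rfl⟩ := A.toF₁_surjective y z
    obtain ⟨σ, h1, h2, h3⟩ := hsub.exists_section w
    obtain ⟨T, hT, hTs⟩ := hsub.1.exists_extension w
    set S := {p : A.F₁ y × SelfJet n X (q + 1) | p.2 ∈ isotropy n (q + 1) y}
    have hx : (A.toF₁ y w, g) ∈ S := hg
    have s1 : SmNear (𝓘(ℝ, Euc r₁).prod (jetModel n n (q + 1))) (jetModel n d 1)
        (fun p : A.F₁ y × SelfJet n X (q + 1) => (σ p.1).1) (A.toF₁ y w, g) :=
      SmNear.comp (f := Prod.fst) (g := fun z => (σ z).1) h2 (smNear_fst _)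
    have s2 : SmOn (𝓘(ℝ, Euc r₁).prod (jetModel n n (q + 1))) (jetModel n d 1) S
        (fun p : A.F₁ y × SelfJet n X (q + 1) => A.pact (σ p.1).1 p.2) (A.toF₁ y w, g) := by
      refine SmOn.comp (f := fun p : A.F₁ y × SelfJet n X (q + 1) => ((σ p.1).1, p.2)) hx
        (A.smOn_pact hF (mem_pactDomain_isotropy (σ (A.toF₁ y w)).2 hg))
        ((s1.prodMk (smNear_snd _)).smOn S) ?_
      filter_upwards [self_mem_nhdsWithin] with p hp
      exact mem_pactDomain_isotropy (σ p.1).2 hp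
    have s3 := SmOn.comp hx (hTs _ (A.pact_mem_sectionJetsAt (σ (A.toF₁ y w)).2 hg)) s2 (by
      filter_upwards [self_mem_nhdsWithin] with p hp
      exact A.pact_mem_sectionJetsAt (σ p.1).2 hp)
    refine s3.congr ?_
    have h4 : ∀ᶠ p : A.F₁ y × SelfJet n X (q + 1) in 𝓝 (A.toF₁ y w, g),
        A.toF₁ y (σ p.1) = p.1 := (continuous_fst.tendsto (A.toF₁ y w, g)).eventually h3
    filter_upwards [self_mem_nhdsWithin, mem_nhdsWithin_of_mem_nhds h4] with p hp hp4
    conv_lhs => rw [← hp4]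
    rw [A.actF₁_toF₁ _ hp]
    exact (hT _).symm

/-- Everything is deduced from order `q + 1`: algebraically by lifting single isotropy elements, and
for smoothness by a smooth local lift of jets, which stays in the isotropy group since source and
target are not changed by projection. -/
lemma isIsotropyAction_actF₁q (hF : HasFibredCharts n d r π)
    (hsub : IsSubmersionOnSubset (jetModel n d 1) 𝓘(ℝ, Euc r₁) (A.toF₁ y)) :
    IsIsotropyAction r₁ y (A.ActF₁q y) (A.actF₁q y) where
  iff z z' g hg := by
    constructor
    · rintro ⟨h, hh, rfl, hz⟩
      rw [A.actF₁q_proj z hh]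
      exact (A.actF₁_iff z z' hh).1 hz
    · rintro rfl
      obtain ⟨h, hh, rfl⟩ := exists_isotropy_lift hg
      exact ⟨h, hh, rfl, (A.actF₁_iff _ _ hh).2 (A.actF₁q_proj z hh).symm⟩
  unit z := by
    rw [← proj_unitJet, A.actF₁q_proj z (isotropy_unit y), A.actF₁_kernel z (kernel_unit y)]
  comp z g hg h hh := by
    obtain ⟨g', hg', rfl⟩ := exists_isotropy_lift hg
    obtain ⟨h', hh', rfl⟩ := exists_isotropy_lift hh
    rw [← proj_comp_jet (hg'.2.1.trans hh'.2.2.symm), A.actF₁q_proj z hg', A.actF₁q_proj _ hh',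
      A.actF₁q_proj z (isotropy_comp hg' hh'), A.actF₁_comp z hg' hh']
  smooth z g hg := by
    obtain ⟨h, hh, rfl⟩ := exists_isotropy_lift hg
    obtain ⟨l, hl, hlh, hlp⟩ := Jet.exists_lift h
    set S := {p : A.F₁ y × SelfJet n X q | p.2 ∈ isotropy n q y}
    have s1 : SmNear (𝓘(ℝ, Euc r₁).prod (jetModel n n q)) (jetModel n n (q + 1))
        (fun p : A.F₁ y × SelfJet n X q => l p.2) (z, h.proj) :=
      SmNear.comp (f := Prod.snd) hl (smNear_snd _)
    have h1 : ∀ᶠ p : A.F₁ y × SelfJet n X q in 𝓝 (z, h.proj),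
        l p.2 ∈ fullJetGroupoid n X (q + 1) :=
      s1.continuousAt.eventually (eventually_mem (by dsimp only; rw [hlh]; exact hh.1))
    have h2 : ∀ᶠ p : A.F₁ y × SelfJet n X q in 𝓝 (z, h.proj), (l p.2).proj = p.2 :=
      (continuous_snd.tendsto (z, h.proj)).eventually hlp
    have h3 : ∀ᶠ p : A.F₁ y × SelfJet n X q in 𝓝[S] (z, h.proj),
        l p.2 ∈ isotropy n (q + 1) y ∧ (l p.2).proj = p.2 := by
      filter_upwards [mem_nhdsWithin_of_mem_nhds h1, mem_nhdsWithin_of_mem_nhds h2,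
        self_mem_nhdsWithin] with p e1 e2 e3
      have e3' : p.2 ∈ isotropy n q y := e3
      refine ⟨⟨e1, ?_, ?_⟩, e2⟩
      · rw [← Jet.src_proj, e2, e3'.2.1]
      · rw [← Jet.tgt_proj, e2, e3'.2.2]
    refine (SmOn.comp (f := fun p : A.F₁ y × SelfJet n X q => (p.1, l p.2)) (S := S) hg
      ((A.isIsotropyAction_actF₁ hF hsub).smooth z (l h.proj) (hlh.symm ▸ hh))
      (((smNear_fst _).prodMk s1).smOn S) (by filter_upwards [h3] with p hp using hp.1)).congr ?_
    filter_upwards [h3] with p hp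
    conv_lhs => rw [← hp.2]
    exact A.actF₁q_proj _ hp.1

end JetAction

end IsotropyActions

/-! ### The groupoid action on an associated bundle -/

section RightMultiplication

variable {n k r₁ : ℕ} {X Z : Type*} [TopologicalSpace X] [ChartedSpace (Euc n) X]
  [TopologicalSpace Z] [ChartedSpace (Euc r₁) Z]
  [IsManifold 𝓘(ℝ, Euc n) ∞ X] {y₀ : X} {ρ : Z → SelfJet n X k → Z → Prop}

namespace AssocBundle

/-- The right action `[f, z] g = [f g, z]` on an associated bundle. -/
def rightMul (u : AssocBundle y₀ ρ) (g : SelfJet n X k) : AssocBundle y₀ ρ :=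
  open Classical in
  -- Jets that cannot be composed with `f` act as the identity. Whether they can depends only on the
  -- source of `f`, so the case distinction descends to the quotient.
  Quot.liftOn u (fun p => if h : g ∈ fullJetGroupoid n X k ∧ p.1.1.src = g.tgt then
      mk ρ (principalBundle.mul p.1 g h.1 h.2) p.2 else mk ρ p.1 p.2) (by
    rintro ⟨f, z⟩ ⟨f', z'⟩ h
    obtain ⟨g₀, hg₀, h1, h2⟩ := id h
    dsimp only at h1 h2 ⊢
    have h3 : f.1.src = f'.1.src := by rw [h1, Jet.src_comp]
    by_cases hg : g ∈ fullJetGroupoid n X k ∧ f.1.src = g.tgt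
    · rw [dif_pos hg, dif_pos (h3 ▸ hg)]
      refine Quot.sound ⟨g₀, hg₀, ?_, h2⟩
      change f.1.comp g = g₀.comp (f'.1.comp g)
      rw [h1, jet_comp_assoc (hg₀.2.1.trans f'.2.2.symm) (h3 ▸ hg.2)]
    · rw [dif_neg hg, dif_neg (h3 ▸ hg)]
      exact Quot.sound h)

lemma rightMul_mk (f : principalBundle n k y₀) (z : Z) {g : SelfJet n X k}
    (hg : g ∈ fullJetGroupoid n X k) (h : f.1.src = g.tgt) :
    rightMul (mk ρ f z) g = mk ρ (principalBundle.mul f g hg h) z := dif_pos ⟨hg, h⟩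

/-- The right action on an associated bundle as an action of `Π_k`. -/
def jetAction {d₁ : ℕ} [TopologicalSpace (AssocBundle y₀ ρ)]
    [ChartedSpace (Euc d₁) (AssocBundle y₀ ρ)]
    (hsub : IsSubmersionOnSubset ((jetModel n n k).prod 𝓘(ℝ, Euc r₁)) 𝓘(ℝ, Euc d₁)
      (quotientMap (y₀ := y₀) ρ)) :
    JetAction n d₁ k (base : AssocBundle y₀ ρ → X) where
  act := rightMul
  π_act u f hf h := by
    obtain ⟨e, z, rfl⟩ := mk_surjective u
    rw [rightMul_mk e z hf h]
    exact Jet.src_comp _ _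
  act_comp u f hf g hg h hfg := by
    obtain ⟨e, z, rfl⟩ := mk_surjective u
    have h' : (principalBundle.mul e f hf h).1.src = g.tgt := (Jet.src_comp _ _).trans hfg
    rw [rightMul_mk e z hf h, rightMul_mk _ z hg h',
      rightMul_mk e z (comp_mem hf hg hfg) (h.trans (Jet.tgt_comp hfg).symm)]
    congr 1
    exact Subtype.ext (jet_comp_assoc h hfg)
  act_unit u := by
    obtain ⟨e, z, rfl⟩ := mk_surjective u
    refine (rightMul_mk e z (unitJet_mem _) (tgt_unitJet _).symm).trans ?_
    congr 1
    exact Subtype.ext (jet_comp_unit e.1)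
  smooth := by
    refine smoothOnSubset_iff_smOn (f := fun p : AssocBundle y₀ ρ × SelfJet n X k =>
      rightMul p.1 p.2) |>.2 ?_
    rintro ⟨u, g⟩ ⟨hg, hug⟩
    obtain ⟨p, rfl⟩ := quotientMap_surjective u
    obtain ⟨σ, h1, h2, h3⟩ := hsub.exists_section p
    obtain ⟨T, hT, hTs⟩ := hsub.1.exists_extension p
    set S := {p : AssocBundle y₀ ρ × SelfJet n X k |
      p.2 ∈ fullJetGroupoid n X k ∧ base p.1 = p.2.tgt}
    set x : AssocBundle y₀ ρ × SelfJet n X k := (quotientMap ρ p, g)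
    have hx : x ∈ S := ⟨hg, hug⟩
    have s1 : SmNear (𝓘(ℝ, Euc d₁).prod (jetModel n n k)) ((jetModel n n k).prod 𝓘(ℝ, Euc r₁))
        (fun v : AssocBundle y₀ ρ × SelfJet n X k => (σ v.1).1) x :=
      SmNear.comp (f := Prod.fst) (g := fun z => (σ z).1) h2 (smNear_fst _)
    have h4 : ∀ᶠ v in 𝓝[S] x, quotientMap ρ (σ v.1) = v.1 :=
      mem_nhdsWithin_of_mem_nhds ((continuous_fst.tendsto x).eventually h3)
    -- The lifted representative of a class near `x` remains composable, as its source is the base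
    -- point of the class.
    have h5 : ∀ᶠ v in 𝓝[S] x, (σ v.1).1.1.src = v.2.tgt := by
      filter_upwards [h4, self_mem_nhdsWithin] with v e1 e2
      have := congrArg base e1
      exact this.trans e2.2
    have hpx : (σ x.1).1.1.src = x.2.tgt := h5.self_of_nhdsWithin hx
    have s2 : SmOn (𝓘(ℝ, Euc d₁).prod (jetModel n n k)) (jetModel n n k) S
        (fun v => (σ v.1).1.1.comp v.2) x := by
      refine SmOn.comp (f := fun v : AssocBundle y₀ ρ × SelfJet n X k => ((σ v.1).1.1, v.2)) hx
        (Jet.smOn_comp hpx) ((s1.fst.prodMk (smNear_snd x)).smOn S) ?_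
      filter_upwards [h5] with v hv using hv
    have hmem : ∀ v ∈ S, (σ v.1).1.1.src = v.2.tgt →
        (σ v.1).1.1.comp v.2 ∈ principalBundle n k y₀ := fun v hv e =>
      (principalBundle.mul ⟨_, (σ v.1).2⟩ v.2 hv.1 e).2
    refine (SmOn.comp (f := fun v : AssocBundle y₀ ρ × SelfJet n X k =>
      ((σ v.1).1.1.comp v.2, (σ v.1).1.2)) hx (hTs _ (hmem x hx hpx))
      (s2.prodMk (s1.snd.smOn S)) ?_).congr ?_
    · filter_upwards [h5, self_mem_nhdsWithin] with v e1 e2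
      exact hmem v e2 e1
    · filter_upwards [h4, h5, self_mem_nhdsWithin] with v e1 e2 e3
      conv_lhs => rw [← e1]
      exact (rightMul_mk (ρ := ρ) ⟨_, (σ v.1).2⟩ (σ v.1).1.2 e3.1 e2).trans
        (hT ⟨((σ v.1).1.1.comp v.2, (σ v.1).1.2), hmem v e3 e2⟩).symm

end AssocBundle

end RightMultiplication

/-! ### The isomorphism between the bundles built from orders `q + 1` and `q` -/

section Projection

variable {n q r₁ d₁ : ℕ} {X Z : Type*} [TopologicalSpace X] [ChartedSpace (Euc n) X]
  [TopologicalSpace Z] [ChartedSpace (Euc r₁) Z]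
  [IsManifold 𝓘(ℝ, Euc n) ∞ X] [IsManifold 𝓘(ℝ, Euc r₁) ∞ Z] {y₀ : X}
  {ρ' : Z → SelfJet n X (q + 1) → Z → Prop} {a' : Z → SelfJet n X (q + 1) → Z}
  {ρ : Z → SelfJet n X q → Z → Prop} {a : Z → SelfJet n X q → Z}

namespace AssocBundle

/-- Equality of classes is expressed by the action of `f f'⁻¹` on the fibre, and the action in order
`q + 1` factors through the projection. So the map is well defined and injective at once. -/
lemma mk_proj_eq_iff (ha' : IsIsotropyAction r₁ y₀ ρ' a') (ha : IsIsotropyAction r₁ y₀ ρ a)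
    (haa : ∀ z, ∀ g ∈ isotropy n (q + 1) y₀, a z g.proj = a' z g)
    {f f' : principalBundle n (q + 1) y₀} {z z' : Z} :
    mk ρ (principalBundle.proj f) z = mk ρ (principalBundle.proj f') z' ↔
      mk ρ' f z = mk ρ' f' z' := by
  rw [ha.mk_eq_iff, ha'.mk_eq_iff]
  change f.1.proj.src = f'.1.proj.src ∧ a z (f.1.proj.comp (jetInv f'.1.proj)) = z' ↔ _
  rw [Jet.src_proj, Jet.src_proj]
  refine and_congr_right fun h => ?_
  rw [← proj_jetInv f'.2.1, ← proj_comp_jet (h.trans (tgt_jetInv f'.2.1).symm),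
    haa z _ (comp_jetInv_mem_isotropy f f' h)]

lemma proj_surjective (f : principalBundle n q y₀) :
    ∃ g : principalBundle n (q + 1) y₀, principalBundle.proj g = f := by
  obtain ⟨g, hg, h⟩ := exists_lift_mem f.2.1
  exact ⟨⟨g, hg, by rw [← Jet.tgt_proj, h, f.2.2]⟩, Subtype.ext h⟩

/-- The map `[f, z] ↦ [π(f), z]` between associated bundles of consecutive orders. -/
def projEquiv (ha' : IsIsotropyAction r₁ y₀ ρ' a') (ha : IsIsotropyAction r₁ y₀ ρ a)
    (haa : ∀ z, ∀ g ∈ isotropy n (q + 1) y₀, a z g.proj = a' z g) :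
    AssocBundle y₀ ρ' ≃ AssocBundle y₀ ρ :=
  Equiv.ofBijective
    (Quot.lift (fun p => mk ρ (principalBundle.proj p.1) p.2) fun _ _ h =>
      (mk_proj_eq_iff ha' ha haa).2 (Quot.sound h)) (by
    constructor
    · intro u v h
      obtain ⟨f, z, rfl⟩ := mk_surjective u
      obtain ⟨f', z', rfl⟩ := mk_surjective v
      exact (mk_proj_eq_iff ha' ha haa).1 h
    · intro u
      obtain ⟨f, z, rfl⟩ := mk_surjective u
      obtain ⟨g, rfl⟩ := proj_surjective f
      exact ⟨mk ρ' g z, rfl⟩)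

variable (ha' : IsIsotropyAction r₁ y₀ ρ' a') (ha : IsIsotropyAction r₁ y₀ ρ a)
  (haa : ∀ z, ∀ g ∈ isotropy n (q + 1) y₀, a z g.proj = a' z g)
  [TopologicalSpace (AssocBundle y₀ ρ')] [ChartedSpace (Euc d₁) (AssocBundle y₀ ρ')]
  [TopologicalSpace (AssocBundle y₀ ρ)] [ChartedSpace (Euc d₁) (AssocBundle y₀ ρ)]
  (hsub' : IsSubmersionOnSubset ((jetModel n n (q + 1)).prod 𝓘(ℝ, Euc r₁)) 𝓘(ℝ, Euc d₁)
    (quotientMap (y₀ := y₀) ρ'))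
  (hsub : IsSubmersionOnSubset ((jetModel n n q).prod 𝓘(ℝ, Euc r₁)) 𝓘(ℝ, Euc d₁)
    (quotientMap (y₀ := y₀) ρ))

lemma projEquiv_mk (f : principalBundle n (q + 1) y₀) (z : Z) :
    projEquiv ha' ha haa (mk ρ' f z) = mk ρ (principalBundle.proj f) z := rfl

lemma projEquiv_symm_mk (f : principalBundle n (q + 1) y₀) (z : Z) :
    (projEquiv ha' ha haa).symm (mk ρ (principalBundle.proj f) z) = mk ρ' f z := by
  rw [Equiv.symm_apply_eq, projEquiv_mk]

lemma base_projEquiv (u : AssocBundle y₀ ρ') : (projEquiv ha' ha haa u).base = u.base := by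
  obtain ⟨f, z, rfl⟩ := mk_surjective u
  exact Jet.src_proj _

include hsub' hsub in
lemma smNear_projEquiv (u : AssocBundle y₀ ρ') :
    SmNear 𝓘(ℝ, Euc d₁) 𝓘(ℝ, Euc d₁) (projEquiv ha' ha haa) u := by
  obtain ⟨p, rfl⟩ := quotientMap_surjective u
  obtain ⟨σ, h1, h2, h3⟩ := hsub'.exists_section p
  refine SmNear.congr (hsub.1.comp_smNear (K := 𝓘(ℝ, Euc d₁))
    (γ := fun v => ⟨((σ v).1.1.proj, (σ v).1.2), (principalBundle.proj ⟨_, (σ v).2⟩).2⟩)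
    ((SmNear.comp (f := fun v => (σ v).1.1) (Jet.smNear_proj _) h2.fst).prodMk h2.snd)) ?_
  filter_upwards [h3] with v hv
  conv_lhs => rw [← hv]
  rfl

include hsub' hsub in
-- A representative `(f, z)` is chosen smoothly by a local section of the quotient map, and `f` is
-- then raised to order `q + 1` by a smooth lift of jets.
lemma smNear_projEquiv_symm (u : AssocBundle y₀ ρ) :
    SmNear 𝓘(ℝ, Euc d₁) 𝓘(ℝ, Euc d₁) (projEquiv ha' ha haa).symm u := by
  obtain ⟨f, z, rfl⟩ := mk_surjective u
  obtain ⟨f, rfl⟩ := proj_surjective f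
  obtain ⟨σ, h1, h2, h3⟩ := hsub.exists_section ⟨(f.1.proj, z), (principalBundle.proj f).2⟩
  obtain ⟨l, hl, hlf, hlp⟩ := Jet.exists_lift f.1
  set u := mk ρ (principalBundle.proj f) z
  have hσu : σ u = ⟨(f.1.proj, z), (principalBundle.proj f).2⟩ := h1
  have s1 : SmNear 𝓘(ℝ, Euc d₁) (jetModel n n q) (fun v => (σ v).1.1) u := SmNear.fst h2
  have e1 : (σ u).1.1 = f.1.proj := by rw [hσu]
  have s2 : SmNear 𝓘(ℝ, Euc d₁) (jetModel n n (q + 1)) (fun v => l (σ v).1.1) u :=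
    hl.comp_eq s1 e1
  have ht : Tendsto (fun v => (σ v).1.1) (𝓝 u) (𝓝 f.1.proj) := e1 ▸ s1.continuousAt.tendsto
  have hmem : ∀ᶠ v in 𝓝 u, l (σ v).1.1 ∈ principalBundle n (q + 1) y₀ ∧
      (l (σ v).1.1).proj = (σ v).1.1 := by
    filter_upwards [ht.eventually hlp, s2.continuousAt.eventually
      (eventually_mem (f := l (σ u).1.1) (by rw [e1, hlf]; exact f.2.1))] with v e2 e3
    exact ⟨⟨e3, by rw [← Jet.tgt_proj, e2, (σ v).2.2]⟩, e2⟩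
  classical
  -- The lift is in the principal bundle only near `u`; elsewhere a fixed element is used.
  set γ : AssocBundle y₀ ρ → {p : SelfJet n X (q + 1) × Z | p.1 ∈ principalBundle n (q + 1) y₀} :=
    fun v => if h : l (σ v).1.1 ∈ principalBundle n (q + 1) y₀ then ⟨(l (σ v).1.1, (σ v).1.2), h⟩
      else ⟨(f.1, z), f.2⟩ with hγ
  have s3 : SmNear 𝓘(ℝ, Euc d₁) ((jetModel n n (q + 1)).prod 𝓘(ℝ, Euc r₁)) (fun v => (γ v).1) u := by
    refine (s2.prodMk h2.snd).congr ?_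
    filter_upwards [hmem] with v hv
    exact congrArg Subtype.val (dif_pos hv.1)
  refine (hsub'.1.comp_smNear s3).congr ?_
  filter_upwards [hmem, h3] with v hv hv3
  have e4 : γ v = ⟨(l (σ v).1.1, (σ v).1.2), hv.1⟩ := dif_pos hv.1
  rw [e4, Equiv.symm_apply_eq]
  conv_lhs => rw [← hv3]
  change mk ρ ⟨(σ v).1.1, (σ v).2⟩ (σ v).1.2 = mk ρ (principalBundle.proj ⟨_, hv.1⟩) (σ v).1.2
  congr 1
  exact Subtype.ext hv.2.symm

/-- The diffeomorphism `[f, z] ↦ [π(f), z]`. -/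
def projDiffeo : AssocBundle y₀ ρ' ≃ₘ⟮𝓘(ℝ, Euc d₁), 𝓘(ℝ, Euc d₁)⟯ AssocBundle y₀ ρ where
  toEquiv := projEquiv ha' ha haa
  contMDiff_toFun u := (smNear_projEquiv ha' ha haa hsub' hsub u).contMDiffAt
  contMDiff_invFun u := (smNear_projEquiv_symm ha' ha haa hsub' hsub u).contMDiffAt

end AssocBundle

/-- An action on a bundle, moved along a diffeomorphism of bundles. -/
def JetAction.transport {k : ℕ} {B B' : Type*} [TopologicalSpace B] [ChartedSpace (Euc d₁) B]
    [TopologicalSpace B'] [ChartedSpace (Euc d₁) B'] {π : B → X} {π' : B' → X}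
    (A : JetAction n d₁ k π') (Ψ : B ≃ₘ⟮𝓘(ℝ, Euc d₁), 𝓘(ℝ, Euc d₁)⟯ B')
    (hΨ : ∀ u, π' (Ψ u) = π u) : JetAction n d₁ k π where
  act u g := Ψ.symm (A.act (Ψ u) g)
  π_act u f hf h := by
    rw [← hΨ, Ψ.apply_symm_apply, A.π_act _ f hf ((hΨ u).trans h)]
  act_comp u f hf g hg h hfg := by
    rw [A.act_comp _ f hf g hg ((hΨ u).trans h) hfg, Ψ.apply_symm_apply]
  act_unit u := by
    rw [← hΨ, A.act_unit, Ψ.symm_apply_apply]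
  smooth := by
    refine smoothOnSubset_iff_smOn (f := fun p : B × SelfJet n X k =>
      Ψ.symm (A.act (Ψ p.1) p.2)) |>.2 ?_
    rintro ⟨u, g⟩ ⟨hg, hu⟩
    have hu' : π u = g.tgt := hu
    have s1 : SmNear (𝓘(ℝ, Euc d₁).prod (jetModel n n k)) (𝓘(ℝ, Euc d₁).prod (jetModel n n k))
        (fun p : B × SelfJet n X k => (Ψ p.1, p.2)) (u, g) :=
      (SmNear.comp (f := Prod.fst) (ContMDiff.smNear Ψ.contMDiff u) (smNear_fst (u, g))).prodMk
        (smNear_snd _)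
    refine SmNear.comp_smOn (f := fun p : B × SelfJet n X k => A.act (Ψ p.1) p.2)
      (show (u, g) ∈ {p : B × SelfJet n X k | p.2 ∈ fullJetGroupoid n X k ∧ π p.1 = p.2.tgt} from
        ⟨hg, hu⟩) (ContMDiff.smNear Ψ.symm.contMDiff _) ?_
    refine SmOn.comp (f := fun p : B × SelfJet n X k => (Ψ p.1, p.2))
      (show (u, g) ∈ {p : B × SelfJet n X k | p.2 ∈ fullJetGroupoid n X k ∧ π p.1 = p.2.tgt} from
        ⟨hg, hu⟩)
      (smoothOnSubset_iff_smOn (f := fun p : B' × SelfJet n X k => A.act p.1 p.2) |>.1 A.smooth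
        (Ψ u, g) ⟨hg, (hΨ u).trans hu'⟩) (s1.smOn _) ?_
    filter_upwards [self_mem_nhdsWithin] with p hp
    exact ⟨hp.1, (hΨ p.1).trans hp.2⟩

end Projection

/-! ### The submersion `I` from 1-jets of sections -/

section JetClass

variable {n d r q r₁ d₁ : ℕ} {X B : Type*} [TopologicalSpace X] [ChartedSpace (Euc n) X]
  [TopologicalSpace B] [ChartedSpace (Euc d) B]
  [IsManifold 𝓘(ℝ, Euc n) ∞ X] [IsManifold 𝓘(ℝ, Euc d) ∞ B] {π : B → X}

lemma isSubmersionOnSubset_of_smNear {E H M E' H' N : Type*}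
    [NormedAddCommGroup E] [NormedSpace ℝ E] [TopologicalSpace H]
    [TopologicalSpace M] [ChartedSpace H M] {I : ModelWithCorners ℝ E H}
    [NormedAddCommGroup E'] [NormedSpace ℝ E'] [TopologicalSpace H']
    [TopologicalSpace N] [ChartedSpace H' N] {J : ModelWithCorners ℝ E' H'}
    {S : Set M} {f : S → N} (hf : SmoothOnSubset I J f)
    (h : ∀ x : S, ∃ σ : N → S, σ (f x) = x ∧ SmNear J I (fun y => (σ y : M)) (f x) ∧
      ∀ᶠ y in 𝓝 (f x), f (σ y) = y) : IsSubmersionOnSubset I J f :=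
  ⟨hf, fun x => by
    obtain ⟨σ, h1, h2, h3⟩ := h x
    refine ⟨_, h2.and h3, σ, h1, fun y hy => hy.1.contMDiffWithinAt, fun y hy => hy.2⟩⟩

namespace JetAction

variable (A : JetAction n d q π) {y₀ : X}

lemma mem_pactDomain_jetInv {v : Jet (Euc n) (Euc d) X B 1} (hv : v ∈ sectionJets n d 1 π)
    {f : SelfJet n X (q + 1)} (hf : f ∈ fullJetGroupoid n X (q + 1)) (h : f.src = v.src) :
    (v, jetInv f) ∈ pactDomain n d q π :=
  ⟨hv, jetInv_mem hf, h.symm.trans (tgt_jetInv hf).symm⟩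

lemma pact_jetInv_mem {v : Jet (Euc n) (Euc d) X B 1} (hv : v ∈ sectionJets n d 1 π)
    (f : principalBundle n (q + 1) y₀) (h : f.1.src = v.src) :
    A.pact v (jetInv f.1) ∈ sectionJetsAt n d π y₀ := by
  have h1 := mem_pactDomain_jetInv hv f.2.1 h
  exact ⟨A.pact_mem h1, by rw [A.src_pact h1, src_jetInv f.2.1, f.2.2]⟩

lemma mem_pactDomain_principal {w : Jet (Euc n) (Euc d) X B 1} (hw : w ∈ sectionJetsAt n d π y₀)
    (f : principalBundle n (q + 1) y₀) : (w, f.1) ∈ pactDomain n d q π :=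
  ⟨hw.1, f.2.1, hw.2.trans f.2.2.symm⟩

variable (y₀) in
/-- The invariant quotient map from the bundle of 1-jets of sections: `w f ↦ [f, w K]`. -/
def jetClass (v : sectionJets n d 1 π) : A.𝓕₁ y₀ :=
  AssocBundle.mk (A.ActF₁ y₀) (exists_mem_principalBundle (n := n) (q + 1) y₀ v.1.src).choose
    (A.toF₁ y₀ ⟨_, A.pact_jetInv_mem v.2 _
      (exists_mem_principalBundle (n := n) (q + 1) y₀ v.1.src).choose_spec⟩)

@[simp] lemma base_jetClass (v : sectionJets n d 1 π) : (A.jetClass y₀ v).base = v.1.src :=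
  (exists_mem_principalBundle (n := n) (q + 1) y₀ v.1.src).choose_spec

variable [TopologicalSpace (A.F₁ y₀)] [ChartedSpace (Euc r₁) (A.F₁ y₀)]
  [IsManifold 𝓘(ℝ, Euc r₁) ∞ (A.F₁ y₀)]

section

variable (ha : IsIsotropyAction r₁ y₀ (A.ActF₁ y₀) (A.actF₁ y₀))

include ha

/-- Two arrows `g`, `f` from the source of `v` to `y₀` differ by the isotropy element `g f⁻¹`, which
takes `v g⁻¹` to `v f⁻¹` and is absorbed by the quotient. -/
lemma jetClass_eq (v : sectionJets n d 1 π) (f : principalBundle n (q + 1) y₀)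
    (h : f.1.src = v.1.src) : A.jetClass y₀ v =
      AssocBundle.mk (A.ActF₁ y₀) f (A.toF₁ y₀ ⟨_, A.pact_jetInv_mem v.2 f h⟩) := by
  unfold jetClass
  set g := (exists_mem_principalBundle (n := n) (q + 1) y₀ v.1.src).choose
  have hg : g.1.src = v.1.src :=
    (exists_mem_principalBundle (n := n) (q + 1) y₀ v.1.src).choose_spec
  have h1 := comp_jetInv_mem_isotropy g f (hg.trans h.symm)
  refine ha.mk_eq_iff.2 ⟨hg.trans h.symm, ?_⟩
  rw [A.actF₁_toF₁ _ h1]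
  congr 2
  dsimp only
  have e : g.1.src = (jetInv f.1).tgt := (hg.trans h.symm).trans (tgt_jetInv f.2.1).symm
  rw [← A.pact_comp (mem_pactDomain_jetInv v.2 g.2.1 hg) h1.1
    (by rw [src_jetInv g.2.1, Jet.tgt_comp e]), comp_jetInv_comp g.2.1 e]

lemma jetClass_pact (w : sectionJetsAt n d π y₀) (f : principalBundle n (q + 1) y₀)
    {w' : sectionJets n d 1 π} (h : A.pact w.1 f.1 = w'.1) :
    A.jetClass y₀ w' = AssocBundle.mk (A.ActF₁ y₀) f (A.toF₁ y₀ w) := by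
  have h1 := mem_pactDomain_principal w.2 f
  have hs : f.1.src = w'.1.src := by rw [← h, A.src_pact h1]
  rw [A.jetClass_eq ha w' f hs]
  congr 2
  refine Subtype.ext ?_
  dsimp only
  rw [← h, A.pact_jetInv_of_pact h1]

/-- The fibres of `jetClass` are the orbits of the kernels of `Π_{q+1} → Π_q`. -/
lemma jetClass_eq_iff {v v' : sectionJets n d 1 π} (h : v.1.src = v'.1.src) :
    A.jetClass y₀ v = A.jetClass y₀ v' ↔ ∃ k ∈ kernel n q v.1.src, A.pact v.1 k = v'.1 := by
  obtain ⟨f, hf⟩ := exists_mem_principalBundle (n := n) (q + 1) y₀ v.1.src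
  have d1 := mem_pactDomain_jetInv v.2 f.2.1 hf
  have hi := src_jetInv f.2.1
  rw [A.jetClass_eq ha v f hf, A.jetClass_eq ha v' f (hf.trans h), ha.mk_eq_iff,
    and_iff_right rfl, ha.act_comp_jetInv_self, A.toF₁_eq_iff]
  constructor
  · rintro ⟨k, hk, e⟩
    dsimp only at e
    have e1 : k.src = f.1.tgt := hk.1.2.1.trans f.2.2.symm
    have e2 : (jetInv f.1).src = k.tgt := by rw [hi, f.2.2, hk.1.2.2]
    refine ⟨_, kernel_conj f.2.1 hf f.2.2 hk, ?_⟩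
    rw [A.pact_comp d1 (comp_mem hk.1.1 f.2.1 e1) (by rw [Jet.tgt_comp e1, e2]),
      A.pact_comp (A.mem_pactDomain_pact d1 hk.1.1 e2) f.2.1 e1, e,
      A.pact_pact_jetInv v'.2 f.2.1 (h.symm.trans hf.symm)]
  · rintro ⟨k, hk, e⟩
    refine ⟨_, kernel_conj_jetInv f.2.1 hf f.2.2 hk, ?_⟩
    dsimp only
    have d2 : (v.1, k) ∈ pactDomain n d q π := ⟨v.2, hk.1.1, hk.1.2.2.symm⟩
    have e0 : k.src = (jetInv f.1).tgt := by rw [tgt_jetInv f.2.1, hk.1.2.1, hf]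
    have e1 : f.1.src = (k.comp (jetInv f.1)).tgt := by rw [Jet.tgt_comp e0, hk.1.2.2, hf]
    have m1 := comp_mem hk.1.1 (jetInv_mem f.2.1) e0
    rw [← A.pact_comp d1 (comp_mem f.2.1 m1 e1) (by rw [Jet.tgt_comp e1, hi]),
      comp_jetInv_comp f.2.1 e1, A.pact_comp d2 (jetInv_mem f.2.1) e0, e]

variable [TopologicalSpace (A.𝓕₁ y₀)] [ChartedSpace (Euc d₁) (A.𝓕₁ y₀)]

/-- For smoothness, the chosen arrow is replaced by a smooth local section of the principal bundle.
A local section of the map sends a class to a smooth representative `(f, z)`, lifts `z` to a jet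
`w`, and forms `w f`. -/
lemma isSubmersionOnSubset_jetClass (hF : HasFibredCharts n d r π)
    (hsub : IsSubmersionOnSubset (jetModel n d 1) 𝓘(ℝ, Euc r₁) (A.toF₁ y₀))
    (hsub' : IsSubmersionOnSubset ((jetModel n n (q + 1)).prod 𝓘(ℝ, Euc r₁)) 𝓘(ℝ, Euc d₁)
      (AssocBundle.quotientMap (y₀ := y₀) (A.ActF₁ y₀))) :
    IsSubmersionOnSubset (jetModel n d 1) 𝓘(ℝ, Euc d₁) (A.jetClass y₀) := by
  refine isSubmersionOnSubset_of_smNear ?_ fun v => ?_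
  · refine smoothOnSubset_of_smOn fun v => ?_
    obtain ⟨f, hf⟩ := exists_mem_principalBundle (n := n) (q + 1) y₀ v.1.src
    obtain ⟨θ, hθ, hθ0, hθs⟩ := exists_principal_section f
    rw [hf] at hθ0 hθs
    obtain ⟨T, hT, hTs⟩ := hsub.1.exists_extension ⟨_, A.pact_jetInv_mem v.2 f hf⟩
    obtain ⟨Q, hQ, hQs⟩ := hsub'.1.exists_extension
      ⟨(f.1, A.toF₁ y₀ ⟨_, A.pact_jetInv_mem v.2 f hf⟩), f.2⟩
    have s1 : SmNear (jetModel n d 1) (jetModel n n (q + 1)) (fun w => (θ w.src).1) v.1 :=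
      SmNear.comp (f := Jet.src) (g := fun x => (θ x).1) hθs (Jet.smNear_src v.1)
    have s2 : SmNear (jetModel n d 1) (jetModel n n (q + 1)) (fun w => jetInv (θ w.src).1) v.1 :=
      SmNear.comp (f := fun w : Jet (Euc n) (Euc d) X B 1 => (θ w.src).1)
        (smNear_jetInv (θ v.1.src).2.1).2 s1
    have s3 : SmOn (jetModel n d 1) (jetModel n d 1) (sectionJets n d 1 π)
        (fun w => A.pact w (jetInv (θ w.src).1)) v.1 := by
      refine SmOn.comp (f := fun w : Jet (Euc n) (Euc d) X B 1 => (w, jetInv (θ w.src).1)) v.2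
        (A.smOn_pact hF (mem_pactDomain_jetInv v.2 (θ v.1.src).2.1 (hθ _)))
        (((smNear_id v.1).prodMk s2).smOn _) ?_
      filter_upwards [self_mem_nhdsWithin] with w hw
      exact mem_pactDomain_jetInv hw (θ w.src).2.1 (hθ _)
    have hmem : ∀ w ∈ sectionJets n d 1 π, A.pact w (jetInv (θ w.src).1) ∈ sectionJetsAt n d π y₀ := fun w hw =>
      A.pact_jetInv_mem hw (θ w.src) (hθ _)
    have s4 : SmOn (jetModel n d 1) 𝓘(ℝ, Euc r₁) (sectionJets n d 1 π)
        (fun w => T (A.pact w (jetInv (θ w.src).1))) v.1 := by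
      refine SmOn.comp v.2 (hTs _ (hmem v.1 v.2)) s3 ?_
      filter_upwards [self_mem_nhdsWithin] with w hw using hmem w hw
    refine ⟨fun w => Q ((θ w.src).1, T (A.pact w (jetInv (θ w.src).1))), ?_, fun w => ?_⟩
    · refine SmOn.comp (f := fun w : Jet (Euc n) (Euc d) X B 1 =>
        ((θ w.src).1, T (A.pact w (jetInv (θ w.src).1)))) v.2 (hQs _ (θ v.1.src).2)
        ((s1.smOn _).prodMk s4) ?_
      exact Eventually.of_forall fun w => (θ w.src).2
    · refine (hQ ⟨((θ w.1.src).1, T (A.pact w.1 (jetInv (θ w.1.src).1))), (θ w.1.src).2⟩).trans ?_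
      rw [A.jetClass_eq ha w (θ w.1.src) (hθ _), ← hT]
      rfl
  · obtain ⟨f, hf⟩ := exists_mem_principalBundle (n := n) (q + 1) y₀ v.1.src
    set w : sectionJetsAt n d π y₀ := ⟨_, A.pact_jetInv_mem v.2 f hf⟩
    have hw : A.jetClass y₀ v = AssocBundle.mk (A.ActF₁ y₀) f (A.toF₁ y₀ w) :=
      A.jetClass_eq ha v f hf
    obtain ⟨σ, h1, h2, h3⟩ := hsub'.exists_section ⟨(f.1, A.toF₁ y₀ w), f.2⟩
    change σ (AssocBundle.mk (A.ActF₁ y₀) f (A.toF₁ y₀ w)) = _ at h1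
    rw [show AssocBundle.quotientMap (A.ActF₁ y₀) ⟨(f.1, A.toF₁ y₀ w), f.2⟩ =
      AssocBundle.mk (A.ActF₁ y₀) f (A.toF₁ y₀ w) from rfl, ← hw] at h2 h3
    rw [← hw] at h1
    obtain ⟨ς, g1, g2, g3⟩ := hsub.exists_section w
    have hσ2 : (σ (A.jetClass y₀ v)).1.2 = A.toF₁ y₀ w := by rw [h1]
    have hσ1 : (σ (A.jetClass y₀ v)).1.1 = f.1 := by rw [h1]
    have hd : ∀ u, ((ς (σ u).1.2).1, (σ u).1.1) ∈ pactDomain n d q π := fun u =>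
      mem_pactDomain_principal (ς (σ u).1.2).2 ⟨_, (σ u).2⟩
    -- At the class of `v` this is `(v f⁻¹) f = v`, so the local section passes through `v`.
    refine ⟨fun u => ⟨A.pact (ς (σ u).1.2).1 (σ u).1.1, A.pact_mem (hd u)⟩, ?_, ?_, ?_⟩
    · refine Subtype.ext ?_
      dsimp only
      rw [hσ2, hσ1, g1, A.pact_pact_jetInv v.2 f.2.1 hf.symm]
    · refine SmOn.comp_smNear (f := fun u => ((ς (σ u).1.2).1, (σ u).1.1))
        (A.smOn_pact hF (hd _)) (SmNear.prodMk (SmNear.comp_eq (f := fun u => (σ u).1.2)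
          (g := fun z => (ς z).1) g2 (SmNear.snd h2) hσ2) (SmNear.fst h2)) ?_
      exact Eventually.of_forall hd
    · have ht : Tendsto (fun u => (σ u).1.2) (𝓝 (A.jetClass y₀ v)) (𝓝 (A.toF₁ y₀ w)) := by
        have := (SmNear.snd h2).continuousAt.tendsto
        rwa [hσ2] at this
      filter_upwards [h3, ht.eventually g3] with u e1 e2
      rw [A.jetClass_pact ha (ς (σ u).1.2) ⟨_, (σ u).2⟩ rfl, e2]
      exact e1

end

end JetAction

end JetClass

/-! ### Prolonged symmetry groupoids and their projections -/

section Stabilizers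

variable {n d r q r₁ d₁ : ℕ} {X B : Type*} [TopologicalSpace X] [ChartedSpace (Euc n) X]
  [TopologicalSpace B] [ChartedSpace (Euc d) B]
  [IsManifold 𝓘(ℝ, Euc n) ∞ X] [IsManifold 𝓘(ℝ, Euc d) ∞ B] {π : B → X}

namespace JetAction

/-- For a homogeneous bundle of order zero the fibres are points, so sections with the same source
have the same germ. -/
lemma sectionJets_eq_of_order_zero (A : JetAction n d 0 π) (hA : A.IsHomogeneous)
    {v v' : Jet (Euc n) (Euc d) X B 1} (hv : v ∈ sectionJets n d 1 π)
    (hv' : v' ∈ sectionJets n d 1 π) (h : v.src = v'.src) : v = v' := by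
  obtain ⟨s, hs, e⟩ := exists_sec hv
  obtain ⟨s', hs', e'⟩ := exists_sec hv'
  rw [← h] at hs' e'
  rw [e, e']
  refine Jet.of_congr hs'.smooth ?_
  filter_upwards [hs.sec, hs'.sec] with x e1 e2
  exact A.subsingleton_fibre_of_order_zero hA (e1.trans e2.symm)

variable (A : JetAction n d q π)

/-- One side of the equation `ω(t(j)) j = ω(s(j))` of the symmetry groupoid, as a function on the
open set `Π_q`; through it 1-jets of families of arrows give 1-jets of sections. -/
lemma smNear_act_section {ω₀ : X → B} (hω : ∀ x, IsSec n d π ω₀ x) {f : SelfJet n X q}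
    (hf : f ∈ fullJetGroupoid n X q) :
    SmNear (jetModel n n q) 𝓘(ℝ, Euc d) (fun j => A.act (ω₀ j.tgt) j) f := by
  have hs : ∀ x, π (ω₀ x) = x := fun x => (hω x).sec.self_of_nhds
  refine SmOn.comp_smNear (f := fun j : SelfJet n X q => (ω₀ j.tgt, j)) (A.smOn_act hf (hs _))
    ((SmNear.comp (f := Jet.tgt) (hω f.tgt).smooth (Jet.smNear_tgt f)).prodMk (smNear_id f)) ?_
  filter_upwards [eventually_mem hf] with j hj
  exact ⟨hj, hs _⟩

/-- If a 1-jet of a section is invariant under `j_{q+1}(φ)`, then `j_{q+1}(φ)` belongs to the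
prolongation of the symmetry groupoid of the section. -/
lemma mem_prolongation_stab [T2Space X] [T2Space B] (hF : HasFibredCharts n d r π)
    (hA : A.IsHomogeneous) {ω₀ : X → B} (hω : ∀ x, IsSec n d π ω₀ x) {g : SelfJet n X (q + 1)}
    (hg : g ∈ fullJetGroupoid n X (q + 1))
    (h : A.pact (Jet.of (Euc n) (Euc d) 1 ω₀ g.tgt) g = Jet.of (Euc n) (Euc d) 1 ω₀ g.src) :
    g ∈ prolongation (A.stab ω₀) := by
  have hs : ∀ x, π (ω₀ x) = x := fun x => (hω x).sec.self_of_nhds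
  obtain ⟨φ, ψ, hφ, hgφ⟩ := exists_locDiff hg
  generalize g.src = x at hφ hgφ h
  subst hgφ
  rw [Jet.tgt_of, A.pact_of (hω _) hφ] at h
  -- The transform of the section by `φ`; by hypothesis it has the same 1-jet at `x` as `ω₀`.
  set ω₁ : X → B := fun y => A.act (ω₀ (φ y)) (Jet.of (Euc n) (Euc n) q φ y) with hω'
  have hsec : IsSec n d π ω₁ x := A.isSec_act (hω _) hφ
  set u₀ := ω₀ x with hu₀
  have hu : π u₀ = x := hs x
  have hωx : ω₁ x = u₀ := by
    have := congrArg Jet.tgt h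
    rwa [Jet.tgt_of, Jet.tgt_of] at this
  obtain ⟨τ, hτ, -⟩ := A.exists_isOrbitSection hF hA u₀ (unitJet_mem (q := q) (π u₀))
    (tgt_unitJet _)
  rw [A.act_unit] at hτ
  set f := Jet.of (Euc n) (Euc n) q φ x with hf
  have hfs : f.src = x := Jet.src_of _ _
  set D : Set (SelfJet n X q × B) := {p | p.1.src = π p.2} with hD
  have hfD : (f, u₀) ∈ D := hfs.trans hu.symm
  -- The correction `j τ(b)⁻¹ τ(ω₀(s(j)))`. For `b = ω₁(y)` and `j = j_q(φ)(y)` it is a symmetry of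
  -- `ω₀`; for `b = ω₀(y)` the two factors cancel and it is `j` again.
  set κ : SelfJet n X q × B → SelfJet n X q :=
    fun p => (p.1.comp (jetInv (τ p.2))).comp (τ (ω₀ p.1.src)) with hκ
  have hτ0 := hτ.sec.self_of_nhds
  have t1 : ∀ᶠ p : SelfJet n X q × B in 𝓝 (f, u₀), τ p.2 ∈ fullJetGroupoid n X q ∧
      (τ p.2).src = π p.2 ∧ (τ p.2).tgt = π u₀ ∧ A.act u₀ (τ p.2) = p.2 :=
    (continuous_snd.tendsto (f, u₀)).eventually hτ.sec
  have s0 : SmNear ((jetModel n n q).prod 𝓘(ℝ, Euc d)) 𝓘(ℝ, Euc d)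
      (fun p : SelfJet n X q × B => ω₀ p.1.src) (f, u₀) :=
    SmNear.comp (f := fun p : SelfJet n X q × B => p.1.src) (hω f.src).smooth
      (SmNear.comp (f := Prod.fst) (Jet.smNear_src f) (smNear_fst (f, u₀)))
  have hω0 : ω₀ f.src = u₀ := by rw [hfs]
  have t2 : ∀ᶠ p : SelfJet n X q × B in 𝓝 (f, u₀), (τ (ω₀ p.1.src)).tgt = π u₀ := by
    have ht : Tendsto (fun p : SelfJet n X q × B => ω₀ p.1.src) (𝓝 (f, u₀)) (𝓝 u₀) := by
      have := s0.continuousAt.tendsto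
      rwa [hω0] at this
    filter_upwards [ht.eventually hτ.sec] with p hp using hp.2.2.1
  have e1 : ∀ p ∈ D, τ p.2 ∈ fullJetGroupoid n X q → (τ p.2).src = π p.2 →
      p.1.src = (jetInv (τ p.2)).tgt := fun p hp h1 h2 => by
    rw [tgt_jetInv h1, h2]
    exact hp
  have s1 : SmOn ((jetModel n n q).prod 𝓘(ℝ, Euc d)) (jetModel n n q) D
      (fun p => p.1.comp (jetInv (τ p.2))) (f, u₀) := by
    have s2 : SmNear ((jetModel n n q).prod 𝓘(ℝ, Euc d)) (jetModel n n q)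
        (fun p : SelfJet n X q × B => jetInv (τ p.2)) (f, u₀) :=
      SmNear.comp (f := fun p : SelfJet n X q × B => τ p.2) (smNear_jetInv hτ0.1).2
        (SmNear.comp (f := Prod.snd) hτ.smooth (smNear_snd (f, u₀)))
    refine SmOn.comp (f := fun p : SelfJet n X q × B => (p.1, jetInv (τ p.2))) hfD
      (Jet.smOn_comp (e1 _ hfD hτ0.1 hτ0.2.1)) (((smNear_fst _).prodMk s2).smOn D) ?_
    filter_upwards [self_mem_nhdsWithin, mem_nhdsWithin_of_mem_nhds t1] with p hp h1
    exact e1 p hp h1.1 h1.2.1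
  have s3 : SmOn ((jetModel n n q).prod 𝓘(ℝ, Euc d)) (jetModel n n q) D κ (f, u₀) := by
    have s4 : SmNear ((jetModel n n q).prod 𝓘(ℝ, Euc d)) (jetModel n n q)
        (fun p : SelfJet n X q × B => τ (ω₀ p.1.src)) (f, u₀) := hτ.smooth.comp_eq s0 hω0
    have e2 : ∀ᶠ p : SelfJet n X q × B in 𝓝 (f, u₀),
        (p.1.comp (jetInv (τ p.2))).src = (τ (ω₀ p.1.src)).tgt := by
      filter_upwards [t1, t2] with p h1 h2
      rw [Jet.src_comp, src_jetInv h1.1, h1.2.2.1, h2]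
    refine SmOn.comp (f := fun p : SelfJet n X q × B =>
      (p.1.comp (jetInv (τ p.2)), τ (ω₀ p.1.src))) hfD (Jet.smOn_comp e2.self_of_nhds)
      (s1.prodMk (s4.smOn D)) ?_
    exact mem_nhdsWithin_of_mem_nhds e2
  have hjs : SmNear 𝓘(ℝ, Euc n) (jetModel n n q) (fun y => Jet.of (Euc n) (Euc n) q φ y) x :=
    Jet.smNear_of_self hφ.smooth
  have hpair : ∀ s : X → B, IsSec n d π s x → s x = u₀ →
      SmNear 𝓘(ℝ, Euc n) ((jetModel n n q).prod 𝓘(ℝ, Euc d))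
        (fun y => (Jet.of (Euc n) (Euc n) q φ y, s y)) x ∧
      Tendsto (fun y => (Jet.of (Euc n) (Euc n) q φ y, s y)) (𝓝 x) (𝓝[D] (f, u₀)) := by
    intro s h1 h2
    have h3 : SmNear 𝓘(ℝ, Euc n) ((jetModel n n q).prod 𝓘(ℝ, Euc d))
        (fun y => (Jet.of (Euc n) (Euc n) q φ y, s y)) x := hjs.prodMk h1.smooth
    refine ⟨h3, tendsto_nhdsWithin_iff.2 ⟨?_, ?_⟩⟩
    · have := h3.continuousAt.tendsto
      rwa [h2] at this
    · filter_upwards [h1.sec] with y hy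
      exact (Jet.src_of _ _).trans hy.symm
  obtain ⟨H, hH, hHκ⟩ := id s3
  -- As `ω₁` and `ω₀` have the same 1-jet at `x`, the corrected arrows and the arrows `j_q(φ)` have
  -- the same 1-jet there.
  have key := Jet.of_one_congr (h := H) (f := fun y => Jet.of (Euc n) (Euc n) q φ y)
    (f' := fun y => Jet.of (Euc n) (Euc n) q φ y) (g := ω₁) (g' := ω₀) hjs hjs hsec.smooth
    (hω x).smooth (by rw [hωx]; exact hH) rfl h
  obtain ⟨p1, p2⟩ := hpair ω₁ hsec hωx
  obtain ⟨p3, p4⟩ := hpair ω₀ (hω x) rfl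
  have hτω' : ∀ᶠ y in 𝓝 x, τ (ω₁ y) ∈ fullJetGroupoid n X q ∧ (τ (ω₁ y)).src = π (ω₁ y) ∧
      (τ (ω₁ y)).tgt = π u₀ ∧ A.act u₀ (τ (ω₁ y)) = ω₁ y :=
    (p2.mono_right nhdsWithin_le_nhds).eventually t1
  have hτω : ∀ᶠ y in 𝓝 x, τ (ω₀ y) ∈ fullJetGroupoid n X q ∧ (τ (ω₀ y)).src = π (ω₀ y) ∧
      (τ (ω₀ y)).tgt = π u₀ ∧ A.act u₀ (τ (ω₀ y)) = ω₀ y :=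
    (p4.mono_right nhdsWithin_le_nhds).eventually t1
  set σ : X → SelfJet n X q := fun y => κ (Jet.of (Euc n) (Euc n) q φ y, ω₁ y) with hσ
  have hσs : SmNear 𝓘(ℝ, Euc n) (jetModel n n q) σ x := by
    refine SmOn.comp_smNear (f := fun y => (Jet.of (Euc n) (Euc n) q φ y, ω₁ y))
      (g := κ) (T := D) ?_ p1 (p2.eventually self_mem_nhdsWithin)
    rw [hωx]
    exact s3
  refine ⟨φ, x, hφ.smooth, rfl, σ, hσs, ?_, ?_⟩
  · filter_upwards [hφ.eventually, hsec.sec, hτω', hτω] with y l1 l2 ⟨a1, a2, a3, a4⟩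
      ⟨b1, b2, b3, b4⟩
    set j := Jet.of (Euc n) (Euc n) q φ y with hj
    have hjm : j ∈ fullJetGroupoid n X q := l1.jet_mem
    have hjs : j.src = y := Jet.src_of _ _
    have hjt : j.tgt = φ y := Jet.tgt_of _ _
    have hσy : σ y = (j.comp (jetInv (τ (ω₁ y)))).comp (τ (ω₀ y)) := by
      simp only [hσ, hκ]
      rw [hjs]
    have c1 : j.src = (jetInv (τ (ω₁ y))).tgt := by rw [hjs, tgt_jetInv a1, a2, l2]
    have c2 : (j.comp (jetInv (τ (ω₁ y)))).src = (τ (ω₀ y)).tgt := by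
      rw [Jet.src_comp, src_jetInv a1, a3, b3]
    have m1 := comp_mem hjm (jetInv_mem a1) c1
    have c3 : (σ y).src = y := by rw [hσy, Jet.src_comp, b2, hs]
    have c4 : (σ y).tgt = φ y := by rw [hσy, Jet.tgt_comp c2, Jet.tgt_comp c1, hjt]
    refine ⟨c3, ?_, ?_⟩
    · rw [hσy]
      exact comp_mem m1 b1 c2
    · rw [c3, c4, hσy, A.act_comp _ _ m1 _ b1 (by rw [Jet.tgt_comp c1, hjt, hs]) c2,
        A.act_comp _ _ hjm _ (jetInv_mem a1) (by rw [hjt, hs]) c1]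
      -- The first arrow takes `ω₀(φ(y))` to `ω₁(y)`, the second one to `u₀`, and the third one to
      -- `ω₀(y)`.
      change A.act (A.act (ω₁ y) (jetInv (τ (ω₁ y)))) (τ (ω₀ y)) = ω₀ y
      have c5 := A.act_jetInv_of_act a1 (b := u₀) a3.symm
      rw [a4] at c5
      rw [c5, b4]
  · have k1 : Jet.of (Euc n) (Euc n × jetCoord (Euc n) (Euc n) q) 1 σ x =
        Jet.of (Euc n) (Euc n × jetCoord (Euc n) (Euc n) q) 1
          (fun y => H (Jet.of (Euc n) (Euc n) q φ y, ω₁ y)) x := by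
      refine (Jet.of_congr hσs ?_).symm
      filter_upwards [p2.eventually hHκ] with y hy using hy.symm
    rw [k1, key]
    refine Jet.of_congr hjs ?_
    filter_upwards [p4.eventually hHκ, hτω] with y hy ⟨b1, b2, b3, b4⟩
    rw [← hy]
    simp only [hκ]
    rw [Jet.src_of, comp_jetInv_comp_cancel b1 (by rw [Jet.src_of, b2, hs])]

variable {y₀ : X}

section

variable [TopologicalSpace (A.F₁ y₀)] [ChartedSpace (Euc r₁) (A.F₁ y₀)]
  [IsManifold 𝓘(ℝ, Euc r₁) ∞ (A.F₁ y₀)]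
  [TopologicalSpace (A.𝓕₁ y₀)] [ChartedSpace (Euc d₁) (A.𝓕₁ y₀)]
  (ha : IsIsotropyAction r₁ y₀ (A.ActF₁ y₀) (A.actF₁ y₀))
  {A₁ : JetAction n d₁ q (AssocBundle.base : A.𝓕₁ y₀ → X)}
  (hA₁ : ∀ (f : principalBundle n (q + 1) y₀) (z : A.F₁ y₀) (g : SelfJet n X (q + 1))
    (hg : g ∈ fullJetGroupoid n X (q + 1)) (h : f.1.src = g.tgt),
    A₁.act (AssocBundle.mk (A.ActF₁ y₀) f z) g.proj =
      AssocBundle.mk (A.ActF₁ y₀) (principalBundle.mul f g hg h) z)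

include ha hA₁

/-- Equivariance of `I`: if `v = w f`, then `v g = w (f g)`. -/
lemma act_jetClass {v v' : sectionJets n d 1 π} {g : SelfJet n X (q + 1)}
    (h : (v.1, g) ∈ pactDomain n d q π) (hv' : A.pact v.1 g = v'.1) :
    A₁.act (A.jetClass y₀ v) g.proj = A.jetClass y₀ v' := by
  have hg : g ∈ fullJetGroupoid n X (q + 1) := h.2.1
  have hvg : v.1.src = g.tgt := h.2.2
  obtain ⟨f, hf⟩ := exists_mem_principalBundle (n := n) (q + 1) y₀ v.1.src
  have e := hf.trans hvg
  rw [A.jetClass_eq ha v f hf, hA₁ f _ g hg e]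
  refine (A.jetClass_pact ha _ _ ?_).symm
  change A.pact (A.pact v.1 (jetInv f.1)) (f.1.comp g) = v'.1
  rw [← A.pact_comp (mem_pactDomain_jetInv v.2 f.2.1 hf) (comp_mem f.2.1 hg e)
    (by rw [src_jetInv f.2.1, Jet.tgt_comp e]), comp_jetInv_comp f.2.1 e, hv']

/-- The projection of the prolongation of the symmetry groupoid of a section. -/
theorem proj_prolongation_stab [T2Space X] [T2Space B] (hF : HasFibredCharts n d r π)
    (hA : A.IsHomogeneous) {ω₀ : X → B} (hω : ∀ x, IsSec n d π ω₀ x) {J : X → A.𝓕₁ y₀}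
    (hJ : ∀ x, J x = A.jetClass y₀ ⟨Jet.of (Euc n) (Euc d) 1 ω₀ x, (hω x).mem 1⟩) :
    Jet.proj '' prolongation (A.stab ω₀) = A₁.stab J := by
  have hs : ∀ x, π (ω₀ x) = x := fun x => (hω x).sec.self_of_nhds
  have hdom : ∀ g ∈ fullJetGroupoid n X (q + 1),
      (Jet.of (Euc n) (Euc d) 1 ω₀ g.tgt, g) ∈ pactDomain n d q π := fun g hg =>
    ⟨(hω _).mem 1, hg, Jet.src_of _ _⟩
  -- By equivariance, invariance of the class under the projection of `g` means that the moved jet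
  -- and the jet at the source have the same class, and these classes are kernel orbits.
  have hiff : ∀ g ∈ fullJetGroupoid n X (q + 1),
      (A₁.act (J g.tgt) g.proj = J g.src ↔ ∃ k ∈ kernel n q g.src,
        A.pact (A.pact (Jet.of (Euc n) (Euc d) 1 ω₀ g.tgt) g) k =
          Jet.of (Euc n) (Euc d) 1 ω₀ g.src) := by
    intro g hg
    have h1 := A.src_pact (hdom g hg)
    rw [hJ, hJ, A.act_jetClass ha hA₁
      (v := ⟨Jet.of (Euc n) (Euc d) 1 ω₀ g.tgt, (hω _).mem 1⟩)
      (v' := ⟨_, A.pact_mem (hdom g hg)⟩) (hdom g hg) rfl,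
      A.jetClass_eq_iff ha (h1.trans (Jet.src_of _ _).symm), h1]
  refine Subset.antisymm ?_ ?_
  · rintro _ ⟨_, ⟨φ, x, hφ, rfl, σ, hσ, hσe, hj⟩, rfl⟩
    rw [Jet.proj_of hφ]
    have hx : σ x = Jet.of (Euc n) (Euc n) q φ x := by
      have := congrArg Jet.tgt hj
      rwa [Jet.tgt_of, Jet.tgt_of] at this
    have hσx := hσe.self_of_nhds.2.1
    have hmem := hσx
    rw [hx] at hmem
    refine ⟨hmem, ?_⟩
    -- In order zero an element of the prolongation may fail to be invertible even though its
    -- projection lies in `Π_0`. Another lift is used; the condition is void since 1-jets of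
    -- sections are determined by their source.
    rcases q with _ | q
    · obtain ⟨g, hg, hgf⟩ := exists_lift_mem hmem
      have e1 : g.tgt = (Jet.of (Euc n) (Euc n) 0 φ x).tgt := by rw [← Jet.tgt_proj, hgf]
      have e2 : g.src = (Jet.of (Euc n) (Euc n) 0 φ x).src := by rw [← Jet.src_proj, hgf]
      rw [← e1, ← e2, ← hgf, hiff g hg]
      refine ⟨_, kernel_unit _, ?_⟩
      have h1 := A.pact_unit (A.pact_mem (hdom g hg))
      rw [A.src_pact (hdom g hg)] at h1
      rw [h1]
      exact A.sectionJets_eq_of_order_zero hA (A.pact_mem (hdom g hg)) ((hω _).mem 1)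
        ((A.src_pact (hdom g hg)).trans (Jet.src_of _ _).symm)
    · set g := Jet.of (Euc n) (Euc n) (q + 1 + 1) φ x with hg
      have hgp : g.proj = Jet.of (Euc n) (Euc n) (q + 1) φ x := Jet.proj_of hφ
      have hgs : g.src = x := Jet.src_of _ _
      have hgt : g.tgt = φ x := Jet.tgt_of _ _
      -- Here the projection has order at least one and therefore decides invertibility.
      have hgm : g ∈ fullJetGroupoid n X (q + 1 + 1) := mem_of_proj_mem (by rwa [hgp])
      obtain ⟨φ', ψ', hφ', hgφ'⟩ := exists_locDiff hgm
      rw [hgs] at hφ' hgφ'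
      obtain ⟨ψ, hψ⟩ := exists_locInv_of_jet_eq hφ hφ'
        (Jet.of_le hφ hφ'.smooth (Nat.le_add_left 1 (q + 1)) hgφ')
      have e1 : (Jet.of (Euc n) (Euc n) (q + 1) φ x).tgt = g.tgt := by rw [Jet.tgt_of, hgt]
      have e2 : (Jet.of (Euc n) (Euc n) (q + 1) φ x).src = g.src := by rw [Jet.src_of, hgs]
      rw [e1, e2, ← hgp, hiff g hgm]
      refine ⟨_, kernel_unit _, ?_⟩
      have h1 := A.pact_unit (A.pact_mem (hdom g hgm))
      rw [A.src_pact (hdom g hgm)] at h1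
      rw [h1, hgt, hgs, hg, A.pact_of (hω _) hψ]
      -- The families `σ` and `j_q(φ)` have the same 1-jet, hence also their images under `j ↦
      -- ω₀(t(j)) j`; along the symmetries `σ` this image is `ω₀`.
      have h2 := Jet.of_one_congr_left (h := fun j => A.act (ω₀ j.tgt) j) hσ
        (Jet.smNear_of_self (q := q + 1) hφ) (A.smNear_act_section hω hσx) hj
      simp only [Jet.tgt_of] at h2
      rw [← h2]
      refine Jet.of_congr (hω x).smooth ?_
      filter_upwards [hσe] with y hy
      rw [hy.2.2, hy.1]
  · rintro f ⟨hf, hfJ⟩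
    obtain ⟨g, hg, rfl⟩ := exists_lift_mem hf
    rw [Jet.tgt_proj, Jet.src_proj, hiff g hg] at hfJ
    obtain ⟨k, hk, hgk⟩ := hfJ
    have e : g.src = k.tgt := hk.1.2.2.symm
    -- An arbitrary lift fixes the 1-jet only up to the kernel; multiplying by `k` corrects it
    -- without changing the projection.
    refine ⟨g.comp k, A.mem_prolongation_stab hF hA hω (comp_mem hg hk.1.1 e) ?_, ?_⟩
    · rw [Jet.tgt_comp e, A.pact_comp (hdom g hg) hk.1.1 e, Jet.src_comp, hk.1.2.1, hgk]
    · rw [proj_comp_jet e, hk.2, ← Jet.src_proj, jet_comp_unit]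

end

end JetAction

end Stabilizers

end JetGroupoid

end

/-! ### Assembly of the theorem -/

open JetGroupoid in
theorem mainTheorem4 {n d r q : ℕ} {X B F : Type*}
    [TopologicalSpace X] [ChartedSpace (Euc n) X] [SmoothManifold n X]
    [TopologicalSpace B] [ChartedSpace (Euc d) B] [SmoothManifold d B]
    [TopologicalSpace F] [ChartedSpace (Euc r) F] [SmoothManifold r F]
    (π : B → X) (_hπ : IsSmoothFibreBundle n d r F π)
    (A : JetAction n d q π) (_hA : A.IsHomogeneous) (y₀ : X) :
    -- `F_1 = J_1(F) / K_{q+1}` is a quotient manifold of `J_1(F)`,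
    ∃ (r₁ : ℕ) (_ : TopologicalSpace (A.F₁ y₀)) (_ : ChartedSpace (Euc r₁) (A.F₁ y₀))
      (_ : SmoothManifold r₁ (A.F₁ y₀)),
      IsSubmersionOnSubset 𝓘(ℝ, Euc n × jetCoord (Euc n) (Euc d) 1) 𝓘(ℝ, Euc r₁) (A.toF₁ y₀) ∧
    -- the associated bundles `𝓕_1` and `P_q ×_{GL_q} F_1` are smooth fibre bundles,
    ∃ (d₁ : ℕ) (_ : TopologicalSpace (A.𝓕₁ y₀)) (_ : ChartedSpace (Euc d₁) (A.𝓕₁ y₀))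
      (_ : SmoothManifold d₁ (A.𝓕₁ y₀))
      (_ : TopologicalSpace (A.𝓕₁q y₀)) (_ : ChartedSpace (Euc d₁) (A.𝓕₁q y₀))
      (_ : SmoothManifold d₁ (A.𝓕₁q y₀)),
      IsSubmersionOnSubset
        (𝓘(ℝ, Euc n × jetCoord (Euc n) (Euc n) (q + 1)).prod 𝓘(ℝ, Euc r₁)) 𝓘(ℝ, Euc d₁)
        (AssocBundle.quotientMap (y₀ := y₀) (A.ActF₁ y₀)) ∧
      IsSmoothFibreBundle n d₁ r₁ (A.F₁ y₀) (AssocBundle.base : A.𝓕₁ y₀ → X) ∧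
      IsSubmersionOnSubset
        (𝓘(ℝ, Euc n × jetCoord (Euc n) (Euc n) q).prod 𝓘(ℝ, Euc r₁)) 𝓘(ℝ, Euc d₁)
        (AssocBundle.quotientMap (y₀ := y₀) (A.ActF₁q y₀)) ∧
      IsSmoothFibreBundle n d₁ r₁ (A.F₁ y₀) (AssocBundle.base : A.𝓕₁q y₀ → X) ∧
    -- both are natural bundles of order `q`, and they are isomorphic as natural bundles;
    ∃ (A₁ : JetAction n d₁ q (AssocBundle.base : A.𝓕₁ y₀ → X))
      (A₁q : JetAction n d₁ q (AssocBundle.base : A.𝓕₁q y₀ → X))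
      (Ψ : A.𝓕₁ y₀ ≃ₘ⟮𝓘(ℝ, Euc d₁), 𝓘(ℝ, Euc d₁)⟯ A.𝓕₁q y₀),
      (∀ (f : principalBundle n (q + 1) y₀) (z : A.F₁ y₀) (g : SelfJet n X (q + 1))
        (hg : g ∈ fullJetGroupoid n X (q + 1)) (h : f.1.src = g.tgt),
        A₁.act (AssocBundle.mk (A.ActF₁ y₀) f z) g.proj =
          AssocBundle.mk (A.ActF₁ y₀) (principalBundle.mul f g hg h) z) ∧
      (∀ (f : principalBundle n q y₀) (z : A.F₁ y₀) (g : SelfJet n X q)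
        (hg : g ∈ fullJetGroupoid n X q) (h : f.1.src = g.tgt),
        A₁q.act (AssocBundle.mk (A.ActF₁q y₀) f z) g =
          AssocBundle.mk (A.ActF₁q y₀) (principalBundle.mul f g hg h) z) ∧
      (∀ (f : principalBundle n (q + 1) y₀) (z : A.F₁ y₀),
        Ψ (AssocBundle.mk (A.ActF₁ y₀) f z) = AssocBundle.mk (A.ActF₁q y₀) (principalBundle.proj f) z) ∧
      (∀ u : A.𝓕₁ y₀, (Ψ u).base = u.base) ∧
      (∀ u : A.𝓕₁ y₀, ∀ g ∈ fullJetGroupoid n X q, u.base = g.tgt →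
        Ψ (A₁.act u g) = A₁q.act (Ψ u) g) ∧
    -- the quotient map `I : J_1(𝓕) → 𝓕_1`, given by `I(w f) = [f, w K_{q+1}]`,
    ∃ I : sectionJets n d 1 π → A.𝓕₁ y₀,
      IsSubmersionOnSubset 𝓘(ℝ, Euc n × jetCoord (Euc n) (Euc d) 1) 𝓘(ℝ, Euc d₁) I ∧
      (∀ (w : JetAction.sectionJetsAt n d π y₀) (f : principalBundle n (q + 1) y₀)
        (w' : sectionJets n d 1 π), A.ProlongedAct w f w' →
        I w' = AssocBundle.mk (A.ActF₁ y₀) f (A.toF₁ y₀ w)) ∧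
    -- and the description of the projection `R_q^{(1)}` for every section of `𝓕`.
      ∀ (ω₀ : X → B) (hω₀ : ContMDiff 𝓘(ℝ, Euc n) 𝓘(ℝ, Euc d) ∞ ω₀) (hs : ∀ x, π (ω₀ x) = x),
        ContMDiff 𝓘(ℝ, Euc n) 𝓘(ℝ, Euc d₁) ∞
          (fun x => I ⟨Jet.of (Euc n) (Euc d) 1 ω₀ x, jet_mem_sectionJets n d hω₀ hs 1 x⟩) ∧
        (∀ x, (I ⟨Jet.of (Euc n) (Euc d) 1 ω₀ x,
          jet_mem_sectionJets n d hω₀ hs 1 x⟩).base = x) ∧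
        Jet.proj '' (prolongation (A.stab ω₀)) =
          A₁.stab (fun x => I ⟨Jet.of (Euc n) (Euc d) 1 ω₀ x,
            jet_mem_sectionJets n d hω₀ hs 1 x⟩) := by
  have hF := _hπ.hasFibredCharts
  obtain ⟨r₁, t₁, c₁, m₁, hsub⟩ := A.exists_F₁_manifold hF _hA y₀
  have ha := A.isIsotropyAction_actF₁ hF hsub
  have haq := A.isIsotropyAction_actF₁q hF hsub
  have haa : ∀ z, ∀ g ∈ isotropy n (q + 1) y₀, A.actF₁q y₀ z g.proj = A.actF₁ y₀ z g :=
    fun z g hg => A.actF₁q_proj z hg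
  obtain ⟨t₂, c₂, m₂, hsub', hbdl'⟩ := exists_assocBundle_manifold ha
  obtain ⟨t₃, c₃, m₃, hsubq, hbdlq⟩ := exists_assocBundle_manifold haq
  let Ψ := AssocBundle.projDiffeo ha haq haa hsub' hsubq
  have hΨb : ∀ u : A.𝓕₁ y₀, (Ψ u).base = u.base := AssocBundle.base_projEquiv ha haq haa
  let A₁q := AssocBundle.jetAction hsubq
  -- The action on `𝓕_1` as a bundle of order `q` is obtained by transport along the diffeomorphism,
  -- which makes the latter equivariant by construction; the formula with lifts is verified
  -- afterwards.
  let A₁ := A₁q.transport Ψ hΨb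
  have hA₁ : ∀ (f : principalBundle n (q + 1) y₀) (z : A.F₁ y₀) (g : SelfJet n X (q + 1))
      (hg : g ∈ fullJetGroupoid n X (q + 1)) (h : f.1.src = g.tgt),
      A₁.act (AssocBundle.mk (A.ActF₁ y₀) f z) g.proj =
        AssocBundle.mk (A.ActF₁ y₀) (principalBundle.mul f g hg h) z := by
    intro f z g hg h
    change Ψ.symm (AssocBundle.rightMul (AssocBundle.mk (A.ActF₁q y₀) (principalBundle.proj f) z)
      g.proj) = _
    have h' : (principalBundle.proj f).1.src = g.proj.tgt :=
      (Jet.src_proj f.1).trans (h.trans (Jet.tgt_proj g).symm)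
    rw [AssocBundle.rightMul_mk _ _ (proj_mem hg) h']
    have e : principalBundle.mul (principalBundle.proj f) g.proj (proj_mem hg) h' =
        principalBundle.proj (principalBundle.mul f g hg h) :=
      Subtype.ext (proj_comp_jet h).symm
    rw [e]
    exact AssocBundle.projEquiv_symm_mk ha haq haa _ z
  have hI := A.isSubmersionOnSubset_jetClass ha hF hsub hsub'
  refine ⟨r₁, t₁, c₁, m₁, hsub, n + r₁, t₂, c₂, m₂, t₃, c₃, m₃, hsub', hbdl', hsubq, hbdlq,
    A₁, A₁q, Ψ, hA₁, fun f z g hg h => AssocBundle.rightMul_mk f z hg h, fun f z => rfl, hΨb,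
    fun u g _ _ => Ψ.apply_symm_apply _, A.jetClass y₀, hI, fun w f w' h =>
      A.jetClass_pact ha w f (A.pact_eq h), fun ω₀ hω₀ hs => ?_⟩
  have hω : ∀ x, IsSec n d π ω₀ x := fun x => ⟨hω₀.smNear x, Eventually.of_forall hs⟩
  refine ⟨fun x => ?_, fun x => ?_, A.proj_prolongation_stab ha hA₁ hF _hA hω fun x => rfl⟩
  · exact (hI.1.comp_smNear (K := 𝓘(ℝ, Euc n))
      (γ := fun x => ⟨Jet.of (Euc n) (Euc d) 1 ω₀ x, jet_mem_sectionJets n d hω₀ hs 1 x⟩)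
      (Jet.smNear_of_self (hω x).smooth)).contMDiffAt
  · rw [A.base_jetClass, Jet.src_of]
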